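/- Let $\mathscr V$ be a symmetric monoidal closed category that is complete and cocomplete, and let $\mathscr A$ be a small right closed monoidal $\mathscr V$-category, with tensor product $\otimes$, unit object $I$ and hom-objects $\mathscr A(X,Y)\in\mathscr V$. Right closed means that for all objects $X,Y$ of $\mathscr A$ there are an object $Y^X$ and an evaluation $X\otimes Y^X\to Y$ inducing isomorphisms $\mathscr A(X\otimes B,Y)\cong\mathscr A(B,Y^X)$ in $\mathscr V$ for all $B$; then $(X,Y)\mapsto Y^X$ is a $\mathscr V$-functor $\mathscr A^{\mathrm{op}}\otimes\mathscr A\to\mathscr A$. For a small $\mathscr V$-category $\mathscr C$ let $[\mathscr C,\mathscr V]$ be the $\mathscr V$-category of $\mathscr V$-functors $\mathscr C\to\mathscr V$, with hom-objects the ends $[\mathscr C,\mathscr V](F,G)=\int_{X}[FX,GX]$ and projections $\mathrm{pr}_X:[\mathscr C,\mathscr V](F,G)\to[FX,GX]$. Then: 1. $[\mathscr A,\mathscr V]$ is a monoidal $\mathscr V$-category under Day convolution $$(F*G)(X)=\int^{U,W}\mathscr A(U\otimes W,X)\otimes FU\otimes GW,$$ with unit $\mathscr A(I,-)$ and with associativity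 and unit isomorphisms induced by those of $\mathscr V$ and $\mathscr A$. 2. The $\mathscr V$-category $[\mathscr A^{\mathrm{op}}\otimes\mathscr A,\mathscr V]$ of endomodules of $\mathscr A$ is a monoidal $\mathscr V$-category under composition of endomodules $$(S\otimes_{\mathscr A}T)(X,Y)=\int^{Z}S(X,Z)\otimes T(Z,Y),$$ with unit $\mathscr A(-,-)$, with associativity isomorphisms induced by those of $\mathscr V$ and unit isomorphisms induced by the actions of $\mathscr A$ on endomodules. 3. Let $\Upsilon:[\mathscr A,\mathscr V]\to[\mathscr A^{\mathrm{op}}\otimes\mathscr A,\mathscr V]$ be the Cayley $\mathscr V$-functor: $\Upsilon(F)(X,Y)=F(Y^X)$ on objects, and on hom-objects $\Upsilon_{F,G}$ is the morphism with $\mathrm{pr}_{X,Y}\circ\Upsilon_{F,G}=\mathrm{pr}_{Y^X}$ for all $X,Y$. Then $\Upsilon$ is a strong monoidal $\mathscr V$-functor from the monoidal structure of 1 to that of 2, for any choice of the coends that define these structures: there are an isomorphism $\mathscr A(-,-)\cong\Upsilon(\mathscr A(I,-))$ and isomorphisms $$\Upsilon(F)\otimes_{\mathscr A}\Upsilon(G)\cong\Upsilon(F*G),$$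 $\mathscr V$-natural in $F$ and $G$, that satisfy the associativity and unit coherence conditions of a monoidal functor. -/

import Mathlib

open CategoryTheory MonoidalCategory Limits Opposite

universe v u w w' t t'

noncomputable section
namespace EnrichedCayley

attribute [local instance] MonoidalClosed.enrichedCategorySelf

section tensorProduct

variable (V : Type u) [Category.{v} V] [MonoidalCategory V] [BraidedCategory V]

/-- Objects of the tensor product of two `V`-categories: pairs of objects. -/
structure TensorCat (C : Type w) (D : Type w') where
  fst : C
  snd : D

/-- The tensor product `C ⊗ D` of two `V`-categories, with hom-objects
`(C ⊗ D)((X, Y), (X', Y')) = C(X, X') ⊗ D(Y, Y')`. -/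
instance TensorCat.enrichedCategory (C : Type w) (D : Type w')
    [EnrichedCategory V C] [EnrichedCategory V D] : EnrichedCategory V (TensorCat C D) where
  Hom X Y := (X.fst ⟶[V] Y.fst) ⊗ (X.snd ⟶[V] Y.snd)
  id X := (λ_ (𝟙_ V)).inv ≫ (eId V X.fst ⊗ₘ eId V X.snd)
  comp X Y Z := tensorμ _ _ _ _ ≫ (eComp V X.fst Y.fst Z.fst ⊗ₘ eComp V X.snd Y.snd Z.snd)
  id_comp X Y := by
    rw [comp_whiskerRight, Category.assoc, tensorμ_natural_left_assoc, tensorHom_comp_tensorHom,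
      Iso.inv_comp_eq, Category.comp_id, tensor_left_unitality]
    congr 3 <;> simp [← cancel_epi (λ_ _).inv]
  comp_id X Y := by
    rw [MonoidalCategory.whiskerLeft_comp, Category.assoc, tensorμ_natural_right_assoc,
      tensorHom_comp_tensorHom, Iso.inv_comp_eq, Category.comp_id, tensor_right_unitality]
    congr 3 <;> simp [← cancel_epi (ρ_ _).inv]
  assoc W X Y Z := by
    rw [Iso.inv_comp_eq]
    simp only [comp_whiskerRight, MonoidalCategory.whiskerLeft_comp, Category.assoc]
    rw [tensorμ_natural_left_assoc, tensorμ_natural_right_assoc, ← tensor_associativity_assoc]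
    simp only [tensorHom_comp_tensorHom, e_assoc']

end tensorProduct

section functorCategory

variable (V : Type u) [Category.{v} V] [MonoidalCategory V] [MonoidalClosed V]

/-- A `V`-functor from the `V`-category `C` to `V`, where `V` is enriched in itself through its
internal hom. -/
structure VFunctor (C : Type w) [EnrichedCategory V C] where
  toEnriched : EnrichedFunctor V C V

namespace VFunctor

variable {V} {C : Type w} [EnrichedCategory V C]

/-- The object `F X` of `V`. -/
def obj (F : VFunctor V C) (X : C) : V := F.toEnriched.obj X

/-- The effect `C(X, Y) ⟶ [F X, F Y]` of `F` on homs. -/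
def map (F : VFunctor V C) (X Y : C) : (X ⟶[V] Y) ⟶ (ihom (F.obj X)).obj (F.obj Y) :=
  F.toEnriched.map X Y

/-- The effect of `F` on homs, transposed: `F X ⊗ C(X, Y) ⟶ F Y`. -/
def act (F : VFunctor V C) (X Y : C) : F.obj X ⊗ (X ⟶[V] Y) ⟶ F.obj Y :=
  MonoidalClosed.uncurry (F.map X Y)

@[simp]
lemma act_id (F : VFunctor V C) (X : C) : F.obj X ◁ eId V X ≫ F.act X X = (ρ_ _).hom := by
  have h : eId V X ≫ F.map X X = MonoidalClosed.id (F.obj X) := F.toEnriched.map_id X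
  rw [act, ← MonoidalClosed.uncurry_natural_left, h]
  exact MonoidalClosed.uncurry_curry _

lemma uncurry_comp' (X Y Z T T' : V) (f : T ⟶ (ihom X).obj Y) (g : T' ⟶ (ihom Y).obj Z) :
    MonoidalClosed.uncurry ((f ⊗ₘ g) ≫ MonoidalClosed.comp X Y Z) =
      (α_ _ _ _).inv ≫ MonoidalClosed.uncurry f ▷ _ ≫ MonoidalClosed.uncurry g := by
  rw [MonoidalClosed.uncurry_natural_left, MonoidalClosed.comp_eq, MonoidalClosed.uncurry_curry,
    MonoidalClosed.compTranspose_eq, MonoidalClosed.uncurry_eq, MonoidalClosed.uncurry_eq]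
  simp only [MonoidalCategory.tensorHom_def, MonoidalCategory.whiskerLeft_comp, Category.assoc,
    comp_whiskerRight]
  simp [← whisker_exchange_assoc]

lemma act_comp (F : VFunctor V C) (X Y Z : C) :
    F.obj X ◁ eComp V X Y Z ≫ F.act X Z =
      (α_ _ _ _).inv ≫ F.act X Y ▷ _ ≫ F.act Y Z := by
  have h : eComp V X Y Z ≫ F.map X Z = (F.map X Y ⊗ₘ F.map Y Z) ≫ MonoidalClosed.comp _ _ _ :=
    F.toEnriched.map_comp X Y Z
  rw [act, ← MonoidalClosed.uncurry_natural_left, h]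
  exact uncurry_comp' _ _ _ _ _ _ _

/-- A `V`-functor from its transposed effect on homs. -/
def ofAct (o : C → V) (a : ∀ X Y : C, o X ⊗ (X ⟶[V] Y) ⟶ o Y)
    (a_id : ∀ X, o X ◁ eId V X ≫ a X X = (ρ_ _).hom)
    (a_comp : ∀ X Y Z, o X ◁ eComp V X Y Z ≫ a X Z = (α_ _ _ _).inv ≫ a X Y ▷ _ ≫ a Y Z) :
    VFunctor V C where
  toEnriched :=
    { obj := o
      map := fun X Y => MonoidalClosed.curry (a X Y)
      map_id := fun X => by
        rw [← MonoidalClosed.curry_natural_left, a_id]; rfl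
      map_comp := fun X Y Z => by
        apply MonoidalClosed.uncurry_injective
        refine Eq.trans ?_ (uncurry_comp' _ _ _ _ _ _ _).symm
        rw [MonoidalClosed.uncurry_natural_left, MonoidalClosed.uncurry_curry,
          MonoidalClosed.uncurry_curry, MonoidalClosed.uncurry_curry, a_comp] }

@[simp]
lemma ofAct_act (o : C → V) (a : ∀ X Y : C, o X ⊗ (X ⟶[V] Y) ⟶ o Y) (h h') (X Y : C) :
    (ofAct o a h h').act X Y = a X Y :=
  MonoidalClosed.uncurry_curry _

/-- A `V`-natural transformation between `V`-valued `V`-functors: naturality is expressed at the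
level of hom-objects. -/
@[ext]
structure VNat (F G : VFunctor V C) where
  app (X : C) : F.obj X ⟶ G.obj X
  naturality (X Y : C) : F.act X Y ≫ app Y = app X ▷ (X ⟶[V] Y) ≫ G.act X Y

/-- The ordinary category underlying the `V`-functor `V`-category `[C, V]`. -/
instance category : Category (VFunctor V C) where
  Hom F G := VNat F G
  id F := { app := fun X => 𝟙 _, naturality := by simp }
  comp f g :=
    { app := fun X => f.app X ≫ g.app X
      naturality := fun X Y => by
        rw [reassoc_of% f.naturality, g.naturality, comp_whiskerRight, Category.assoc] }

/-- The component at `X` of a `V`-natural transformation. -/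
def app {F G : VFunctor V C} (f : F ⟶ G) (X : C) : F.obj X ⟶ G.obj X := VNat.app f X

lemma app_naturality {F G : VFunctor V C} (f : F ⟶ G) (X Y : C) :
    F.act X Y ≫ app f Y = app f X ▷ (X ⟶[V] Y) ≫ G.act X Y :=
  VNat.naturality f X Y

@[ext]
lemma hom_ext {F G : VFunctor V C} {f g : F ⟶ G} (h : ∀ X, app f X = app g X) : f = g :=
  VNat.ext (funext h)

@[simp] lemma id_app (F : VFunctor V C) (X : C) : app (𝟙 F) X = 𝟙 _ := rfl

@[simp]
lemma comp_app {F G H : VFunctor V C} (f : F ⟶ G) (g : G ⟶ H) (X : C) :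
    app (f ≫ g) X = app f X ≫ app g X := rfl

end VFunctor

end functorCategory

section homObjects

/-- The symmetry `(A ⊗ B) ⊗ C ⟶ (A ⊗ C) ⊗ B`. -/
def swapRight {V : Type u} [Category.{v} V] [MonoidalCategory V] [BraidedCategory V] (A B C : V) :
    (A ⊗ B) ⊗ C ⟶ (A ⊗ C) ⊗ B :=
  (α_ A B C).hom ≫ A ◁ (β_ B C).hom ≫ (α_ A C B).inv

section

variable {V : Type u} [Category.{v} V] [MonoidalCategory V] [BraidedCategory V]

lemma swapRight_naturality_left {A A' : V} (f : A ⟶ A') (B C : V) :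
    f ▷ B ▷ C ≫ swapRight A' B C = swapRight A B C ≫ f ▷ C ▷ B := by
  simp only [swapRight, Category.assoc]
  rw [associator_naturality_left_assoc, ← whisker_exchange_assoc, associator_inv_naturality_left]

lemma swapRight_naturality_right (A B : V) {C C' : V} (f : C ⟶ C') :
    (A ⊗ B) ◁ f ≫ swapRight A B C' = swapRight A B C ≫ (A ◁ f) ▷ B := by
  simp only [swapRight, Category.assoc]
  rw [associator_naturality_right_assoc, ← MonoidalCategory.whiskerLeft_comp_assoc,
    BraidedCategory.braiding_naturality_right, MonoidalCategory.whiskerLeft_comp_assoc,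
    associator_inv_naturality_middle]

lemma swapRight_tensor (A B C D : V) :
    (α_ (A ⊗ B) C D).inv ≫ swapRight A B C ▷ D ≫ swapRight (A ⊗ C) B D =
      swapRight A B (C ⊗ D) ≫ (α_ A C D).inv ▷ B := by
  simp only [swapRight, BraidedCategory.braiding_tensor_right_hom]
  monoidal

lemma swapRight_unit (A B : V) :
    swapRight A B (𝟙_ V) ≫ (ρ_ A).hom ▷ B = (ρ_ (A ⊗ B)).hom := by
  simp [swapRight, braiding_tensorUnit_right]

end

variable {V : Type u} [Category.{v} V] [MonoidalCategory V] [MonoidalClosed V]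
  [SymmetricCategory V] {C : Type v} [EnrichedCategory V C]

namespace VFunctor

/-- The parallel family of morphisms
`[F X, G X] ⟶ [F X ⊗ C(X, Y), G Y] ⟵ [F Y, G Y]` whose joint equalizer is the end
`∫_X [F X, G X]`. -/
def endIndex (F G : VFunctor V C) :
    MulticospanIndex (MulticospanShape.mk C (C × C) Prod.fst Prod.snd) V where
  left X := (ihom (F.obj X)).obj (G.obj X)
  right p := (ihom (F.obj p.1 ⊗ (p.1 ⟶[V] p.2))).obj (G.obj p.2)
  fst p := MonoidalClosed.curry
    (swapRight _ _ _ ≫ (ihom.ev (F.obj p.1)).app (G.obj p.1) ▷ _ ≫ G.act p.1 p.2)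
  snd p := MonoidalClosed.curry
    (F.act p.1 p.2 ▷ _ ≫ (ihom.ev (F.obj p.2)).app (G.obj p.2))

variable [HasLimits V]

/-- The hom-object `[C, V](F, G) = ∫_X [F X, G X]`. -/
def homObj (F G : VFunctor V C) : V := multiequalizer (endIndex F G)

/-- The projection `[C, V](F, G) ⟶ [F X, G X]` of the end. -/
def proj (F G : VFunctor V C) (X : C) : homObj F G ⟶ (ihom (F.obj X)).obj (G.obj X) :=
  Multiequalizer.ι (endIndex F G) X

/-- The projection of the end, transposed: `F X ⊗ [C, V](F, G) ⟶ G X`. -/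
def ev (F G : VFunctor V C) (X : C) : F.obj X ⊗ homObj F G ⟶ G.obj X :=
  MonoidalClosed.uncurry (proj F G X)

lemma ev_naturality (F G : VFunctor V C) (X Y : C) :
    F.act X Y ▷ homObj F G ≫ ev F G Y =
      swapRight _ _ _ ≫ ev F G X ▷ (X ⟶[V] Y) ≫ G.act X Y := by
  have h : proj F G X ≫ (endIndex F G).fst (X, Y) = proj F G Y ≫ (endIndex F G).snd (X, Y) :=
    Multiequalizer.condition (endIndex F G) (X, Y)
  dsimp only [endIndex] at h
  rw [← MonoidalClosed.curry_natural_left, ← MonoidalClosed.curry_natural_left] at h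
  have h' := MonoidalClosed.curry_injective h
  dsimp only [ev]
  rw [MonoidalClosed.uncurry_eq, MonoidalClosed.uncurry_eq, ← whisker_exchange_assoc]
  erw [← h']
  simp only [swapRight, Category.assoc, comp_whiskerRight]
  rw [associator_naturality_right_assoc, ← MonoidalCategory.whiskerLeft_comp_assoc,
    BraidedCategory.braiding_naturality_right, MonoidalCategory.whiskerLeft_comp_assoc,
    associator_inv_naturality_middle_assoc]

lemma ev_naturality_comp (F G : VFunctor V C) {X Y : C} {T : V} (k : T ⟶ (X ⟶[V] Y)) :
    (F.obj X ◁ k ≫ F.act X Y) ▷ homObj F G ≫ ev F G Y =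
      swapRight _ _ _ ≫ ev F G X ▷ T ≫ G.obj X ◁ k ≫ G.act X Y := by
  rw [comp_whiskerRight, Category.assoc, ev_naturality, ← whisker_exchange_assoc]
  simp only [swapRight, Category.assoc]
  rw [associator_naturality_middle_assoc, ← MonoidalCategory.whiskerLeft_comp_assoc,
    BraidedCategory.braiding_naturality_left, MonoidalCategory.whiskerLeft_comp_assoc,
    associator_inv_naturality_right_assoc]

/-- The universal property of `[C, V](F, G)`. -/
def homLift (F G : VFunctor V C) {T : V} (τ : ∀ X, F.obj X ⊗ T ⟶ G.obj X)
    (h : ∀ X Y, F.act X Y ▷ T ≫ τ Y = swapRight _ _ _ ≫ τ X ▷ (X ⟶[V] Y) ≫ G.act X Y) :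
    T ⟶ homObj F G :=
  Multiequalizer.lift (endIndex F G) T (fun X => MonoidalClosed.curry (τ X)) (by
    rintro ⟨X, Y⟩
    dsimp only [endIndex]
    erw [← MonoidalClosed.curry_natural_left, ← MonoidalClosed.curry_natural_left]
    congr 1
    rw [whisker_exchange_assoc, ← MonoidalClosed.uncurry_eq, MonoidalClosed.uncurry_curry, h]
    simp only [swapRight, Category.assoc]
    rw [associator_naturality_right_assoc, ← MonoidalCategory.whiskerLeft_comp_assoc,
      BraidedCategory.braiding_naturality_right, MonoidalCategory.whiskerLeft_comp_assoc,
      associator_inv_naturality_middle_assoc, ← comp_whiskerRight_assoc,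
      ← MonoidalClosed.uncurry_eq, MonoidalClosed.uncurry_curry])

@[simp]
lemma homLift_ev (F G : VFunctor V C) {T : V} (τ : ∀ X, F.obj X ⊗ T ⟶ G.obj X) (h) (X : C) :
    F.obj X ◁ homLift F G τ h ≫ ev F G X = τ X := by
  rw [ev, ← MonoidalClosed.uncurry_natural_left, proj, homLift]
  erw [Multiequalizer.lift_ι]
  rw [MonoidalClosed.uncurry_curry]

lemma homObj_ext {F G : VFunctor V C} {T : V} {f g : T ⟶ homObj F G}
    (h : ∀ X, F.obj X ◁ f ≫ ev F G X = F.obj X ◁ g ≫ ev F G X) : f = g := by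
  refine Multiequalizer.hom_ext (endIndex F G) f g fun X => ?_
  apply MonoidalClosed.uncurry_injective
  have := h X
  rwa [ev, ← MonoidalClosed.uncurry_natural_left, ← MonoidalClosed.uncurry_natural_left] at this

/-- The morphism `𝟙 ⟶ [C, V](F, G)` corresponding to a `V`-natural transformation. -/
def ofNat {F G : VFunctor V C} (f : F ⟶ G) : 𝟙_ V ⟶ homObj F G :=
  homLift F G (fun X => (ρ_ _).hom ≫ app f X) (fun X Y => by
    rw [comp_whiskerRight, Category.assoc, reassoc_of% @swapRight_unit, rightUnitor_naturality_assoc,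
      app_naturality])

@[simp]
lemma ofNat_ev {F G : VFunctor V C} (f : F ⟶ G) (X : C) :
    F.obj X ◁ ofNat f ≫ ev F G X = (ρ_ _).hom ≫ app f X :=
  homLift_ev _ _ _ _ _

/-- The `V`-natural transformation corresponding to a morphism `𝟙 ⟶ [C, V](F, G)`. -/
def toNat {F G : VFunctor V C} (f : 𝟙_ V ⟶ homObj F G) : F ⟶ G where
  app X := (ρ_ _).inv ≫ F.obj X ◁ f ≫ ev F G X
  naturality X Y := by
    rw [rightUnitor_inv_naturality_assoc, ← whisker_exchange_assoc, ev_naturality,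
      reassoc_of% @swapRight_naturality_right, Iso.inv_comp_eq, ← reassoc_of% @swapRight_unit]
    simp only [comp_whiskerRight, Category.assoc, hom_inv_whiskerRight_assoc]

/-- Composition `[C, V](F, G) ⊗ [C, V](G, H) ⟶ [C, V](F, H)`. -/
def homComp (F G H : VFunctor V C) : homObj F G ⊗ homObj G H ⟶ homObj F H :=
  homLift F H (fun X => (α_ _ _ _).inv ≫ ev F G X ▷ _ ≫ ev G H X) (fun X Y => by
    rw [associator_inv_naturality_left_assoc, ← comp_whiskerRight_assoc, ev_naturality]
    simp only [comp_whiskerRight, Category.assoc]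
    rw [ev_naturality, reassoc_of% @swapRight_naturality_left, reassoc_of% @swapRight_tensor])

@[simp]
lemma homComp_ev (F G H : VFunctor V C) (X : C) :
    F.obj X ◁ homComp F G H ≫ ev F H X = (α_ _ _ _).inv ≫ ev F G X ▷ _ ≫ ev G H X :=
  homLift_ev _ _ _ _ _

/-- The `V`-functor `V`-category `[C, V]`. -/
instance enrichedCategory : EnrichedCategory V (VFunctor V C) where
  Hom F G := homObj F G
  id F := ofNat (𝟙 F)
  comp F G H := homComp F G H
  id_comp F G := homObj_ext fun X => by
    simp only [MonoidalCategory.whiskerLeft_comp, Category.assoc, homComp_ev]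
    rw [associator_inv_naturality_middle_assoc, ← comp_whiskerRight_assoc, ofNat_ev]
    simp
  comp_id F G := homObj_ext fun X => by
    simp only [MonoidalCategory.whiskerLeft_comp, Category.assoc, homComp_ev]
    rw [associator_inv_naturality_right_assoc, whisker_exchange_assoc, ofNat_ev]
    simp
  assoc F G H K := homObj_ext fun X => by
    simp only [MonoidalCategory.whiskerLeft_comp, Category.assoc, homComp_ev]
    rw [associator_inv_naturality_right_assoc, whisker_exchange_assoc, homComp_ev,
      associator_inv_naturality_middle_assoc, ← comp_whiskerRight_assoc, homComp_ev]
    simp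

/-- `V`-natural transformations `F ⟶ G` are the same as morphisms `𝟙 ⟶ [C, V](F, G)`. -/
instance enrichedOrdinaryCategory : EnrichedOrdinaryCategory V (VFunctor V C) where
  homEquiv {F G} :=
    { toFun := fun f => ofNat f
      invFun := fun f => toNat f
      left_inv := fun f => by
        ext X
        exact (congrArg ((ρ_ _).inv ≫ ·) (ofNat_ev f X)).trans (Iso.inv_hom_id_assoc _ _)
      right_inv := fun f => homObj_ext fun X => by
        rw [ofNat_ev]
        exact Iso.hom_inv_id_assoc _ _ }
  homEquiv_id F := rfl
  homEquiv_comp {F G H} f g := homObj_ext fun X => by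
    change F.obj X ◁ ofNat (f ≫ g) ≫ ev F H X =
      F.obj X ◁ ((λ_ _).inv ≫ (ofNat f ⊗ₘ ofNat g) ≫ homComp F G H) ≫ ev F H X
    simp only [MonoidalCategory.whiskerLeft_comp, Category.assoc, homComp_ev,
      MonoidalCategory.tensorHom_def]
    rw [associator_inv_naturality_right_assoc, whisker_exchange_assoc, ofNat_ev, ofNat_ev,
      associator_inv_naturality_middle_assoc, ← comp_whiskerRight_assoc, ofNat_ev]
    simp

end VFunctor

end homObjects

section monoidal

/-- A monoidal `V`-category: the `V`-category `C`, with underlying ordinary category identified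
through `EnrichedOrdinaryCategory`, has an ordinary monoidal structure whose tensor product is
the underlying functor of a `V`-functor `C ⊗ C ⟶ C` (with effect `tensorHomObj` on hom-objects) and
whose associativity and unit isomorphisms are `V`-natural. -/
class MonoidalVCategory (V : Type u) [Category.{v} V] [MonoidalCategory V] [BraidedCategory V]
    (C : Type w) [Category.{w'} C] [MonoidalCategory C] [EnrichedOrdinaryCategory V C] where
  /-- `C(X, X') ⊗ C(Y, Y') ⟶ C(X ⊗ Y, X' ⊗ Y')` -/
  tensorHomObj (X X' Y Y' : C) : (X ⟶[V] X') ⊗ (Y ⟶[V] Y') ⟶ ((X ⊗ Y : C) ⟶[V] (X' ⊗ Y' : C))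
  tensorHomObj_eHomEquiv {X X' Y Y' : C} (f : X ⟶ X') (g : Y ⟶ Y') :
    (λ_ (𝟙_ V)).inv ≫ (eHomEquiv V f ⊗ₘ eHomEquiv V g) ≫ tensorHomObj X X' Y Y' =
      eHomEquiv V (f ⊗ₘ g)
  tensorHomObj_comp (X X' X'' Y Y' Y'' : C) :
    tensorμ _ _ _ _ ≫ (eComp V X X' X'' ⊗ₘ eComp V Y Y' Y'') ≫ tensorHomObj X X'' Y Y'' =
      (tensorHomObj X X' Y Y' ⊗ₘ tensorHomObj X' X'' Y' Y'') ≫ eComp V _ _ _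
  associator_naturality (X X' Y Y' Z Z' : C) :
    tensorHomObj X X' Y Y' ▷ (Z ⟶[V] Z') ≫ tensorHomObj (X ⊗ Y) (X' ⊗ Y') Z Z' ≫
        eHomWhiskerLeft V _ (α_ X' Y' Z').hom =
      (α_ _ _ _).hom ≫ (X ⟶[V] X') ◁ tensorHomObj Y Y' Z Z' ≫
        tensorHomObj X X' (Y ⊗ Z) (Y' ⊗ Z') ≫ eHomWhiskerRight V (α_ X Y Z).hom _
  leftUnitor_naturality (X X' : C) :
    (λ_ _).inv ≫ eId V (𝟙_ C) ▷ (X ⟶[V] X') ≫ tensorHomObj (𝟙_ C) (𝟙_ C) X X' ≫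
        eHomWhiskerLeft V _ (λ_ X').hom =
      eHomWhiskerRight V (λ_ X).hom X'
  rightUnitor_naturality (X X' : C) :
    (ρ_ _).inv ≫ (X ⟶[V] X') ◁ eId V (𝟙_ C) ≫ tensorHomObj X X' (𝟙_ C) (𝟙_ C) ≫
        eHomWhiskerLeft V _ (ρ_ X').hom =
      eHomWhiskerRight V (ρ_ X).hom X'

lemma eId_eId_eComp (V : Type u) [Category.{v} V] [MonoidalCategory V]
    {C : Type w} [EnrichedCategory V C] (X : C) :
    (eId V X ⊗ₘ eId V X) ≫ eComp V X X X = (λ_ _).hom ≫ eId V X := by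
  rw [MonoidalCategory.tensorHom_def', Category.assoc, ← Iso.inv_comp_eq,
    ← leftUnitor_inv_naturality_assoc, e_id_comp, Category.comp_id]

namespace MonoidalVCategory

variable (V : Type u) [Category.{v} V] [MonoidalCategory V] [BraidedCategory V]
  {C : Type w} [Category.{w'} C] [MonoidalCategory C] [EnrichedOrdinaryCategory V C]
  [MonoidalVCategory V C]

/-- The effect `C(B, B') ⟶ C(X ⊗ B, X ⊗ B')` of `X ⊗ -` on hom-objects. -/
def tensorLeftHom (X B B' : C) : (B ⟶[V] B') ⟶ ((X ⊗ B : C) ⟶[V] (X ⊗ B' : C)) :=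
  (λ_ _).inv ≫ eId V X ▷ _ ≫ tensorHomObj X X B B'

/-- The effect `C(X, X') ⟶ C(X ⊗ B, X' ⊗ B)` of `- ⊗ B` on hom-objects. -/
def tensorRightHom (B X X' : C) : (X ⟶[V] X') ⟶ ((X ⊗ B : C) ⟶[V] (X' ⊗ B : C)) :=
  (ρ_ _).inv ≫ _ ◁ eId V B ≫ tensorHomObj X X' B B

lemma eId_tensorHomObj (X Y : C) :
    (λ_ (𝟙_ V)).inv ≫ (eId V X ⊗ₘ eId V Y) ≫ tensorHomObj X X Y Y = eId V (X ⊗ Y) := by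
  rw [← eHomEquiv_id, ← eHomEquiv_id, tensorHomObj_eHomEquiv, id_tensorHom_id, eHomEquiv_id]

lemma eId_tensorLeftHom (X B : C) : eId V B ≫ tensorLeftHom V X B B = eId V (X ⊗ B) := by
  rw [tensorLeftHom, leftUnitor_inv_naturality_assoc, whisker_exchange_assoc,
    ← MonoidalCategory.tensorHom_def_assoc, eId_tensorHomObj]

lemma eId_tensorRightHom (B X : C) : eId V X ≫ tensorRightHom V B X X = eId V (X ⊗ B) := by
  rw [tensorRightHom, rightUnitor_inv_naturality_assoc, ← MonoidalCategory.tensorHom_def_assoc,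
    ← unitors_inv_equal, eId_tensorHomObj]

lemma eComp_tensorLeftHom (X B B' B'' : C) :
    eComp V B B' B'' ≫ tensorLeftHom V X B B'' =
      (tensorLeftHom V X B B' ⊗ₘ tensorLeftHom V X B' B'') ≫ eComp V _ _ _ := by
  have e : tensorLeftHom V X B B' ⊗ₘ tensorLeftHom V X B' B'' =
      ((λ_ _).inv ⊗ₘ (λ_ _).inv) ≫ ((eId V X ⊗ₘ 𝟙 _) ⊗ₘ (eId V X ⊗ₘ 𝟙 _)) ≫
        (tensorHomObj X X B B' ⊗ₘ tensorHomObj X X B' B'') := by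
    simp [tensorLeftHom]
  have l : ((λ_ (B ⟶[V] B')).inv ⊗ₘ (λ_ (B' ⟶[V] B'')).inv) ≫ tensorμ _ _ _ _ =
      (λ_ _).inv ≫ (λ_ _).inv ▷ _ := by
    rw [← cancel_epi ((λ_ (B ⟶[V] B')).hom ⊗ₘ (λ_ (B' ⟶[V] B'')).hom)]
    conv_rhs => rw [leftUnitor_monoidal]
    simp
  rw [e, Category.assoc, Category.assoc, ← tensorHomObj_comp, tensorμ_natural_assoc,
    tensorHom_comp_tensorHom_assoc, eId_eId_eComp, reassoc_of% l, tensorLeftHom,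
    leftUnitor_inv_naturality_assoc, whisker_exchange_assoc]
  simp [MonoidalCategory.tensorHom_def]

lemma eComp_tensorRightHom (B X X' X'' : C) :
    eComp V X X' X'' ≫ tensorRightHom V B X X'' =
      (tensorRightHom V B X X' ⊗ₘ tensorRightHom V B X' X'') ≫ eComp V _ _ _ := by
  have e : tensorRightHom V B X X' ⊗ₘ tensorRightHom V B X' X'' =
      ((ρ_ _).inv ⊗ₘ (ρ_ _).inv) ≫ ((𝟙 _ ⊗ₘ eId V B) ⊗ₘ (𝟙 _ ⊗ₘ eId V B)) ≫
        (tensorHomObj X X' B B ⊗ₘ tensorHomObj X' X'' B B) := by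
    simp [tensorRightHom]
  have l : ((ρ_ (X ⟶[V] X')).inv ⊗ₘ (ρ_ (X' ⟶[V] X'')).inv) ≫ tensorμ _ _ _ _ =
      (ρ_ _).inv ≫ _ ◁ (λ_ _).inv := by
    rw [← cancel_epi ((ρ_ (X ⟶[V] X')).hom ⊗ₘ (ρ_ (X' ⟶[V] X'')).hom)]
    conv_rhs => rw [rightUnitor_monoidal]
    simp
  rw [e, Category.assoc, Category.assoc, ← tensorHomObj_comp, tensorμ_natural_assoc,
    tensorHom_comp_tensorHom_assoc, eId_eId_eComp, reassoc_of% l, tensorRightHom,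
    rightUnitor_inv_naturality_assoc, ← whisker_exchange_assoc]
  simp [MonoidalCategory.tensorHom_def']

lemma tensorRightHom_tensorLeftHom (X X' B B' : C) :
    (tensorRightHom V B X X' ⊗ₘ tensorLeftHom V X' B B') ≫ eComp V _ _ _ =
      tensorHomObj X X' B B' := by
  have e : tensorRightHom V B X X' ⊗ₘ tensorLeftHom V X' B B' =
      ((ρ_ _).inv ⊗ₘ (λ_ _).inv) ≫ ((𝟙 _ ⊗ₘ eId V B) ⊗ₘ (eId V X' ⊗ₘ 𝟙 _)) ≫
        (tensorHomObj X X' B B ⊗ₘ tensorHomObj X' X' B B') := by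
    simp [tensorRightHom, tensorLeftHom]
  have l : ((ρ_ (X ⟶[V] X')).inv ⊗ₘ (λ_ (B ⟶[V] B')).inv) ≫ tensorμ _ _ _ _ =
      (ρ_ _).inv ⊗ₘ (λ_ _).inv := by
    simp only [tensorμ, braiding_tensorUnit_left]
    monoidal
  rw [e, Category.assoc, Category.assoc, ← tensorHomObj_comp, tensorμ_natural_assoc, reassoc_of% l,
    tensorHom_comp_tensorHom_assoc, tensorHom_comp_tensorHom_assoc]
  simp

lemma tensorLeftHom_tensorRightHom (X X' B B' : C) :
    (tensorLeftHom V X B B' ⊗ₘ tensorRightHom V B' X X') ≫ eComp V _ _ _ =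
      (β_ _ _).hom ≫ tensorHomObj X X' B B' := by
  have e : tensorLeftHom V X B B' ⊗ₘ tensorRightHom V B' X X' =
      ((λ_ _).inv ⊗ₘ (ρ_ _).inv) ≫ ((eId V X ⊗ₘ 𝟙 _) ⊗ₘ (𝟙 _ ⊗ₘ eId V B')) ≫
        (tensorHomObj X X B B' ⊗ₘ tensorHomObj X X' B' B') := by
    simp [tensorRightHom, tensorLeftHom]
  have l : ((λ_ (B ⟶[V] B')).inv ⊗ₘ (ρ_ (X ⟶[V] X')).inv) ≫ tensorμ _ _ _ _ =
      (β_ _ _).hom ≫ ((λ_ _).inv ⊗ₘ (ρ_ _).inv) := by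
    simp only [tensorμ]
    monoidal
  rw [e, Category.assoc, Category.assoc, ← tensorHomObj_comp, tensorμ_natural_assoc, reassoc_of% l,
    tensorHom_comp_tensorHom_assoc, tensorHom_comp_tensorHom_assoc]
  simp

end MonoidalVCategory

open MonoidalVCategory

/-- The monoidal `V`-category `C` is right closed: every `X ⊗ -` has a right `V`-adjoint, given by
objects `exp X Y` (written `Y^X`) and evaluations `X ⊗ Y^X ⟶ Y` inducing isomorphisms
`C(B, Y^X) ≅ C(X ⊗ B, Y)`. -/
class RightClosed (V : Type u) [Category.{v} V] [MonoidalCategory V] [BraidedCategory V]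
    (C : Type w) [Category.{w'} C] [MonoidalCategory C] [EnrichedOrdinaryCategory V C]
    [MonoidalVCategory V C] where
  exp : C → C → C
  eval (X Y : C) : X ⊗ exp X Y ⟶ Y
  isIso_transpose (X B Y : C) :
    IsIso (tensorLeftHom V X B (exp X Y) ≫ eHomWhiskerLeft V (X ⊗ B) (eval X Y))

namespace RightClosed

variable (V : Type u) [Category.{v} V] [MonoidalCategory V] [BraidedCategory V]
  {C : Type w} [Category.{w'} C] [MonoidalCategory C] [EnrichedOrdinaryCategory V C]
  [MonoidalVCategory V C] [RightClosed V C]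

/-- The isomorphism `C(B, Y^X) ≅ C(X ⊗ B, Y)`. -/
def transpose (X B Y : C) : (B ⟶[V] exp V X Y) ≅ ((X ⊗ B : C) ⟶[V] Y) :=
  haveI := isIso_transpose (V := V) X B Y
  asIso (tensorLeftHom V X B (exp V X Y) ≫ eHomWhiskerLeft V (X ⊗ B) (eval X Y))

/-- `C(X', X) ⊗ C(Y, Y') ⟶ C(X' ⊗ Y^X, Y')`: in terms of elements, `f ⊗ g` goes to the composite
`X' ⊗ Y^X ⟶ X ⊗ Y^X ⟶ Y ⟶ Y'` of `f ⊗ 1`, evaluation and `g`. -/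
def expHomAux (X Y X' Y' : C) :
    (X' ⟶[V] X) ⊗ (Y ⟶[V] Y') ⟶ ((X' ⊗ exp V X Y : C) ⟶[V] Y') :=
  (tensorRightHom V (exp V X Y) X' X ≫ eHomWhiskerLeft V _ (eval X Y)) ▷ _ ≫ eComp V _ _ _

/-- The effect `C(X', X) ⊗ C(Y, Y') ⟶ C(Y^X, Y'^X')` on hom-objects of the internal hom. -/
def expHom (X Y X' Y' : C) :
    (X' ⟶[V] X) ⊗ (Y ⟶[V] Y') ⟶ (exp V X Y ⟶[V] exp V X' Y') :=
  expHomAux V X Y X' Y' ≫ (transpose V X' (exp V X Y) Y').inv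

lemma expHom_transpose_hom (X Y X' Y' : C) :
    expHom V X Y X' Y' ≫ (transpose V X' (exp V X Y) Y').hom = expHomAux V X Y X' Y' := by
  rw [expHom, Category.assoc, Iso.inv_hom_id, Category.comp_id]

lemma expHom_transpose (X Y X' Y' : C) :
    expHom V X Y X' Y' ≫ tensorLeftHom V X' _ _ ≫ eHomWhiskerLeft V _ (eval X' Y') =
      expHomAux V X Y X' Y' := by
  exact expHom_transpose_hom V X Y X' Y'

lemma eComp_transpose (X B B' Y : C) :
    eComp V B B' (exp V X Y) ≫ (transpose V X B Y).hom =
      (tensorLeftHom V X B B' ⊗ₘ (transpose V X B' Y).hom) ≫ eComp V _ _ _ := by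
  dsimp only [transpose, asIso_hom]
  rw [reassoc_of% @eComp_tensorLeftHom, eComp_eHomWhiskerLeft]
  simp [MonoidalCategory.tensorHom_def]

lemma expHomAux_eComp (X Y X' Y' Y'' : C) :
    expHomAux V X Y X' Y' ▷ (Y' ⟶[V] Y'') ≫ eComp V _ _ _ =
      (α_ _ _ _).hom ≫ _ ◁ eComp V Y Y' Y'' ≫ expHomAux V X Y X' Y'' := by
  simp only [expHomAux, comp_whiskerRight, Category.assoc]
  rw [← e_assoc']
  simp [whisker_exchange_assoc]

lemma expHom_tensorRightHom (X Y X' Y' X'' : C) :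
    (expHom V X Y X' Y' ≫ tensorLeftHom V X'' _ _ ⊗ₘ
        tensorRightHom V (exp V X' Y') X'' X' ≫ eHomWhiskerLeft V _ (eval X' Y')) ≫ eComp V _ _ _ =
      (β_ _ _).hom ≫ (α_ _ _ _).inv ≫ eComp V X'' X' X ▷ _ ≫ expHomAux V X Y X'' Y' := by
  have h : (tensorRightHom V (exp V X Y) X'' X' ⊗ₘ expHomAux V X Y X' Y') ≫ eComp V _ _ _ =
      (α_ _ _ _).inv ≫ eComp V X'' X' X ▷ _ ≫ expHomAux V X Y X'' Y' := by
    simp only [expHomAux]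
    rw [← comp_whiskerRight_assoc, reassoc_of% @eComp_tensorRightHom, eComp_eHomWhiskerLeft]
    simp only [MonoidalCategory.tensorHom_def, MonoidalCategory.whiskerLeft_comp, Category.assoc,
      comp_whiskerRight]
    rw [← e_assoc]
    simp
  rw [← h, ← expHom_transpose]
  have e₁ : expHom V X Y X' Y' ≫ tensorLeftHom V X'' _ _ ⊗ₘ
        tensorRightHom V (exp V X' Y') X'' X' ≫ eHomWhiskerLeft V _ (eval X' Y') =
      (expHom V X Y X' Y' ⊗ₘ 𝟙 _) ≫ (tensorLeftHom V X'' _ _ ⊗ₘ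
        tensorRightHom V (exp V X' Y') X'' X') ≫ _ ◁ eHomWhiskerLeft V _ (eval X' Y') := by
    simp only [← id_tensorHom, tensorHom_comp_tensorHom, Category.id_comp, Category.comp_id]
  have e₂ : tensorRightHom V (exp V X Y) X'' X' ⊗ₘ expHom V X Y X' Y' ≫
        tensorLeftHom V X' _ _ ≫ eHomWhiskerLeft V _ (eval X' Y') =
      (𝟙 _ ⊗ₘ expHom V X Y X' Y') ≫ (tensorRightHom V (exp V X Y) X'' X' ⊗ₘ
        tensorLeftHom V X' _ _) ≫ _ ◁ eHomWhiskerLeft V _ (eval X' Y') := by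
    simp only [← id_tensorHom, tensorHom_comp_tensorHom, Category.id_comp, Category.comp_id]
  rw [e₁, e₂, Category.assoc, Category.assoc, Category.assoc, Category.assoc,
    ← eComp_eHomWhiskerLeft, reassoc_of% @tensorLeftHom_tensorRightHom, ← eComp_eHomWhiskerLeft,
    reassoc_of% @tensorRightHom_tensorLeftHom, BraidedCategory.braiding_naturality_assoc]

lemma expHomAux_comp (X Y X' Y' X'' Y'' : C) :
    tensorμ _ _ _ _ ≫ (((β_ _ _).hom ≫ eComp V X'' X' X) ⊗ₘ eComp V Y Y' Y'') ≫
        expHomAux V X Y X'' Y'' =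
      (expHom V X Y X' Y' ≫ tensorLeftHom V X'' _ _ ⊗ₘ expHomAux V X' Y' X'' Y'') ≫
        eComp V _ _ _ := by
  have e : (expHom V X Y X' Y' ≫ tensorLeftHom V X'' _ _ ⊗ₘ expHomAux V X' Y' X'' Y'') ≫
        eComp V _ _ _ =
      (α_ _ _ _).inv ≫ ((expHom V X Y X' Y' ≫ tensorLeftHom V X'' _ _ ⊗ₘ
        tensorRightHom V (exp V X' Y') X'' X' ≫ eHomWhiskerLeft V _ (eval X' Y')) ≫
          eComp V _ _ _) ▷ _ ≫ eComp V _ _ _ := by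
    rw [comp_whiskerRight, Category.assoc, ← e_assoc']
    simp only [expHomAux, MonoidalCategory.tensorHom_def, MonoidalCategory.whiskerLeft_comp,
      Category.assoc, comp_whiskerRight]
    simp
  rw [e, expHom_tensorRightHom]
  simp only [comp_whiskerRight, Category.assoc]
  rw [expHomAux_eComp]
  simp only [MonoidalCategory.tensorHom_def, comp_whiskerRight, Category.assoc, tensorμ,
    BraidedCategory.braiding_tensor_left_hom]
  monoidal

/-- The internal hom `(X, Y) ↦ Y^X` as a `V`-functor `Cᵒᵖ ⊗ C ⟶ C`. -/
def expFunctor : EnrichedFunctor V (TensorCat Cᵒᵖ C) C where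
  obj P := exp V P.fst.unop P.snd
  map P Q := expHom V P.fst.unop P.snd Q.fst.unop Q.snd
  map_id P := by
    rw [expHom, ← Category.assoc, Iso.comp_inv_eq]
    change ((λ_ (𝟙_ V)).inv ≫ (eId V P.fst.unop ⊗ₘ eId V P.snd)) ≫ _ = _
    dsimp only [transpose, asIso_hom, expHomAux]
    rw [reassoc_of% @eId_tensorLeftHom, Category.assoc, tensorHom_comp_whiskerRight_assoc,
      reassoc_of% @eId_tensorRightHom, MonoidalCategory.tensorHom_def_assoc, unitors_inv_equal,
      ← rightUnitor_inv_naturality_assoc, e_comp_id, Category.comp_id]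
  map_comp P Q R := by
    rw [← cancel_mono (transpose V R.fst.unop _ R.snd).hom, Category.assoc, Category.assoc,
      eComp_transpose, tensorHom_comp_tensorHom_assoc, expHom_transpose_hom, expHom_transpose_hom]
    exact (Category.assoc _ _ _).trans (expHomAux_comp V P.fst.unop P.snd Q.fst.unop Q.snd
      R.fst.unop R.snd)

end RightClosed

end monoidal

open MonoidalVCategory

section strongMonoidal

variable {V : Type u} [Category.{v} V] [MonoidalCategory V]
  {C : Type w} [Category.{w'} C] [EnrichedOrdinaryCategory V C]
  {D : Type t} [Category.{t'} D] [EnrichedOrdinaryCategory V D]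

/-- The ordinary functor underlying a `V`-functor. -/
def underlying (Φ : EnrichedFunctor V C D) : C ⥤ D where
  obj X := Φ.obj X
  map {X Y} f := (eHomEquiv V).symm (eHomEquiv V f ≫ Φ.map X Y)
  map_id X := (eHomEquiv V).injective (by simp)
  map_comp {X Y Z} f g := (eHomEquiv V).injective (by simp [eHomEquiv_comp])

variable [BraidedCategory V] [MonoidalCategory C] [MonoidalVCategory V C]
  [MonoidalCategory D] [MonoidalVCategory V D]

/-- A strong monoidal structure on a `V`-functor `Φ` between monoidal `V`-categories: invertible
structure morphisms `𝟙 ⟶ Φ 𝟙` and `Φ X ⊗ Φ Y ⟶ Φ (X ⊗ Y)`, coherent with respect to the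
associativity and unit isomorphisms, the latter being `V`-natural in `X` and `Y`. -/
structure StrongMonoidal (Φ : EnrichedFunctor V C D) where
  monoidal : (underlying Φ).Monoidal
  μ_naturality (X X' Y Y' : C) :
    (Φ.map X X' ⊗ₘ Φ.map Y Y') ≫
        tensorHomObj (Φ.obj X) (Φ.obj X') (Φ.obj Y) (Φ.obj Y') ≫
          eHomWhiskerLeft V (Φ.obj X ⊗ Φ.obj Y) (Functor.LaxMonoidal.μ (underlying Φ) X' Y') =
      tensorHomObj X X' Y Y' ≫ Φ.map (X ⊗ Y) (X' ⊗ Y') ≫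
        eHomWhiskerRight V (Functor.LaxMonoidal.μ (underlying Φ) X Y) (Φ.obj (X' ⊗ Y'))

end strongMonoidal

section cayley

variable (V : Type u) [Category.{v} V] [MonoidalCategory V] [MonoidalClosed V]
  [SymmetricCategory V] (A : Type v) [Category.{w} A] [EnrichedOrdinaryCategory V A]

/-- Endomodules of the `V`-category `A`: `V`-functors `Aᵒᵖ ⊗ A ⟶ V`. -/
abbrev Endomodule := VFunctor V (TensorCat Aᵒᵖ A)

variable {V A} [MonoidalCategory A] [MonoidalVCategory V A] [RightClosed V A]

open RightClosed VFunctor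

/-- The endomodule `(X, Y) ↦ F (Y^X)`. -/
def cayleyObj (F : VFunctor V A) : Endomodule V A where
  toEnriched := (expFunctor V).comp V F.toEnriched

lemma cayleyObj_act (F : VFunctor V A) (P Q : TensorCat Aᵒᵖ A) :
    (cayleyObj F).act P Q = F.obj _ ◁ (expFunctor V).map P Q ≫ F.act _ _ :=
  MonoidalClosed.uncurry_natural_left _ _

variable [HasLimits V]

/-- The effect of the Cayley `V`-functor on hom-objects: its composite with the projection at
`(X, Y)` is the projection at `Y^X`. -/
def cayleyHom (F G : VFunctor V A) : homObj F G ⟶ homObj (cayleyObj F) (cayleyObj G) :=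
  homLift (cayleyObj F) (cayleyObj G) (fun P => ev F G (exp V P.fst.unop P.snd)) (fun P Q => by
    rw [cayleyObj_act, cayleyObj_act]
    exact ev_naturality_comp F G ((expFunctor V).map P Q))

lemma cayleyHom_ev (F G : VFunctor V A) (P : TensorCat Aᵒᵖ A) :
    (cayleyObj F).obj P ◁ cayleyHom F G ≫ ev (cayleyObj F) (cayleyObj G) P =
      ev F G (exp V P.fst.unop P.snd) :=
  homLift_ev _ _ _ _ _

variable (V A) in
/-- The Cayley `V`-functor `[A, V] ⟶ [Aᵒᵖ ⊗ A, V]`. -/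
def cayley : EnrichedFunctor V (VFunctor V A) (Endomodule V A) where
  obj F := cayleyObj F
  map F G := cayleyHom F G
  map_id F := homObj_ext fun P => by
    rw [MonoidalCategory.whiskerLeft_comp, Category.assoc, cayleyHom_ev]
    exact (ofNat_ev (𝟙 F) _).trans (ofNat_ev (𝟙 (cayleyObj F)) P).symm
  map_comp F G H := homObj_ext fun P => by
    rw [MonoidalCategory.whiskerLeft_comp, Category.assoc, cayleyHom_ev]
    refine (homComp_ev F G H _).trans ?_
    rw [MonoidalCategory.whiskerLeft_comp, Category.assoc]
    refine Eq.trans ?_ (congrArg _ (homComp_ev (cayleyObj F) (cayleyObj G) (cayleyObj H) P).symm)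
    rw [MonoidalCategory.tensorHom_def, MonoidalCategory.whiskerLeft_comp, Category.assoc]
    erw [associator_inv_naturality_right_assoc, whisker_exchange_assoc, cayleyHom_ev,
      associator_inv_naturality_middle_assoc, ← comp_whiskerRight_assoc, cayleyHom_ev]
    rfl

end cayley

section day

variable (V : Type u) [Category.{v} V] [MonoidalCategory V] [MonoidalClosed V]
  [SymmetricCategory V] (A : Type v) [Category.{w} A] [EnrichedOrdinaryCategory V A]

/-- The effect of a `V`-functor on ordinary morphisms. -/
def VFunctor.mapHom {V : Type u} [Category.{v} V] [MonoidalCategory V] [MonoidalClosed V]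
    {A : Type v} [Category.{w} A] [EnrichedOrdinaryCategory V A]
    (F : VFunctor V A) {X Y : A} (f : X ⟶ Y) : F.obj X ⟶ F.obj Y :=
  (ρ_ _).inv ≫ F.obj X ◁ eHomEquiv V f ≫ F.act X Y

/-- The unit `A(𝟙, -)` of Day convolution. -/
def dayUnit [MonoidalCategory A] : VFunctor V A :=
  VFunctor.ofAct (fun X => (𝟙_ A) ⟶[V] X) (fun X Y => eComp V (𝟙_ A) X Y)
    (fun X => by
      rw [← Iso.inv_comp_eq_id]; simp)
    (fun X Y Z => by rw [e_assoc])

variable [MonoidalCategory A] [MonoidalVCategory V A]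

variable {V A} in
/-- `V`-cowedges `F U ⊗ G W ⊗ A(U ⊗ W, X) ⟶ T`, indexed by the `V`-category `A ⊗ A` of pairs
`(U, W)`: the two morphisms out of
`(F U ⊗ G W) ⊗ (A(U, U') ⊗ A(W, W')) ⊗ A(U' ⊗ W', X)` agree. -/
def IsDayCowedge (F G : VFunctor V A) (X : A) {T : V}
    (t : ∀ U W : A, (F.obj U ⊗ G.obj W) ⊗ ((U ⊗ W : A) ⟶[V] X) ⟶ T) : Prop :=
  ∀ U U' W W' : A,
    (tensorμ _ _ _ _ ≫ (F.act U U' ⊗ₘ G.act W W')) ▷ ((U' ⊗ W' : A) ⟶[V] X) ≫ t U' W' =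
      (α_ _ _ _).hom ≫
        (F.obj U ⊗ G.obj W) ◁ (tensorHomObj U U' W W' ▷ _ ≫ eComp V _ _ _) ≫ t U W

/-- The object part of Day convolution: a monoidal `V`-category structure on `[A, V]` with tensor
product the coend `(F ⊗ G) X = ∫^{U, W} F U ⊗ G W ⊗ A(U ⊗ W, X)`, `V`-functorially in `X`. -/
structure DayCoends [HasLimits V] where
  [monoidalCategory : MonoidalCategory (VFunctor V A)]
  [monoidalVCategory : MonoidalVCategory V (VFunctor V A)]
  /-- the coprojections of the coend -/
  copr (F G : VFunctor V A) (U W X : A) :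
    (F.obj U ⊗ G.obj W) ⊗ ((U ⊗ W : A) ⟶[V] X) ⟶ (F ⊗ G : VFunctor V A).obj X
  isDayCowedge (F G : VFunctor V A) (X : A) :
    IsDayCowedge F G X (fun U W => copr F G U W X)
  existsUnique_desc (F G : VFunctor V A) (X : A) {T : V}
    (t : ∀ U W : A, (F.obj U ⊗ G.obj W) ⊗ ((U ⊗ W : A) ⟶[V] X) ⟶ T) (ht : IsDayCowedge F G X t) :
    ∃! d : (F ⊗ G : VFunctor V A).obj X ⟶ T, ∀ U W : A, copr F G U W X ≫ d = t U W
  copr_act (F G : VFunctor V A) (U W X Y : A) :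
    copr F G U W X ▷ (X ⟶[V] Y) ≫ (F ⊗ G : VFunctor V A).act X Y =
      (α_ _ _ _).hom ≫ (F.obj U ⊗ G.obj W) ◁ eComp V (U ⊗ W : A) X Y ≫ copr F G U W Y

variable {V A} in
/-- The universal morphism `F U ⊗ G W ⟶ (F ⊗ G) (U ⊗ W)`: the coprojection at the identity of
`U ⊗ W`. -/
def DayCoends.ins [HasLimits V] (D : DayCoends V A) (F G : VFunctor V A) (U W : A) :
    letI := D.monoidalCategory
    F.obj U ⊗ G.obj W ⟶ (F ⊗ G : VFunctor V A).obj (U ⊗ W) :=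
  (ρ_ _).inv ≫ _ ◁ eId V (U ⊗ W : A) ≫ D.copr F G U W (U ⊗ W)

/-- A Day convolution monoidal structure on the `V`-category `[A, V]`: the tensor product is the
coend `(F ⊗ G) X = ∫^{U, W} F U ⊗ G W ⊗ A(U ⊗ W, X)`, `V`-functorially in `X`, `F` and `G`, the
unit is `A(𝟙, -)`, and the associativity and unit isomorphisms are those induced by the ones of
`V` and `A`. -/
structure DayConvolution [HasLimits V] extends DayCoends V A where
  ins_tensorHomObj (F F' G G' : VFunctor V A) (U W : A) :
    toDayCoends.ins F G U W ▷ ((F ⟶[V] F') ⊗ (G ⟶[V] G')) ≫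
        (F ⊗ G : VFunctor V A).obj (U ⊗ W) ◁ tensorHomObj F F' G G' ≫
          VFunctor.ev (F ⊗ G) (F' ⊗ G') (U ⊗ W) =
      tensorμ _ _ _ _ ≫ (VFunctor.ev F F' U ⊗ₘ VFunctor.ev G G' W) ≫ toDayCoends.ins F' G' U W
  ins_associator (F G H : VFunctor V A) (U W Z : A) :
    toDayCoends.ins F G U W ▷ H.obj Z ≫ toDayCoends.ins (F ⊗ G) H (U ⊗ W) Z ≫
        VFunctor.app (α_ F G H).hom ((U ⊗ W) ⊗ Z) ≫
          (F ⊗ (G ⊗ H) : VFunctor V A).mapHom (α_ U W Z).hom =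
      (α_ _ _ _).hom ≫ F.obj U ◁ toDayCoends.ins G H W Z ≫ toDayCoends.ins F (G ⊗ H) U (W ⊗ Z)
  /-- the identification of the unit with `A(𝟙, -)` -/
  unitIso : dayUnit V A ≅ 𝟙_ (VFunctor V A)
  ins_leftUnitor (F : VFunctor V A) (U : A) :
    (eId V (𝟙_ A) ≫ VFunctor.app unitIso.hom (𝟙_ A)) ▷ F.obj U ≫
        toDayCoends.ins (𝟙_ (VFunctor V A)) F (𝟙_ A) U ≫
          VFunctor.app (λ_ F).hom (𝟙_ A ⊗ U) ≫ F.mapHom (λ_ U).hom =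
      (λ_ (F.obj U)).hom
  ins_rightUnitor (F : VFunctor V A) (U : A) :
    F.obj U ◁ (eId V (𝟙_ A) ≫ VFunctor.app unitIso.hom (𝟙_ A)) ≫
        toDayCoends.ins F (𝟙_ (VFunctor V A)) U (𝟙_ A) ≫
          VFunctor.app (ρ_ F).hom (U ⊗ 𝟙_ A) ≫ F.mapHom (ρ_ U).hom =
      (ρ_ (F.obj U)).hom

end day

section homEndomodule

variable (V : Type u) [Category.{v} V] [MonoidalCategory V] [BraidedCategory V]
  (A : Type w) [EnrichedCategory V A]

lemma homEndomodule_id (X Y : A) :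
    (X ⟶[V] Y) ◁ ((λ_ _).inv ≫ (eId V X ⊗ₘ eId V Y)) ≫ (α_ _ _ _).inv ≫
        ((β_ _ _).hom ≫ eComp V X X Y) ▷ _ ≫ eComp V X Y Y = (ρ_ _).hom := by
  have h₁ : (X ⟶[V] Y) ◁ eId V X ≫ (β_ _ _).hom ≫ eComp V X X Y = (ρ_ _).hom := by
    rw [BraidedCategory.braiding_naturality_right_assoc, braiding_tensorUnit_right,
      Category.assoc, e_id_comp, Category.comp_id]
  have h₂ : (X ⟶[V] Y) ◁ eId V Y ≫ eComp V X Y Y = (ρ_ _).hom := by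
    rw [← Iso.inv_comp_eq_id, e_comp_id]
  rw [MonoidalCategory.tensorHom_def, MonoidalCategory.whiskerLeft_comp,
    MonoidalCategory.whiskerLeft_comp, Category.assoc, Category.assoc,
    associator_inv_naturality_right_assoc, whisker_exchange_assoc, h₂,
    associator_inv_naturality_middle_assoc, ← comp_whiskerRight_assoc, h₁]
  simp

lemma homEndomodule_comp (X Y X' Y' X'' Y'' : A) :
    (X ⟶[V] Y) ◁ (tensorμ _ _ _ _ ≫
        (((β_ _ _).hom ≫ eComp V X'' X' X) ⊗ₘ eComp V Y Y' Y'')) ≫ (α_ _ _ _).inv ≫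
        ((β_ _ _).hom ≫ eComp V X'' X Y) ▷ _ ≫ eComp V X'' Y Y'' =
      (α_ _ _ _).inv ≫ ((α_ _ _ _).inv ≫ ((β_ _ _).hom ≫
        eComp V X' X Y) ▷ _ ≫ eComp V X' Y Y') ▷ _ ≫ (α_ _ _ _).inv ≫
        ((β_ _ _).hom ≫ eComp V X'' X' Y') ▷ _ ≫ eComp V X'' Y' Y'' := by
  have h : (X'' ⟶[V] X') ◁ (eComp V X' X Y ▷ (Y ⟶[V] Y') ≫ eComp V X' Y Y') ≫
      eComp V X'' X' Y' = (α_ _ _ _).inv ≫ ((α_ _ _ _).inv ≫ eComp V X'' X' X ▷ _ ≫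
        eComp V X'' X Y) ▷ _ ≫ eComp V X'' Y Y' := by
    rw [e_assoc, comp_whiskerRight, Category.assoc, ← associator_inv_naturality_middle_assoc,
      e_assoc]
    simp
  have l : ((β_ _ _).hom ≫ eComp V X' X Y) ▷ (Y ⟶[V] Y') ≫ eComp V X' Y Y' =
      (β_ _ _).hom ▷ _ ≫ eComp V X' X Y ▷ (Y ⟶[V] Y') ≫ eComp V X' Y Y' := by simp
  have r : ((α_ _ _ _).inv ≫ ((β_ _ _).hom ≫
        eComp V X' X Y) ▷ _ ≫ eComp V X' Y Y') ▷ ((X'' ⟶[V] X') ⊗ (Y' ⟶[V] Y'')) ≫ (α_ _ _ _).inv ≫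
        ((β_ _ _).hom ≫ eComp V X'' X' Y') ▷ _ ≫ eComp V X'' Y' Y'' =
      ((α_ _ _ _).inv ≫ (β_ _ _).hom ▷ _) ▷ _ ≫ (α_ _ _ _).inv ≫ (β_ _ _).hom ▷ _ ≫
        ((α_ _ _ _).inv ≫ ((α_ _ _ _).inv ≫ eComp V X'' X' X ▷ _ ≫ eComp V X'' X Y) ▷ _) ▷ _ ≫
        (α_ _ _ _).hom ≫ _ ◁ eComp V Y Y' Y'' ≫ eComp V X'' Y Y'' := by
    rw [e_assoc', ← comp_whiskerRight_assoc _ (eComp V X'' Y Y'), Category.assoc, ← h, l,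
      ← Category.assoc (α_ _ _ _).inv, comp_whiskerRight _ (_ ≫ _), Category.assoc,
      associator_inv_naturality_left_assoc, ← comp_whiskerRight_assoc,
      BraidedCategory.braiding_naturality_left_assoc]
    simp only [comp_whiskerRight, Category.assoc]
  have q : (X ⟶[V] Y) ◁ ((β_ _ _).hom ≫ eComp V X'' X' X) ≫ (β_ _ _).hom ≫ eComp V X'' X Y =
      _ ◁ (β_ _ _).hom ≫ (β_ _ _).hom ≫ eComp V X'' X' X ▷ _ ≫ eComp V X'' X Y := by
    rw [MonoidalCategory.whiskerLeft_comp, Category.assoc,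
      BraidedCategory.braiding_naturality_right_assoc]
  have r' : ((α_ (X ⟶[V] Y) (X' ⟶[V] X) (Y ⟶[V] Y')).inv ≫ (β_ _ _).hom ▷ _) ▷
        ((X'' ⟶[V] X') ⊗ (Y' ⟶[V] Y'')) ≫ (α_ _ _ _).inv ≫ (β_ _ _).hom ▷ _ =
      (α_ _ _ _).inv ▷ _ ≫ (α_ _ _ _).inv ≫ (β_ _ _).hom ▷ _ ≫ (_ ◁ ((β_ _ _).hom ▷ _)) ▷ _ := by
    rw [comp_whiskerRight, Category.assoc, associator_inv_naturality_left_assoc,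
      ← comp_whiskerRight, BraidedCategory.braiding_naturality_left, comp_whiskerRight]
  rw [r, reassoc_of% r']
  rw [MonoidalCategory.tensorHom_def, MonoidalCategory.whiskerLeft_comp,
    MonoidalCategory.whiskerLeft_comp, Category.assoc, Category.assoc,
    associator_inv_naturality_right_assoc, whisker_exchange_assoc,
    associator_inv_naturality_middle_assoc, ← comp_whiskerRight_assoc, q]
  simp only [tensorμ, BraidedCategory.braiding_tensor_left_hom,
    BraidedCategory.braiding_tensor_right_hom]
  monoidal

end homEndomodule

section composition

variable (V : Type u) [Category.{v} V] [MonoidalCategory V] [MonoidalClosed V]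
  [SymmetricCategory V] (A : Type v) [Category.{w} A] [EnrichedOrdinaryCategory V A]

variable {V A} in
/-- The value `T(X, Y)` of an endomodule. -/
abbrev Endomodule.at (T : Endomodule V A) (X Y : A) : V := VFunctor.obj T ⟨op X, Y⟩

variable {V A} in
/-- The contravariant action `T(X, Y) ⊗ A(X', X) ⟶ T(X', Y)`. -/
def Endomodule.actL (T : Endomodule V A) (X' X Y : A) :
    Endomodule.at T X Y ⊗ (X' ⟶[V] X) ⟶ Endomodule.at T X' Y :=
  _ ◁ ((ρ_ _).inv ≫ _ ◁ eId V Y) ≫ VFunctor.act T ⟨op X, Y⟩ ⟨op X', Y⟩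

variable {V A} in
/-- The covariant action `T(X, Y) ⊗ A(Y, Y') ⟶ T(X, Y')`. -/
def Endomodule.actR (T : Endomodule V A) (X Y Y' : A) :
    Endomodule.at T X Y ⊗ (Y ⟶[V] Y') ⟶ Endomodule.at T X Y' :=
  _ ◁ ((λ_ _).inv ≫ eId V X ▷ _) ≫ VFunctor.act T ⟨op X, Y⟩ ⟨op X, Y'⟩

/-- The identity endomodule `A(-, -)`: the action sends `h ⊗ (f ⊗ g)` to `f ≫ h ≫ g`. -/
def homEndomodule : Endomodule V A :=
  VFunctor.ofAct (fun P => P.fst.unop ⟶[V] P.snd)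
    (fun P Q => (α_ _ _ _).inv ≫ ((β_ _ _).hom ≫
      eComp V Q.fst.unop P.fst.unop P.snd) ▷ _ ≫ eComp V Q.fst.unop P.snd Q.snd)
    (fun P => by
      change _ ◁ ((λ_ _).inv ≫ (eId V P.fst.unop ⊗ₘ eId V P.snd)) ≫ _ = _
      exact homEndomodule_id V A P.fst.unop P.snd)
    (fun P Q R => homEndomodule_comp V A P.fst.unop P.snd Q.fst.unop Q.snd R.fst.unop R.snd)

variable {V A} in
/-- `V`-cowedges `S(X, Z) ⊗ T(Z, Y) ⟶ W`, indexed by `Z` in the `V`-category `A`: the two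
morphisms out of `S(X, Z) ⊗ A(Z, Z') ⊗ T(Z', Y)` agree. -/
def IsCompCowedge (S T : Endomodule V A) (X Y : A) {W : V}
    (t : ∀ Z : A, Endomodule.at S X Z ⊗ Endomodule.at T Z Y ⟶ W) : Prop :=
  ∀ Z Z' : A,
    Endomodule.actR S X Z Z' ▷ Endomodule.at T Z' Y ≫ t Z' =
      (α_ _ _ _).hom ≫ _ ◁ ((β_ _ _).hom ≫ Endomodule.actL T Z Z' Y) ≫ t Z

/-- The monoidal structure on the `V`-category `[Aᵒᵖ ⊗ A, V]` given by composition of endomodules: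
the tensor product is the coend `(S ⊗ T)(X, Y) = ∫^Z S(X, Z) ⊗ T(Z, Y)`, `V`-functorially in
`X`, `Y`, `S` and `T`, the unit is `A(-, -)`, and the associativity and unit isomorphisms are
those induced by the associativity isomorphisms of `V` and by the actions of `A`. -/
structure EndomoduleComposition [HasLimits V] where
  [monoidalCategory : MonoidalCategory (Endomodule V A)]
  [monoidalVCategory : MonoidalVCategory V (Endomodule V A)]
  /-- the coprojections of the coend -/
  copr (S T : Endomodule V A) (X Z Y : A) :
    Endomodule.at S X Z ⊗ Endomodule.at T Z Y ⟶ Endomodule.at (S ⊗ T : Endomodule V A) X Y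
  isCompCowedge (S T : Endomodule V A) (X Y : A) : IsCompCowedge S T X Y (fun Z => copr S T X Z Y)
  existsUnique_desc (S T : Endomodule V A) (X Y : A) {W : V}
    (t : ∀ Z : A, Endomodule.at S X Z ⊗ Endomodule.at T Z Y ⟶ W) (ht : IsCompCowedge S T X Y t) :
    ∃! d : Endomodule.at (S ⊗ T : Endomodule V A) X Y ⟶ W, ∀ Z : A, copr S T X Z Y ≫ d = t Z
  copr_act (S T : Endomodule V A) (X X' Y Y' Z : A) :
    copr S T X Z Y ▷ ((X' ⟶[V] X) ⊗ (Y ⟶[V] Y')) ≫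
        VFunctor.act (S ⊗ T : Endomodule V A) ⟨op X, Y⟩ ⟨op X', Y'⟩ =
      tensorμ _ _ _ _ ≫ (Endomodule.actL S X' X Z ⊗ₘ Endomodule.actR T Z Y Y') ≫ copr S T X' Z Y'
  copr_tensorHomObj (S S' T T' : Endomodule V A) (X Y Z : A) :
    copr S T X Z Y ▷ ((S ⟶[V] S') ⊗ (T ⟶[V] T')) ≫
        Endomodule.at (S ⊗ T : Endomodule V A) X Y ◁ tensorHomObj S S' T T' ≫
          VFunctor.ev (S ⊗ T : Endomodule V A) (S' ⊗ T') ⟨op X, Y⟩ =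
      tensorμ _ _ _ _ ≫ (VFunctor.ev S S' ⟨op X, Z⟩ ⊗ₘ VFunctor.ev T T' ⟨op Z, Y⟩) ≫
        copr S' T' X Z Y
  copr_associator (R S T : Endomodule V A) (X Z W Y : A) :
    copr R S X Z W ▷ Endomodule.at T W Y ≫ copr (R ⊗ S) T X W Y ≫
        VFunctor.app (α_ R S T).hom ⟨op X, Y⟩ =
      (α_ _ _ _).hom ≫ Endomodule.at R X Z ◁ copr S T Z W Y ≫ copr R (S ⊗ T) X Z Y
  /-- the identification of the unit with `A(-, -)` -/
  unitIso : homEndomodule V A ≅ 𝟙_ (Endomodule V A)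
  copr_leftUnitor (T : Endomodule V A) (X Z Y : A) :
    VFunctor.app unitIso.hom ⟨op X, Z⟩ ▷ Endomodule.at T Z Y ≫
        copr (𝟙_ (Endomodule V A)) T X Z Y ≫ VFunctor.app (λ_ T).hom ⟨op X, Y⟩ =
      (β_ (X ⟶[V] Z) (Endomodule.at T Z Y)).hom ≫ Endomodule.actL T X Z Y
  copr_rightUnitor (S : Endomodule V A) (X Z Y : A) :
    Endomodule.at S X Z ◁ VFunctor.app unitIso.hom ⟨op Z, Y⟩ ≫
        copr S (𝟙_ (Endomodule V A)) X Z Y ≫ VFunctor.app (ρ_ S).hom ⟨op X, Y⟩ =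
      Endomodule.actR S X Z Y

end composition

variable {V : Type u} [Category.{v} V] [MonoidalCategory V] [MonoidalClosed V]
  [SymmetricCategory V] {A : Type v} [Category.{w} A] [EnrichedOrdinaryCategory V A]
  [MonoidalCategory A] [MonoidalVCategory V A] [RightClosed V A] [HasLimits V]

/-- Strong monoidal structures on the Cayley `V`-functor, from Day convolution to composition of
endomodules. -/
def CayleyStrongMonoidal (D : DayConvolution V A) (E : EndomoduleComposition V A) :=
  letI := D.monoidalCategory
  letI := D.monoidalVCategory
  letI := E.monoidalCategory
  letI := E.monoidalVCategory
  StrongMonoidal (cayley V A)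

end EnrichedCayley

end

/-! Why `Υ` is strong monoidal. At `(X, Y)` the composite endomodule is the coend over `Z` of `F
(Z^X) ⊗ G (Y^Z)`. By co-Yoneda, `F (Z^X)` is the coend over `U` of `F U ⊗ A(U, Z^X)`, and `A(U, Z^X)
≅ A(X ⊗ U, Z)`, so the composite is the coend over `U` of `F U ⊗ G (Y^(X ⊗ U))`. Expanding `G` in
the same way and using `A(W, Y^(X ⊗ U)) ≅ A(U ⊗ W, Y^X)` gives `(F * G)(Y^X)`. The units agree
because `A(X, Y) ≅ A(X ⊗ 𝟙, Y) ≅ A(𝟙, Y^X)`.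

Instead of chaining these isomorphisms, the proof shows that one explicit family is a universal
cowedge: the universal map `F (Z^X) ⊗ G (Y^Z) ⟶ (F * G)(Z^X ⊗ Y^Z)` followed by internal composition
`Z^X ⊗ Y^Z ⟶ Y^X` (`DayTensor.isUniversal_cayleyCopr`). A family `k` dinatural in `Z` yields a Day
cowedge by transposing `A(U ⊗ W, Y^X)` to `A(W, Y^(X ⊗ U))`, acting on `G`, applying the
coevaluation `U ⟶ (X ⊗ U)^X` under `F`, and using `k` at `X ⊗ U`. So `Υ` carries a Day convolution
to a composite of endomodules (`DayTensor.cayley`), and likewise its associator and unit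
isomorphisms. The structure isomorphism of `Υ` is the comparison of two composites of the same pair,
and its coherence is the naturality of the associator and the unit isomorphisms under a change of
chosen coends.

Both monoidal structures are therefore treated for arbitrary choices of coends. By Yoneda, a Day
convolution `P` of `F` and `G` amounts to a family `F U ⊗ G W ⟶ P (U ⊗ W)`, natural in each variable
and universal as such (`DayTensor`); a composite is a universal dinatural family (`EndoTensor`).
Morphisms are built by lifting along these families, and equations, including those between
hom-objects, are tested on them. Since `V` is closed, tensoring with a fixed object preserves the
universal families, which permits three and four factors as well as hom-object parameters. Coherence
then reduces to coherence in `V` and in `A`. Existence uses multicoequalizers in `V`. -/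

noncomputable section
namespace EnrichedCayley

/-! ### Morphisms parametrized by an object of `V` and the squares between them -/

section parametrized

variable {V : Type u} [Category.{v} V] [MonoidalCategory V]

/-- A square of morphisms `a : P ⊗ T ⟶ Q` and `b : P' ⊗ T ⟶ Q'` parametrized by `T`. -/
def Sq {P Q P' Q' T : V} (a : P ⊗ T ⟶ Q) (b : P' ⊗ T ⟶ Q') (f : P ⟶ P') (h : Q ⟶ Q') : Prop :=
  a ≫ h = f ▷ T ≫ b

/-- `B ⊗ -` applied to a parametrized morphism. -/
def actLeft (B : V) {P Q T : V} (a : P ⊗ T ⟶ Q) : (B ⊗ P) ⊗ T ⟶ B ⊗ Q :=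
  (α_ B P T).hom ≫ B ◁ a

namespace Sq

variable {P Q P' Q' P'' Q'' T : V}

lemma comp {a : P ⊗ T ⟶ Q} {b : P' ⊗ T ⟶ Q'} {c : P'' ⊗ T ⟶ Q''} {f : P ⟶ P'} {h : Q ⟶ Q'}
    {f' : P' ⟶ P''} {h' : Q' ⟶ Q''} (s : Sq a b f h) (s' : Sq b c f' h') :
    Sq a c (f ≫ f') (h ≫ h') := by
  unfold Sq at *
  rw [reassoc_of% s, s', comp_whiskerRight, Category.assoc]

lemma precomp {S : V} {a : P ⊗ T ⟶ Q} {b : P' ⊗ T ⟶ Q'} {f : P ⟶ P'} {h : Q ⟶ Q'}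
    (s : Sq a b f h) (k : S ⟶ T) : Sq (P ◁ k ≫ a) (P' ◁ k ≫ b) f h := by
  unfold Sq at *
  rw [Category.assoc, s, whisker_exchange_assoc]

/-- Two parameters are applied in succession. This glues naturality in one variable at a time into
joint naturality. -/
lemma seq {T' : V} {m m' : V} {a : P ⊗ T ⟶ m} {b : P' ⊗ T ⟶ m'} {f : P ⟶ P'} {g : m ⟶ m'}
    {a' : m ⊗ T' ⟶ Q} {b' : m' ⊗ T' ⟶ Q'} {h : Q ⟶ Q'}
    (s : Sq a b f g) (s' : Sq a' b' g h) :
    Sq ((α_ _ _ _).inv ≫ a ▷ T' ≫ a') ((α_ _ _ _).inv ≫ b ▷ T' ≫ b') f h := by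
  unfold Sq at *
  rw [Category.assoc, Category.assoc, s', ← comp_whiskerRight_assoc, s, comp_whiskerRight_assoc,
    associator_inv_naturality_left_assoc]

lemma of_iso {a : P ⊗ T ⟶ Q} {b : P' ⊗ T ⟶ Q'} {f : P ≅ P'} {h : Q ≅ Q'}
    (s : Sq a b f.hom h.hom) : Sq b a f.inv h.inv := by
  unfold Sq at *
  rw [← cancel_epi (f.hom ▷ T), ← reassoc_of% s]
  simp

lemma whiskerLeft (B : V) {a : P ⊗ T ⟶ Q} {b : P' ⊗ T ⟶ Q'} {f : P ⟶ P'} {h : Q ⟶ Q'}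
    (s : Sq a b f h) : Sq (actLeft B a) (actLeft B b) (B ◁ f) (B ◁ h) := by
  unfold Sq actLeft at *
  rw [Category.assoc, ← MonoidalCategory.whiskerLeft_comp, s]
  simp

lemma actLeft_whiskerRight {B B' : V} (k : B ⟶ B') (a : P ⊗ T ⟶ Q) :
    Sq (actLeft B a) (actLeft B' a) (k ▷ P) (k ▷ Q) := by
  unfold Sq actLeft
  rw [Category.assoc, whisker_exchange, associator_naturality_left_assoc]

lemma actLeft_actLeft (B C : V) (a : P ⊗ T ⟶ Q) :
    Sq (actLeft (B ⊗ C) a) (actLeft B (actLeft C a)) (α_ B C P).hom (α_ B C Q).hom := by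
  unfold Sq actLeft
  monoidal

lemma leftUnitor (a : P ⊗ T ⟶ Q) : Sq (actLeft (𝟙_ V) a) a (λ_ P).hom (λ_ Q).hom := by
  unfold Sq actLeft
  monoidal

end Sq

variable [SymmetricCategory V]

/-- `- ⊗ B` applied to a parametrized morphism. -/
def actRight {P Q T : V} (a : P ⊗ T ⟶ Q) (B : V) : (P ⊗ B) ⊗ T ⟶ Q ⊗ B :=
  swapRight P B T ≫ a ▷ B

/-- The tensor product of two parametrized morphisms. -/
def ptensor {P Q T P' Q' T' : V} (a : P ⊗ T ⟶ Q) (b : P' ⊗ T' ⟶ Q') :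
    (P ⊗ P') ⊗ (T ⊗ T') ⟶ Q ⊗ Q' :=
  tensorμ P P' T T' ≫ (a ⊗ₘ b)

lemma swapRight_swapRight (A B C : V) : swapRight A B C ≫ swapRight A C B = 𝟙 _ := by
  simp only [swapRight, Category.assoc, Iso.inv_hom_id_assoc]
  rw [← MonoidalCategory.whiskerLeft_comp_assoc, SymmetricCategory.symmetry]
  simp

lemma swapRight_naturality_middle (A : V) {B B' : V} (f : B ⟶ B') (C : V) :
    (A ◁ f) ▷ C ≫ swapRight A B' C = swapRight A B C ≫ (A ⊗ C) ◁ f := by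
  simp only [swapRight, Category.assoc]
  rw [associator_naturality_middle_assoc, ← MonoidalCategory.whiskerLeft_comp_assoc,
    BraidedCategory.braiding_naturality_left, MonoidalCategory.whiskerLeft_comp_assoc,
    associator_inv_naturality_right]

/-- Acting on both factors at once is acting on the left one and then on the right one; together
with `Sq.seq` this separates the variables. -/
lemma ptensor_eq {P Q T P' Q' T' : V} (a : P ⊗ T ⟶ Q) (b : P' ⊗ T' ⟶ Q') :
    ptensor a b = (α_ _ _ _).inv ≫ actRight a P' ▷ T' ≫ actLeft Q b := by
  unfold ptensor actRight actLeft
  rw [MonoidalCategory.tensorHom_def, comp_whiskerRight, Category.assoc,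
    associator_naturality_left_assoc]
  simp only [tensorμ, swapRight]
  monoidal

namespace Sq

variable {P Q P' Q' P'' Q'' T : V}

lemma whiskerRight {a : P ⊗ T ⟶ Q} {b : P' ⊗ T ⟶ Q'} {f : P ⟶ P'} {h : Q ⟶ Q'}
    (s : Sq a b f h) (B : V) : Sq (actRight a B) (actRight b B) (f ▷ B) (h ▷ B) := by
  unfold Sq actRight at *
  rw [Category.assoc, ← comp_whiskerRight, s, reassoc_of% @swapRight_naturality_left]
  simp

lemma actRight_whiskerLeft {B B' : V} (k : B ⟶ B') (a : P ⊗ T ⟶ Q) :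
    Sq (actRight a B) (actRight a B') (P ◁ k) (Q ◁ k) := by
  unfold Sq actRight
  rw [Category.assoc, ← whisker_exchange, reassoc_of% @swapRight_naturality_middle]

lemma actRight_actRight (B C : V) (a : P ⊗ T ⟶ Q) :
    Sq (actRight (actRight a B) C) (actRight a (B ⊗ C)) (α_ P B C).hom (α_ Q B C).hom := by
  unfold Sq actRight
  simp only [swapRight, BraidedCategory.braiding_tensor_left_hom]
  monoidal

lemma actLeft_actRight (B C : V) (a : P ⊗ T ⟶ Q) :
    Sq (actRight (actLeft B a) C) (actLeft B (actRight a C)) (α_ B P C).hom (α_ B Q C).hom := by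
  unfold Sq actRight actLeft
  simp only [swapRight]
  monoidal

lemma rightUnitor (a : P ⊗ T ⟶ Q) : Sq (actRight a (𝟙_ V)) a (ρ_ P).hom (ρ_ Q).hom := by
  unfold Sq actRight
  simp [swapRight, braiding_tensorUnit_left]

lemma braiding (a : P ⊗ T ⟶ Q) (B : V) :
    Sq (actRight a B) (actLeft B a) (β_ P B).hom (β_ Q B).hom := by
  unfold Sq actRight actLeft
  rw [Category.assoc, BraidedCategory.braiding_naturality_left]
  simp only [swapRight, BraidedCategory.braiding_tensor_left_hom]
  simp [← MonoidalCategory.whiskerLeft_comp_assoc]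

lemma braiding' (a : P ⊗ T ⟶ Q) (B : V) :
    Sq (actLeft B a) (actRight a B) (β_ B P).hom (β_ B Q).hom := by
  rw [SymmetricCategory.braiding_swap_eq_inv_braiding P B,
    SymmetricCategory.braiding_swap_eq_inv_braiding Q B]
  exact (braiding a B).of_iso

end Sq

end parametrized

/-! ### Actions of a `V`-category, naturality and generating families -/

section actions

variable {V : Type u} [Category.{v} V] [MonoidalCategory V] {C : Type w} [EnrichedCategory V C]

/-- The unit and composition laws of a `V`-functor `C ⟶ V` in terms of its action. -/
structure IsAction {m : C → V} (a : ∀ X Y : C, m X ⊗ (X ⟶[V] Y) ⟶ m Y) : Prop where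
  id (X : C) : m X ◁ eId V X ≫ a X X = (ρ_ _).hom
  comp (X Y Z : C) : m X ◁ eComp V X Y Z ≫ a X Z = (α_ _ _ _).inv ≫ a X Y ▷ _ ≫ a Y Z

/-- `V`-naturality of a family of morphisms with respect to actions of `C`. -/
def IsNat {m n : C → V} (a : ∀ X Y : C, m X ⊗ (X ⟶[V] Y) ⟶ m Y)
    (b : ∀ X Y : C, n X ⊗ (X ⟶[V] Y) ⟶ n Y) (φ : ∀ X, m X ⟶ n X) : Prop :=
  ∀ X Y, Sq (a X Y) (b X Y) (φ X) (φ Y)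

lemma IsNat.comp {m n k : C → V} {a : ∀ X Y : C, m X ⊗ (X ⟶[V] Y) ⟶ m Y}
    {b : ∀ X Y : C, n X ⊗ (X ⟶[V] Y) ⟶ n Y} {c : ∀ X Y : C, k X ⊗ (X ⟶[V] Y) ⟶ k Y}
    {φ : ∀ X, m X ⟶ n X} {ψ : ∀ X, n X ⟶ k X} (h : IsNat a b φ) (h' : IsNat b c ψ) :
    IsNat a c (fun X => φ X ≫ ψ X) :=
  fun X Y => (h X Y).comp (h' X Y)

/-- A family of morphisms with common target that is jointly epimorphic. -/
def JointlyEpi {ι : Type*} {P : ι → V} {Q : V} (c : ∀ i, P i ⟶ Q) : Prop :=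
  ∀ ⦃W : V⦄ (f g : Q ⟶ W), (∀ i, c i ≫ f = c i ≫ g) → f = g

/-- The morphisms `e i : E i ⟶ m (u i)` generate the action `a`. -/
def Generates {m : C → V} (a : ∀ X Y : C, m X ⊗ (X ⟶[V] Y) ⟶ m Y) {ι : Type*} {E : ι → V}
    {u : ι → C} (e : ∀ i, E i ⟶ m (u i)) : Prop :=
  ∀ X, JointlyEpi fun i => e i ▷ (u i ⟶[V] X) ≫ a (u i) X

/-- Naturality turns the value on a translate of a generator into the translate of the value on the
generator. The coherence equations for Day convolution are checked through this. -/
lemma Generates.ext {m n : C → V} {a : ∀ X Y : C, m X ⊗ (X ⟶[V] Y) ⟶ m Y}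
    {b : ∀ X Y : C, n X ⊗ (X ⟶[V] Y) ⟶ n Y} {ι : Type*} {E : ι → V}
    {u : ι → C} {e : ∀ i, E i ⟶ m (u i)} (h : Generates a e) {φ ψ : ∀ X, m X ⟶ n X}
    (hφ : IsNat a b φ) (hψ : IsNat a b ψ) (H : ∀ i, e i ≫ φ (u i) = e i ≫ ψ (u i)) (X : C) :
    φ X = ψ X :=
  h X _ _ fun i => by
    rw [Category.assoc, Category.assoc, hφ, hψ, ← comp_whiskerRight_assoc, H,
      comp_whiskerRight_assoc]

omit [MonoidalCategory V] in
lemma JointlyEpi.comp_epi {ι : Type*} {P : ι → V} {Q Q' : V} {c : ∀ i, P i ⟶ Q}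
    (h : JointlyEpi c) (k : Q ⟶ Q') [Epi k] : JointlyEpi fun i => c i ≫ k :=
  fun _ f g H => (cancel_epi k).1 (h _ _ fun i => by simpa using H i)

omit [MonoidalCategory V] in
lemma JointlyEpi.of_comp {ι : Type*} {P P' : ι → V} {Q : V} {k : ∀ i, P' i ⟶ P i}
    {c : ∀ i, P i ⟶ Q} (h : JointlyEpi fun i => k i ≫ c i) : JointlyEpi c :=
  fun _ f g H => h _ _ fun i => by simp [H i]

variable [MonoidalClosed V]

/-- Since `V` is closed, `T ⊗ -` is a left adjoint: transposition moves `T` into the target, where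
the hypothesis applies. -/
lemma JointlyEpi.whiskerLeft (T : V) {ι : Type*} {P : ι → V} {Q : V} {c : ∀ i, P i ⟶ Q}
    (h : JointlyEpi c) : JointlyEpi fun i => T ◁ c i := fun W f g H => by
  apply MonoidalClosed.curry_injective
  refine h _ _ fun i => ?_
  rw [← MonoidalClosed.curry_natural_left, H, MonoidalClosed.curry_natural_left]

lemma Generates.whiskerLeft {m : C → V} {a : ∀ X Y : C, m X ⊗ (X ⟶[V] Y) ⟶ m Y} {ι : Type*}
    {E : ι → V} {u : ι → C} {e : ∀ i, E i ⟶ m (u i)} (h : Generates a e) (T : V) :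
    Generates (fun X Y => actLeft T (a X Y)) (fun i => T ◁ e i) := fun X => by
  refine JointlyEpi.of_comp (k := fun i => (α_ T (E i) (u i ⟶[V] X)).inv) ?_
  convert (h X).whiskerLeft T using 2 with i
  simp [actLeft]

variable [SymmetricCategory V]

lemma JointlyEpi.whiskerRight (T : V) {ι : Type*} {P : ι → V} {Q : V} {c : ∀ i, P i ⟶ Q}
    (h : JointlyEpi c) : JointlyEpi fun i => c i ▷ T := by
  refine JointlyEpi.of_comp (k := fun i => (β_ T (P i)).hom) ?_
  convert (h.whiskerLeft T).comp_epi (β_ T Q).hom using 2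
  simp

lemma Generates.whiskerRight {m : C → V} {a : ∀ X Y : C, m X ⊗ (X ⟶[V] Y) ⟶ m Y} {ι : Type*}
    {E : ι → V} {u : ι → C} {e : ∀ i, E i ⟶ m (u i)} (h : Generates a e) (T : V) :
    Generates (fun X Y => actRight (a X Y) T) (fun i => e i ▷ T) := fun X => by
  refine JointlyEpi.of_comp (k := fun i => swapRight (E i) (u i ⟶[V] X) T) ?_
  convert (h X).whiskerRight T using 2 with i
  simp only [actRight]
  rw [reassoc_of% @swapRight_naturality_left, reassoc_of% @swapRight_swapRight]
  simp

end actions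

/-! ### Transposing actions into an internal hom -/

section cotensor

variable {V : Type u} [Category.{v} V] [MonoidalCategory V] [MonoidalClosed V]

/-- The internal hom `[T, -]` applied to a parametrized morphism. -/
def actCotensor (T : V) {P Q S : V} (a : P ⊗ S ⟶ Q) :
    (ihom T).obj P ⊗ S ⟶ (ihom T).obj Q :=
  MonoidalClosed.curry ((α_ _ _ _).inv ≫ (ihom.ev T).app P ▷ S ≫ a)

lemma whiskerLeft_actCotensor (T : V) {P Q S : V} (a : P ⊗ S ⟶ Q) :
    T ◁ actCotensor T a ≫ (ihom.ev T).app Q = (α_ _ _ _).inv ≫ (ihom.ev T).app P ▷ S ≫ a := by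
  rw [← MonoidalClosed.uncurry_eq, actCotensor, MonoidalClosed.uncurry_curry]

/-- An inert factor `T` in the source can be traded for `[T, -]` in the target without losing
naturality, so a universal property of `P` can be used in the presence of `T`. -/
lemma Sq.curry {T P Q P' Q' S : V} {a : P ⊗ S ⟶ Q} {b : P' ⊗ S ⟶ Q'} {f : T ⊗ P ⟶ P'}
    {h : T ⊗ Q ⟶ Q'} (s : Sq (actLeft T a) b f h) :
    Sq a (actCotensor T b) (MonoidalClosed.curry f) (MonoidalClosed.curry h) := by
  unfold Sq actLeft at *
  rw [← MonoidalClosed.curry_natural_left]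
  apply MonoidalClosed.uncurry_injective
  rw [MonoidalClosed.uncurry_curry, MonoidalClosed.uncurry_natural_left, actCotensor,
    MonoidalClosed.uncurry_curry, associator_inv_naturality_middle_assoc,
    ← comp_whiskerRight_assoc, ← MonoidalClosed.uncurry_eq, MonoidalClosed.uncurry_curry, ← s]
  simp

lemma Sq.uncurry {T P Q P' Q' S : V} {a : P ⊗ S ⟶ Q} {b : P' ⊗ S ⟶ Q'}
    {f : P ⟶ (ihom T).obj P'} {h : Q ⟶ (ihom T).obj Q'} (s : Sq a (actCotensor T b) f h) :
    Sq (actLeft T a) b (MonoidalClosed.uncurry f) (MonoidalClosed.uncurry h) := by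
  unfold Sq actLeft at *
  rw [Category.assoc, ← MonoidalClosed.uncurry_natural_left, s, MonoidalClosed.uncurry_natural_left,
    actCotensor, MonoidalClosed.uncurry_curry, associator_inv_naturality_middle_assoc,
    Iso.hom_inv_id_assoc, ← comp_whiskerRight_assoc, ← MonoidalClosed.uncurry_eq]

variable {C : Type w} [EnrichedCategory V C] {m : C → V}
  {a : ∀ X Y : C, m X ⊗ (X ⟶[V] Y) ⟶ m Y}

/-- Makes `[T, m -]` an admissible target for the lifting property `DayTensor.exists_lift`. -/
lemma IsAction.cotensor (h : IsAction a) (T : V) :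
    IsAction (fun X Y => actCotensor T (a X Y)) where
  id X := by
    apply MonoidalClosed.uncurry_injective
    rw [MonoidalClosed.uncurry_natural_left, actCotensor, MonoidalClosed.uncurry_curry,
      associator_inv_naturality_right_assoc, whisker_exchange_assoc]
    dsimp only [Functor.id_obj]
    rw [h.id,
      MonoidalClosed.uncurry_eq]
    simp
  comp X Y Z := by
    apply MonoidalClosed.uncurry_injective
    rw [MonoidalClosed.uncurry_natural_left, actCotensor, MonoidalClosed.uncurry_curry,
      associator_inv_naturality_right_assoc, whisker_exchange_assoc]
    dsimp only [Functor.id_obj]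
    rw [h.comp,
      MonoidalClosed.uncurry_natural_left, MonoidalClosed.uncurry_natural_left,
      show MonoidalClosed.uncurry (actCotensor T (a Y Z)) = _ from MonoidalClosed.uncurry_curry _,
      associator_inv_naturality_middle_assoc,
      ← comp_whiskerRight_assoc, whiskerLeft_actCotensor]
    simp

end cotensor

lemma VFunctor.isAction {V : Type u} [Category.{v} V] [MonoidalCategory V] [MonoidalClosed V]
    {C : Type w} [EnrichedCategory V C] (F : VFunctor V C) : IsAction F.act :=
  ⟨F.act_id, F.act_comp⟩

/-! ### Restricting an action along `- ⊗ W` and `U ⊗ -` -/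

section shift

variable {V : Type u} [Category.{v} V] [MonoidalCategory V] [BraidedCategory V]
  {A : Type w} [Category.{w'} A] [MonoidalCategory A] [EnrichedOrdinaryCategory V A]
  [MonoidalVCategory V A] {m : A → V}

open MonoidalVCategory

/-- An action precomposed with `- ⊗ W`. -/
def shiftRight (a : ∀ X Y : A, m X ⊗ (X ⟶[V] Y) ⟶ m Y) (W U U' : A) :
    m (U ⊗ W) ⊗ (U ⟶[V] U') ⟶ m (U' ⊗ W) :=
  _ ◁ tensorRightHom V W U U' ≫ a _ _

/-- An action precomposed with `U ⊗ -`. -/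
def shiftLeft (a : ∀ X Y : A, m X ⊗ (X ⟶[V] Y) ⟶ m Y) (U W W' : A) :
    m (U ⊗ W) ⊗ (W ⟶[V] W') ⟶ m (U ⊗ W') :=
  _ ◁ tensorLeftHom V U W W' ≫ a _ _

omit [BraidedCategory V] in
lemma IsAction.precomp {C : Type t} [EnrichedCategory V C] {D : Type t'} [EnrichedCategory V D]
    {m : D → V} {a : ∀ X Y : D, m X ⊗ (X ⟶[V] Y) ⟶ m Y} (h : IsAction a) (o : C → D)
    (k : ∀ X Y : C, (X ⟶[V] Y) ⟶ (o X ⟶[V] o Y)) (k_id : ∀ X, eId V X ≫ k X X = eId V (o X))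
    (k_comp : ∀ X Y Z, eComp V X Y Z ≫ k X Z = (k X Y ⊗ₘ k Y Z) ≫ eComp V _ _ _) :
    IsAction (m := fun X => m (o X)) (fun X Y => m (o X) ◁ k X Y ≫ a _ _) where
  id X := by rw [← MonoidalCategory.whiskerLeft_comp_assoc, k_id, h.id]
  comp X Y Z := by
    rw [← MonoidalCategory.whiskerLeft_comp_assoc, k_comp,
      MonoidalCategory.whiskerLeft_comp_assoc, h.comp, MonoidalCategory.tensorHom_def]
    simp only [MonoidalCategory.whiskerLeft_comp, Category.assoc, comp_whiskerRight]
    rw [associator_inv_naturality_right_assoc, whisker_exchange_assoc,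
      associator_inv_naturality_middle_assoc]

lemma isAction_shiftRight {a : ∀ X Y : A, m X ⊗ (X ⟶[V] Y) ⟶ m Y} (h : IsAction a) (W : A) :
    IsAction (m := fun U => m (U ⊗ W)) (shiftRight a W) :=
  h.precomp (· ⊗ W) (tensorRightHom V W) (eId_tensorRightHom V W) (eComp_tensorRightHom V W)

lemma isAction_shiftLeft {a : ∀ X Y : A, m X ⊗ (X ⟶[V] Y) ⟶ m Y} (h : IsAction a) (U : A) :
    IsAction (m := fun W => m (U ⊗ W)) (shiftLeft a U) :=
  h.precomp (U ⊗ ·) (tensorLeftHom V U) (eId_tensorLeftHom V U) (eComp_tensorLeftHom V U)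

/-- The tensor product on hom-objects of `A` factors as the left variable followed by the right one,
and the composition law of the action splits it accordingly. -/
lemma whiskerLeft_tensorHomObj_act {a : ∀ X Y : A, m X ⊗ (X ⟶[V] Y) ⟶ m Y} (h : IsAction a)
    (U U' W W' : A) :
    m (U ⊗ W) ◁ tensorHomObj U U' W W' ≫ a _ _ =
      (α_ _ _ _).inv ≫ shiftRight a W U U' ▷ _ ≫
        shiftLeft a U' W W' := by
  rw [← tensorRightHom_tensorLeftHom, MonoidalCategory.whiskerLeft_comp_assoc, h.comp,
    MonoidalCategory.tensorHom_def]
  simp only [MonoidalCategory.whiskerLeft_comp, Category.assoc, comp_whiskerRight,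
    shiftRight, shiftLeft]
  rw [associator_inv_naturality_right_assoc, whisker_exchange_assoc,
    associator_inv_naturality_middle_assoc]

/-- Acting in the opposite order differs only by the braiding. Compared with
`whiskerLeft_tensorHomObj_act`, this says that the two restricted actions commute. -/
lemma shiftLeft_shiftRight {a : ∀ X Y : A, m X ⊗ (X ⟶[V] Y) ⟶ m Y} (h : IsAction a)
    (U U' W W' : A) :
    (α_ _ _ _).inv ≫ shiftLeft a U W W' ▷ _ ≫
        shiftRight a W' U U' =
      _ ◁ (β_ _ _).hom ≫ m (U ⊗ W) ◁ tensorHomObj U U' W W' ≫ a _ _ := by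
  rw [← MonoidalCategory.whiskerLeft_comp_assoc, ← tensorLeftHom_tensorRightHom,
    MonoidalCategory.whiskerLeft_comp_assoc, h.comp,
    MonoidalCategory.tensorHom_def]
  simp only [MonoidalCategory.whiskerLeft_comp, Category.assoc, comp_whiskerRight,
    shiftRight, shiftLeft]
  rw [associator_inv_naturality_right_assoc, whisker_exchange_assoc,
    associator_inv_naturality_middle_assoc]

end shift

section shift

variable {V : Type u} [Category.{v} V] [MonoidalCategory V] [SymmetricCategory V]
  {A : Type w} [Category.{w'} A] [MonoidalCategory A] [EnrichedOrdinaryCategory V A]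
  [MonoidalVCategory V A] {m : A → V} {a : ∀ X Y : A, m X ⊗ (X ⟶[V] Y) ⟶ m Y}

lemma sq_shiftRight (h : IsAction a) (U U' W W' : A) :
    Sq (actRight (shiftLeft a U W W') (U ⟶[V] U')) (shiftLeft a U' W W')
      (shiftRight a W U U') (shiftRight a W' U U') := by
  have := shiftLeft_shiftRight h U U' W W'
  rw [whiskerLeft_tensorHomObj_act h] at this
  unfold Sq actRight swapRight
  simp only [Category.assoc]
  rw [this, ← MonoidalCategory.whiskerLeft_comp_assoc, SymmetricCategory.symmetry]
  simp

lemma sq_shiftLeft (h : IsAction a) (U U' W W' : A) :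
    Sq (actRight (shiftRight a W U U') (W ⟶[V] W')) (shiftRight a W' U U')
      (shiftLeft a U W W') (shiftLeft a U' W W') := by
  have := shiftLeft_shiftRight h U U' W W'
  rw [whiskerLeft_tensorHomObj_act h] at this
  unfold Sq actRight swapRight
  simp only [Category.assoc]
  rw [← cancel_epi (α_ _ _ _).inv, this, Iso.inv_hom_id_assoc]

/-- A unit in the second parameter makes the second action trivial. This extracts one-variable
naturality from joint naturality. -/
lemma ptensor_whisker_id {V : Type u} [Category.{v} V] [MonoidalCategory V] [SymmetricCategory V]
    {P P' Q S T : V} (a : P ⊗ T ⟶ Q) (b : P' ⊗ S ⟶ P') (e : 𝟙_ V ⟶ S)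
    (h : P' ◁ e ≫ b = (ρ_ P').hom) :
    (P ⊗ P') ◁ ((ρ_ T).inv ≫ T ◁ e) ≫ ptensor a b = actRight a P' := by
  unfold ptensor actRight swapRight
  rw [MonoidalCategory.whiskerLeft_comp_assoc, ← MonoidalCategory.id_tensorHom T e,
    tensorμ_natural_right_assoc, tensorHom_comp_tensorHom, h]
  simp [tensorμ, MonoidalCategory.tensorHom_def]

lemma ptensor_id_whisker {V : Type u} [Category.{v} V] [MonoidalCategory V] [SymmetricCategory V]
    {P P' Q' S T : V} (a : P ⊗ S ⟶ P) (b : P' ⊗ T ⟶ Q') (e : 𝟙_ V ⟶ S)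
    (h : P ◁ e ≫ a = (ρ_ P).hom) :
    (P ⊗ P') ◁ ((λ_ T).inv ≫ e ▷ T) ≫ ptensor a b = actLeft P b := by
  unfold ptensor actLeft
  rw [MonoidalCategory.whiskerLeft_comp_assoc, ← MonoidalCategory.tensorHom_id e T,
    tensorμ_natural_right_assoc, tensorHom_comp_tensorHom, h]
  simp [tensorμ, MonoidalCategory.tensorHom_def, braiding_tensorUnit_right]
  monoidal

end shift

/-! ### Day convolution through its universal bilinear family -/

section dayTensor

variable {V : Type u} [Category.{v} V] [MonoidalCategory V] [MonoidalClosed V]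
  [SymmetricCategory V] {A : Type v} [Category.{w} A] [EnrichedOrdinaryCategory V A]
  [MonoidalCategory A] [MonoidalVCategory V A]

open MonoidalVCategory

/-- `P` is the Day convolution of `F` and `G`, with universal family `ins`. -/
structure DayTensor (F G P : VFunctor V A) where
  ins (U W : A) : F.obj U ⊗ G.obj W ⟶ P.obj (U ⊗ W)
  nat_left (W U U' : A) :
    Sq (actRight (F.act U U') (G.obj W)) (shiftRight P.act W U U') (ins U W) (ins U' W)
  nat_right (U W W' : A) :
    Sq (actLeft (F.obj U) (G.act W W')) (shiftLeft P.act U W W') (ins U W) (ins U W')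
  existsUnique_desc (X : A) {T : V}
    (t : ∀ U W : A, (F.obj U ⊗ G.obj W) ⊗ ((U ⊗ W : A) ⟶[V] X) ⟶ T) (ht : IsDayCowedge F G X t) :
    ∃! d : P.obj X ⟶ T, ∀ U W : A, (ins U W ▷ _ ≫ P.act (U ⊗ W) X) ≫ d = t U W

/-- One direction inserts identities in one variable; the other composes the two partial squares. -/
lemma sq_ptensor_iff {F G : VFunctor V A} {m : A → V} {a : ∀ X Y : A, m X ⊗ (X ⟶[V] Y) ⟶ m Y}
    (ha : IsAction a) (t : ∀ U W : A, F.obj U ⊗ G.obj W ⟶ m (U ⊗ W)) :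
    (∀ U U' W W', Sq (ptensor (F.act U U') (G.act W W'))
      (m (U ⊗ W) ◁ tensorHomObj U U' W W' ≫ a _ _) (t U W) (t U' W')) ↔
    (∀ W U U', Sq (actRight (F.act U U') (G.obj W)) (shiftRight a W U U') (t U W) (t U' W)) ∧
    (∀ U W W', Sq (actLeft (F.obj U) (G.act W W')) (shiftLeft a U W W') (t U W) (t U W')) := by
  constructor
  · intro h
    constructor
    · intro W U U'
      have := (h U U' W W).precomp ((ρ_ _).inv ≫ _ ◁ eId V W)
      rw [ptensor_whisker_id _ _ _ (G.act_id W), ← MonoidalCategory.whiskerLeft_comp_assoc,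
        Category.assoc] at this
      exact this
    · intro U W W'
      have := (h U U W W').precomp ((λ_ _).inv ≫ eId V U ▷ _)
      rw [ptensor_id_whisker _ _ _ (F.act_id U), ← MonoidalCategory.whiskerLeft_comp_assoc,
        Category.assoc] at this
      exact this
  · rintro ⟨h₁, h₂⟩ U U' W W'
    rw [ptensor_eq, whiskerLeft_tensorHomObj_act ha]
    exact (h₁ W U U').seq (h₂ U' W W')

/-- The Yoneda step: a natural family with values in `m (U ⊗ W)` extends along the action of `A(U ⊗
W, X)`, and its naturality becomes the cowedge condition. -/
lemma isDayCowedge_of_sq {F G : VFunctor V A} {m : A → V}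
    {a : ∀ X Y : A, m X ⊗ (X ⟶[V] Y) ⟶ m Y}
    (ha : IsAction a) (t : ∀ U W : A, F.obj U ⊗ G.obj W ⟶ m (U ⊗ W))
    (h : ∀ U U' W W', Sq (ptensor (F.act U U') (G.act W W'))
      (m (U ⊗ W) ◁ tensorHomObj U U' W W' ≫ a _ _) (t U W) (t U' W')) (X : A) :
    IsDayCowedge F G X (fun U W => t U W ▷ _ ≫ a _ X) := fun U U' W W' => by
  have := h U U' W W'
  unfold Sq ptensor at this
  rw [← comp_whiskerRight_assoc, this, whisker_exchange_assoc]
  simp only [MonoidalCategory.whiskerLeft_comp, Category.assoc, comp_whiskerRight]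
  rw [ha.comp]
  simp

namespace DayTensor

variable {F G P : VFunctor V A} (D : DayTensor F G P)

/-- This is the uniqueness half of the coend property: two morphisms that agree on generators factor
the same cowedge. -/
lemma generates : Generates P.act (fun p : A × A => D.ins p.1 p.2) := fun X W f g H => by
  have ht : IsDayCowedge F G X (fun U W => (D.ins U W ▷ _ ≫ P.act (U ⊗ W) X) ≫ f) := fun U U' W W' => by
    have := isDayCowedge_of_sq P.isAction D.ins
      ((sq_ptensor_iff P.isAction D.ins).2 ⟨D.nat_left, D.nat_right⟩) X U U' W W'
    simpa using congrArg (· ≫ f) this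
  exact (D.existsUnique_desc X _ ht).unique (fun _ _ => rfl) (fun U W => (H (U, W)).symm)

/-- The cowedge extended from `t` gives the components of `τ`. Their naturality is an equation out
of `P X ⊗ A(X, Y)`, hence is tested on generators. -/
lemma exists_lift {m : A → V} {a : ∀ X Y : A, m X ⊗ (X ⟶[V] Y) ⟶ m Y} (ha : IsAction a)
    (t : ∀ U W : A, F.obj U ⊗ G.obj W ⟶ m (U ⊗ W))
    (h₁ : ∀ W U U', Sq (actRight (F.act U U') (G.obj W)) (shiftRight a W U U') (t U W) (t U' W))
    (h₂ : ∀ U W W', Sq (actLeft (F.obj U) (G.act W W')) (shiftLeft a U W W') (t U W) (t U W')) :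
    ∃ τ : ∀ X, P.obj X ⟶ m X, IsNat P.act a τ ∧ ∀ U W, D.ins U W ≫ τ (U ⊗ W) = t U W := by
  choose τ hτ _ using fun X => D.existsUnique_desc X _
    (isDayCowedge_of_sq ha t ((sq_ptensor_iff ha t).2 ⟨h₁, h₂⟩) X)
  simp only [Category.assoc] at hτ
  refine ⟨τ, fun X Y => ?_, fun U W => ?_⟩
  · refine ((D.generates X).whiskerRight (X ⟶[V] Y)) _ _ fun ⟨U, W⟩ => ?_
    have e₁ := P.act_comp (U ⊗ W) X Y
    have e₂ := ha.comp (U ⊗ W) X Y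
    rw [Iso.eq_inv_comp] at e₁ e₂
    dsimp only
    rw [← comp_whiskerRight_assoc, Category.assoc, hτ]
    simp only [comp_whiskerRight, Category.assoc]
    rw [← e₂, ← reassoc_of% e₁, associator_naturality_left_assoc, associator_naturality_left_assoc,
      ← whisker_exchange_assoc, ← whisker_exchange_assoc, hτ]
  -- Evaluating the defining equation of `τ` at the identity of `U ⊗ W` recovers `t`.
  · have := hτ (U ⊗ W) U W
    rw [← cancel_epi (ρ_ _).hom, ← rightUnitor_naturality_assoc, ← P.act_id, Category.assoc,
      ← whisker_exchange_assoc, this, whisker_exchange_assoc, ha.id,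
      MonoidalCategory.rightUnitor_naturality]

/-- The spare factor `T` is transposed to the target, the lift is taken into the cotensored action,
and the result is transposed back. -/
lemma exists_liftLeft {m : A → V} {a : ∀ X Y : A, m X ⊗ (X ⟶[V] Y) ⟶ m Y} (ha : IsAction a)
    (T : V) (t : ∀ U W : A, T ⊗ F.obj U ⊗ G.obj W ⟶ m (U ⊗ W))
    (h₁ : ∀ W U U', Sq (actLeft T (actRight (F.act U U') (G.obj W))) (shiftRight a W U U')
      (t U W) (t U' W))
    (h₂ : ∀ U W W', Sq (actLeft T (actLeft (F.obj U) (G.act W W'))) (shiftLeft a U W W')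
      (t U W) (t U W')) :
    ∃ τ : ∀ X, T ⊗ P.obj X ⟶ m X, IsNat (fun X Y => actLeft T (P.act X Y)) a τ ∧
      ∀ U W, T ◁ D.ins U W ≫ τ (U ⊗ W) = t U W := by
  -- Cotensoring commutes with reindexing the parameter, hence with both restrictions of the action.
  have e {Q Q' S S' : V} (a : Q ⊗ S ⟶ Q') (k : S' ⟶ S) :
      actCotensor T (Q ◁ k ≫ a) = (ihom T).obj Q ◁ k ≫ actCotensor T a := by
    apply MonoidalClosed.uncurry_injective
    rw [MonoidalClosed.uncurry_natural_left, actCotensor, actCotensor,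
      MonoidalClosed.uncurry_curry, MonoidalClosed.uncurry_curry]
    rw [associator_inv_naturality_right_assoc, whisker_exchange_assoc]
    rfl
  obtain ⟨τ, hτ, hτ'⟩ := D.exists_lift (ha.cotensor T) (fun U W => MonoidalClosed.curry (t U W))
    (fun W U U' => by
      have := (h₁ W U U').curry
      rwa [shiftRight, e] at this)
    (fun U W W' => by
      have := (h₂ U W W').curry
      rwa [shiftLeft, e] at this)
  refine ⟨fun X => MonoidalClosed.uncurry (τ X), fun X Y => (hτ X Y).uncurry, fun U W => ?_⟩
  rw [← MonoidalClosed.uncurry_natural_left, hτ', MonoidalClosed.uncurry_curry]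

lemma exists_liftRight {m : A → V} {a : ∀ X Y : A, m X ⊗ (X ⟶[V] Y) ⟶ m Y} (ha : IsAction a)
    (T : V) (t : ∀ U W : A, (F.obj U ⊗ G.obj W) ⊗ T ⟶ m (U ⊗ W))
    (h₁ : ∀ W U U', Sq (actRight (actRight (F.act U U') (G.obj W)) T) (shiftRight a W U U')
      (t U W) (t U' W))
    (h₂ : ∀ U W W', Sq (actRight (actLeft (F.obj U) (G.act W W')) T) (shiftLeft a U W W')
      (t U W) (t U W')) :
    ∃ τ : ∀ X, P.obj X ⊗ T ⟶ m X, IsNat (fun X Y => actRight (P.act X Y) T) a τ ∧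
      ∀ U W, D.ins U W ▷ T ≫ τ (U ⊗ W) = t U W := by
  obtain ⟨τ, hτ, hτ'⟩ := D.exists_liftLeft ha T (fun U W => (β_ _ _).hom ≫ t U W)
    (fun W U U' => (Sq.braiding' _ _).comp (h₁ W U U'))
    (fun U W W' => (Sq.braiding' _ _).comp (h₂ U W W'))
  refine ⟨fun X => (β_ _ _).hom ≫ τ X, fun X Y => (Sq.braiding _ _).comp (hτ X Y), fun U W => ?_⟩
  rw [BraidedCategory.braiding_naturality_left_assoc, hτ', SymmetricCategory.symmetry_assoc]

end DayTensor

end dayTensor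

/-! ### The effect of an action on ordinary morphisms -/

section mapHom

variable {V : Type u} [Category.{v} V] [MonoidalCategory V] {A : Type w} [Category.{w'} A]
  [EnrichedOrdinaryCategory V A] {m : A → V}

lemma actLeft_precomp (B : V) {P Q T S : V} (k : S ⟶ T) (a : P ⊗ T ⟶ Q) :
    actLeft B (P ◁ k ≫ a) = (B ⊗ P) ◁ k ≫ actLeft B a := by
  simp [actLeft]

lemma actRight_precomp [SymmetricCategory V] (B : V) {P Q T S : V} (k : S ⟶ T) (a : P ⊗ T ⟶ Q) :
    actRight (P ◁ k ≫ a) B = (P ⊗ B) ◁ k ≫ actRight a B := by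
  unfold actRight
  rw [reassoc_of% @swapRight_naturality_right, comp_whiskerRight]

/-- The effect of an action on ordinary morphisms. -/
def actHom (a : ∀ X Y : A, m X ⊗ (X ⟶[V] Y) ⟶ m Y) {X Y : A} (f : X ⟶ Y) : m X ⟶ m Y :=
  (ρ_ _).inv ≫ m X ◁ eHomEquiv V f ≫ a X Y

variable {a : ∀ X Y : A, m X ⊗ (X ⟶[V] Y) ⟶ m Y}

lemma actHom_id (h : IsAction a) (X : A) : actHom a (𝟙 X) = 𝟙 _ := by
  simp [actHom, h.id]

lemma act_actHom (h : IsAction a) (X : A) {Y Y' : A} (g : Y ⟶ Y') :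
    a X Y ≫ actHom a g = m X ◁ eHomWhiskerLeft V X g ≫ a X Y' := by
  simp only [actHom, eHomWhiskerLeft, MonoidalCategory.whiskerLeft_comp, Category.assoc]
  rw [h.comp, rightUnitor_inv_naturality_assoc, ← whisker_exchange_assoc]
  simp

lemma actHom_act (h : IsAction a) {X X' : A} (f : X ⟶ X') (Y : A) :
    actHom a f ▷ _ ≫ a X' Y = m X ◁ eHomWhiskerRight V f Y ≫ a X Y := by
  simp only [actHom, eHomWhiskerRight, MonoidalCategory.whiskerLeft_comp, Category.assoc,
    comp_whiskerRight]
  rw [h.comp]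
  simp

lemma actHom_comp (h : IsAction a) {X Y Z : A} (f : X ⟶ Y) (g : Y ⟶ Z) :
    actHom a (f ≫ g) = actHom a f ≫ actHom a g := by
  have : eHomEquiv V (f ≫ g) = eHomEquiv V f ≫ eHomWhiskerLeft V X g := by
    rw [eHomEquiv_comp, eHomWhiskerLeft, rightUnitor_inv_naturality_assoc,
      MonoidalCategory.tensorHom_def, Category.assoc, unitors_inv_equal]
  conv_rhs => rw [actHom, Category.assoc, Category.assoc, act_actHom h]
  rw [← MonoidalCategory.whiskerLeft_comp_assoc, ← this, actHom]

/-- An identity between maps of hom-objects of `A` becomes a naturality square for every action.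
Through it, `V`-naturality of the structure isomorphisms of `A` reaches all `V`-functors. -/
lemma Sq.actHom (h : IsAction a) {T : V} {X Y X' Y' : A} {k : T ⟶ (X ⟶[V] Y)}
    {k' : T ⟶ (X' ⟶[V] Y')} {f : X ⟶ X'} {g : Y ⟶ Y'}
    (s : k ≫ eHomWhiskerLeft V X g = k' ≫ eHomWhiskerRight V f Y') :
    Sq (m X ◁ k ≫ a X Y) (m X' ◁ k' ≫ a X' Y') (actHom a f) (actHom a g) := by
  unfold Sq
  rw [Category.assoc, act_actHom h, ← MonoidalCategory.whiskerLeft_comp_assoc, s,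
    ← whisker_exchange_assoc, actHom_act h]
  simp

/-- The isomorphism induced by an action from an isomorphism of `A`. -/
def actIso (h : IsAction a) {X Y : A} (f : X ≅ Y) : m X ≅ m Y where
  hom := actHom a f.hom
  inv := actHom a f.inv
  hom_inv_id := by rw [← actHom_comp h, f.hom_inv_id, actHom_id h]
  inv_hom_id := by rw [← actHom_comp h, f.inv_hom_id, actHom_id h]

lemma actIso_hom (h : IsAction a) {X Y : A} (f : X ≅ Y) :
    (actIso h f).hom = actHom a f.hom := rfl

lemma actIso_inv (h : IsAction a) {X Y : A} (f : X ≅ Y) :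
    (actIso h f).inv = actHom a f.inv := rfl

lemma IsNat.actHom {n : A → V} {b : ∀ X Y : A, n X ⊗ (X ⟶[V] Y) ⟶ n Y} {φ : ∀ X, m X ⟶ n X}
    (h : IsNat a b φ) {X Y : A} (f : X ⟶ Y) :
    EnrichedCayley.actHom a f ≫ φ Y = φ X ≫ EnrichedCayley.actHom b f := by
  have := h X Y
  unfold Sq at this
  simp [EnrichedCayley.actHom, this, whisker_exchange_assoc]

lemma actHom_actLeft (B : V) {X Y : A} (f : X ⟶ Y) :
    actHom (m := fun X => B ⊗ m X) (fun X Y => actLeft B (a X Y)) f = B ◁ actHom a f := by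
  simp [actHom, actLeft]

lemma actHom_actRight [SymmetricCategory V] (B : V) {X Y : A} (f : X ⟶ Y) :
    actHom (m := fun X => m X ⊗ B) (fun X Y => actRight (a X Y) B) f = actHom a f ▷ B := by
  unfold actHom actRight
  rw [reassoc_of% @swapRight_naturality_right]
  simp [swapRight, braiding_tensorUnit_right]

end mapHom

/-! ### Naturality of the structure isomorphisms of `A`, one variable at a time -/

section shift

open MonoidalVCategory

variable {V : Type u} [Category.{v} V] [MonoidalCategory V] [BraidedCategory V]
  {A : Type w} [Category.{w'} A] [MonoidalCategory A] [EnrichedOrdinaryCategory V A]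
  [MonoidalVCategory V A]

lemma eHomEquiv_tensorRightHom {U U' : A} (f : U ⟶ U') (W : A) :
    eHomEquiv V f ≫ tensorRightHom V W U U' = eHomEquiv V (f ▷ W) := by
  rw [← tensorHom_id, ← tensorHomObj_eHomEquiv, tensorRightHom, rightUnitor_inv_naturality_assoc,
    MonoidalCategory.tensorHom_def_assoc, eHomEquiv_id, unitors_inv_equal]

lemma eHomEquiv_tensorLeftHom (U : A) {W W' : A} (f : W ⟶ W') :
    eHomEquiv V f ≫ tensorLeftHom V U W W' = eHomEquiv V (U ◁ f) := by
  rw [← id_tensorHom, ← tensorHomObj_eHomEquiv, tensorLeftHom, leftUnitor_inv_naturality_assoc,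
    MonoidalCategory.tensorHom_def'_assoc, eHomEquiv_id]

variable (V) in
-- The joint `V`-naturality of the associator is specialized to identities in the last two
-- variables; the next two lemmas specialize to the middle and to the last variable.
lemma tensorRightHom_associator (U U' W Z : A) :
    tensorRightHom V W U U' ≫ tensorRightHom V Z _ _ ≫ eHomWhiskerLeft V _ (α_ U' W Z).hom =
      tensorRightHom V (W ⊗ Z) U U' ≫ eHomWhiskerRight V (α_ U W Z).hom _ := by
  have := congrArg (fun k => ((ρ_ _).inv ≫ _ ◁ eId V W) ≫ (ρ_ _).inv ≫ _ ◁ eId V Z ≫ k)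
    (associator_naturality (V := V) U U' W W Z Z)
  rw [whisker_exchange_assoc, ← rightUnitor_inv_naturality_assoc] at this
  simp only [tensorRightHom, Category.assoc] at this ⊢
  rw [this, ← eId_tensorHomObj]
  simp [MonoidalCategory.tensorHom_def]

variable (V) in
lemma tensorMiddleHom_associator (U W W' Z : A) :
    tensorLeftHom V U W W' ≫ tensorRightHom V Z _ _ ≫ eHomWhiskerLeft V _ (α_ U W' Z).hom =
      tensorRightHom V Z W W' ≫ tensorLeftHom V U _ _ ≫ eHomWhiskerRight V (α_ U W Z).hom _ := by
  have := congrArg (fun k => ((λ_ _).inv ≫ eId V U ▷ _) ≫ (ρ_ _).inv ≫ _ ◁ eId V Z ≫ k)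
    (associator_naturality (V := V) U U W W' Z Z)
  rw [whisker_exchange_assoc, ← rightUnitor_inv_naturality_assoc] at this
  simp only [tensorRightHom, tensorLeftHom, Category.assoc] at this ⊢
  rw [this]
  simp only [← Category.assoc]
  congr 2
  simp only [Category.assoc]
  rw [leftUnitor_inv_naturality_assoc, leftUnitor_inv_naturality_assoc,
    leftUnitor_inv_naturality_assoc, whisker_exchange, whisker_exchange_assoc,
    whisker_exchange_assoc]
  monoidal

variable (V) in
lemma tensorLeftHom_associator (U W Z Z' : A) :
    tensorLeftHom V (U ⊗ W) Z Z' ≫ eHomWhiskerLeft V _ (α_ U W Z').hom =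
      tensorLeftHom V W Z Z' ≫ tensorLeftHom V U _ _ ≫ eHomWhiskerRight V (α_ U W Z).hom _ := by
  have := congrArg (fun k => (λ_ _).inv ≫ ((λ_ _).inv ≫ (eId V U ⊗ₘ eId V W)) ▷ _ ≫ k)
    (associator_naturality (V := V) U U W W Z Z')
  rw [← comp_whiskerRight_assoc, Category.assoc, eId_tensorHomObj] at this
  simp only [tensorLeftHom, Category.assoc]
  rw [this]
  simp only [← Category.assoc]
  congr 2
  simp only [Category.assoc]
  rw [leftUnitor_inv_naturality_assoc, leftUnitor_inv_naturality_assoc,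
    whisker_exchange, whisker_exchange_assoc]
  simp only [MonoidalCategory.tensorHom_def]
  monoidal

variable (V) in
lemma tensorLeftHom_leftUnitor (U U' : A) :
    tensorLeftHom V (𝟙_ A) U U' ≫ eHomWhiskerLeft V _ (λ_ U').hom =
      eHomWhiskerRight V (λ_ U).hom U' := by
  rw [← MonoidalVCategory.leftUnitor_naturality]; simp [tensorLeftHom]

variable (V) in
lemma tensorRightHom_rightUnitor (U U' : A) :
    tensorRightHom V (𝟙_ A) U U' ≫ eHomWhiskerLeft V _ (ρ_ U').hom =
      eHomWhiskerRight V (ρ_ U).hom U' := by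
  rw [← MonoidalVCategory.rightUnitor_naturality]; simp [tensorRightHom]

variable {m : A → V} {a : ∀ X Y : A, m X ⊗ (X ⟶[V] Y) ⟶ m Y}

lemma sq_associator_left (h : IsAction a) (U U' W Z : A) :
    Sq (shiftRight (m := fun U => m (U ⊗ Z)) (shiftRight a Z) W U U')
      (shiftRight a (W ⊗ Z) U U') (actHom a (α_ U W Z).hom) (actHom a (α_ U' W Z).hom) := by
  have := tensorRightHom_associator V U U' W Z
  rw [← Category.assoc] at this
  have := Sq.actHom h this
  rwa [MonoidalCategory.whiskerLeft_comp, Category.assoc] at this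

lemma sq_associator_middle (h : IsAction a) (U W W' Z : A) :
    Sq (shiftLeft (m := fun U => m (U ⊗ Z)) (shiftRight a Z) U W W')
      (shiftRight (m := fun W => m (U ⊗ W)) (shiftLeft a U) Z W W')
      (actHom a (α_ U W Z).hom) (actHom a (α_ U W' Z).hom) := by
  have := tensorMiddleHom_associator V U W W' Z
  rw [← Category.assoc, ← Category.assoc] at this
  have := Sq.actHom h this
  rwa [MonoidalCategory.whiskerLeft_comp, MonoidalCategory.whiskerLeft_comp, Category.assoc,
    Category.assoc] at this

lemma sq_associator_right (h : IsAction a) (U W Z Z' : A) :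
    Sq (shiftLeft a (U ⊗ W) Z Z')
      (shiftLeft (m := fun W => m (U ⊗ W)) (shiftLeft a U) W Z Z')
      (actHom a (α_ U W Z).hom) (actHom a (α_ U W Z').hom) := by
  have := tensorLeftHom_associator V U W Z Z'
  rw [← Category.assoc (tensorLeftHom V W Z Z')] at this
  have := Sq.actHom h this
  rwa [MonoidalCategory.whiskerLeft_comp, Category.assoc] at this

lemma sq_leftUnitor (h : IsAction a) (U U' : A) :
    Sq (shiftLeft a (𝟙_ A) U U') (a U U') (actHom a (λ_ U).hom) (actHom a (λ_ U').hom) := by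
  have := tensorLeftHom_leftUnitor V U U'
  rw [← Category.id_comp (eHomWhiskerRight V (λ_ U).hom U')] at this
  have := Sq.actHom h this
  rwa [MonoidalCategory.whiskerLeft_id, Category.id_comp] at this

lemma sq_rightUnitor (h : IsAction a) (U U' : A) :
    Sq (shiftRight a (𝟙_ A) U U') (a U U') (actHom a (ρ_ U).hom) (actHom a (ρ_ U').hom) := by
  have := tensorRightHom_rightUnitor V U U'
  rw [← Category.id_comp (eHomWhiskerRight V (ρ_ U).hom U')] at this
  have := Sq.actHom h this
  rwa [MonoidalCategory.whiskerLeft_id, Category.id_comp] at this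

lemma actHom_shiftRight (W : A) {U U' : A} (f : U ⟶ U') :
    actHom (m := fun U => m (U ⊗ W)) (shiftRight a W) f = actHom a (f ▷ W) := by
  rw [actHom, shiftRight, ← MonoidalCategory.whiskerLeft_comp_assoc, eHomEquiv_tensorRightHom,
    actHom]

lemma actHom_shiftLeft (U : A) {W W' : A} (f : W ⟶ W') :
    actHom (m := fun W => m (U ⊗ W)) (shiftLeft a U) f = actHom a (U ◁ f) := by
  rw [actHom, shiftLeft, ← MonoidalCategory.whiskerLeft_comp_assoc, eHomEquiv_tensorLeftHom,
    actHom]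

end shift

/-! ### Exchange of independent parameters -/

namespace Sq

variable {V : Type u} [Category.{v} V] [MonoidalCategory V] [SymmetricCategory V]

/-- Tensoring with an independent `r` keeps `x` natural: permute the inert factors so that `H`
stands next to `P`, apply the given square, then apply `r`. -/
lemma ptensor_left {P Q P' Q' B B' T H K : V} {a : P ⊗ T ⟶ Q} {b : P' ⊗ T ⟶ Q'}
    {x : P ⊗ H ⟶ P'} {y : Q ⊗ H ⟶ Q'} (s : Sq (actRight a H) b x y) (r : B ⊗ K ⟶ B') :
    Sq (actRight (actRight a B) (H ⊗ K)) (actRight b B') (ptensor x r) (ptensor y r) := by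
  have h := ((((actRight_actRight B (H ⊗ K) a).comp
    (actRight_whiskerLeft ((α_ B H K).inv ≫ (β_ B H).hom ▷ K ≫ (α_ H B K).hom) a)).comp
    (actRight_actRight H (B ⊗ K) a).of_iso).comp (s.whiskerRight (B ⊗ K))).comp
    (actRight_whiskerLeft r b)
  convert h using 1 <;> simp [ptensor, tensorμ, MonoidalCategory.tensorHom_def]

lemma ptensor_right {P Q P' Q' B B' T H K : V} {a : P ⊗ T ⟶ Q} {b : P' ⊗ T ⟶ Q'}
    {x : P ⊗ K ⟶ P'} {y : Q ⊗ K ⟶ Q'} (s : Sq (actRight a K) b x y) (r : B ⊗ H ⟶ B') :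
    Sq (actRight (actLeft B a) (H ⊗ K)) (actLeft B' b) (ptensor r x) (ptensor r y) := by
  have h₁ := ((actRight_actRight H K a).of_iso.comp ((braiding a H).whiskerRight K)).comp
    (actLeft_actRight H K a)
  have h := ((((actLeft_actRight B (H ⊗ K) a).comp (h₁.whiskerLeft B)).comp
    (actLeft_actLeft B H (actRight a K)).of_iso).comp (s.whiskerLeft (B ⊗ H))).comp
    (actLeft_whiskerRight r b)
  convert h using 1 <;> simp [ptensor, tensorμ, MonoidalCategory.tensorHom_def']

lemma actLeft_actRight_exchange {P Q B B' T S : V} (a : P ⊗ T ⟶ Q) (r : B ⊗ S ⟶ B') :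
    Sq (actRight (actRight a B) S) (actRight a B') (actLeft P r) (actLeft Q r) :=
  (actRight_actRight B S a).comp (actRight_whiskerLeft r a)

lemma actRight_actLeft_exchange {P Q B B' T S : V} (a : P ⊗ T ⟶ Q) (r : B ⊗ S ⟶ B') :
    Sq (actRight (actLeft B a) S) (actLeft B' a) (actRight r P) (actRight r Q) := by
  have h := ((((braiding' a B).whiskerRight S).comp (actLeft_actRight_exchange a r))).comp
    (braiding a B')
  have e (P : V) : (β_ B P).hom ▷ S ≫ actLeft P r ≫ (β_ P B').hom = actRight r P := by
    have := braiding r P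
    unfold Sq at this
    rw [← cancel_mono (β_ B' P).hom, this]
    simp
  simpa only [Category.assoc, e] using h

end Sq

/-! ### Morphisms out of iterated Day convolutions -/

section dayTensor

variable {V : Type u} [Category.{v} V] [MonoidalCategory V] [MonoidalClosed V]
  [SymmetricCategory V] {A : Type v} [Category.{w} A] [EnrichedOrdinaryCategory V A]
  [MonoidalCategory A] [MonoidalVCategory V A]

open MonoidalVCategory VFunctor

/-- The morphism of `V`-functors given by a `V`-natural family. -/
def IsNat.hom {C : Type w} [EnrichedCategory V C] {F G : VFunctor V C}
    {τ : ∀ X, F.obj X ⟶ G.obj X} (h : IsNat F.act G.act τ) : F ⟶ G := VNat.mk τ h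

omit [SymmetricCategory V] in
@[simp]
lemma IsNat.hom_app {C : Type w} [EnrichedCategory V C] {F G : VFunctor V C}
    {τ : ∀ X, F.obj X ⟶ G.obj X} (h : IsNat F.act G.act τ) (X : C) : app h.hom X = τ X := rfl

omit [SymmetricCategory V] in
lemma isNat_app {C : Type w} [EnrichedCategory V C] {F G : VFunctor V C} (f : F ⟶ G) :
    IsNat F.act G.act (app f) := app_naturality f

omit [MonoidalClosed V] in
lemma IsNat.shiftRight {m n : A → V} {a : ∀ X Y : A, m X ⊗ (X ⟶[V] Y) ⟶ m Y}
    {b : ∀ X Y : A, n X ⊗ (X ⟶[V] Y) ⟶ n Y} {φ : ∀ X, m X ⟶ n X} (h : IsNat a b φ) (W : A) :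
    IsNat (shiftRight a W) (shiftRight b W) (fun U => φ (U ⊗ W)) :=
  fun _ _ => (h _ _).precomp _

omit [MonoidalClosed V] in
lemma IsNat.shiftLeft {m n : A → V} {a : ∀ X Y : A, m X ⊗ (X ⟶[V] Y) ⟶ m Y}
    {b : ∀ X Y : A, n X ⊗ (X ⟶[V] Y) ⟶ n Y} {φ : ∀ X, m X ⟶ n X} (h : IsNat a b φ) (U : A) :
    IsNat (shiftLeft a U) (shiftLeft b U) (fun W => φ (U ⊗ W)) :=
  fun _ _ => (h _ _).precomp _

omit [MonoidalClosed V] in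
lemma IsNat.shiftRight_actRight {m n : A → V} {a : ∀ X Y : A, m X ⊗ (X ⟶[V] Y) ⟶ m Y}
    {b : ∀ X Y : A, n X ⊗ (X ⟶[V] Y) ⟶ n Y} {B : V} {φ : ∀ X, m X ⊗ B ⟶ n X}
    (h : IsNat (fun X Y => actRight (a X Y) B) b φ) (W : A) :
    IsNat (fun X Y => actRight (EnrichedCayley.shiftRight a W X Y) B)
      (EnrichedCayley.shiftRight b W) (fun U => φ (U ⊗ W)) := fun U U' => by
  have := (h (U ⊗ W) (U' ⊗ W)).precomp (tensorRightHom V W U U')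
  rwa [← actRight_precomp] at this

namespace DayTensor

variable {F G H L P Q R P' Q' K : VFunctor V A}

lemma hom_ext (D : DayTensor F G P) {f g : P ⟶ K}
    (h : ∀ U W, D.ins U W ≫ app f (U ⊗ W) = D.ins U W ≫ app g (U ⊗ W)) : f = g :=
  VFunctor.hom_ext fun X =>
    D.generates.ext (isNat_app f) (isNat_app g) (fun p => h p.1 p.2) X

lemma isNat_ins (D : DayTensor F G P) (W : A) :
    IsNat (fun U U' => actRight (F.act U U') (G.obj W)) (shiftRight P.act W)
      (fun U => D.ins U W) := D.nat_left W

/-- There are two layers of generators: `Q` is generated by the objects `P X ⊗ H Z`, and for fixed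
`Z` these are generated over `X` by `(F U ⊗ G W) ⊗ H Z`. -/
lemma hom_ext_right (D₁ : DayTensor F G P) (D₂ : DayTensor P H Q) {f g : Q ⟶ K}
    (h : ∀ U W Z, D₁.ins U W ▷ H.obj Z ≫ D₂.ins (U ⊗ W) Z ≫ app f ((U ⊗ W) ⊗ Z) =
      D₁.ins U W ▷ H.obj Z ≫ D₂.ins (U ⊗ W) Z ≫ app g ((U ⊗ W) ⊗ Z)) : f = g :=
  D₂.hom_ext fun X Z => (D₁.generates.whiskerRight (H.obj Z)).ext
    ((D₂.isNat_ins Z).comp ((isNat_app f).shiftRight Z))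
    ((D₂.isNat_ins Z).comp ((isNat_app g).shiftRight Z)) (fun p => h p.1 p.2 Z) X

lemma hom_ext_right₂ (D₁ : DayTensor F G P) (D₂ : DayTensor P H Q) (D₃ : DayTensor Q L R)
    {f g : R ⟶ K}
    (h : ∀ U W Z Y, D₁.ins U W ▷ H.obj Z ▷ L.obj Y ≫ D₂.ins (U ⊗ W) Z ▷ L.obj Y ≫
        D₃.ins ((U ⊗ W) ⊗ Z) Y ≫ app f (((U ⊗ W) ⊗ Z) ⊗ Y) =
      D₁.ins U W ▷ H.obj Z ▷ L.obj Y ≫ D₂.ins (U ⊗ W) Z ▷ L.obj Y ≫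
        D₃.ins ((U ⊗ W) ⊗ Z) Y ≫ app g (((U ⊗ W) ⊗ Z) ⊗ Y)) : f = g :=
  D₂.hom_ext_right D₃ fun X Z Y =>
    ((D₁.generates.whiskerRight (H.obj Z)).whiskerRight (L.obj Y)).ext
      (IsNat.comp (fun U U' => ((D₂.isNat_ins Z) U U').whiskerRight (L.obj Y))
        (IsNat.shiftRight_actRight ((D₃.isNat_ins Y).comp ((isNat_app f).shiftRight Y)) Z))
      (IsNat.comp (fun U U' => ((D₂.isNat_ins Z) U U').whiskerRight (L.obj Y))
        (IsNat.shiftRight_actRight ((D₃.isNat_ins Y).comp ((isNat_app g).shiftRight Y)) Z))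
      (fun p => h p.1 p.2 Z Y) X

lemma hom_ext_left (D₁ : DayTensor G H P) (D₂ : DayTensor F P Q) {f g : Q ⟶ K}
    (h : ∀ U W Z, F.obj U ◁ D₁.ins W Z ≫ D₂.ins U (W ⊗ Z) ≫ app f (U ⊗ (W ⊗ Z)) =
      F.obj U ◁ D₁.ins W Z ≫ D₂.ins U (W ⊗ Z) ≫ app g (U ⊗ (W ⊗ Z))) : f = g :=
  D₂.hom_ext fun U X => (D₁.generates.whiskerLeft (F.obj U)).ext
    (IsNat.comp (D₂.nat_right U) ((isNat_app f).shiftLeft U))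
    (IsNat.comp (D₂.nat_right U) ((isNat_app g).shiftLeft U)) (fun p => h U p.1 p.2) X

/-- Trilinear families induce morphisms out of `(F * G) * H`. -/
lemma exists_hom_right (D₁ : DayTensor F G P) (D₂ : DayTensor P H Q)
    (t : ∀ U W Z, (F.obj U ⊗ G.obj W) ⊗ H.obj Z ⟶ K.obj ((U ⊗ W) ⊗ Z))
    (h₁ : ∀ U U' W Z, Sq (actRight (actRight (F.act U U') (G.obj W)) (H.obj Z))
      (shiftRight (m := fun U => K.obj (U ⊗ Z)) (shiftRight K.act Z) W U U') (t U W Z) (t U' W Z))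
    (h₂ : ∀ U W W' Z, Sq (actRight (actLeft (F.obj U) (G.act W W')) (H.obj Z))
      (shiftLeft (m := fun U => K.obj (U ⊗ Z)) (shiftRight K.act Z) U W W') (t U W Z) (t U W' Z))
    (h₃ : ∀ U W Z Z', Sq (actLeft (F.obj U ⊗ G.obj W) (H.act Z Z'))
      (shiftLeft K.act (U ⊗ W) Z Z') (t U W Z) (t U W Z')) :
    ∃ f : Q ⟶ K, ∀ U W Z, D₁.ins U W ▷ H.obj Z ≫ D₂.ins (U ⊗ W) Z ≫ app f ((U ⊗ W) ⊗ Z) =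
      t U W Z := by
  choose τ hτ hτ' using fun Z => D₁.exists_liftRight (isAction_shiftRight K.isAction Z) (H.obj Z)
    (fun U W => t U W Z) (fun W U U' => h₁ U U' W Z) (fun U W W' => h₂ U W W' Z)
  obtain ⟨f, hf, hf'⟩ := D₂.exists_lift K.isAction (fun X Z => τ Z X) (fun Z X X' => hτ Z X X')
    (fun X Z Z' => by
      -- Naturality of the partial lifts in `Z`: both sides are natural in `X` on `(P X ⊗ H Z) ⊗
      -- A(Z, Z')`, so the generators of `P` suffice, and there it is the hypothesis on `t`.
      refine ((D₁.generates.whiskerRight (H.obj Z)).whiskerRight (Z ⟶[V] Z')).ext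
        (b := shiftRight K.act Z') (φ := fun X => actLeft (P.obj X) (H.act Z Z') ≫ τ Z' X)
        (ψ := fun X => τ Z X ▷ (Z ⟶[V] Z') ≫ shiftLeft K.act X Z Z') ?_ ?_ ?_ X
      · exact fun U U' => (Sq.actLeft_actRight_exchange _ _).comp (hτ Z' U U')
      · exact fun U U' => ((hτ Z U U').whiskerRight _).comp (sq_shiftLeft K.isAction U U' Z Z')
      · rintro ⟨U, W⟩
        have e := Sq.actLeft_whiskerRight (D₁.ins U W) (H.act Z Z')
        have e' := h₃ U W Z Z'
        unfold Sq at e e'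
        dsimp only
        rw [← reassoc_of% e, hτ', e', ← comp_whiskerRight_assoc, hτ'])
  exact ⟨hf.hom, fun U W Z => by rw [hf.hom_app, hf', hτ']⟩

/-- Trilinear families induce morphisms out of `F * (G * H)`. -/
lemma exists_hom_left (D₁ : DayTensor G H P) (D₂ : DayTensor F P Q)
    (t : ∀ U W Z, F.obj U ⊗ (G.obj W ⊗ H.obj Z) ⟶ K.obj (U ⊗ (W ⊗ Z)))
    (h₁ : ∀ U U' W Z, Sq (actRight (F.act U U') (G.obj W ⊗ H.obj Z))
      (shiftRight K.act (W ⊗ Z) U U') (t U W Z) (t U' W Z))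
    (h₂ : ∀ U W W' Z, Sq (actLeft (F.obj U) (actRight (G.act W W') (H.obj Z)))
      (shiftRight (m := fun W => K.obj (U ⊗ W)) (shiftLeft K.act U) Z W W') (t U W Z) (t U W' Z))
    (h₃ : ∀ U W Z Z', Sq (actLeft (F.obj U) (actLeft (G.obj W) (H.act Z Z')))
      (shiftLeft (m := fun W => K.obj (U ⊗ W)) (shiftLeft K.act U) W Z Z') (t U W Z) (t U W Z')) :
    ∃ f : Q ⟶ K, ∀ U W Z, F.obj U ◁ D₁.ins W Z ≫ D₂.ins U (W ⊗ Z) ≫ app f (U ⊗ (W ⊗ Z)) =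
      t U W Z := by
  choose τ hτ hτ' using fun U => D₁.exists_liftLeft (isAction_shiftLeft K.isAction U) (F.obj U)
    (fun W Z => t U W Z) (fun Z W W' => h₂ U W W' Z) (fun W Z Z' => h₃ U W Z Z')
  obtain ⟨f, hf, hf'⟩ := D₂.exists_lift K.isAction (fun U X => τ U X)
    (fun X U U' => by
      -- Naturality in `U`, by the same argument over the generators of the inner convolution.
      refine ((D₁.generates.whiskerLeft (F.obj U)).whiskerRight (U ⟶[V] U')).ext
        (b := shiftLeft K.act U') (φ := fun X => actRight (F.act U U') (P.obj X) ≫ τ U' X)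
        (ψ := fun X => τ U X ▷ (U ⟶[V] U') ≫ shiftRight K.act X U U') ?_ ?_ ?_ X
      · exact fun X X' => (Sq.actRight_actLeft_exchange _ _).comp (hτ U' X X')
      · exact fun X X' => ((hτ U X X').whiskerRight _).comp (sq_shiftRight K.isAction U U' X X')
      · rintro ⟨W, Z⟩
        have e := Sq.actRight_whiskerLeft (D₁.ins W Z) (F.act U U')
        have e' := h₁ U U' W Z
        unfold Sq at e e'
        dsimp only
        rw [← reassoc_of% e, hτ', e', ← comp_whiskerRight_assoc, hτ'])
    (fun U X X' => hτ U X X')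
  exact ⟨hf.hom, fun U W Z => by rw [hf.hom_app, hf', hτ']⟩

end DayTensor

end dayTensor

/-- The composition law of an action, read as naturality of the Yoneda map `m X ⊗ C(X, -) ⟶ m`. -/
lemma IsAction.sq_yoneda {V : Type u} [Category.{v} V] [MonoidalCategory V] {C : Type w}
    [EnrichedCategory V C] {m : C → V} {a : ∀ X Y : C, m X ⊗ (X ⟶[V] Y) ⟶ m Y} (h : IsAction a)
    (X Y Z : C) : Sq (actLeft (m X) (eComp V X Y Z)) (a Y Z) (a X Y) (a X Z) := by
  unfold Sq actLeft
  rw [Category.assoc, h.comp, Iso.hom_inv_id_assoc]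

/-- Yoneda: a representable functor is generated by the identity of its representing object. -/
lemma generates_eComp {V : Type u} [Category.{v} V] [MonoidalCategory V] {C : Type w}
    [EnrichedCategory V C] {I : C}
    {a : ∀ X Y : C, (I ⟶[V] X) ⊗ (X ⟶[V] Y) ⟶ (I ⟶[V] Y)} (ha : a = eComp V I) (ι : Type*)
    [Inhabited ι] :
    Generates (m := fun X => I ⟶[V] X) (u := fun _ : ι => I) a (fun _ => eId V I) :=
  fun X W f g H => by
    have := H default
    dsimp only at this
    rw [← Category.id_comp f, ← Category.id_comp g, ← e_id_comp V I X]
    subst ha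
    simp only [Category.assoc] at this ⊢
    rw [this]

lemma dayUnit_act (V : Type u) [Category.{v} V] [MonoidalCategory V] [MonoidalClosed V]
    (A : Type v) [Category.{w} A] [EnrichedOrdinaryCategory V A] [MonoidalCategory A] :
    (dayUnit V A).act = eComp V (𝟙_ A) := by
  funext X Y
  exact VFunctor.ofAct_act _ _ _ _ _ _

/-! ### Associativity and unit isomorphisms of Day convolution -/

section dayTensor

variable {V : Type u} [Category.{v} V] [MonoidalCategory V] [MonoidalClosed V]
  [SymmetricCategory V] {A : Type v} [Category.{w} A] [EnrichedOrdinaryCategory V A]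
  [MonoidalCategory A] [MonoidalVCategory V A]

open MonoidalVCategory VFunctor

variable (V A) in
/-- The identity of the unit as an element of `A(𝟙, 𝟙)`. -/
def dayUnitId : 𝟙_ V ⟶ (dayUnit V A).obj (𝟙_ A) := eId V (𝟙_ A)

omit [SymmetricCategory V] [MonoidalVCategory V A] in
lemma generates_dayUnit :
    Generates (u := fun _ : Unit => 𝟙_ A) (dayUnit V A).act (fun _ => dayUnitId V A) :=
  generates_eComp (dayUnit_act V A) _

namespace DayTensor

variable {F G H L P Q R P' Q' K : VFunctor V A}

lemma mapHom_whiskerRight_ins (D : DayTensor F G P) {U U' : A} (f : U ⟶ U') (W : A) :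
    F.mapHom f ▷ G.obj W ≫ D.ins U' W = D.ins U W ≫ P.mapHom (f ▷ W) := by
  have := (D.isNat_ins W).actHom f
  rw [actHom_shiftRight, actHom_actRight] at this
  exact this

lemma whiskerLeft_mapHom_ins (D : DayTensor F G P) (U : A) {W W' : A} (f : W ⟶ W') :
    F.obj U ◁ G.mapHom f ≫ D.ins U W' = D.ins U W ≫ P.mapHom (U ◁ f) := by
  have := IsNat.actHom (D.nat_right U) f
  rw [actHom_shiftLeft, actHom_actLeft] at this
  exact this

/-- The triple families on the two sides are matched by the associator of `V`, and transport along
the associator of `A` corrects the object at which the values lie. The induced morphisms are inverse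
to each other because they are so on generators. -/
lemma exists_associator (D₁ : DayTensor F G P) (D₂ : DayTensor P H Q) (D₃ : DayTensor G H P')
    (D₄ : DayTensor F P' Q') :
    ∃ e : Q ≅ Q', ∀ U W Z, D₁.ins U W ▷ H.obj Z ≫ D₂.ins (U ⊗ W) Z ≫
      app e.hom ((U ⊗ W) ⊗ Z) ≫ Q'.mapHom (α_ U W Z).hom =
        (α_ _ _ _).hom ≫ F.obj U ◁ D₃.ins W Z ≫ D₄.ins U (W ⊗ Z) := by
  obtain ⟨f, hf⟩ := D₁.exists_hom_right D₂ (K := Q')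
    (fun U W Z => ((α_ _ _ _).hom ≫ F.obj U ◁ D₃.ins W Z ≫ D₄.ins U (W ⊗ Z)) ≫
      (actIso Q'.isAction (α_ U W Z)).inv)
    (fun U U' W Z => (((Sq.actRight_actRight _ _ _).comp ((Sq.actRight_whiskerLeft _ _).comp
      (D₄.nat_left _ _ _)))).comp
        (Sq.of_iso (f := actIso Q'.isAction (α_ U W Z)) (h := actIso Q'.isAction (α_ U' W Z))
          (sq_associator_left Q'.isAction U U' W Z)))
    (fun U W W' Z => (((Sq.actLeft_actRight _ _ _).comp (((D₃.nat_left Z W W').whiskerLeft _).comp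
      (by
        have := (D₄.nat_right U (W ⊗ Z) (W' ⊗ Z)).precomp (tensorRightHom V Z W W')
        rwa [← actLeft_precomp] at this)))).comp
        (Sq.of_iso (f := actIso Q'.isAction (α_ U W Z)) (h := actIso Q'.isAction (α_ U W' Z))
          (sq_associator_middle Q'.isAction U W W' Z)))
    (fun U W Z Z' => (((Sq.actLeft_actLeft _ _ _).comp (((D₃.nat_right W Z Z').whiskerLeft _).comp
      (by
        have := (D₄.nat_right U (W ⊗ Z) (W ⊗ Z')).precomp (tensorLeftHom V W Z Z')
        rwa [← actLeft_precomp] at this)))).comp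
        (Sq.of_iso (f := actIso Q'.isAction (α_ U W Z)) (h := actIso Q'.isAction (α_ U W Z'))
          (sq_associator_right Q'.isAction U W Z Z')))
  obtain ⟨g, hg⟩ := D₃.exists_hom_left D₄ (K := Q)
    (fun U W Z => ((α_ _ _ _).inv ≫ D₁.ins U W ▷ H.obj Z ≫ D₂.ins (U ⊗ W) Z) ≫
      (actIso Q.isAction (α_ U W Z)).hom)
    (fun U U' W Z => (((Sq.actRight_actRight _ _ _).of_iso.comp
      (((D₁.nat_left W U U').whiskerRight _).comp
      (by
        have := (D₂.nat_left Z (U ⊗ W) (U' ⊗ W)).precomp (tensorRightHom V W U U')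
        rwa [← actRight_precomp] at this)))).comp
          (sq_associator_left Q.isAction U U' W Z))
    (fun U W W' Z => (((Sq.actLeft_actRight _ _ _).of_iso.comp
      (((D₁.nat_right U W W').whiskerRight _).comp
      (by
        have := (D₂.nat_left Z (U ⊗ W) (U ⊗ W')).precomp (tensorLeftHom V U W W')
        rwa [← actRight_precomp] at this)))).comp
          (sq_associator_middle Q.isAction U W W' Z))
    (fun U W Z Z' => (((Sq.actLeft_actLeft _ _ _).of_iso.comp
      ((Sq.actLeft_whiskerRight _ _).comp
      (D₂.nat_right (U ⊗ W) Z Z')))).comp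
          (sq_associator_right Q.isAction U W Z Z'))
  simp only [actIso_hom, actIso_inv, Category.assoc] at hf hg
  have hom_actHom {K K' : VFunctor V A} (f : K ⟶ K') {X Y : A} (k : X ⟶ Y) :
      actHom K.act k ≫ app f Y = app f X ≫ actHom K'.act k := (isNat_app f).actHom k
  refine ⟨⟨f, g, ?_, ?_⟩, fun U W Z => ?_⟩
  · refine D₁.hom_ext_right D₂ fun U W Z => ?_
    rw [comp_app, reassoc_of% hf, hom_actHom, reassoc_of% hg,
      ← actHom_comp Q.isAction]
    simp [actHom_id Q.isAction]
  · refine D₃.hom_ext_left D₄ fun U W Z => ?_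
    rw [comp_app, reassoc_of% hg, hom_actHom, reassoc_of% hf,
      ← actHom_comp Q'.isAction]
    simp [actHom_id Q'.isAction]
  · change _ ≫ _ ≫ _ ≫ actHom Q'.act _ = _
    rw [reassoc_of% hf, ← actHom_comp Q'.isAction]
    simp [actHom_id Q'.isAction]

lemma hom_ext_leftUnit (D : DayTensor (dayUnit V A) F P) {f g : P ⟶ K}
    (h : ∀ U, dayUnitId V A ▷ F.obj U ≫ D.ins (𝟙_ A) U ≫ app f (𝟙_ A ⊗ U) =
      dayUnitId V A ▷ F.obj U ≫ D.ins (𝟙_ A) U ≫ app g (𝟙_ A ⊗ U)) : f = g :=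
  D.hom_ext fun U W => (generates_dayUnit.whiskerRight (F.obj W)).ext
    ((D.isNat_ins W).comp ((isNat_app f).shiftRight W))
    ((D.isNat_ins W).comp ((isNat_app g).shiftRight W)) (fun _ => h W) U

lemma hom_ext_rightUnit (D : DayTensor F (dayUnit V A) P) {f g : P ⟶ K}
    (h : ∀ U, F.obj U ◁ dayUnitId V A ≫ D.ins U (𝟙_ A) ≫ app f (U ⊗ 𝟙_ A) =
      F.obj U ◁ dayUnitId V A ≫ D.ins U (𝟙_ A) ≫ app g (U ⊗ 𝟙_ A)) : f = g :=
  D.hom_ext fun U W => (generates_dayUnit.whiskerLeft (F.obj U)).ext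
    (IsNat.comp (D.nat_right U) ((isNat_app f).shiftLeft U))
    (IsNat.comp (D.nat_right U) ((isNat_app g).shiftLeft U)) (fun _ => h U) W

/-- In terms of elements, `h` in `A(𝟙, U)` and `x` in `F W` go to the action of `h ⊗ W` on the
transport of `x` along `W ≅ 𝟙 ⊗ W`. The inverse `σ` inserts the identity of `𝟙`. -/
lemma exists_leftUnitor (D : DayTensor (dayUnit V A) F P) :
    ∃ e : P ≅ F, ∀ U, dayUnitId V A ▷ F.obj U ≫ D.ins (𝟙_ A) U ≫ app e.hom (𝟙_ A ⊗ U) ≫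
      F.mapHom (λ_ U).hom = (λ_ (F.obj U)).hom := by
  obtain ⟨τ, hτ, hτ'⟩ := D.exists_lift F.isAction
    (fun U W => (β_ _ _).hom ≫ (actIso F.isAction (λ_ W)).inv ▷ ((𝟙_ A) ⟶[V] U) ≫
      shiftRight F.act W (𝟙_ A) U)
    (fun W U U' => by
      rw [dayUnit_act]
      exact (Sq.braiding _ _).comp ((Sq.actLeft_whiskerRight _ _).comp
        ((isAction_shiftRight F.isAction W).sq_yoneda (𝟙_ A) U U')))
    (fun U W W' => (Sq.braiding' _ _).comp (((Sq.of_iso (f := actIso F.isAction (λ_ W))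
        (h := actIso F.isAction (λ_ W')) (sq_leftUnitor F.isAction W W')).whiskerRight _).comp
          (sq_shiftRight F.isAction (𝟙_ A) U W W')))
  -- At the identity of `𝟙` the action is trivial and only the transport along the unit isomorphism
  -- of `A` remains.
  have key (U : A) : dayUnitId V A ▷ F.obj U ≫ D.ins (𝟙_ A) U ≫ τ (𝟙_ A ⊗ U) =
      (λ_ (F.obj U)).hom ≫ (actIso F.isAction (λ_ U)).inv := by
    have e : F.obj U ◁ eId V (𝟙_ A) ≫ (actIso F.isAction (λ_ U)).inv ▷ ((𝟙_ A) ⟶[V] (𝟙_ A)) ≫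
        shiftRight F.act U (𝟙_ A) (𝟙_ A) = (ρ_ _).hom ≫ (actIso F.isAction (λ_ U)).inv := by
      rw [whisker_exchange_assoc, (isAction_shiftRight F.isAction U).id (𝟙_ A)]
      simp
    rw [hτ', BraidedCategory.braiding_naturality_left_assoc]
    exact (congrArg ((β_ _ _).hom ≫ ·) e).trans (by simp [braiding_tensorUnit_left])
  let σ (X : A) : F.obj X ⟶ P.obj X := (λ_ _).inv ≫ dayUnitId V A ▷ F.obj X ≫
    D.ins (𝟙_ A) X ≫ (actIso P.isAction (λ_ X)).hom
  have hσ : IsNat F.act P.act σ := fun X Y =>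
    (Sq.of_iso (f := λ_ _) (h := λ_ _) (Sq.leftUnitor _)).comp ((Sq.actLeft_whiskerRight _ _).comp
      ((D.nat_right _ _ _).comp (sq_leftUnitor P.isAction X Y)))
  refine ⟨⟨hτ.hom, hσ.hom, ?_, ?_⟩, fun U => ?_⟩
  · refine D.hom_ext_leftUnit fun U => ?_
    have := hσ.actHom (λ_ U).inv
    rw [comp_app, hτ.hom_app, reassoc_of% key, hσ.hom_app, actIso_inv, this]
    dsimp only [σ]
    rw [← actIso_inv P.isAction]
    simp
  · refine VFunctor.hom_ext fun X => ?_
    have := hτ.actHom (λ_ X).hom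
    rw [comp_app, hσ.hom_app, hτ.hom_app]
    dsimp only [σ]
    simp only [Category.assoc, actIso_hom]
    rw [this, reassoc_of% key, ← actIso_hom F.isAction]
    simp
  · change _ ≫ _ ≫ _ ≫ actHom F.act (λ_ U).hom = _
    rw [hτ.hom_app, reassoc_of% key, ← actIso_hom F.isAction]
    simp

lemma exists_rightUnitor (D : DayTensor F (dayUnit V A) P) :
    ∃ e : P ≅ F, ∀ U, F.obj U ◁ dayUnitId V A ≫ D.ins U (𝟙_ A) ≫ app e.hom (U ⊗ 𝟙_ A) ≫
      F.mapHom (ρ_ U).hom = (ρ_ (F.obj U)).hom := by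
  obtain ⟨τ, hτ, hτ'⟩ := D.exists_lift F.isAction
    (fun U W => (actIso F.isAction (ρ_ U)).inv ▷ ((𝟙_ A) ⟶[V] W) ≫
      shiftLeft F.act U (𝟙_ A) W)
    (fun W U U' => ((Sq.of_iso (f := actIso F.isAction (ρ_ U))
        (h := actIso F.isAction (ρ_ U')) (sq_rightUnitor F.isAction U U')).whiskerRight _).comp
          (sq_shiftLeft F.isAction U U' (𝟙_ A) W))
    (fun U W W' => by
      rw [dayUnit_act]
      exact (Sq.actLeft_whiskerRight _ _).comp
        ((isAction_shiftLeft F.isAction U).sq_yoneda (𝟙_ A) W W'))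
  have key (U : A) : F.obj U ◁ dayUnitId V A ≫ D.ins U (𝟙_ A) ≫ τ (U ⊗ 𝟙_ A) =
      (ρ_ (F.obj U)).hom ≫ (actIso F.isAction (ρ_ U)).inv := by
    have e : F.obj U ◁ eId V (𝟙_ A) ≫ (actIso F.isAction (ρ_ U)).inv ▷ ((𝟙_ A) ⟶[V] (𝟙_ A)) ≫
        shiftLeft F.act U (𝟙_ A) (𝟙_ A) = (ρ_ _).hom ≫ (actIso F.isAction (ρ_ U)).inv := by
      rw [whisker_exchange_assoc, (isAction_shiftLeft F.isAction U).id (𝟙_ A)]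
      simp
    rw [hτ']
    exact e
  let σ (X : A) : F.obj X ⟶ P.obj X := (ρ_ _).inv ≫ F.obj X ◁ dayUnitId V A ≫
    D.ins X (𝟙_ A) ≫ (actIso P.isAction (ρ_ X)).hom
  have hσ : IsNat F.act P.act σ := fun X Y =>
    (Sq.of_iso (f := ρ_ _) (h := ρ_ _) (Sq.rightUnitor _)).comp ((Sq.actRight_whiskerLeft _ _).comp
      ((D.nat_left _ _ _).comp (sq_rightUnitor P.isAction X Y)))
  refine ⟨⟨hτ.hom, hσ.hom, ?_, ?_⟩, fun U => ?_⟩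
  · refine D.hom_ext_rightUnit fun U => ?_
    have := hσ.actHom (ρ_ U).inv
    rw [comp_app, hτ.hom_app, reassoc_of% key, hσ.hom_app, actIso_inv, this]
    dsimp only [σ]
    rw [← actIso_inv P.isAction]
    simp
  · refine VFunctor.hom_ext fun X => ?_
    have := hτ.actHom (ρ_ X).hom
    rw [comp_app, hσ.hom_app, hτ.hom_app]
    dsimp only [σ]
    simp only [Category.assoc, actIso_hom]
    rw [this, reassoc_of% key, ← actIso_hom F.isAction]
    simp
  · change _ ≫ _ ≫ _ ≫ actHom F.act (ρ_ U).hom = _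
    rw [hτ.hom_app, reassoc_of% key, ← actIso_hom F.isAction]
    simp

end DayTensor

end dayTensor

/-! ### Families universal among those coequalizing given pairs -/

section universal

variable {V : Type u} [Category.{v} V]

/-- The family `c` is universal among the families that coequalize all pairs `(l r, m r)`. -/
structure IsUniversal {ι ρ : Type*} {P : ι → V} {R : ρ → V} {i j : ρ → ι}
    (l : ∀ r, R r ⟶ P (i r)) (m : ∀ r, R r ⟶ P (j r)) {Q : V} (c : ∀ x, P x ⟶ Q) : Prop where
  condition (r : ρ) : l r ≫ c (i r) = m r ≫ c (j r)
  existsUnique_desc {W : V} (k : ∀ x, P x ⟶ W) (hk : ∀ r, l r ≫ k (i r) = m r ≫ k (j r)) :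
    ∃! d : Q ⟶ W, ∀ x, c x ≫ d = k x

/-- The index types lie in the universe of the morphisms of `V`, so the required multicoequalizer is
a small colimit. -/
lemma exists_isUniversal [HasColimits V] {ι ρ : Type v} {P : ι → V} {R : ρ → V} {i j : ρ → ι}
    (l : ∀ r, R r ⟶ P (i r)) (m : ∀ r, R r ⟶ P (j r)) :
    ∃ (Q : V) (c : ∀ x, P x ⟶ Q), IsUniversal l m c := by
  let I : MultispanIndex (MultispanShape.mk ρ ι i j) V := ⟨R, P, l, m⟩
  exact ⟨multicoequalizer I, Multicoequalizer.π I, Multicoequalizer.condition I, fun k hk =>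
    ⟨Multicoequalizer.desc I _ k hk, Multicoequalizer.π_desc I _ k hk, fun d hd =>
      Multicoequalizer.hom_ext I _ _ fun x =>
        (hd x).trans (Multicoequalizer.π_desc I _ k hk x).symm⟩⟩

namespace IsUniversal

variable {ι ρ : Type*} {P : ι → V} {R : ρ → V} {i j : ρ → ι}
  {l : ∀ r, R r ⟶ P (i r)} {m : ∀ r, R r ⟶ P (j r)} {Q : V} {c : ∀ x, P x ⟶ Q}

lemma jointlyEpi (h : IsUniversal l m c) : JointlyEpi c := fun W f g H => by
  refine (h.existsUnique_desc (fun x => c x ≫ f) fun r => ?_).unique (fun _ => rfl)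
    fun x => (H x).symm
  rw [← Category.assoc, ← Category.assoc, h.condition]

variable [MonoidalCategory V] [MonoidalClosed V]

/-- Closedness again: transpose the family into `[T, W]`, descend, and transpose back. Uniqueness
comes separately, from `JointlyEpi.whiskerLeft`. -/
lemma exists_descLeft (h : IsUniversal l m c) (T : V) {W : V} (k : ∀ x, T ⊗ P x ⟶ W)
    (hk : ∀ r, T ◁ l r ≫ k (i r) = T ◁ m r ≫ k (j r)) :
    ∃ d : T ⊗ Q ⟶ W, ∀ x, T ◁ c x ≫ d = k x := by
  obtain ⟨d, hd, -⟩ := h.existsUnique_desc (fun x => MonoidalClosed.curry (k x)) fun r => by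
    rw [← MonoidalClosed.curry_natural_left, hk, MonoidalClosed.curry_natural_left]
  refine ⟨MonoidalClosed.uncurry d, fun x => ?_⟩
  rw [← MonoidalClosed.uncurry_natural_left, hd, MonoidalClosed.uncurry_curry]

lemma exists_descRight [BraidedCategory V] (h : IsUniversal l m c) (T : V) {W : V}
    (k : ∀ x, P x ⊗ T ⟶ W) (hk : ∀ r, l r ▷ T ≫ k (i r) = m r ▷ T ≫ k (j r)) :
    ∃ d : Q ⊗ T ⟶ W, ∀ x, c x ▷ T ≫ d = k x := by
  obtain ⟨d, hd⟩ := h.exists_descLeft T (fun x => (β_ _ _).inv ≫ k x) fun r => by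
    rw [BraidedCategory.braiding_inv_naturality_right_assoc, hk,
      BraidedCategory.braiding_inv_naturality_right_assoc]
  exact ⟨(β_ _ _).hom ≫ d, fun x => by
    rw [BraidedCategory.braiding_naturality_left_assoc, hd, Iso.hom_inv_id_assoc]⟩

end IsUniversal

end universal

/-! ### Existence of Day convolutions -/

section dayTensor

variable {V : Type u} [Category.{v} V] [MonoidalCategory V] [MonoidalClosed V]
  [SymmetricCategory V] {A : Type v} [Category.{w} A] [EnrichedOrdinaryCategory V A]
  [MonoidalCategory A] [MonoidalVCategory V A]

open MonoidalVCategory VFunctor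

/-- The Day convolution presented by the coprojections of the coend. -/
def DayTensor.ofCopr {F G P : VFunctor V A}
    (copr : ∀ U W X : A, (F.obj U ⊗ G.obj W) ⊗ ((U ⊗ W : A) ⟶[V] X) ⟶ P.obj X)
    (isDayCowedge : ∀ X, IsDayCowedge F G X (fun U W => copr U W X))
    (existsUnique_desc : ∀ (X : A) {T : V}
      (t : ∀ U W : A, (F.obj U ⊗ G.obj W) ⊗ ((U ⊗ W : A) ⟶[V] X) ⟶ T),
      IsDayCowedge F G X t → ∃! d : P.obj X ⟶ T, ∀ U W : A, copr U W X ≫ d = t U W)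
    (copr_act : ∀ U W X Y : A, copr U W X ▷ (X ⟶[V] Y) ≫ P.act X Y =
      (α_ _ _ _).hom ≫ (F.obj U ⊗ G.obj W) ◁ eComp V (U ⊗ W : A) X Y ≫ copr U W Y) :
    DayTensor F G P :=
  -- A coprojection is recovered by the action from its value at the identity, so these values carry
  -- the whole coend.
  have key (U W X : A) : ((ρ_ _).inv ≫ _ ◁ eId V (U ⊗ W : A) ≫ copr U W (U ⊗ W)) ▷ _ ≫
      P.act (U ⊗ W) X = copr U W X := by
    simp only [comp_whiskerRight, Category.assoc]
    have e : eId V (U ⊗ W : A) ▷ _ ≫ eComp V (U ⊗ W) (U ⊗ W) X = (λ_ _).hom := by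
      rw [← cancel_epi (λ_ _).inv, e_id_comp, Iso.inv_hom_id]
    rw [copr_act, associator_naturality_middle_assoc, ← MonoidalCategory.whiskerLeft_comp_assoc, e]
    simp
  -- The cowedge condition at the identity of `U' ⊗ W'` is the joint naturality of the universal
  -- family.
  have h : ∀ U U' W W', Sq (ptensor (F.act U U') (G.act W W'))
      (P.obj (U ⊗ W) ◁ tensorHomObj U U' W W' ≫ P.act _ _)
      ((ρ_ _).inv ≫ _ ◁ eId V (U ⊗ W : A) ≫ copr U W (U ⊗ W))
      ((ρ_ _).inv ≫ _ ◁ eId V (U' ⊗ W' : A) ≫ copr U' W' (U' ⊗ W')) := fun U U' W W' => by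
    have := isDayCowedge (U' ⊗ W') U U' W W'
    unfold Sq
    rw [← whisker_exchange_assoc, key, rightUnitor_inv_naturality_assoc, ← whisker_exchange_assoc]
    unfold ptensor
    rw [this]
    have e : tensorHomObj U U' W W' ≫ (ρ_ _).inv ≫ _ ◁ eId V (U' ⊗ W' : A) ≫ eComp V _ _ _ =
        tensorHomObj U U' W W' := by rw [e_comp_id, Category.comp_id]
    rw [associator_naturality_right_assoc, ← MonoidalCategory.whiskerLeft_comp_assoc,
      whisker_exchange_assoc]
    conv_rhs => rw [← e]
    simp
  { ins := fun U W => (ρ_ _).inv ≫ _ ◁ eId V (U ⊗ W : A) ≫ copr U W (U ⊗ W)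
    nat_left := ((sq_ptensor_iff P.isAction _).1 h).1
    nat_right := ((sq_ptensor_iff P.isAction _).1 h).2
    existsUnique_desc := fun X T t ht => by
      simp only [key]
      exact existsUnique_desc X t ht }

/-- The coends are formed separately for each `X`. They assemble into a `V`-functor because `- ⊗
A(X, Y)` preserves each of them. -/
lemma exists_dayTensor [HasColimits V] (F G : VFunctor V A) :
    ∃ P : VFunctor V A, Nonempty (DayTensor F G P) := by
  choose Q c hc using fun X : A => exists_isUniversal (V := V) (ι := A × A)
    (ρ := (A × A) × (A × A)) (i := fun r => (r.1.2, r.2.2)) (j := fun r => (r.1.1, r.2.1))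
    (P := fun x => (F.obj x.1 ⊗ G.obj x.2) ⊗ ((x.1 ⊗ x.2 : A) ⟶[V] X))
    (fun r => (tensorμ _ _ _ _ ≫ (F.act r.1.1 r.1.2 ⊗ₘ G.act r.2.1 r.2.2)) ▷
      ((r.1.2 ⊗ r.2.2 : A) ⟶[V] X))
    (fun r => (α_ _ _ _).hom ≫ (F.obj r.1.1 ⊗ G.obj r.2.1) ◁
      (tensorHomObj r.1.1 r.1.2 r.2.1 r.2.2 ▷ _ ≫ eComp V _ _ _))
  -- The action composes in the factor `A(U ⊗ W, X)`; it respects the relations of the coend by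
  -- associativity of composition in `A`.
  choose a ha using fun X Y : A => (hc X).exists_descRight (X ⟶[V] Y)
    (fun x => (α_ _ _ _).hom ≫ _ ◁ eComp V (x.1 ⊗ x.2 : A) X Y ≫ c Y x) fun r => by
      have := (hc Y).condition r
      dsimp only at this ⊢
      rw [Category.assoc] at this
      rw [associator_naturality_left_assoc, ← whisker_exchange_assoc, this]
      have e {T : V} (k : T ⟶ ((r.1.1 ⊗ r.2.1 : A) ⟶[V] (r.1.2 ⊗ r.2.2 : A))) :
          T ◁ eComp V (r.1.2 ⊗ r.2.2 : A) X Y ≫ k ▷ _ ≫ eComp V _ _ _ =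
            (α_ _ _ _).inv ≫ (k ▷ _ ≫ eComp V _ _ _) ▷ _ ≫ eComp V _ _ _ := by
        rw [whisker_exchange_assoc, comp_whiskerRight_assoc, ← e_assoc']
        simp
      rw [associator_naturality_right_assoc, ← MonoidalCategory.whiskerLeft_comp_assoc, e]
      monoidal
  have hc' (X : A) : JointlyEpi (c X) := (hc X).jointlyEpi
  -- Both action laws are tested on the coprojections, where they are the unit and associativity
  -- laws of `A`.
  let P : VFunctor V A := ofAct Q a
    (fun X => ((hc' X).whiskerRight (𝟙_ V)) _ _ fun x => by
      have e : _ ◁ eId V X ≫ eComp V (x.1 ⊗ x.2 : A) X X = (ρ_ _).hom := by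
        rw [← cancel_epi (ρ_ _).inv, e_comp_id, Iso.inv_hom_id]
      rw [← whisker_exchange_assoc, ha, associator_naturality_right_assoc,
        ← MonoidalCategory.whiskerLeft_comp_assoc, e]
      simp)
    (fun X Y Z => (hc' X).whiskerRight _ _ _ fun x => by
      rw [← whisker_exchange_assoc, ha, associator_inv_naturality_left_assoc,
        ← comp_whiskerRight_assoc, ha]
      simp only [comp_whiskerRight, Category.assoc]
      rw [ha, associator_naturality_right_assoc, ← MonoidalCategory.whiskerLeft_comp_assoc,
        ← e_assoc]
      monoidal)
  have hP (X Y : A) : P.act X Y = a X Y := ofAct_act _ _ _ _ _ _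
  exact ⟨P, ⟨DayTensor.ofCopr (fun U W X => c X (U, W))
    (fun X U U' W W' => ((hc X).condition ((U, U'), (W, W'))).trans
      (by rw [Category.assoc]; rfl))
    (fun X T t ht => by
      obtain ⟨d, hd, hd'⟩ := (hc X).existsUnique_desc (fun x => t x.1 x.2)
        fun r => by
          simpa only [Category.assoc] using ht r.1.1 r.1.2 r.2.1 r.2.2
      exact ⟨d, fun U W => hd (U, W), fun d' h => hd' d' fun x => h x.1 x.2⟩)
    (fun U W X Y => by rw [hP]; exact ha X Y (U, W))⟩⟩

end dayTensor

/-! ### Calculus of tensor products of parametrized morphisms -/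

section ptensor

variable {V : Type u} [Category.{v} V] [MonoidalCategory V] [SymmetricCategory V]

lemma ptensor_precomp {P Q T S P' Q' T' S' : V} (k : S ⟶ T) (k' : S' ⟶ T') (a : P ⊗ T ⟶ Q)
    (b : P' ⊗ T' ⟶ Q') :
    (P ⊗ P') ◁ (k ⊗ₘ k') ≫ ptensor a b = ptensor (P ◁ k ≫ a) (P' ◁ k' ≫ b) := by
  unfold ptensor
  rw [tensorμ_natural_right_assoc, tensorHom_comp_tensorHom]

lemma ptensor_unit {P Q P' Q' : V} (f : P ⟶ Q) (g : P' ⟶ Q') :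
    (P ⊗ P') ◁ (λ_ (𝟙_ V)).inv ≫ ptensor ((ρ_ P).hom ≫ f) ((ρ_ P').hom ≫ g) =
      (ρ_ (P ⊗ P')).hom ≫ (f ⊗ₘ g) := by
  unfold ptensor
  rw [tensor_right_unitality, ← tensorHom_comp_tensorHom]
  simp

/-- The interchange law, from the coherence of `tensorμ`. It underlies functoriality of tensor
products on hom-objects. -/
lemma ptensor_seq {P M Q T S P' M' Q' T' S' : V} (a : P ⊗ T ⟶ M) (a' : M ⊗ S ⟶ Q)
    (b : P' ⊗ T' ⟶ M') (b' : M' ⊗ S' ⟶ Q') :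
    (P ⊗ P') ◁ tensorμ T T' S S' ≫ ptensor ((α_ _ _ _).inv ≫ a ▷ S ≫ a')
        ((α_ _ _ _).inv ≫ b ▷ S' ≫ b') =
      (α_ _ _ _).inv ≫ ptensor a b ▷ _ ≫ ptensor a' b' := by
  have h := tensor_associativity P P' T T' S S'
  rw [← Iso.inv_comp_eq] at h
  unfold ptensor
  rw [← reassoc_of% h, comp_whiskerRight, Category.assoc, tensorμ_natural_left_assoc,
    tensorHom_comp_tensorHom, tensorHom_comp_tensorHom, Iso.hom_inv_id_assoc,
    Iso.hom_inv_id_assoc]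

lemma sq_ptensor_associator {P Q T P' Q' T' P'' Q'' T'' : V} (a : P ⊗ T ⟶ Q) (b : P' ⊗ T' ⟶ Q')
    (c : P'' ⊗ T'' ⟶ Q'') :
    Sq (ptensor (ptensor a b) c) (_ ◁ (α_ T T' T'').hom ≫ ptensor a (ptensor b c))
      (α_ P P' P'').hom (α_ Q Q' Q'').hom := by
  have h := associator_monoidal P P' P'' T T' T''
  have e : tensorμ P P' T T' ≫ (a ⊗ₘ b) ⊗ₘ c =
      tensorμ P P' T T' ▷ _ ≫ ((a ⊗ₘ b) ⊗ₘ c) := by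
    simp [MonoidalCategory.tensorHom_def]
  have e' : a ⊗ₘ tensorμ P' P'' T' T'' ≫ (b ⊗ₘ c) =
      _ ◁ tensorμ P' P'' T' T'' ≫ (a ⊗ₘ (b ⊗ₘ c)) := by
    simp [MonoidalCategory.tensorHom_def']
  unfold Sq ptensor
  rw [e, e', Category.assoc, Category.assoc, associator_naturality, reassoc_of% h,
    MonoidalCategory.tensorHom_def_assoc]

lemma ptensor_comp_tensorHom {P Q R T P' Q' R' T' : V} (a : P ⊗ T ⟶ Q) (b : P' ⊗ T' ⟶ Q')
    (f : Q ⟶ R) (g : Q' ⟶ R') : ptensor a b ≫ (f ⊗ₘ g) = ptensor (a ≫ f) (b ≫ g) := by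
  simp [ptensor]

lemma tensorHom_whiskerRight_ptensor {P Q R T P' Q' R' T' : V} (a : Q ⊗ T ⟶ R) (b : Q' ⊗ T' ⟶ R')
    (f : P ⟶ Q) (g : P' ⟶ Q') :
    (f ⊗ₘ g) ▷ (T ⊗ T') ≫ ptensor a b = ptensor (f ▷ T ≫ a) (g ▷ T' ≫ b) := by
  unfold ptensor
  rw [tensorμ_natural_left_assoc, tensorHom_comp_tensorHom]

end ptensor

/-! ### Hom-objects tested on generators -/

section homObj

variable {V : Type u} [Category.{v} V] [MonoidalCategory V] [MonoidalClosed V]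
  [SymmetricCategory V] {C : Type v} [EnrichedCategory V C] [HasLimits V]

open VFunctor

/-- This is the defining condition of the end, with the hom-object regarded as an inert right
factor. -/
lemma isNat_ev (F G : VFunctor V C) :
    IsNat (fun X Y => actRight (F.act X Y) (homObj F G)) G.act (ev F G) := fun X Y => by
  unfold Sq actRight
  rw [Category.assoc, ev_naturality, reassoc_of% @swapRight_swapRight]

lemma isNat_whiskerLeft_ev (F G : VFunctor V C) {T : V} (f : T ⟶ homObj F G) :
    IsNat (fun X Y => actRight (F.act X Y) T) G.act (fun X => F.obj X ◁ f ≫ ev F G X) :=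
  fun X Y => (Sq.actRight_whiskerLeft f (F.act X Y)).comp (isNat_ev F G X Y)

lemma IsNat.exists_homLift {F G : VFunctor V C} {T : V} {τ : ∀ X, F.obj X ⊗ T ⟶ G.obj X}
    (h : IsNat (fun X Y => actRight (F.act X Y) T) G.act τ) :
    ∃ k : T ⟶ homObj F G, ∀ X, F.obj X ◁ k ≫ ev F G X = τ X :=
  ⟨homLift F G τ fun X Y => by
    have := h X Y
    unfold Sq actRight at this
    rw [← this, Category.assoc, reassoc_of% @swapRight_swapRight], homLift_ev F G τ _⟩

/-- A morphism into `[C, V](F, G)` is determined by its evaluations, and naturality of evaluation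
reduces these to the generators of `F`. -/
lemma Generates.homObj_ext {F G : VFunctor V C} {ι : Type*} {E : ι → V} {o : ι → C}
    {e : ∀ i, E i ⟶ F.obj (o i)} (he : Generates F.act e) {T : V} {f g : T ⟶ homObj F G}
    (h : ∀ i, e i ▷ T ≫ F.obj (o i) ◁ f ≫ ev F G (o i) =
      e i ▷ T ≫ F.obj (o i) ◁ g ≫ ev F G (o i)) : f = g :=
  VFunctor.homObj_ext ((he.whiskerRight T).ext (isNat_whiskerLeft_ev F G f)
    (isNat_whiskerLeft_ev F G g) h)

lemma whiskerLeft_eHomWhiskerLeft_ev (F : VFunctor V C) {G H : VFunctor V C} (f : G ⟶ H) (X : C) :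
    F.obj X ◁ eHomWhiskerLeft V F f ≫ ev F H X = ev F G X ≫ app f X := by
  change F.obj X ◁ ((ρ_ (homObj F G)).inv ≫ homObj F G ◁ ofNat f ≫ homComp F G H) ≫ _ = _
  simp only [MonoidalCategory.whiskerLeft_comp, Category.assoc, homComp_ev]
  rw [associator_inv_naturality_right_assoc, whisker_exchange_assoc, ofNat_ev]
  simp

lemma whiskerLeft_eHomWhiskerRight_ev {F G : VFunctor V C} (f : F ⟶ G) (H : VFunctor V C) (X : C) :
    F.obj X ◁ eHomWhiskerRight V f H ≫ ev F H X = app f X ▷ homObj G H ≫ ev G H X := by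
  change F.obj X ◁ ((λ_ (homObj G H)).inv ≫ ofNat f ▷ homObj G H ≫ homComp F G H) ≫ _ = _
  simp only [MonoidalCategory.whiskerLeft_comp, Category.assoc, homComp_ev]
  rw [associator_inv_naturality_middle_assoc, ← comp_whiskerRight_assoc, ofNat_ev]
  simp

lemma app_toNat {F G : VFunctor V C} (f : 𝟙_ V ⟶ homObj F G) (X : C) :
    app (toNat f) X = (ρ_ _).inv ≫ F.obj X ◁ f ≫ ev F G X := rfl

variable {J : Type*} {s s' o : J → C} {F G P F' G' P' F'' G'' P'' : VFunctor V C}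

/-- The morphism `h` between hom-objects of `V`-valued `V`-functors is the one induced by the
tensor product of `V` on the generating families `e` and `e'`. -/
def IsHomTensor (e : ∀ j, F.obj (s j) ⊗ G.obj (s' j) ⟶ P.obj (o j))
    (e' : ∀ j, F'.obj (s j) ⊗ G'.obj (s' j) ⟶ P'.obj (o j))
    (h : homObj F F' ⊗ homObj G G' ⟶ homObj P P') : Prop :=
  ∀ j, e j ▷ _ ≫ P.obj (o j) ◁ h ≫ ev P P' (o j) =
    ptensor (ev F F' (s j)) (ev G G' (s' j)) ≫ e' j

variable {e : ∀ j, F.obj (s j) ⊗ G.obj (s' j) ⟶ P.obj (o j)}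
  {e' : ∀ j, F'.obj (s j) ⊗ G'.obj (s' j) ⟶ P'.obj (o j)}
  {e'' : ∀ j, F''.obj (s j) ⊗ G''.obj (s' j) ⟶ P''.obj (o j)}

/-- The elements of the hom-objects named by `f` and `g` are sent to an element of `[C, V](P, P')`,
which names a morphism `k`; evaluation identifies `k` on the generators. -/
lemma IsHomTensor.exists_tensorHom {h : homObj F F' ⊗ homObj G G' ⟶ homObj P P'}
    (hh : IsHomTensor e e' h) (f : F ⟶ F') (g : G ⟶ G') :
    ∃ k : P ⟶ P', (∀ j, e j ≫ app k (o j) = (app f (s j) ⊗ₘ app g (s' j)) ≫ e' j) ∧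
      (λ_ (𝟙_ V)).inv ≫ (ofNat f ⊗ₘ ofNat g) ≫ h = ofNat k := by
  refine ⟨toNat ((λ_ (𝟙_ V)).inv ≫ (ofNat f ⊗ₘ ofNat g) ≫ h), fun j => ?_, ?_⟩
  · rw [app_toNat, MonoidalCategory.whiskerLeft_comp, MonoidalCategory.whiskerLeft_comp,
      Category.assoc, Category.assoc, rightUnitor_inv_naturality_assoc, ← whisker_exchange_assoc,
      ← whisker_exchange_assoc, hh, reassoc_of% @ptensor_precomp, ofNat_ev, ofNat_ev,
      reassoc_of% @ptensor_unit, Iso.inv_hom_id_assoc]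
  · exact ((enrichedOrdinaryCategory (V := V) (C := C)).homEquiv.apply_symm_apply _).symm

/-- On a generator both sides become two successive tensor products of evaluations, by
`ptensor_seq`. The argument serves Day convolution and composition of endomodules alike. -/
lemma IsHomTensor.comp (he : Generates P.act e) {h : homObj F F' ⊗ homObj G G' ⟶ homObj P P'}
    {h' : homObj F' F'' ⊗ homObj G' G'' ⟶ homObj P' P''}
    {h'' : homObj F F'' ⊗ homObj G G'' ⟶ homObj P P''}
    (hh : IsHomTensor e e' h) (hh' : IsHomTensor e' e'' h') (hh'' : IsHomTensor e e'' h'') :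
    tensorμ _ _ _ _ ≫ (homComp F F' F'' ⊗ₘ homComp G G' G'') ≫ h'' =
      (h ⊗ₘ h') ≫ homComp P P' P'' := by
  refine he.homObj_ext fun j => ?_
  simp only [MonoidalCategory.whiskerLeft_comp, Category.assoc]
  rw [← whisker_exchange_assoc, ← whisker_exchange_assoc, hh'', reassoc_of% @ptensor_precomp,
    homComp_ev, homComp_ev, reassoc_of% @ptensor_seq, homComp_ev, MonoidalCategory.tensorHom_def,
    MonoidalCategory.whiskerLeft_comp_assoc, associator_inv_naturality_right_assoc,
    whisker_exchange_assoc, associator_inv_naturality_middle_assoc,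
    associator_inv_naturality_left_assoc, ← comp_whiskerRight_assoc, ← comp_whiskerRight_assoc,
    Category.assoc, hh, comp_whiskerRight_assoc, hh']

end homObj

section mapHom

variable {V : Type u} [Category.{v} V] [MonoidalCategory V] [MonoidalClosed V]
  {A : Type v} [Category.{w} A] [EnrichedOrdinaryCategory V A]

namespace VFunctor

lemma mapHom_id (F : VFunctor V A) (X : A) : F.mapHom (𝟙 X) = 𝟙 _ := actHom_id F.isAction X

lemma mapHom_comp (F : VFunctor V A) {X Y Z : A} (f : X ⟶ Y) (g : Y ⟶ Z) :
    F.mapHom f ≫ F.mapHom g = F.mapHom (f ≫ g) := (actHom_comp F.isAction f g).symm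

lemma mapHom_app {F G : VFunctor V A} (k : F ⟶ G) {X Y : A} (f : X ⟶ Y) :
    F.mapHom f ≫ app k Y = app k X ≫ G.mapHom f := (isNat_app k).actHom f

lemma mapHom_whiskerLeft_ev [SymmetricCategory V] [HasLimits V] (F G : VFunctor V A) {T : V}
    (k : T ⟶ homObj F G) {X Y : A} (f : X ⟶ Y) :
    F.mapHom f ▷ T ≫ F.obj Y ◁ k ≫ ev F G Y = (F.obj X ◁ k ≫ ev F G X) ≫ G.mapHom f := by
  have := (isNat_whiskerLeft_ev F G k).actHom f
  rwa [actHom_actRight] at this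

end VFunctor

end mapHom

/-! ### Coherence of Day convolution for arbitrary choices of coends -/

section dayTensor

variable {V : Type u} [Category.{v} V] [MonoidalCategory V] [MonoidalClosed V]
  [SymmetricCategory V] {A : Type v} [Category.{w} A] [EnrichedOrdinaryCategory V A]
  [MonoidalCategory A] [MonoidalVCategory V A]

open MonoidalVCategory VFunctor

omit [MonoidalClosed V] in
lemma IsNat.shiftLeft_actRight {m n : A → V} {a : ∀ X Y : A, m X ⊗ (X ⟶[V] Y) ⟶ m Y}
    {b : ∀ X Y : A, n X ⊗ (X ⟶[V] Y) ⟶ n Y} {B : V} {φ : ∀ X, m X ⊗ B ⟶ n X}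
    (h : IsNat (fun X Y => actRight (a X Y) B) b φ) (U : A) :
    IsNat (fun X Y => actRight (EnrichedCayley.shiftLeft a U X Y) B)
      (EnrichedCayley.shiftLeft b U) (fun W => φ (U ⊗ W)) := fun W W' => by
  have := (h (U ⊗ W) (U ⊗ W')).precomp (tensorLeftHom V U W W')
  rwa [← actRight_precomp] at this

namespace DayTensor

variable {F G H L P Q R P' Q' R' K F' G' H' : VFunctor V A}

/-- `k` is the associativity isomorphism of the Day convolution. -/
def IsAssociator (D₁ : DayTensor F G P) (D₂ : DayTensor P H Q) (D₃ : DayTensor G H P')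
    (D₄ : DayTensor F P' Q') (k : Q ⟶ Q') : Prop :=
  ∀ U W Z, D₁.ins U W ▷ H.obj Z ≫ D₂.ins (U ⊗ W) Z ≫ app k ((U ⊗ W) ⊗ Z) ≫
      Q'.mapHom (α_ U W Z).hom =
    (α_ _ _ _).hom ≫ F.obj U ◁ D₃.ins W Z ≫ D₄.ins U (W ⊗ Z)

lemma IsAssociator.ins_app {D₁ : DayTensor F G P} {D₂ : DayTensor P H Q} {D₃ : DayTensor G H P'}
    {D₄ : DayTensor F P' Q'} {k : Q ⟶ Q'} (h : IsAssociator D₁ D₂ D₃ D₄ k) (U W Z : A) :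
    D₁.ins U W ▷ H.obj Z ≫ D₂.ins (U ⊗ W) Z ≫ app k ((U ⊗ W) ⊗ Z) =
      (α_ _ _ _).hom ≫ F.obj U ◁ D₃.ins W Z ≫ D₄.ins U (W ⊗ Z) ≫
        Q'.mapHom (α_ U W Z).inv := by
  have := h U W Z
  rw [← reassoc_of% this, mapHom_comp, Iso.hom_inv_id, mapHom_id, Category.comp_id]

/-- `k` is the left unit isomorphism of the Day convolution. -/
def IsLeftUnitor (D : DayTensor (dayUnit V A) F P) (k : P ⟶ F) : Prop :=
  ∀ U, dayUnitId V A ▷ F.obj U ≫ D.ins (𝟙_ A) U ≫ app k (𝟙_ A ⊗ U) ≫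
      F.mapHom (λ_ U).hom = (λ_ (F.obj U)).hom

lemma IsLeftUnitor.ins_app {D : DayTensor (dayUnit V A) F P} {k : P ⟶ F} (h : IsLeftUnitor D k)
    (U : A) : dayUnitId V A ▷ F.obj U ≫ D.ins (𝟙_ A) U ≫ app k (𝟙_ A ⊗ U) =
      (λ_ (F.obj U)).hom ≫ F.mapHom (λ_ U).inv := by
  have := h U
  rw [← reassoc_of% this, mapHom_comp, Iso.hom_inv_id, mapHom_id, Category.comp_id]

/-- `k` is the right unit isomorphism of the Day convolution. -/
def IsRightUnitor (D : DayTensor F (dayUnit V A) P) (k : P ⟶ F) : Prop :=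
  ∀ U, F.obj U ◁ dayUnitId V A ≫ D.ins U (𝟙_ A) ≫ app k (U ⊗ 𝟙_ A) ≫
      F.mapHom (ρ_ U).hom = (ρ_ (F.obj U)).hom

lemma IsRightUnitor.ins_app {D : DayTensor F (dayUnit V A) P} {k : P ⟶ F} (h : IsRightUnitor D k)
    (U : A) : F.obj U ◁ dayUnitId V A ≫ D.ins U (𝟙_ A) ≫ app k (U ⊗ 𝟙_ A) =
      (ρ_ (F.obj U)).hom ≫ F.mapHom (ρ_ U).inv := by
  have := h U
  rw [← reassoc_of% this, mapHom_comp, Iso.hom_inv_id, mapHom_id, Category.comp_id]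

/-- `k` is the Day convolution of `f` and `g`. -/
def IsTensorHom (D : DayTensor F G P) (D' : DayTensor F' G' P') (f : F ⟶ F') (g : G ⟶ G')
    (k : P ⟶ P') : Prop :=
  ∀ U W, D.ins U W ≫ app k (U ⊗ W) = (app f U ⊗ₘ app g W) ≫ D'.ins U W

/-- On a fourfold generator, naturality collects all transports along associators of `A` at the end.
The equation then splits into the pentagon of `V` on the source and the pentagon of `A` on the
value. -/
lemma pentagon
    {FG GH HL FG_H F_GH GH_L G_HL FG_HL FG_H_L F_GH_L F_GHL' F_G_HL : VFunctor V A}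
    (dFG : DayTensor F G FG) (dGH : DayTensor G H GH) (dHL : DayTensor H L HL)
    (d₁ : DayTensor FG H FG_H) (d₂ : DayTensor F GH F_GH) (d₃ : DayTensor GH L GH_L)
    (d₄ : DayTensor G HL G_HL) (d₅ : DayTensor FG HL FG_HL) (d₆ : DayTensor FG_H L FG_H_L)
    (d₇ : DayTensor F_GH L F_GH_L) (d₈ : DayTensor F GH_L F_GHL') (d₉ : DayTensor F G_HL F_G_HL)
    {a : FG_H ⟶ F_GH} {aL : FG_H_L ⟶ F_GH_L} {b : F_GH_L ⟶ F_GHL'} {c : GH_L ⟶ G_HL}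
    {Fc : F_GHL' ⟶ F_G_HL} {x : FG_H_L ⟶ FG_HL} {y : FG_HL ⟶ F_G_HL}
    (ha : IsAssociator dFG d₁ dGH d₂ a) (haL : IsTensorHom d₆ d₇ a (𝟙 L) aL)
    (hb : IsAssociator d₂ d₇ d₃ d₈ b) (hc : IsAssociator dGH d₃ dHL d₄ c)
    (hFc : IsTensorHom d₈ d₉ (𝟙 F) c Fc) (hx : IsAssociator d₁ d₆ dHL d₅ x)
    (hy : IsAssociator dFG d₅ d₄ d₉ y) : aL ≫ b ≫ Fc = x ≫ y := by
  refine dFG.hom_ext_right₂ d₁ d₆ fun U W Z Y => ?_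
  have e₁ := congrArg (· ▷ L.obj Y) (ha.ins_app U W Z)
  have e₂ := congrArg (F.obj U ◁ ·) (hc.ins_app W Z Y)
  simp only [comp_whiskerRight, MonoidalCategory.whiskerLeft_comp] at e₁ e₂
  have hb' := hb.ins_app U (W ⊗ Z) Y
  have hx' := hx.ins_app (U ⊗ W) Z Y
  have hy' := hy.ins_app U W (Z ⊗ Y)
  have hFc' := hFc U ((W ⊗ Z) ⊗ Y)
  have haL' := haL ((U ⊗ W) ⊗ Z) Y
  rw [id_app, id_tensorHom] at hFc'
  rw [id_app, tensorHom_id] at haL'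
  simp only [comp_app]
  rw [reassoc_of% haL', reassoc_of% e₁, reassoc_of% (d₇.mapHom_whiskerRight_ins),
    ← Category.assoc (F_GH_L.mapHom _), mapHom_app, Category.assoc, reassoc_of% hb', mapHom_app,
    ← Category.assoc (F_GHL'.mapHom _), mapHom_app, Category.assoc, reassoc_of% hFc',
    associator_naturality_middle_assoc, reassoc_of% e₂, reassoc_of% (d₉.whiskerLeft_mapHom_ins),
    mapHom_comp, mapHom_comp, reassoc_of% hx', mapHom_app, associator_naturality_left_assoc,
    ← whisker_exchange_assoc, reassoc_of% hy', mapHom_comp, associator_naturality_right_assoc,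
    pentagon_assoc]
  -- What remains is the pentagon of `A`, for inverse associators.
  congr 6
  simp [← pentagon_inv]

lemma IsAssociator.naturality {D₁ : DayTensor F G P} {D₂ : DayTensor P H Q}
    {D₃ : DayTensor G H R} {D₄ : DayTensor F R L} {D₁' : DayTensor F' G' P'}
    {D₂' : DayTensor P' H' Q'} {D₃' : DayTensor G' H' R'} {D₄' : DayTensor F' R' K}
    {a : Q ⟶ L} {a' : Q' ⟶ K} (ha : IsAssociator D₁ D₂ D₃ D₄ a)
    (ha' : IsAssociator D₁' D₂' D₃' D₄' a') {f : F ⟶ F'} {g : G ⟶ G'} {h : H ⟶ H'}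
    {fg : P ⟶ P'} {fgh : Q ⟶ Q'} {gh : R ⟶ R'} {fgh' : L ⟶ K} (hfg : IsTensorHom D₁ D₁' f g fg)
    (hfgh : IsTensorHom D₂ D₂' fg h fgh) (hgh : IsTensorHom D₃ D₃' g h gh)
    (hfgh' : IsTensorHom D₄ D₄' f gh fgh') : fgh ≫ a' = a ≫ fgh' := by
  refine D₁.hom_ext_right D₂ fun U W Z => ?_
  have e : D₁.ins U W ▷ H.obj Z ≫ (app fg (U ⊗ W) ⊗ₘ app h Z) =
      ((app f U ⊗ₘ app g W) ⊗ₘ app h Z) ≫ D₁'.ins U W ▷ H'.obj Z := by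
    rw [whiskerRight_comp_tensorHom, hfg U W, tensorHom_comp_whiskerRight]
  have e' : F.obj U ◁ D₃.ins W Z ≫ (app f U ⊗ₘ app gh (W ⊗ Z)) =
      (app f U ⊗ₘ (app g W ⊗ₘ app h Z)) ≫ F'.obj U ◁ D₃'.ins W Z := by
    rw [whiskerLeft_comp_tensorHom, hgh W Z, tensorHom_comp_whiskerLeft]
  simp only [comp_app]
  rw [reassoc_of% (hfgh (U ⊗ W) Z), reassoc_of% (ha.ins_app U W Z), mapHom_app,
    reassoc_of% (hfgh' U (W ⊗ Z)), reassoc_of% e, reassoc_of% e', ha'.ins_app,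
    MonoidalCategory.associator_naturality_assoc]

lemma IsLeftUnitor.naturality {D : DayTensor (dayUnit V A) F P} {D' : DayTensor (dayUnit V A) F' P'}
    {k : P ⟶ F} {k' : P' ⟶ F'} (hk : IsLeftUnitor D k) (hk' : IsLeftUnitor D' k') {f : F ⟶ F'}
    {g : P ⟶ P'} (hg : IsTensorHom D D' (𝟙 _) f g) : g ≫ k' = k ≫ f := by
  refine D.hom_ext_leftUnit fun U => ?_
  have e := hg (𝟙_ A) U
  rw [id_app, id_tensorHom] at e
  rw [comp_app, comp_app, reassoc_of% e, ← whisker_exchange_assoc, hk'.ins_app,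
    reassoc_of% (hk.ins_app U), mapHom_app, MonoidalCategory.leftUnitor_naturality_assoc]

lemma IsRightUnitor.naturality {D : DayTensor F (dayUnit V A) P}
    {D' : DayTensor F' (dayUnit V A) P'} {k : P ⟶ F} {k' : P' ⟶ F'} (hk : IsRightUnitor D k)
    (hk' : IsRightUnitor D' k') {f : F ⟶ F'} {g : P ⟶ P'} (hg : IsTensorHom D D' f (𝟙 _) g) :
    g ≫ k' = k ≫ f := by
  refine D.hom_ext_rightUnit fun U => ?_
  have e := hg U (𝟙_ A)
  rw [id_app, tensorHom_id] at e
  rw [comp_app, comp_app, reassoc_of% e, whisker_exchange_assoc, hk'.ins_app,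
    reassoc_of% (hk.ins_app U), mapHom_app, MonoidalCategory.rightUnitor_naturality_assoc]

/-- The middle factor `A(𝟙, -)` is generated by the identity of `𝟙`, so only that element need be
tested. -/
lemma hom_ext_middleUnit (D₁ : DayTensor F (dayUnit V A) P) (D₂ : DayTensor P G Q) {f g : Q ⟶ K}
    (h : ∀ U Z, (F.obj U ◁ dayUnitId V A) ▷ G.obj Z ≫ D₁.ins U (𝟙_ A) ▷ G.obj Z ≫
        D₂.ins (U ⊗ 𝟙_ A) Z ≫ app f ((U ⊗ 𝟙_ A) ⊗ Z) =
      (F.obj U ◁ dayUnitId V A) ▷ G.obj Z ≫ D₁.ins U (𝟙_ A) ▷ G.obj Z ≫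
        D₂.ins (U ⊗ 𝟙_ A) Z ≫ app g ((U ⊗ 𝟙_ A) ⊗ Z)) : f = g :=
  D₁.hom_ext_right D₂ fun U W Z =>
    ((generates_dayUnit.whiskerLeft (F.obj U)).whiskerRight (G.obj Z)).ext
      (IsNat.comp (fun W W' => (D₁.nat_right U W W').whiskerRight (G.obj Z))
        (IsNat.shiftLeft_actRight ((D₂.isNat_ins Z).comp ((isNat_app f).shiftRight Z)) U))
      (IsNat.comp (fun W W' => (D₁.nat_right U W W').whiskerRight (G.obj Z))
        (IsNat.shiftLeft_actRight ((D₂.isNat_ins Z).comp ((isNat_app g).shiftRight Z)) U))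
      (fun _ => h U Z) W

/-- On the generators of `hom_ext_middleUnit` the equation is the triangle identity of `V` together
with that of `A` under transport. -/
lemma triangle {D₁ : DayTensor F (dayUnit V A) P} {D₂ : DayTensor P G Q}
    {D₃ : DayTensor (dayUnit V A) G P'} {D₄ : DayTensor F P' Q'} {D : DayTensor F G R}
    {a : Q ⟶ Q'} {l : P' ⟶ G} {r : P ⟶ F} {Fl : Q' ⟶ R} {rG : Q ⟶ R}
    (ha : IsAssociator D₁ D₂ D₃ D₄ a) (hl : IsLeftUnitor D₃ l) (hr : IsRightUnitor D₁ r)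
    (hFl : IsTensorHom D₄ D (𝟙 F) l Fl) (hrG : IsTensorHom D₂ D r (𝟙 G) rG) : a ≫ Fl = rG := by
  refine hom_ext_middleUnit D₁ D₂ fun U Z => ?_
  have e₁ := hFl U (𝟙_ A ⊗ Z)
  have e₂ := hrG (U ⊗ 𝟙_ A) Z
  have e₃ := congrArg (· ▷ G.obj Z) (hr.ins_app U)
  have e₄ := congrArg (F.obj U ◁ ·) (hl.ins_app Z)
  simp only [comp_whiskerRight, MonoidalCategory.whiskerLeft_comp] at e₃ e₄
  rw [id_app, id_tensorHom] at e₁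
  rw [id_app, tensorHom_id] at e₂
  rw [comp_app, reassoc_of% (ha.ins_app U (𝟙_ A) Z), e₂, reassoc_of% e₃, mapHom_app,
    reassoc_of% e₁, associator_naturality_middle_assoc, reassoc_of% e₄,
    reassoc_of% (D.whiskerLeft_mapHom_ins), mapHom_comp, D.mapHom_whiskerRight_ins]
  simp

/-- The tensor product of two evaluations followed by the universal map is natural in both
variables, with the hom-objects as a spare factor. It lifts to `P`, and the lift, being natural,
factors through the end. -/
lemma exists_homTensor [HasLimits V] (D : DayTensor F G P) (D' : DayTensor F' G' P') :
    ∃ h : homObj F F' ⊗ homObj G G' ⟶ homObj P P',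
      IsHomTensor (fun p : A × A => D.ins p.1 p.2) (fun p => D'.ins p.1 p.2) h := by
  obtain ⟨τ, hτ, hτ'⟩ := D.exists_liftRight P'.isAction (homObj F F' ⊗ homObj G G')
    (fun U W => ptensor (ev F F' U) (ev G G' W) ≫ D'.ins U W)
    (fun W U U' => (Sq.ptensor_left (isNat_ev F F' U U') _).comp (D'.nat_left W U U'))
    (fun U W W' => (Sq.ptensor_right (isNat_ev G G' W W') _).comp (D'.nat_right U W W'))
  obtain ⟨k, hk⟩ := hτ.exists_homLift
  exact ⟨k, fun p => by rw [hk, hτ']⟩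

end DayTensor

variable [HasColimits V]

/-- A chosen Day convolution of `F` and `G`. -/
def dayObj (F G : VFunctor V A) : VFunctor V A := (exists_dayTensor F G).choose

/-- The universal property of the chosen Day convolution. -/
def dayTensor (F G : VFunctor V A) : DayTensor F G (dayObj F G) :=
  (exists_dayTensor F G).choose_spec.some

/-- The associativity isomorphism of Day convolution. -/
def dayAssociator (F G H : VFunctor V A) : dayObj (dayObj F G) H ≅ dayObj F (dayObj G H) :=
  ((dayTensor F G).exists_associator (dayTensor _ H) (dayTensor G H) (dayTensor F _)).choose

lemma isAssociator_dayAssociator (F G H : VFunctor V A) :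
    (dayTensor F G).IsAssociator (dayTensor _ H) (dayTensor G H) (dayTensor F _)
      (dayAssociator F G H).hom :=
  ((dayTensor F G).exists_associator (dayTensor _ H) (dayTensor G H) (dayTensor F _)).choose_spec

/-- The left unit isomorphism of Day convolution. -/
def dayLeftUnitor (F : VFunctor V A) : dayObj (dayUnit V A) F ≅ F :=
  (dayTensor (dayUnit V A) F).exists_leftUnitor.choose

lemma isLeftUnitor_dayLeftUnitor (F : VFunctor V A) :
    (dayTensor (dayUnit V A) F).IsLeftUnitor (dayLeftUnitor F).hom :=
  (dayTensor (dayUnit V A) F).exists_leftUnitor.choose_spec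

/-- The right unit isomorphism of Day convolution. -/
def dayRightUnitor (F : VFunctor V A) : dayObj F (dayUnit V A) ≅ F :=
  (dayTensor F (dayUnit V A)).exists_rightUnitor.choose

lemma isRightUnitor_dayRightUnitor (F : VFunctor V A) :
    (dayTensor F (dayUnit V A)).IsRightUnitor (dayRightUnitor F).hom :=
  (dayTensor F (dayUnit V A)).exists_rightUnitor.choose_spec

end dayTensor

section ptensor

variable {V : Type u} [Category.{v} V] [MonoidalCategory V] [SymmetricCategory V]

lemma ptensor_precomp_left {P Q T S P' Q' T' : V} (k : S ⟶ T) (a : P ⊗ T ⟶ Q)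
    (b : P' ⊗ T' ⟶ Q') : (P ⊗ P') ◁ k ▷ T' ≫ ptensor a b = ptensor (P ◁ k ≫ a) b := by
  have := ptensor_precomp k (𝟙 T') a b
  rwa [tensorHom_id, MonoidalCategory.whiskerLeft_id, Category.id_comp] at this

lemma ptensor_precomp_right {P Q T P' Q' T' S' : V} (k' : S' ⟶ T') (a : P ⊗ T ⟶ Q)
    (b : P' ⊗ T' ⟶ Q') : (P ⊗ P') ◁ T ◁ k' ≫ ptensor a b = ptensor a (P' ◁ k' ≫ b) := by
  have := ptensor_precomp (𝟙 T) k' a b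
  rwa [id_tensorHom, MonoidalCategory.whiskerLeft_id, Category.id_comp] at this

lemma whiskerRight_ptensor {P Q R T P' R' T' : V} (a : Q ⊗ T ⟶ R) (b : P' ⊗ T' ⟶ R')
    (f : P ⟶ Q) : (f ▷ P') ▷ (T ⊗ T') ≫ ptensor a b = ptensor (f ▷ T ≫ a) b := by
  have := tensorHom_whiskerRight_ptensor a b f (𝟙 P')
  rwa [tensorHom_id, id_whiskerRight, Category.id_comp] at this

lemma whiskerLeft_ptensor {P Q' R T P' R' T' : V} (a : P ⊗ T ⟶ R) (b : Q' ⊗ T' ⟶ R')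
    (g : P' ⟶ Q') : (P ◁ g) ▷ (T ⊗ T') ≫ ptensor a b = ptensor a (g ▷ T' ≫ b) := by
  have := tensorHom_whiskerRight_ptensor a b (𝟙 P) g
  rwa [id_tensorHom, id_whiskerRight, Category.id_comp] at this

lemma ptensor_comp_whiskerRight {P Q R T P' Q' T' : V} (a : P ⊗ T ⟶ Q) (b : P' ⊗ T' ⟶ Q')
    (f : Q ⟶ R) : ptensor (a ≫ f) b = ptensor a b ≫ f ▷ Q' := by
  rw [← tensorHom_id, ptensor_comp_tensorHom, Category.comp_id]

lemma ptensor_comp_whiskerLeft {P Q R' T P' Q' T' : V} (a : P ⊗ T ⟶ Q) (b : P' ⊗ T' ⟶ Q')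
    (g : Q' ⟶ R') : ptensor a (b ≫ g) = ptensor a b ≫ Q ◁ g := by
  rw [← id_tensorHom, ptensor_comp_tensorHom, Category.comp_id]

end ptensor

/-! ### Day convolution as a monoidal `V`-category -/

section dayTensor

variable {V : Type u} [Category.{v} V] [MonoidalCategory V] [MonoidalClosed V]
  [SymmetricCategory V] {A : Type v} [Category.{w} A] [EnrichedOrdinaryCategory V A]
  [MonoidalCategory A] [MonoidalVCategory V A] [HasLimits V]

open MonoidalVCategory VFunctor

namespace DayTensor

variable {F G H L P Q R P' Q' R' K F' G' H' : VFunctor V A}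

/-- `h` is the effect of Day convolution on hom-objects. -/
abbrev IsHom (D : DayTensor F G P) (D' : DayTensor F' G' P')
    (h : homObj F F' ⊗ homObj G G' ⟶ homObj P P') : Prop :=
  IsHomTensor (fun p : A × A => D.ins p.1 p.2) (fun p => D'.ins p.1 p.2) h

lemma IsHom.ins_ev {D : DayTensor F G P} {D' : DayTensor F' G' P'}
    {h : homObj F F' ⊗ homObj G G' ⟶ homObj P P'} (hh : IsHom D D' h) (U W : A) :
    D.ins U W ▷ _ ≫ P.obj (U ⊗ W) ◁ h ≫ ev P P' (U ⊗ W) =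
      ptensor (ev F F' U) (ev G G' W) ≫ D'.ins U W := hh (U, W)

lemma homObj_ext_right (D₁ : DayTensor F G P) (D₂ : DayTensor P H Q) {T : V}
    {f g : T ⟶ homObj Q K}
    (h : ∀ U W Z, (D₁.ins U W ▷ H.obj Z) ▷ T ≫ D₂.ins (U ⊗ W) Z ▷ T ≫
        Q.obj ((U ⊗ W) ⊗ Z) ◁ f ≫ ev Q K ((U ⊗ W) ⊗ Z) =
      (D₁.ins U W ▷ H.obj Z) ▷ T ≫ D₂.ins (U ⊗ W) Z ▷ T ≫
        Q.obj ((U ⊗ W) ⊗ Z) ◁ g ≫ ev Q K ((U ⊗ W) ⊗ Z)) : f = g :=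
  D₂.generates.homObj_ext fun p =>
    ((D₁.generates.whiskerRight (H.obj p.2)).whiskerRight T).ext
      (IsNat.comp (fun U U' => (D₂.isNat_ins p.2 U U').whiskerRight T)
        (IsNat.shiftRight_actRight (isNat_whiskerLeft_ev Q K f) p.2))
      (IsNat.comp (fun U U' => (D₂.isNat_ins p.2 U U').whiskerRight T)
        (IsNat.shiftRight_actRight (isNat_whiskerLeft_ev Q K g) p.2)) (fun q => h q.1 q.2 p.2) p.1

lemma homObj_ext_leftUnit (D : DayTensor (dayUnit V A) F P) {T : V} {f g : T ⟶ homObj P K}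
    (h : ∀ U, (dayUnitId V A ▷ F.obj U) ▷ T ≫ D.ins (𝟙_ A) U ▷ T ≫
        P.obj (𝟙_ A ⊗ U) ◁ f ≫ ev P K (𝟙_ A ⊗ U) =
      (dayUnitId V A ▷ F.obj U) ▷ T ≫ D.ins (𝟙_ A) U ▷ T ≫
        P.obj (𝟙_ A ⊗ U) ◁ g ≫ ev P K (𝟙_ A ⊗ U)) : f = g :=
  D.generates.homObj_ext fun p =>
    ((generates_dayUnit.whiskerRight (F.obj p.2)).whiskerRight T).ext
      (IsNat.comp (fun U U' => (D.isNat_ins p.2 U U').whiskerRight T)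
        (IsNat.shiftRight_actRight (isNat_whiskerLeft_ev P K f) p.2))
      (IsNat.comp (fun U U' => (D.isNat_ins p.2 U U').whiskerRight T)
        (IsNat.shiftRight_actRight (isNat_whiskerLeft_ev P K g) p.2)) (fun _ => h p.2) p.1

lemma homObj_ext_rightUnit (D : DayTensor F (dayUnit V A) P) {T : V} {f g : T ⟶ homObj P K}
    (h : ∀ U, (F.obj U ◁ dayUnitId V A) ▷ T ≫ D.ins U (𝟙_ A) ▷ T ≫
        P.obj (U ⊗ 𝟙_ A) ◁ f ≫ ev P K (U ⊗ 𝟙_ A) =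
      (F.obj U ◁ dayUnitId V A) ▷ T ≫ D.ins U (𝟙_ A) ▷ T ≫
        P.obj (U ⊗ 𝟙_ A) ◁ g ≫ ev P K (U ⊗ 𝟙_ A)) : f = g :=
  D.generates.homObj_ext fun p =>
    ((generates_dayUnit.whiskerLeft (F.obj p.1)).whiskerRight T).ext
      (IsNat.comp (fun W W' => (D.nat_right p.1 W W').whiskerRight T)
        (IsNat.shiftLeft_actRight (isNat_whiskerLeft_ev P K f) p.1))
      (IsNat.comp (fun W W' => (D.nat_right p.1 W W').whiskerRight T)
        (IsNat.shiftLeft_actRight (isNat_whiskerLeft_ev P K g) p.1)) (fun _ => h p.1) p.2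

/-- On triple generators the hom-objects act by a triple tensor product of evaluations, so the claim
becomes `sq_ptensor_associator` in `V`. The transport along the associator of `A` passes through
because evaluation is natural. -/
lemma IsAssociator.homObj_naturality {D₁ : DayTensor F G P} {D₂ : DayTensor P H Q}
    {D₃ : DayTensor G H R} {D₄ : DayTensor F R L} {D₁' : DayTensor F' G' P'}
    {D₂' : DayTensor P' H' Q'} {D₃' : DayTensor G' H' R'} {D₄' : DayTensor F' R' K}
    {a : Q ⟶ L} {a' : Q' ⟶ K} (ha : IsAssociator D₁ D₂ D₃ D₄ a)
    (ha' : IsAssociator D₁' D₂' D₃' D₄' a') {h₁ : homObj F F' ⊗ homObj G G' ⟶ homObj P P'}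
    {h₂ : homObj P P' ⊗ homObj H H' ⟶ homObj Q Q'} {h₃ : homObj G G' ⊗ homObj H H' ⟶ homObj R R'}
    {h₄ : homObj F F' ⊗ homObj R R' ⟶ homObj L K} (hh₁ : IsHom D₁ D₁' h₁)
    (hh₂ : IsHom D₂ D₂' h₂) (hh₃ : IsHom D₃ D₃' h₃) (hh₄ : IsHom D₄ D₄' h₄) :
    h₁ ▷ homObj H H' ≫ h₂ ≫ eHomWhiskerLeft V Q a' =
      (α_ _ _ _).hom ≫ homObj F F' ◁ h₃ ≫ h₄ ≫ eHomWhiskerRight V a K := by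
  refine D₁.homObj_ext_right D₂ fun U W Z => ?_
  have e₁ : (D₁.ins U W ▷ H.obj Z) ▷ _ ≫ (P.obj (U ⊗ W) ⊗ H.obj Z) ◁ (h₁ ▷ homObj H H') ≫
      ptensor (ev P P' (U ⊗ W)) (ev H H' Z) =
        ptensor (ptensor (ev F F' U) (ev G G' W)) (ev H H' Z) ≫ D₁'.ins U W ▷ H'.obj Z := by
    rw [ptensor_precomp_left, whiskerRight_ptensor, hh₁.ins_ev, ptensor_comp_whiskerRight]
  have e₂ : (F.obj U ◁ D₃.ins W Z) ▷ _ ≫ (F.obj U ⊗ R.obj (W ⊗ Z)) ◁ (homObj F F' ◁ h₃) ≫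
      ptensor (ev F F' U) (ev R R' (W ⊗ Z)) =
        ptensor (ev F F' U) (ptensor (ev G G' W) (ev H H' Z)) ≫ F'.obj U ◁ D₃'.ins W Z := by
    rw [ptensor_precomp_right, whiskerLeft_ptensor, hh₃.ins_ev, ptensor_comp_whiskerLeft]
  have s := sq_ptensor_associator (ev F F' U) (ev G G' W) (ev H H' Z)
  unfold Sq at s
  have l : (D₁.ins U W ▷ H.obj Z) ▷ _ ≫ D₂.ins (U ⊗ W) Z ▷ _ ≫ Q.obj ((U ⊗ W) ⊗ Z) ◁
      (h₁ ▷ homObj H H' ≫ h₂ ≫ eHomWhiskerLeft V Q a') ≫ ev Q K ((U ⊗ W) ⊗ Z) =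
      (ptensor (ptensor (ev F F' U) (ev G G' W)) (ev H H' Z) ≫ (α_ _ _ _).hom) ≫
        F'.obj U ◁ D₃'.ins W Z ≫ D₄'.ins U (W ⊗ Z) ≫ K.mapHom (α_ U W Z).inv := by
    have e := hh₂.ins_ev (U ⊗ W) Z
    have w := whiskerLeft_eHomWhiskerLeft_ev Q a' ((U ⊗ W) ⊗ Z)
    simp only [MonoidalCategory.whiskerLeft_comp, Category.assoc] at w ⊢
    rw [w, ← whisker_exchange_assoc, reassoc_of% e, reassoc_of% e₁, ha'.ins_app]
  have r : (D₁.ins U W ▷ H.obj Z) ▷ _ ≫ D₂.ins (U ⊗ W) Z ▷ _ ≫ Q.obj ((U ⊗ W) ⊗ Z) ◁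
      ((α_ _ _ _).hom ≫ homObj F F' ◁ h₃ ≫ h₄ ≫ eHomWhiskerRight V a K) ≫
        ev Q K ((U ⊗ W) ⊗ Z) =
      ((α_ _ _ _).hom ▷ _ ≫ (_ ◁ (α_ _ _ _).hom ≫ ptensor (ev F F' U)
        (ptensor (ev G G' W) (ev H H' Z)))) ≫
        F'.obj U ◁ D₃'.ins W Z ≫ D₄'.ins U (W ⊗ Z) ≫ K.mapHom (α_ U W Z).inv := by
    have e := hh₄.ins_ev U (W ⊗ Z)
    have w := whiskerLeft_eHomWhiskerRight_ev a K ((U ⊗ W) ⊗ Z)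
    have m := mapHom_whiskerLeft_ev L K ((α_ _ _ _).hom ≫ homObj F F' ◁ h₃ ≫ h₄) (α_ U W Z).inv
    have n := congrArg (· ▷ ((homObj F F' ⊗ homObj G G') ⊗ homObj H H')) (ha.ins_app U W Z)
    simp only [MonoidalCategory.whiskerLeft_comp, comp_whiskerRight, Category.assoc] at w m n ⊢
    rw [w, whisker_exchange_assoc, whisker_exchange_assoc, whisker_exchange_assoc,
      reassoc_of% n, m, ← whisker_exchange_assoc (D₄.ins U (W ⊗ Z)),
      ← whisker_exchange_assoc (D₄.ins U (W ⊗ Z)), reassoc_of% e,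
      ← whisker_exchange_assoc (F.obj U ◁ D₃.ins W Z), reassoc_of% e₂]
  exact l.trans ((congrArg (· ≫ _) s).trans r.symm)

/-- Tested on the identity of `𝟙`: the identity of `A(𝟙, -)` contributes nothing, and what remains
is naturality of the left unit isomorphism of `V`. -/
lemma IsLeftUnitor.homObj_naturality {D : DayTensor (dayUnit V A) F P}
    {D' : DayTensor (dayUnit V A) F' P'} {k : P ⟶ F} {k' : P' ⟶ F'} (hk : IsLeftUnitor D k)
    (hk' : IsLeftUnitor D' k') {h : homObj (dayUnit V A) (dayUnit V A) ⊗ homObj F F' ⟶ homObj P P'}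
    (hh : IsHom D D' h) :
    (λ_ _).inv ≫ ofNat (𝟙 (dayUnit V A)) ▷ homObj F F' ≫ h ≫ eHomWhiskerLeft V P k' =
      eHomWhiskerRight V k F' := by
  refine D.homObj_ext_leftUnit fun U => ?_
  have e := hh.ins_ev (𝟙_ A) U
  have w := whiskerLeft_eHomWhiskerLeft_ev P k' (𝟙_ A ⊗ U)
  have w' := whiskerLeft_eHomWhiskerRight_ev k F' (𝟙_ A ⊗ U)
  have n := congrArg (· ▷ homObj F F') (hk.ins_app U)
  have p := ptensor_id_whisker (ev (dayUnit V A) (dayUnit V A) (𝟙_ A)) (ev F F' U)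
    (ofNat (𝟙 (dayUnit V A))) ((ofNat_ev _ _).trans (by simp))
  have s := Sq.actLeft_whiskerRight (dayUnitId V A) (ev F F' U)
  have s' := Sq.leftUnitor (ev F F' U)
  have m := mapHom_whiskerLeft_ev F F' (𝟙 _) (λ_ U).inv
  unfold Sq at s s'
  simp only [MonoidalCategory.whiskerLeft_comp, comp_whiskerRight, Category.assoc,
    MonoidalCategory.whiskerLeft_id, Category.id_comp] at w w' m n p ⊢
  rw [w, w', ← whisker_exchange_assoc (D.ins _ _), ← whisker_exchange_assoc (D.ins _ _),
    reassoc_of% e, reassoc_of% p, reassoc_of% n, m, ← reassoc_of% s, hk'.ins_app, reassoc_of% s']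

lemma IsRightUnitor.homObj_naturality {D : DayTensor F (dayUnit V A) P}
    {D' : DayTensor F' (dayUnit V A) P'} {k : P ⟶ F} {k' : P' ⟶ F'} (hk : IsRightUnitor D k)
    (hk' : IsRightUnitor D' k') {h : homObj F F' ⊗ homObj (dayUnit V A) (dayUnit V A) ⟶ homObj P P'}
    (hh : IsHom D D' h) :
    (ρ_ _).inv ≫ homObj F F' ◁ ofNat (𝟙 (dayUnit V A)) ≫ h ≫ eHomWhiskerLeft V P k' =
      eHomWhiskerRight V k F' := by
  refine D.homObj_ext_rightUnit fun U => ?_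
  have e := hh.ins_ev U (𝟙_ A)
  have w := whiskerLeft_eHomWhiskerLeft_ev P k' (U ⊗ 𝟙_ A)
  have w' := whiskerLeft_eHomWhiskerRight_ev k F' (U ⊗ 𝟙_ A)
  have n := congrArg (· ▷ homObj F F') (hk.ins_app U)
  have p := ptensor_whisker_id (ev F F' U) (ev (dayUnit V A) (dayUnit V A) (𝟙_ A))
    (ofNat (𝟙 (dayUnit V A))) ((ofNat_ev _ _).trans (by simp))
  have s := Sq.actRight_whiskerLeft (dayUnitId V A) (ev F F' U)
  have s' := Sq.rightUnitor (ev F F' U)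
  have m := mapHom_whiskerLeft_ev F F' (𝟙 _) (ρ_ U).inv
  unfold Sq at s s'
  simp only [MonoidalCategory.whiskerLeft_comp, comp_whiskerRight, Category.assoc,
    MonoidalCategory.whiskerLeft_id, Category.id_comp] at w w' m n p ⊢
  rw [w, w', ← whisker_exchange_assoc (D.ins _ _), ← whisker_exchange_assoc (D.ins _ _),
    reassoc_of% e, reassoc_of% p, reassoc_of% n, m, ← reassoc_of% s, hk'.ins_app, reassoc_of% s']

end DayTensor

variable [HasColimits V]

/-- The effect of Day convolution on hom-objects. -/
def dayHomTensor (F F' G G' : VFunctor V A) :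
    homObj F F' ⊗ homObj G G' ⟶ homObj (dayObj F G) (dayObj F' G') :=
  ((dayTensor F G).exists_homTensor (dayTensor F' G')).choose

lemma isHom_dayHomTensor (F F' G G' : VFunctor V A) :
    (dayTensor F G).IsHom (dayTensor F' G') (dayHomTensor F F' G G') :=
  ((dayTensor F G).exists_homTensor (dayTensor F' G')).choose_spec

/-- The Day convolution of morphisms. -/
def dayTensorHom {F F' G G' : VFunctor V A} (f : F ⟶ F') (g : G ⟶ G') :
    dayObj F G ⟶ dayObj F' G' :=
  ((isHom_dayHomTensor F F' G G').exists_tensorHom f g).choose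

lemma isTensorHom_dayTensorHom {F F' G G' : VFunctor V A} (f : F ⟶ F') (g : G ⟶ G') :
    (dayTensor F G).IsTensorHom (dayTensor F' G') f g (dayTensorHom f g) := fun U W =>
  ((isHom_dayHomTensor F F' G G').exists_tensorHom f g).choose_spec.1 (U, W)

lemma ofNat_dayTensorHom {F F' G G' : VFunctor V A} (f : F ⟶ F') (g : G ⟶ G') :
    (λ_ (𝟙_ V)).inv ≫ (ofNat f ⊗ₘ ofNat g) ≫ dayHomTensor F F' G G' = ofNat (dayTensorHom f g) :=
  ((isHom_dayHomTensor F F' G G').exists_tensorHom f g).choose_spec.2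

variable (V A) in
/-- The monoidal category `[A, V]` under Day convolution. -/
abbrev dayMonoidalCategory : MonoidalCategory (VFunctor V A) :=
  letI : MonoidalCategoryStruct (VFunctor V A) :=
    { tensorObj := dayObj
      tensorHom := dayTensorHom
      whiskerLeft := fun F _ _ g => dayTensorHom (𝟙 F) g
      whiskerRight := fun f G => dayTensorHom f (𝟙 G)
      tensorUnit := dayUnit V A
      associator := dayAssociator
      leftUnitor := dayLeftUnitor
      rightUnitor := dayRightUnitor }
  MonoidalCategory.ofTensorHom
    (id_tensorHom_id := fun F G => (dayTensor F G).hom_ext fun U W => by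
      have := isTensorHom_dayTensorHom (𝟙 F) (𝟙 G) U W
      exact this.trans ((by simp : _ = (dayTensor F G).ins U W).trans (Category.comp_id _).symm))
    (id_tensorHom := fun _ _ _ _ => rfl)
    (tensorHom_id := fun _ _ => rfl)
    (tensorHom_comp_tensorHom := fun f₁ f₂ g₁ g₂ => (dayTensor _ _).hom_ext fun U W => by
      have h₁ := isTensorHom_dayTensorHom f₁ f₂ U W
      have h₂ := isTensorHom_dayTensorHom g₁ g₂ U W
      have h₃ := isTensorHom_dayTensorHom (f₁ ≫ g₁) (f₂ ≫ g₂) U W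
      refine Eq.trans ?_ h₃.symm
      rw [comp_app]
      refine ((reassoc_of% h₁) _).trans ?_
      refine (congrArg ((app f₁ U ⊗ₘ app f₂ W) ≫ ·) h₂).trans ?_
      simp)
    (associator_naturality := fun f₁ f₂ f₃ =>
      (isAssociator_dayAssociator _ _ _).naturality (isAssociator_dayAssociator _ _ _)
        (isTensorHom_dayTensorHom f₁ f₂) (isTensorHom_dayTensorHom _ f₃)
        (isTensorHom_dayTensorHom f₂ f₃) (isTensorHom_dayTensorHom f₁ _))
    (leftUnitor_naturality := fun f => (isLeftUnitor_dayLeftUnitor _).naturality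
      (isLeftUnitor_dayLeftUnitor _) (isTensorHom_dayTensorHom _ f))
    (rightUnitor_naturality := fun f => (isRightUnitor_dayRightUnitor _).naturality
      (isRightUnitor_dayRightUnitor _) (isTensorHom_dayTensorHom f _))
    (pentagon := fun F G H L => DayTensor.pentagon _ _ _ _ _ _ _ _ _ _ _ _
      (isAssociator_dayAssociator F G H) (isTensorHom_dayTensorHom _ _)
      (isAssociator_dayAssociator _ _ _) (isAssociator_dayAssociator G H L)
      (isTensorHom_dayTensorHom _ _) (isAssociator_dayAssociator _ _ _)
      (isAssociator_dayAssociator _ _ _))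
    (triangle := fun F G => DayTensor.triangle (isAssociator_dayAssociator _ _ _)
      (isLeftUnitor_dayLeftUnitor _) (isRightUnitor_dayRightUnitor _)
      (isTensorHom_dayTensorHom _ _) (isTensorHom_dayTensorHom _ _))

variable (V A) in
/-- The monoidal `V`-category `[A, V]` under Day convolution. -/
abbrev dayMonoidalVCategory :
    letI := dayMonoidalCategory V A
    MonoidalVCategory V (VFunctor V A) :=
  letI := dayMonoidalCategory V A
  { tensorHomObj := fun F F' G G' => dayHomTensor F F' G G'
    tensorHomObj_eHomEquiv := fun f g => ofNat_dayTensorHom f g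
    tensorHomObj_comp := fun F F' F'' G G' G'' =>
      IsHomTensor.comp (dayTensor F G).generates (isHom_dayHomTensor F F' G G')
        (isHom_dayHomTensor F' F'' G' G'') (isHom_dayHomTensor F F'' G G'')
    associator_naturality := fun F F' G G' H H' =>
      (isAssociator_dayAssociator _ _ _).homObj_naturality (isAssociator_dayAssociator _ _ _)
        (isHom_dayHomTensor F F' G G') (isHom_dayHomTensor _ _ H H')
        (isHom_dayHomTensor G G' H H') (isHom_dayHomTensor F F' _ _)
    leftUnitor_naturality := fun F F' => (isLeftUnitor_dayLeftUnitor _).homObj_naturality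
      (isLeftUnitor_dayLeftUnitor _) (isHom_dayHomTensor _ _ F F')
    rightUnitor_naturality := fun F F' => (isRightUnitor_dayRightUnitor _).homObj_naturality
      (isRightUnitor_dayRightUnitor _) (isHom_dayHomTensor F F' _ _) }

variable (V A) in
/-- The coends of the chosen Day convolutions. -/
abbrev dayCoends : DayCoends V A :=
  letI := dayMonoidalCategory V A
  { monoidalCategory := dayMonoidalCategory V A
    monoidalVCategory := dayMonoidalVCategory V A
    copr := fun F G U W X => (dayTensor F G).ins U W ▷ _ ≫ (dayObj F G).act (U ⊗ W) X
    isDayCowedge := fun F G X => isDayCowedge_of_sq (dayObj F G).isAction _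
      ((sq_ptensor_iff (dayObj F G).isAction _).2 ⟨(dayTensor F G).nat_left,
        (dayTensor F G).nat_right⟩) X
    existsUnique_desc := fun F G X _ t ht => (dayTensor F G).existsUnique_desc X t ht
    copr_act := fun F G U W X Y => by
      have := (dayObj F G).act_comp (U ⊗ W) X Y
      change ((dayTensor F G).ins U W ▷ _ ≫ (dayObj F G).act (U ⊗ W) X) ▷ _ ≫
        (dayObj F G).act X Y = _
      rw [whisker_exchange_assoc, this]
      simp }

/-- The coprojections were defined by acting on the universal family, and the identity of `U ⊗ W`
acts trivially. -/
lemma dayCoends_ins (F G : VFunctor V A) (U W : A) :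
    (dayCoends V A).ins F G U W = (dayTensor F G).ins U W := by
  change (ρ_ _).inv ≫ _ ◁ eId V (U ⊗ W : A) ≫ (dayTensor F G).ins U W ▷ _ ≫
    (dayObj F G).act (U ⊗ W) (U ⊗ W) = _
  rw [whisker_exchange_assoc, act_id]
  simp

lemma nonempty_dayConvolution : Nonempty (DayConvolution V A) :=
  letI := dayMonoidalCategory V A
  letI := dayMonoidalVCategory V A
  ⟨{ toDayCoends := dayCoends V A
     ins_tensorHomObj := fun F F' G G' U W => by
      simp only [dayCoends_ins]
      exact ((isHom_dayHomTensor F F' G G').ins_ev U W).trans (Category.assoc _ _ _)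
     ins_associator := fun F G H U W Z => by
      simp only [dayCoends_ins]
      exact isAssociator_dayAssociator F G H U W Z
     unitIso := Iso.refl _
     ins_leftUnitor := fun F U => by
      simp only [dayCoends_ins]
      have u : eId V (𝟙_ A) ≫ app (Iso.refl (dayUnit V A)).hom (𝟙_ A) = dayUnitId V A :=
        Category.comp_id _
      exact (congrArg (fun x => x ▷ F.obj U ≫ _) u).trans (isLeftUnitor_dayLeftUnitor F U)
     ins_rightUnitor := fun F U => by
      simp only [dayCoends_ins]
      have u : eId V (𝟙_ A) ≫ app (Iso.refl (dayUnit V A)).hom (𝟙_ A) = dayUnitId V A :=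
        Category.comp_id _
      exact (congrArg (fun x => F.obj U ◁ x ≫ _) u).trans (isRightUnitor_dayRightUnitor F U) }⟩

end dayTensor

/-! ### Actions in two variables -/

section tensorCat

variable {V : Type u} [Category.{v} V] [MonoidalCategory V] [SymmetricCategory V]
  {C : Type w} [EnrichedCategory V C] {D : Type w'} [EnrichedCategory V D]

variable (V) in
/-- The effect on hom-objects of the `V`-functor `(-, Y)`. -/
def fstHom (Y : D) (X X' : C) :
    (X ⟶[V] X') ⟶ ((⟨X, Y⟩ : TensorCat C D) ⟶[V] (⟨X', Y⟩ : TensorCat C D)) :=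
  (ρ_ _).inv ≫ (X ⟶[V] X') ◁ eId V Y

variable (V) in
/-- The effect on hom-objects of the `V`-functor `(X, -)`. -/
def sndHom (X : C) (Y Y' : D) :
    (Y ⟶[V] Y') ⟶ ((⟨X, Y⟩ : TensorCat C D) ⟶[V] (⟨X, Y'⟩ : TensorCat C D)) :=
  (λ_ _).inv ≫ eId V X ▷ (Y ⟶[V] Y')

lemma eId_fstHom (Y : D) (X : C) : eId V X ≫ fstHom V Y X X = eId V (⟨X, Y⟩ : TensorCat C D) := by
  change _ = (λ_ (𝟙_ V)).inv ≫ (eId V X ⊗ₘ eId V Y)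
  rw [fstHom, rightUnitor_inv_naturality_assoc, MonoidalCategory.tensorHom_def, unitors_inv_equal]

lemma eId_sndHom (X : C) (Y : D) : eId V Y ≫ sndHom V X Y Y = eId V (⟨X, Y⟩ : TensorCat C D) := by
  change _ = (λ_ (𝟙_ V)).inv ≫ (eId V X ⊗ₘ eId V Y)
  rw [sndHom, leftUnitor_inv_naturality_assoc, MonoidalCategory.tensorHom_def']

lemma fstHom_sndHom (X X' : C) (Y Y' : D) :
    (fstHom V Y X X' ⊗ₘ sndHom V X' Y Y') ≫ eComp V (⟨X, Y⟩ : TensorCat C D) ⟨X', Y⟩ ⟨X', Y'⟩ =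
      𝟙 ((X ⟶[V] X') ⊗ (Y ⟶[V] Y')) := by
  change ((ρ_ _).inv ≫ (X ⟶[V] X') ◁ eId V Y ⊗ₘ (λ_ _).inv ≫ eId V X' ▷ (Y ⟶[V] Y')) ≫
    tensorμ _ _ _ _ ≫ (eComp V X X' X' ⊗ₘ eComp V Y Y Y') = _
  have l : ((ρ_ (X ⟶[V] X')).inv ⊗ₘ (λ_ (Y ⟶[V] Y')).inv) ≫ tensorμ _ _ _ _ =
      (ρ_ _).inv ⊗ₘ (λ_ _).inv := by
    simp only [tensorμ, braiding_tensorUnit_left]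
    monoidal
  rw [← tensorHom_comp_tensorHom, ← id_tensorHom, ← tensorHom_id, Category.assoc,
    tensorμ_natural_assoc, reassoc_of% l, tensorHom_comp_tensorHom, tensorHom_comp_tensorHom]
  simp

lemma sndHom_fstHom (X X' : C) (Y Y' : D) :
    (sndHom V X Y Y' ⊗ₘ fstHom V Y' X X') ≫ eComp V (⟨X, Y⟩ : TensorCat C D) ⟨X, Y'⟩ ⟨X', Y'⟩ =
      (β_ (Y ⟶[V] Y') (X ⟶[V] X')).hom := by
  change ((λ_ _).inv ≫ eId V X ▷ (Y ⟶[V] Y') ⊗ₘ (ρ_ _).inv ≫ (X ⟶[V] X') ◁ eId V Y') ≫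
    tensorμ _ _ _ _ ≫ (eComp V X X X' ⊗ₘ eComp V Y Y' Y') = _
  have l : ((λ_ (Y ⟶[V] Y')).inv ⊗ₘ (ρ_ (X ⟶[V] X')).inv) ≫ tensorμ _ _ _ _ =
      (β_ _ _).hom ≫ ((λ_ _).inv ⊗ₘ (ρ_ _).inv) := by
    simp only [tensorμ]
    monoidal
  rw [← tensorHom_comp_tensorHom, ← id_tensorHom, ← tensorHom_id, Category.assoc,
    tensorμ_natural_assoc, reassoc_of% l, tensorHom_comp_tensorHom, tensorHom_comp_tensorHom]
  simp

lemma eComp_fstHom (Y : D) (X X' X'' : C) :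
    eComp V X X' X'' ≫ fstHom V Y X X'' =
      (fstHom V Y X X' ⊗ₘ fstHom V Y X' X'') ≫ eComp V (⟨X, Y⟩ : TensorCat C D) ⟨X', Y⟩ ⟨X'', Y⟩ := by
  change _ = ((ρ_ _).inv ≫ (X ⟶[V] X') ◁ eId V Y ⊗ₘ (ρ_ _).inv ≫ (X' ⟶[V] X'') ◁ eId V Y) ≫
    tensorμ _ _ _ _ ≫ (eComp V X X' X'' ⊗ₘ eComp V Y Y Y)
  have l : ((ρ_ (X ⟶[V] X')).inv ⊗ₘ (ρ_ (X' ⟶[V] X'')).inv) ≫ tensorμ _ _ _ _ =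
      (ρ_ _).inv ≫ _ ◁ (λ_ _).inv := by
    rw [← cancel_epi ((ρ_ (X ⟶[V] X')).hom ⊗ₘ (ρ_ (X' ⟶[V] X'')).hom)]
    conv_rhs => rw [rightUnitor_monoidal]
    simp
  rw [← tensorHom_comp_tensorHom, ← id_tensorHom, ← id_tensorHom, Category.assoc,
    tensorμ_natural_assoc, reassoc_of% l, tensorHom_comp_tensorHom, eId_eId_eComp, fstHom,
    rightUnitor_inv_naturality_assoc, whiskerLeft_comp_tensorHom, Iso.inv_hom_id_assoc,
    ← MonoidalCategory.tensorHom_def, id_tensorHom_id, Category.id_comp]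

lemma eComp_sndHom (X : C) (Y Y' Y'' : D) :
    eComp V Y Y' Y'' ≫ sndHom V X Y Y'' =
      (sndHom V X Y Y' ⊗ₘ sndHom V X Y' Y'') ≫ eComp V (⟨X, Y⟩ : TensorCat C D) ⟨X, Y'⟩ ⟨X, Y''⟩ := by
  change _ = ((λ_ _).inv ≫ eId V X ▷ (Y ⟶[V] Y') ⊗ₘ (λ_ _).inv ≫ eId V X ▷ (Y' ⟶[V] Y'')) ≫
    tensorμ _ _ _ _ ≫ (eComp V X X X ⊗ₘ eComp V Y Y' Y'')
  have l : ((λ_ (Y ⟶[V] Y')).inv ⊗ₘ (λ_ (Y' ⟶[V] Y'')).inv) ≫ tensorμ _ _ _ _ =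
      (λ_ _).inv ≫ (λ_ _).inv ▷ _ := by
    rw [← cancel_epi ((λ_ (Y ⟶[V] Y')).hom ⊗ₘ (λ_ (Y' ⟶[V] Y'')).hom)]
    conv_rhs => rw [leftUnitor_monoidal]
    simp
  rw [← tensorHom_comp_tensorHom, ← tensorHom_id, ← tensorHom_id, Category.assoc,
    tensorμ_natural_assoc, reassoc_of% l, tensorHom_comp_tensorHom, eId_eId_eComp, sndHom,
    leftUnitor_inv_naturality_assoc, whiskerRight_comp_tensorHom, Iso.inv_hom_id_assoc,
    ← MonoidalCategory.tensorHom_def', id_tensorHom_id, Category.id_comp]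

variable {m n : TensorCat C D → V} {a : ∀ P Q : TensorCat C D, m P ⊗ (P ⟶[V] Q) ⟶ m Q}
  {b : ∀ P Q : TensorCat C D, n P ⊗ (P ⟶[V] Q) ⟶ n Q}

/-- The action of the first variable. -/
def actFst (a : ∀ P Q : TensorCat C D, m P ⊗ (P ⟶[V] Q) ⟶ m Q) (Y : D) (X X' : C) :
    m ⟨X, Y⟩ ⊗ (X ⟶[V] X') ⟶ m ⟨X', Y⟩ :=
  _ ◁ fstHom V Y X X' ≫ a ⟨X, Y⟩ ⟨X', Y⟩

/-- The action of the second variable. -/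
def actSnd (a : ∀ P Q : TensorCat C D, m P ⊗ (P ⟶[V] Q) ⟶ m Q) (X : C) (Y Y' : D) :
    m ⟨X, Y⟩ ⊗ (Y ⟶[V] Y') ⟶ m ⟨X, Y'⟩ :=
  _ ◁ sndHom V X Y Y' ≫ a ⟨X, Y⟩ ⟨X, Y'⟩

lemma IsAction.fst (h : IsAction a) (Y : D) : IsAction (m := fun X => m ⟨X, Y⟩) (actFst a Y) :=
  h.precomp (fun X => ⟨X, Y⟩) (fstHom V Y) (eId_fstHom Y) (eComp_fstHom Y)

lemma IsAction.snd (h : IsAction a) (X : C) : IsAction (m := fun Y => m ⟨X, Y⟩) (actSnd a X) :=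
  h.precomp (fun Y => ⟨X, Y⟩) (sndHom V X) (eId_sndHom X) (eComp_sndHom X)

/-- The hom-object of `C ⊗ D` factors through the first variable and then the second, by
`fstHom_sndHom`; hence the partial actions determine the whole action. -/
lemma IsAction.actFst_actSnd (h : IsAction a) (X X' : C) (Y Y' : D) :
    (α_ _ _ _).inv ≫ actFst a Y X X' ▷ (Y ⟶[V] Y') ≫ actSnd a X' Y Y' =
      a ⟨X, Y⟩ ⟨X', Y'⟩ := by
  have := congrArg (m ⟨X, Y⟩ ◁ · ≫ a _ _) (fstHom_sndHom (V := V) X X' Y Y')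
  rw [MonoidalCategory.whiskerLeft_comp_assoc, h.comp, MonoidalCategory.tensorHom_def] at this
  refine Eq.trans ?_ (this.trans (Eq.trans ?_ (Category.id_comp _)))
  · simp only [MonoidalCategory.whiskerLeft_comp, Category.assoc, comp_whiskerRight, actFst, actSnd]
    rw [associator_inv_naturality_right_assoc, whisker_exchange_assoc,
      associator_inv_naturality_middle_assoc]
  · exact congrArg (· ≫ _) (MonoidalCategory.whiskerLeft_id _ _)

lemma IsAction.actSnd_actFst (h : IsAction a) (X X' : C) (Y Y' : D) :
    (α_ _ _ _).inv ≫ actSnd a X Y Y' ▷ (X ⟶[V] X') ≫ actFst a Y' X X' =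
      _ ◁ (β_ _ _).hom ≫ a ⟨X, Y⟩ ⟨X', Y'⟩ := by
  have := congrArg (m ⟨X, Y⟩ ◁ · ≫ a _ _) (sndHom_fstHom (V := V) X X' Y Y')
  rw [MonoidalCategory.whiskerLeft_comp_assoc, h.comp, MonoidalCategory.tensorHom_def] at this
  refine Eq.trans ?_ this
  simp only [MonoidalCategory.whiskerLeft_comp, Category.assoc, comp_whiskerRight, actFst, actSnd]
  rw [associator_inv_naturality_right_assoc, whisker_exchange_assoc,
    associator_inv_naturality_middle_assoc]

lemma IsAction.sq_actFst (h : IsAction a) (X X' : C) (Y Y' : D) :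
    Sq (actRight (actFst a Y X X') (Y ⟶[V] Y')) (actFst a Y' X X') (actSnd a X Y Y')
      (actSnd a X' Y Y') := by
  have h₁ := h.actFst_actSnd X X' Y Y'
  have h₂ := h.actSnd_actFst X X' Y Y'
  rw [← h₁] at h₂
  unfold Sq actRight swapRight
  simp only [Category.assoc]
  rw [← h₂, Iso.hom_inv_id_assoc]

/-- Joint naturality restricts along `fstHom` and `sndHom`; conversely the two partial squares
compose by `Sq.seq`. -/
lemma isNat_tensorCat_iff (ha : IsAction a) (hb : IsAction b) {φ : ∀ P, m P ⟶ n P} :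
    IsNat a b φ ↔
      (∀ X X' Y, Sq (actFst a Y X X') (actFst b Y X X') (φ ⟨X, Y⟩) (φ ⟨X', Y⟩)) ∧
      (∀ X Y Y', Sq (actSnd a X Y Y') (actSnd b X Y Y') (φ ⟨X, Y⟩) (φ ⟨X, Y'⟩)) := by
  refine ⟨fun h => ⟨fun X X' Y => (h _ _).precomp _, fun X Y Y' => (h _ _).precomp _⟩, ?_⟩
  rintro ⟨h₁, h₂⟩ ⟨X, Y⟩ ⟨X', Y'⟩
  rw [← ha.actFst_actSnd, ← hb.actFst_actSnd]
  exact (h₁ X X' Y).seq (h₂ X' Y Y')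

lemma IsAction.ptensor {m : C → V} {a : ∀ X Y : C, m X ⊗ (X ⟶[V] Y) ⟶ m Y} {n : D → V}
    {b : ∀ X Y : D, n X ⊗ (X ⟶[V] Y) ⟶ n Y} (ha : IsAction a) (hb : IsAction b) :
    IsAction (C := TensorCat C D) (m := fun P => m P.fst ⊗ n P.snd)
      (fun P Q => EnrichedCayley.ptensor (a P.fst Q.fst) (b P.snd Q.snd)) where
  id P := by
    change _ ◁ ((λ_ (𝟙_ V)).inv ≫ (eId V P.fst ⊗ₘ eId V P.snd)) ≫ _ = _
    rw [MonoidalCategory.whiskerLeft_comp_assoc, ptensor_precomp, ha.id, hb.id]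
    have := ptensor_unit (𝟙 (m P.fst)) (𝟙 (n P.snd))
    simpa using this
  comp P Q R := by
    change _ ◁ (tensorμ _ _ _ _ ≫ (eComp V P.fst Q.fst R.fst ⊗ₘ eComp V P.snd Q.snd R.snd)) ≫ _ = _
    rw [MonoidalCategory.whiskerLeft_comp_assoc, ptensor_precomp, ha.comp, hb.comp]
    exact ptensor_seq _ _ _ _

end tensorCat

/-! ### Descending squares and relations along universal families -/

section universal

variable {V : Type u} [Category.{v} V] [MonoidalCategory V]

/-- Pulls back a relation satisfied in one coend along compatible squares, to show that a family
induced from it satisfies the relation of another coend. -/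
lemma Sq.coequalize {P Q Q' P' R R' T W : V} {l : P ⊗ T ⟶ Q} {m : P ⊗ T ⟶ Q'} {l' : P' ⊗ T ⟶ R}
    {m' : P' ⊗ T ⟶ R'} {f : P ⟶ P'} {g : Q ⟶ R} {g' : Q' ⟶ R'} (s : Sq l l' f g)
    (s' : Sq m m' f g') {k : R ⟶ W} {k' : R' ⟶ W} (h : l' ≫ k = m' ≫ k') :
    l ≫ g ≫ k = m ≫ g' ≫ k' := by
  unfold Sq at s s'
  rw [reassoc_of% s, reassoc_of% s', h]

/-- Naturality descends along a jointly epimorphic family because tensoring with the parameter keeps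
it jointly epimorphic. -/
lemma JointlyEpi.sq [MonoidalClosed V] [SymmetricCategory V] {ι : Type*} {P P' : ι → V}
    {Q Q' R R' T : V} {c : ∀ i, P i ⟶ Q} {c' : ∀ i, P' i ⟶ Q'} (h : JointlyEpi c)
    {b : ∀ i, P i ⊗ T ⟶ P' i} {a : Q ⊗ T ⟶ Q'} {k : R ⊗ T ⟶ R'} {φ : Q ⟶ R} {φ' : Q' ⟶ R'}
    (s : ∀ i, Sq (b i) a (c i) (c' i)) (s' : ∀ i, Sq (b i) k (c i ≫ φ) (c' i ≫ φ')) :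
    Sq a k φ φ' := by
  refine h.whiskerRight T _ _ fun i => ?_
  have e := s i
  have e' := s' i
  unfold Sq at e e'
  rw [← reassoc_of% e, e', comp_whiskerRight_assoc]

lemma JointlyEpi.coequalize [MonoidalClosed V] [SymmetricCategory V] {ι : Type*} {P P' P'' : ι → V}
    {Q Q' Q'' R T : V} {c : ∀ i, P i ⟶ Q} {c' : ∀ i, P' i ⟶ Q'} {c'' : ∀ i, P'' i ⟶ Q''}
    (h : JointlyEpi c)
    {l : ∀ i, P i ⊗ T ⟶ P' i} {l' : Q ⊗ T ⟶ Q'} {m : ∀ i, P i ⊗ T ⟶ P'' i} {m' : Q ⊗ T ⟶ Q''}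
    {k' : Q' ⟶ R} {k'' : Q'' ⟶ R} (s : ∀ i, Sq (l i) l' (c i) (c' i))
    (s' : ∀ i, Sq (m i) m' (c i) (c'' i)) (e : ∀ i, l i ≫ c' i ≫ k' = m i ≫ c'' i ≫ k'') :
    l' ≫ k' = m' ≫ k'' := by
  refine h.whiskerRight T _ _ fun i => ?_
  have e₁ := s i
  have e₂ := s' i
  unfold Sq at e₁ e₂
  rw [← reassoc_of% e₁, e, reassoc_of% e₂]

namespace IsUniversal

variable [MonoidalClosed V] {ι ρ : Type*} {P : ι → V} {R S : ρ → V}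
  {i j : ρ → ι} {l : ∀ r, R r ⊗ S r ⟶ P (i r)} {m : ∀ r, R r ⊗ S r ⟶ P (j r)} {Q : V}
  {c : ∀ x, P x ⟶ Q}

lemma exists_desc_actLeft (h : IsUniversal l m c) (T : V) {W : V} (k : ∀ x, T ⊗ P x ⟶ W)
    (hk : ∀ r, actLeft T (l r) ≫ k (i r) = actLeft T (m r) ≫ k (j r)) :
    ∃ d : T ⊗ Q ⟶ W, ∀ x, T ◁ c x ≫ d = k x :=
  h.exists_descLeft T k fun r => by
    have := hk r
    unfold actLeft at this
    simpa only [Category.assoc, cancel_epi] using this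

lemma exists_desc_actRight [SymmetricCategory V] (h : IsUniversal l m c) (T : V) {W : V} (k : ∀ x, P x ⊗ T ⟶ W)
    (hk : ∀ r, actRight (l r) T ≫ k (i r) = actRight (m r) T ≫ k (j r)) :
    ∃ d : Q ⊗ T ⟶ W, ∀ x, c x ▷ T ≫ d = k x :=
  h.exists_descRight T k fun r => by
    have := congrArg (swapRight _ _ _ ≫ ·) (hk r)
    unfold actRight at this
    simpa only [Category.assoc, reassoc_of% @swapRight_swapRight] using this

end IsUniversal

end universal

namespace VFunctor

variable {V : Type u} [Category.{v} V] [MonoidalCategory V] [MonoidalClosed V] {C : Type w}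
  [EnrichedCategory V C]

/-- A `V`-natural transformation with invertible components is invertible. -/
def isoOfComponents {F G : VFunctor V C} (f : F ⟶ G) (g : ∀ X, G.obj X ⟶ F.obj X)
    (h : ∀ X, app f X ≫ g X = 𝟙 _) (h' : ∀ X, g X ≫ app f X = 𝟙 _) : F ≅ G where
  hom := f
  inv := VNat.mk g fun X Y => Sq.of_iso (f := ⟨app f X, g X, h X, h' X⟩)
    (h := ⟨app f Y, g Y, h Y, h' Y⟩) (app_naturality f X Y)
  hom_inv_id := VFunctor.hom_ext h
  inv_hom_id := VFunctor.hom_ext h'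

end VFunctor

/-! ### Composites of endomodules through their universal dinatural family -/

section endomodule

variable {V : Type u} [Category.{v} V] [MonoidalCategory V] [MonoidalClosed V]
  [SymmetricCategory V] {A : Type v} [Category.{w} A] [EnrichedOrdinaryCategory V A]

open VFunctor

namespace Endomodule

variable (T : Endomodule V A)

lemma actL_id (X Y : A) : T.at X Y ◁ eId V X ≫ T.actL X X Y = (ρ_ _).hom :=
  (T.isAction.fst Y).id (op X)

lemma actL_comp (X'' X' X Y : A) :
    T.at X Y ◁ ((β_ _ _).hom ≫ eComp V X'' X' X) ≫ T.actL X'' X Y =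
      (α_ _ _ _).inv ≫ T.actL X' X Y ▷ _ ≫ T.actL X'' X' Y :=
  (T.isAction.fst Y).comp (op X) (op X') (op X'')

lemma actR_id (X Y : A) : T.at X Y ◁ eId V Y ≫ T.actR X Y Y = (ρ_ _).hom :=
  (T.isAction.snd (op X)).id Y

lemma actR_comp (X Y Y' Y'' : A) :
    T.at X Y ◁ eComp V Y Y' Y'' ≫ T.actR X Y Y'' =
      (α_ _ _ _).inv ≫ T.actR X Y Y' ▷ _ ≫ T.actR X Y' Y'' :=
  (T.isAction.snd (op X)).comp Y Y' Y''

lemma actL_actR (X' X Y Y' : A) :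
    (α_ _ _ _).inv ≫ T.actL X' X Y ▷ (Y ⟶[V] Y') ≫ T.actR X' Y Y' =
      T.act ⟨op X, Y⟩ ⟨op X', Y'⟩ :=
  T.isAction.actFst_actSnd (op X) (op X') Y Y'

lemma sq_actL (X' X Y Y' : A) :
    Sq (actRight (T.actL X' X Y) (Y ⟶[V] Y')) (T.actL X' X Y') (T.actR X Y Y') (T.actR X' Y Y') :=
  T.isAction.sq_actFst (op X) (op X') Y Y'

variable {T} {K : Endomodule V A}

/-- A morphism of endomodules from a family of morphisms natural in both variables. -/
def homMk (τ : ∀ X Y, T.at X Y ⟶ K.at X Y)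
    (hL : ∀ X' X Y, Sq (T.actL X' X Y) (K.actL X' X Y) (τ X Y) (τ X' Y))
    (hR : ∀ X Y Y', Sq (T.actR X Y Y') (K.actR X Y Y') (τ X Y) (τ X Y')) : T ⟶ K :=
  ((isNat_tensorCat_iff T.isAction K.isAction (φ := fun P => τ P.fst.unop P.snd)).2
    ⟨fun X X' Y => hL X'.unop X.unop Y, fun X Y Y' => hR X.unop Y Y'⟩).hom

lemma hom_ext {f g : T ⟶ K} (h : ∀ X Y, app f ⟨op X, Y⟩ = app g ⟨op X, Y⟩) : f = g :=
  VFunctor.hom_ext fun P => h P.fst.unop P.snd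

lemma sq_app_actL (f : T ⟶ K) (X' X Y : A) :
    Sq (T.actL X' X Y) (K.actL X' X Y) (app f ⟨op X, Y⟩) (app f ⟨op X', Y⟩) :=
  ((isNat_tensorCat_iff T.isAction K.isAction).1 (isNat_app f)).1 (op X) (op X') Y

lemma sq_app_actR (f : T ⟶ K) (X Y Y' : A) :
    Sq (T.actR X Y Y') (K.actR X Y Y') (app f ⟨op X, Y⟩) (app f ⟨op X, Y'⟩) :=
  ((isNat_tensorCat_iff T.isAction K.isAction).1 (isNat_app f)).2 (op X) Y Y'

end Endomodule

open Endomodule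

/-- `P` is the composite of the endomodules `S` and `T`, with universal family `copr`. -/
structure EndoTensor (S T P : Endomodule V A) where
  copr (X Z Y : A) : S.at X Z ⊗ T.at Z Y ⟶ P.at X Y
  nat_left (X' X Z Y : A) : Sq (actRight (S.actL X' X Z) (T.at Z Y)) (P.actL X' X Y)
    (copr X Z Y) (copr X' Z Y)
  nat_right (X Z Y Y' : A) : Sq (actLeft (S.at X Z) (T.actR Z Y Y')) (P.actR X Y Y')
    (copr X Z Y) (copr X Z Y')
  isUniversal (X Y : A) : IsUniversal (i := Prod.snd) (j := Prod.fst)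
    (fun r : A × A => actRight (S.actR X r.1 r.2) (T.at r.2 Y))
    (fun r => actLeft (S.at X r.1) (T.actL r.1 r.2 Y)) (fun Z => copr X Z Y)

namespace EndoTensor

variable {R S T P Q P' Q' K : Endomodule V A}

section

variable (D : EndoTensor S T P)
include D

lemma dinat (X Z Z' Y : A) : actRight (S.actR X Z Z') (T.at Z' Y) ≫ D.copr X Z' Y =
    actLeft (S.at X Z) (T.actL Z Z' Y) ≫ D.copr X Z Y :=
  (D.isUniversal X Y).condition (Z, Z')

lemma jointlyEpi (X Y : A) : JointlyEpi fun Z => D.copr X Z Y := (D.isUniversal X Y).jointlyEpi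

lemma hom_ext {f g : P ⟶ K} (h : ∀ X Z Y, D.copr X Z Y ≫ app f ⟨op X, Y⟩ =
    D.copr X Z Y ≫ app g ⟨op X, Y⟩) : f = g :=
  Endomodule.hom_ext fun X Y => D.jointlyEpi X Y _ _ fun Z => h X Z Y

/-- The universal property of the composite of endomodules, in families. -/
lemma exists_hom (t : ∀ X Z Y, S.at X Z ⊗ T.at Z Y ⟶ K.at X Y)
    (hd : ∀ X Z Z' Y, actRight (S.actR X Z Z') (T.at Z' Y) ≫ t X Z' Y =
      actLeft (S.at X Z) (T.actL Z Z' Y) ≫ t X Z Y)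
    (hL : ∀ X' X Z Y, Sq (actRight (S.actL X' X Z) (T.at Z Y)) (K.actL X' X Y)
      (t X Z Y) (t X' Z Y))
    (hR : ∀ X Z Y Y', Sq (actLeft (S.at X Z) (T.actR Z Y Y')) (K.actR X Y Y')
      (t X Z Y) (t X Z Y')) :
    ∃ f : P ⟶ K, ∀ X Z Y, D.copr X Z Y ≫ app f ⟨op X, Y⟩ = t X Z Y := by
  choose τ hτ _ using fun X Y => (D.isUniversal X Y).existsUnique_desc (fun Z => t X Z Y)
    fun r => hd X r.1 r.2 Y
  dsimp only at hτ
  exact ⟨homMk τ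
    (fun X' X Y => (D.jointlyEpi X Y).sq (fun Z => D.nat_left X' X Z Y) fun Z => by
      rw [hτ, hτ]; exact hL X' X Z Y)
    (fun X Y Y' => (D.jointlyEpi X Y).sq (fun Z => D.nat_right X Z Y Y') fun Z => by
      rw [hτ, hτ]; exact hR X Z Y Y'), fun X Z Y => hτ X Y Z⟩

end

lemma hom_ext_right (D₁ : EndoTensor R S P) (D₂ : EndoTensor P T Q) {f g : Q ⟶ K}
    (h : ∀ X Z W Y, D₁.copr X Z W ▷ T.at W Y ≫ D₂.copr X W Y ≫ app f ⟨op X, Y⟩ =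
      D₁.copr X Z W ▷ T.at W Y ≫ D₂.copr X W Y ≫ app g ⟨op X, Y⟩) : f = g :=
  D₂.hom_ext fun X W Y => (D₁.jointlyEpi X W).whiskerRight _ _ _ fun Z => h X Z W Y

lemma hom_ext_left (D₁ : EndoTensor S T P) (D₂ : EndoTensor R P Q) {f g : Q ⟶ K}
    (h : ∀ X Z W Y, R.at X Z ◁ D₁.copr Z W Y ≫ D₂.copr X Z Y ≫ app f ⟨op X, Y⟩ =
      R.at X Z ◁ D₁.copr Z W Y ≫ D₂.copr X Z Y ≫ app g ⟨op X, Y⟩) : f = g :=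
  D₂.hom_ext fun X Z Y => (D₁.jointlyEpi Z Y).whiskerLeft _ _ _ fun W => h X Z W Y

/-- First descend in `Z`, using that `- ⊗ T(W, Y)` preserves the inner coend, then in `W`. The
conditions for the second descent are tested on the inner coprojections. -/
lemma exists_hom_right (D₁ : EndoTensor R S P) (D₂ : EndoTensor P T Q)
    (t : ∀ X Z W Y, (R.at X Z ⊗ S.at Z W) ⊗ T.at W Y ⟶ K.at X Y)
    (h₁ : ∀ X Z Z' W Y, actRight (actRight (R.actR X Z Z') (S.at Z' W)) (T.at W Y) ≫ t X Z' W Y =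
      actRight (actLeft (R.at X Z) (S.actL Z Z' W)) (T.at W Y) ≫ t X Z W Y)
    (h₂ : ∀ X Z W W' Y, actRight (actLeft (R.at X Z) (S.actR Z W W')) (T.at W' Y) ≫ t X Z W' Y =
      actLeft (R.at X Z ⊗ S.at Z W) (T.actL W W' Y) ≫ t X Z W Y)
    (hL : ∀ X' X Z W Y, Sq (actRight (actRight (R.actL X' X Z) (S.at Z W)) (T.at W Y))
      (K.actL X' X Y) (t X Z W Y) (t X' Z W Y))
    (hR : ∀ X Z W Y Y', Sq (actLeft (R.at X Z ⊗ S.at Z W) (T.actR W Y Y'))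
      (K.actR X Y Y') (t X Z W Y) (t X Z W Y')) :
    ∃ f : Q ⟶ K, ∀ X Z W Y, D₁.copr X Z W ▷ T.at W Y ≫ D₂.copr X W Y ≫ app f ⟨op X, Y⟩ =
      t X Z W Y := by
  choose τ hτ using fun X W Y => (D₁.isUniversal X W).exists_desc_actRight (T.at W Y)
    (fun Z => t X Z W Y) fun r => h₁ X r.1 r.2 W Y
  obtain ⟨f, hf⟩ := D₂.exists_hom (K := K) τ
    (fun X W W' Y => (D₁.jointlyEpi X W).whiskerRight (T.at W' Y) |>.coequalize
      (fun Z => (D₁.nat_right X Z W W').whiskerRight (T.at W' Y))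
      (fun Z => Sq.actLeft_whiskerRight _ _) fun Z => by rw [hτ, hτ]; exact h₂ X Z W W' Y)
    (fun X' X W Y => ((D₁.jointlyEpi X W).whiskerRight (T.at W Y)).sq
      (fun Z => (D₁.nat_left X' X Z W).whiskerRight (T.at W Y))
      fun Z => by rw [hτ, hτ]; exact hL X' X Z W Y)
    (fun X W Y Y' => ((D₁.jointlyEpi X W).whiskerRight (T.at W Y)).sq
      (fun Z => Sq.actLeft_whiskerRight (D₁.copr X Z W) _)
      fun Z => by rw [hτ, hτ]; exact hR X Z W Y Y')
  exact ⟨f, fun X Z W Y => by rw [hf, hτ]⟩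

lemma exists_hom_left (D₁ : EndoTensor S T P) (D₂ : EndoTensor R P Q)
    (t : ∀ X Z W Y, R.at X Z ⊗ (S.at Z W ⊗ T.at W Y) ⟶ K.at X Y)
    (h₁ : ∀ X Z Z' W Y, actRight (R.actR X Z Z') (S.at Z' W ⊗ T.at W Y) ≫ t X Z' W Y =
      actLeft (R.at X Z) (actRight (S.actL Z Z' W) (T.at W Y)) ≫ t X Z W Y)
    (h₂ : ∀ X Z W W' Y, actLeft (R.at X Z) (actRight (S.actR Z W W') (T.at W' Y)) ≫ t X Z W' Y =
      actLeft (R.at X Z) (actLeft (S.at Z W) (T.actL W W' Y)) ≫ t X Z W Y)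
    (hL : ∀ X' X Z W Y, Sq (actRight (R.actL X' X Z) (S.at Z W ⊗ T.at W Y))
      (K.actL X' X Y) (t X Z W Y) (t X' Z W Y))
    (hR : ∀ X Z W Y Y', Sq (actLeft (R.at X Z) (actLeft (S.at Z W) (T.actR W Y Y')))
      (K.actR X Y Y') (t X Z W Y) (t X Z W Y')) :
    ∃ f : Q ⟶ K, ∀ X Z W Y, R.at X Z ◁ D₁.copr Z W Y ≫ D₂.copr X Z Y ≫ app f ⟨op X, Y⟩ =
      t X Z W Y := by
  choose τ hτ using fun X Z Y => (D₁.isUniversal Z Y).exists_desc_actLeft (R.at X Z)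
    (fun W => t X Z W Y) fun r => h₂ X Z r.1 r.2 Y
  obtain ⟨f, hf⟩ := D₂.exists_hom (K := K) τ
    (fun X Z Z' Y => (D₁.jointlyEpi Z' Y).whiskerLeft (R.at X Z) |>.coequalize
      (fun W => Sq.actRight_whiskerLeft _ _)
      (fun W => (D₁.nat_left Z Z' W Y).whiskerLeft (R.at X Z))
      fun W => by rw [hτ, hτ]; exact h₁ X Z Z' W Y)
    (fun X' X Z Y => ((D₁.jointlyEpi Z Y).whiskerLeft (R.at X Z)).sq
      (fun W => Sq.actRight_whiskerLeft (D₁.copr Z W Y) _)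
      fun W => by rw [hτ, hτ]; exact hL X' X Z W Y)
    (fun X Z Y Y' => ((D₁.jointlyEpi Z Y).whiskerLeft (R.at X Z)).sq
      (fun W => (D₁.nat_right Z W Y Y').whiskerLeft (R.at X Z))
      fun W => by rw [hτ, hτ]; exact hR X Z W Y Y')
  exact ⟨f, fun X Z W Y => by rw [hf, hτ]⟩

/-- Unlike for Day convolution, no transport in `A` is needed: the two iterated universal families
correspond under the associator of `V` alone. -/
lemma exists_associator (D₁ : EndoTensor R S P) (D₂ : EndoTensor P T Q) (D₃ : EndoTensor S T P')
    (D₄ : EndoTensor R P' Q') :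
    ∃ e : Q ≅ Q', ∀ X Z W Y, D₁.copr X Z W ▷ T.at W Y ≫ D₂.copr X W Y ≫ app e.hom ⟨op X, Y⟩ =
      (α_ _ _ _).hom ≫ R.at X Z ◁ D₃.copr Z W Y ≫ D₄.copr X Z Y := by
  obtain ⟨f, hf⟩ := D₁.exists_hom_right D₂ (K := Q')
    (fun X Z W Y => (α_ _ _ _).hom ≫ R.at X Z ◁ D₃.copr Z W Y ≫ D₄.copr X Z Y)
    (fun X Z Z' W Y => Sq.coequalize (Sq.actRight_actRight _ _ _) (Sq.actLeft_actRight _ _ _)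
      (Sq.coequalize (Sq.actRight_whiskerLeft _ _) ((D₃.nat_left _ _ _ _).whiskerLeft _)
        (D₄.dinat _ _ _ _)))
    (fun X Z W W' Y => Sq.coequalize (Sq.actLeft_actRight _ _ _) (Sq.actLeft_actLeft _ _ _) (by
      have := congrArg (actLeft (R.at X Z) · ≫ D₄.copr X Z Y) (D₃.dinat Z W W' Y)
      simpa [actLeft] using this))
    (fun X' X Z W Y => (Sq.actRight_actRight _ _ _).comp
      ((Sq.actRight_whiskerLeft _ _).comp (D₄.nat_left _ _ _ _)))
    (fun X Z W Y Y' => (Sq.actLeft_actLeft _ _ _).comp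
      (((D₃.nat_right _ _ _ _).whiskerLeft _).comp (D₄.nat_right _ _ _ _)))
  obtain ⟨g, hg⟩ := D₃.exists_hom_left D₄ (K := Q)
    (fun X Z W Y => (α_ _ _ _).inv ≫ D₁.copr X Z W ▷ T.at W Y ≫ D₂.copr X W Y)
    (fun X Z Z' W Y => Sq.coequalize (Sq.actRight_actRight _ _ _).of_iso
      (Sq.actLeft_actRight _ _ _).of_iso (by
      have := congrArg (actRight · (T.at W Y) ≫ D₂.copr X W Y) (D₁.dinat X Z Z' W)
      simpa [actRight] using this))
    (fun X Z W W' Y => Sq.coequalize (Sq.actLeft_actRight _ _ _).of_iso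
      (Sq.actLeft_actLeft _ _ _).of_iso (Sq.coequalize ((D₁.nat_right _ _ _ _).whiskerRight _)
        (Sq.actLeft_whiskerRight _ _) (D₂.dinat _ _ _ _)))
    (fun X' X Z W Y => (Sq.actRight_actRight _ _ _).of_iso.comp
      (((D₁.nat_left _ _ _ _).whiskerRight _).comp (D₂.nat_left _ _ _ _)))
    (fun X Z W Y Y' => (Sq.actLeft_actLeft _ _ _).of_iso.comp
      ((Sq.actLeft_whiskerRight _ _).comp (D₂.nat_right _ _ _ _)))
  refine ⟨⟨f, g, ?_, ?_⟩, hf⟩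
  · refine D₁.hom_ext_right D₂ fun X Z W Y => ?_
    rw [comp_app, reassoc_of% hf, hg]
    simp
  · refine D₃.hom_ext_left D₄ fun X Z W Y => ?_
    rw [comp_app, reassoc_of% hg, hf]
    simp

end EndoTensor

end endomodule

section cowedge

variable {V : Type u} [Category.{v} V] [MonoidalCategory V] [SymmetricCategory V]

/-- The parameter may stand between the two factors or to the right of both; a permutation of the
source, invertible by symmetry, relates the two forms of the cowedge condition. -/
lemma whisker_cowedge_iff {P T Q B Q' W : V} (a : P ⊗ T ⟶ Q) (b : B ⊗ T ⟶ Q') (t : Q ⊗ B ⟶ W)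
    (t' : P ⊗ Q' ⟶ W) :
    a ▷ B ≫ t = (α_ _ _ _).hom ≫ P ◁ ((β_ _ _).hom ≫ b) ≫ t' ↔
      actRight a B ≫ t = actLeft P b ≫ t' := by
  have e : actLeft P b = swapRight _ _ _ ≫ (α_ _ _ _).hom ≫ P ◁ ((β_ _ _).hom ≫ b) := by
    simp [actLeft, swapRight, ← MonoidalCategory.whiskerLeft_comp_assoc]
  rw [e]
  unfold actRight
  constructor
  · intro h
    simp only [Category.assoc, h]
  · intro h
    have := congrArg (swapRight _ _ _ ≫ ·) h
    simpa only [Category.assoc, reassoc_of% @swapRight_swapRight] using this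

end cowedge

/-! ### Unit isomorphisms and coherence for composition of endomodules -/

section endomodule

variable {V : Type u} [Category.{v} V] [MonoidalCategory V] [MonoidalClosed V]
  [SymmetricCategory V] {A : Type v} [Category.{w} A] [EnrichedOrdinaryCategory V A]

open VFunctor Endomodule

lemma homEndomodule_act (P Q : TensorCat Aᵒᵖ A) :
    (homEndomodule V A).act P Q = (α_ _ _ _).inv ≫ ((β_ _ _).hom ≫
      eComp V Q.fst.unop P.fst.unop P.snd) ▷ _ ≫ eComp V Q.fst.unop P.snd Q.snd :=
  ofAct_act _ _ _ _ _ _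

omit [MonoidalClosed V] [SymmetricCategory V] in
lemma whiskerLeft_eId_eComp (X Y : A) : (X ⟶[V] Y) ◁ eId V Y ≫ eComp V X Y Y = (ρ_ _).hom := by
  rw [← Iso.inv_comp_eq_id, e_comp_id]

omit [MonoidalClosed V] [SymmetricCategory V] in
lemma eId_whiskerRight_eComp (X Y : A) : eId V X ▷ (X ⟶[V] Y) ≫ eComp V X X Y = (λ_ _).hom := by
  rw [← Iso.inv_comp_eq_id, e_id_comp]

lemma homEndomodule_actL (X' X Y : A) :
    (homEndomodule V A).actL X' X Y = (β_ _ _).hom ≫ eComp V X' X Y := by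
  unfold actL
  rw [homEndomodule_act]
  change (X ⟶[V] Y) ◁ ((ρ_ _).inv ≫ (X' ⟶[V] X) ◁ eId V Y) ≫ (α_ _ _ _).inv ≫
    ((β_ _ _).hom ≫ eComp V X' X Y) ▷ (Y ⟶[V] Y) ≫ eComp V X' Y Y = _
  rw [MonoidalCategory.whiskerLeft_comp_assoc, associator_inv_naturality_right_assoc,
    whisker_exchange_assoc, whiskerLeft_eId_eComp]
  simp

lemma homEndomodule_actR (X Y Y' : A) :
    (homEndomodule V A).actR X Y Y' = eComp V X Y Y' := by
  unfold actR
  rw [homEndomodule_act]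
  change (X ⟶[V] Y) ◁ ((λ_ _).inv ≫ eId V X ▷ (Y ⟶[V] Y')) ≫ (α_ _ _ _).inv ≫
    ((β_ _ _).hom ≫ eComp V X X Y) ▷ (Y ⟶[V] Y') ≫ eComp V X Y Y' = _
  rw [MonoidalCategory.whiskerLeft_comp_assoc, associator_inv_naturality_middle_assoc,
    ← comp_whiskerRight_assoc, BraidedCategory.braiding_naturality_right_assoc,
    eId_whiskerRight_eComp]
  simp [braiding_tensorUnit_right]

lemma Endomodule.sq_actR (T : Endomodule V A) (X Z Y Y' : A) :
    Sq (actRight (T.actR Z Y Y') (X ⟶[V] Z)) (T.actR X Y Y') (T.actL X Z Y) (T.actL X Z Y') := by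
  have h := congrArg (swapRight _ _ _ ≫ ·) (T.sq_actL X Z Y Y')
  unfold actRight at h
  simp only [Category.assoc, reassoc_of% @swapRight_swapRight] at h
  unfold Sq actRight
  rw [Category.assoc, h]

/-- Functoriality of the contravariant action, with the factors permuted. It makes that action a
cowedge on `A(X, Z) ⊗ T(Z, Y)`. -/
lemma Endomodule.dinat_actL (T : Endomodule V A) (X Z Z' Y : A) :
    actRight (eComp V X Z Z') (T.at Z' Y) ≫ (β_ _ _).hom ≫ T.actL X Z' Y =
      actLeft (X ⟶[V] Z) (T.actL Z Z' Y) ≫ (β_ _ _).hom ≫ T.actL X Z Y := by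
  have h₁ := Sq.braiding (eComp V X Z Z') (T.at Z' Y)
  have h₂ := Sq.braiding' (T.actL Z Z' Y) (X ⟶[V] Z)
  have e := congrArg (T.at Z' Y ◁ (β_ _ _).hom ≫ ·) (T.actL_comp X Z Z' Y)
  simp only [← MonoidalCategory.whiskerLeft_comp_assoc, SymmetricCategory.symmetry_assoc] at e
  unfold Sq at h₁ h₂
  rw [reassoc_of% h₁, reassoc_of% h₂]
  unfold actLeft actRight swapRight
  simp only [Category.assoc]
  rw [e]

lemma Endomodule.dinat_actR (S : Endomodule V A) (X Z Z' Y : A) :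
    actRight (S.actR X Z Z') (Z' ⟶[V] Y) ≫ S.actR X Z' Y =
      actLeft (S.at X Z) ((β_ _ _).hom ≫ eComp V Z Z' Y) ≫ S.actR X Z Y := by
  unfold actLeft actRight swapRight
  simp only [Category.assoc, MonoidalCategory.whiskerLeft_comp]
  rw [S.actR_comp X Z Z' Y]

/-- Co-Yoneda: applied to the identity of `X`, `h` in `A(X, Z)` and `t` in `T(Z, Y)`, the cowedge
relation identifies the coprojection of `h ⊗ t` at `Z` with that of the identity tensored with the
action of `h` on `t`, at `X`. -/
lemma Endomodule.actL_leftUnitor_inv (T : Endomodule V A) (X Y : A) {Q : V}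
    (c : ∀ Z, (X ⟶[V] Z) ⊗ T.at Z Y ⟶ Q)
    (hc : ∀ Z, actRight (eComp V X X Z) (T.at Z Y) ≫ c Z =
      actLeft (X ⟶[V] X) (T.actL X Z Y) ≫ c X) (Z : A) :
    ((β_ _ _).hom ≫ T.actL X Z Y) ≫ (λ_ (T.at X Y)).inv ≫ eId V X ▷ _ ≫ c X = c Z := by
  have e := (whisker_cowedge_iff (eComp V X X Z) (T.actL X Z Y) (c Z) (c X)).2 (hc Z)
  have e' : (λ_ (X ⟶[V] Z)).inv ▷ T.at Z Y ≫ eId V X ▷ (X ⟶[V] Z) ▷ T.at Z Y ≫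
      eComp V X X Z ▷ T.at Z Y = 𝟙 _ := by
    rw [← comp_whiskerRight, eId_whiskerRight_eComp]
    simp
  rw [← Category.id_comp (c Z), ← e']
  simp only [Category.assoc]
  rw [e, associator_naturality_left_assoc, ← whisker_exchange_assoc]
  simp

lemma Endomodule.leftUnitor_inv_actL (T : Endomodule V A) (X Y : A) {Q : V}
    (c : (X ⟶[V] X) ⊗ T.at X Y ⟶ Q) (g : Q ⟶ T.at X Y) (h : c ≫ g = (β_ _ _).hom ≫ T.actL X X Y) :
    ((λ_ (T.at X Y)).inv ≫ eId V X ▷ _ ≫ c) ≫ g = 𝟙 _ := by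
  rw [Category.assoc, Category.assoc, h, BraidedCategory.braiding_naturality_left_assoc,
    T.actL_id X Y]
  simp [braiding_tensorUnit_left]

lemma Endomodule.actR_rightUnitor_inv (S : Endomodule V A) (X Y : A) {Q : V}
    (c : ∀ Z, S.at X Z ⊗ (Z ⟶[V] Y) ⟶ Q)
    (hc : ∀ Z, actRight (S.actR X Z Y) (Y ⟶[V] Y) ≫ c Y =
      actLeft (S.at X Z) ((β_ _ _).hom ≫ eComp V Z Y Y) ≫ c Z) (Z : A) :
    S.actR X Z Y ≫ (ρ_ (S.at X Y)).inv ≫ _ ◁ eId V Y ≫ c Y = c Z := by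
  have e := (whisker_cowedge_iff (S.actR X Z Y) ((β_ _ _).hom ≫ eComp V Z Y Y) (c Y) (c Z)).2 (hc Z)
  rw [rightUnitor_inv_naturality_assoc, ← whisker_exchange_assoc, e,
    associator_naturality_right_assoc, ← MonoidalCategory.whiskerLeft_comp_assoc,
    SymmetricCategory.symmetry_assoc, whiskerLeft_eId_eComp]
  simp

lemma Endomodule.rightUnitor_inv_actR (S : Endomodule V A) (X Y : A) {Q : V}
    (c : S.at X Y ⊗ (Y ⟶[V] Y) ⟶ Q) (g : Q ⟶ S.at X Y) (h : c ≫ g = S.actR X Y Y) :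
    ((ρ_ (S.at X Y)).inv ≫ _ ◁ eId V Y ≫ c) ≫ g = 𝟙 _ := by
  rw [Category.assoc, Category.assoc, h, S.actR_id X Y, Iso.inv_hom_id]

namespace EndoTensor

variable {R S T P Q P' Q' K L S' T' R' : Endomodule V A}

lemma exists_leftUnitor (D : EndoTensor (homEndomodule V A) T P) :
    ∃ e : P ≅ T, ∀ X Z Y, D.copr X Z Y ≫ app e.hom ⟨op X, Y⟩ =
      (β_ (X ⟶[V] Z) (T.at Z Y)).hom ≫ T.actL X Z Y := by
  obtain ⟨f, hf⟩ := D.exists_hom (K := T) (fun X Z Y => (β_ _ _).hom ≫ T.actL X Z Y)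
    (fun X Z Z' Y => by
      rw [homEndomodule_actR]
      exact T.dinat_actL X Z Z' Y)
    (fun X' X Z Y => by
      rw [homEndomodule_actL]
      exact (Sq.braiding _ _).comp ((T.isAction.fst Y).sq_yoneda (op Z) (op X) (op X')))
    (fun X Z Y Y' => (Sq.braiding' _ _).comp (T.sq_actR X Z Y Y'))
  exact ⟨isoOfComponents f (fun P => (λ_ (T.at P.fst.unop P.snd)).inv ≫
      eId V P.fst.unop ▷ T.at P.fst.unop P.snd ≫ D.copr P.fst.unop P.fst.unop P.snd)
    (fun P => D.jointlyEpi P.fst.unop P.snd _ _ fun Z => (Category.assoc _ _ _).symm.trans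
      ((congrArg (· ≫ _) (hf P.fst.unop Z P.snd)).trans
        ((T.actL_leftUnitor_inv P.fst.unop P.snd _ (fun Z => by
          have e := D.dinat P.fst.unop P.fst.unop Z P.snd
          rwa [homEndomodule_actR] at e) Z).trans (Category.comp_id _).symm)))
    (fun P => T.leftUnitor_inv_actL P.fst.unop P.snd _ _
      (hf P.fst.unop P.fst.unop P.snd)), hf⟩

lemma exists_rightUnitor (D : EndoTensor S (homEndomodule V A) P) :
    ∃ e : P ≅ S, ∀ X Z Y, D.copr X Z Y ≫ app e.hom ⟨op X, Y⟩ = S.actR X Z Y := by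
  obtain ⟨f, hf⟩ := D.exists_hom (K := S) (fun X Z Y => S.actR X Z Y)
    (fun X Z Z' Y => by
      rw [homEndomodule_actL]
      exact S.dinat_actR X Z Z' Y)
    (fun X' X Z Y => S.sq_actL X' X Z Y)
    (fun X Z Y Y' => by
      rw [homEndomodule_actR]
      exact (S.isAction.snd (op X)).sq_yoneda Z Y Y')
  exact ⟨isoOfComponents f (fun P => (ρ_ (S.at P.fst.unop P.snd)).inv ≫
      S.at P.fst.unop P.snd ◁ eId V P.snd ≫ D.copr P.fst.unop P.snd P.snd)
    (fun P => D.jointlyEpi P.fst.unop P.snd _ _ fun Z => (Category.assoc _ _ _).symm.trans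
      ((congrArg (· ≫ _) (hf P.fst.unop Z P.snd)).trans
        ((S.actR_rightUnitor_inv P.fst.unop P.snd (fun Z => D.copr P.fst.unop Z P.snd) (fun Z => by
          have e := D.dinat P.fst.unop Z P.snd P.snd
          rwa [homEndomodule_actL] at e) Z).trans (Category.comp_id _).symm)))
    (fun P => S.rightUnitor_inv_actR P.fst.unop P.snd _ _
      (hf P.fst.unop P.snd P.snd)), hf⟩

/-- `k` is the composite of the morphisms `f` and `g` of endomodules. -/
def IsTensorHom (D : EndoTensor S T P) (D' : EndoTensor S' T' P') (f : S ⟶ S') (g : T ⟶ T')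
    (k : P ⟶ P') : Prop :=
  ∀ X Z Y, D.copr X Z Y ≫ app k ⟨op X, Y⟩ =
    (app f ⟨op X, Z⟩ ⊗ₘ app g ⟨op Z, Y⟩) ≫ D'.copr X Z Y

/-- `k` is the associativity isomorphism of the composition of endomodules. -/
def IsAssociator (D₁ : EndoTensor R S P) (D₂ : EndoTensor P T Q) (D₃ : EndoTensor S T P')
    (D₄ : EndoTensor R P' Q') (k : Q ⟶ Q') : Prop :=
  ∀ X Z W Y, D₁.copr X Z W ▷ T.at W Y ≫ D₂.copr X W Y ≫ app k ⟨op X, Y⟩ =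
    (α_ _ _ _).hom ≫ R.at X Z ◁ D₃.copr Z W Y ≫ D₄.copr X Z Y

/-- `k` is the left unit isomorphism of the composition of endomodules. -/
def IsLeftUnitor (D : EndoTensor (homEndomodule V A) T P) (k : P ⟶ T) : Prop :=
  ∀ X Z Y, D.copr X Z Y ≫ app k ⟨op X, Y⟩ = (β_ (X ⟶[V] Z) (T.at Z Y)).hom ≫ T.actL X Z Y

/-- `k` is the right unit isomorphism of the composition of endomodules. -/
def IsRightUnitor (D : EndoTensor S (homEndomodule V A) P) (k : P ⟶ S) : Prop :=
  ∀ X Z Y, D.copr X Z Y ≫ app k ⟨op X, Y⟩ = S.actR X Z Y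

lemma hom_ext_right₂ (D₁ : EndoTensor R S P) (D₂ : EndoTensor P T Q) (D₃ : EndoTensor Q L P')
    {f g : P' ⟶ K}
    (h : ∀ X Z W U Y, D₁.copr X Z W ▷ T.at W U ▷ L.at U Y ≫ D₂.copr X W U ▷ L.at U Y ≫
        D₃.copr X U Y ≫ app f ⟨op X, Y⟩ =
      D₁.copr X Z W ▷ T.at W U ▷ L.at U Y ≫ D₂.copr X W U ▷ L.at U Y ≫
        D₃.copr X U Y ≫ app g ⟨op X, Y⟩) : f = g :=
  D₂.hom_ext_right D₃ fun X W U Y =>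
    ((D₁.jointlyEpi X W).whiskerRight (T.at W U)).whiskerRight (L.at U Y) _ _
      fun Z => h X Z W U Y

/-- On fourfold generators only associators of `V` occur, so this is the pentagon of `V`. -/
lemma pentagon {U RS ST TU RS_T R_ST ST_U S_TU RS_TU RS_T_U R_ST_U R_STU' R_S_TU : Endomodule V A}
    (dRS : EndoTensor R S RS) (dST : EndoTensor S T ST) (dTU : EndoTensor T U TU)
    (d₁ : EndoTensor RS T RS_T) (d₂ : EndoTensor R ST R_ST) (d₃ : EndoTensor ST U ST_U)
    (d₄ : EndoTensor S TU S_TU) (d₅ : EndoTensor RS TU RS_TU) (d₆ : EndoTensor RS_T U RS_T_U)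
    (d₇ : EndoTensor R_ST U R_ST_U) (d₈ : EndoTensor R ST_U R_STU')
    (d₉ : EndoTensor R S_TU R_S_TU)
    {a : RS_T ⟶ R_ST} {aU : RS_T_U ⟶ R_ST_U} {b : R_ST_U ⟶ R_STU'} {c : ST_U ⟶ S_TU}
    {Rc : R_STU' ⟶ R_S_TU} {x : RS_T_U ⟶ RS_TU} {y : RS_TU ⟶ R_S_TU}
    (ha : IsAssociator dRS d₁ dST d₂ a) (haU : IsTensorHom d₆ d₇ a (𝟙 U) aU)
    (hb : IsAssociator d₂ d₇ d₃ d₈ b) (hc : IsAssociator dST d₃ dTU d₄ c)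
    (hRc : IsTensorHom d₈ d₉ (𝟙 R) c Rc) (hx : IsAssociator d₁ d₆ dTU d₅ x)
    (hy : IsAssociator dRS d₅ d₄ d₉ y) : aU ≫ b ≫ Rc = x ≫ y := by
  refine dRS.hom_ext_right₂ d₁ d₆ fun X Z W W' Y => ?_
  have e₁ := congrArg (· ▷ U.at W' Y) (ha X Z W W')
  have e₂ := congrArg (R.at X Z ◁ ·) (hc Z W W' Y)
  simp only [comp_whiskerRight, MonoidalCategory.whiskerLeft_comp] at e₁ e₂
  have hRc' := hRc X Z Y
  have haU' := haU X W' Y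
  rw [id_app, id_tensorHom] at hRc'
  rw [id_app, tensorHom_id] at haU'
  simp only [comp_app]
  rw [reassoc_of% haU', reassoc_of% e₁, reassoc_of% (hb X Z W' Y), hRc',
    associator_naturality_middle_assoc, reassoc_of% e₂, reassoc_of% (hx X W W' Y),
    associator_naturality_left_assoc, ← whisker_exchange_assoc, hy X Z W Y,
    associator_naturality_right_assoc, pentagon_assoc]

/-- The composites on the two sides are chosen independently. With identities for `f`, `g`, `h` this
therefore compares the associators of two choices of coends, which is how associativity of `Υ` is
obtained. -/
lemma IsAssociator.naturality {D₁ : EndoTensor R S P} {D₂ : EndoTensor P T Q}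
    {D₃ : EndoTensor S T L} {D₄ : EndoTensor R L K} {P₁ Q₁ L₁ K₁ : Endomodule V A}
    {D₁' : EndoTensor R' S' P₁} {D₂' : EndoTensor P₁ T' Q₁} {D₃' : EndoTensor S' T' L₁}
    {D₄' : EndoTensor R' L₁ K₁} {a : Q ⟶ K} {a' : Q₁ ⟶ K₁} (ha : IsAssociator D₁ D₂ D₃ D₄ a)
    (ha' : IsAssociator D₁' D₂' D₃' D₄' a') {f : R ⟶ R'} {g : S ⟶ S'} {h : T ⟶ T'}
    {fg : P ⟶ P₁} {fgh : Q ⟶ Q₁} {gh : L ⟶ L₁} {fgh' : K ⟶ K₁} (hfg : IsTensorHom D₁ D₁' f g fg)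
    (hfgh : IsTensorHom D₂ D₂' fg h fgh) (hgh : IsTensorHom D₃ D₃' g h gh)
    (hfgh' : IsTensorHom D₄ D₄' f gh fgh') : fgh ≫ a' = a ≫ fgh' := by
  refine D₁.hom_ext_right D₂ fun X Z W Y => ?_
  have e : D₁.copr X Z W ▷ T.at W Y ≫ (app fg ⟨op X, W⟩ ⊗ₘ app h ⟨op W, Y⟩) =
      ((app f ⟨op X, Z⟩ ⊗ₘ app g ⟨op Z, W⟩) ⊗ₘ app h ⟨op W, Y⟩) ≫
        D₁'.copr X Z W ▷ T'.at W Y := by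
    rw [whiskerRight_comp_tensorHom, hfg X Z W, tensorHom_comp_whiskerRight]
  have e' : R.at X Z ◁ D₃.copr Z W Y ≫ (app f ⟨op X, Z⟩ ⊗ₘ app gh ⟨op Z, Y⟩) =
      (app f ⟨op X, Z⟩ ⊗ₘ (app g ⟨op Z, W⟩ ⊗ₘ app h ⟨op W, Y⟩)) ≫
        R'.at X Z ◁ D₃'.copr Z W Y := by
    rw [whiskerLeft_comp_tensorHom, hgh Z W Y, tensorHom_comp_whiskerLeft]
  simp only [comp_app]
  rw [reassoc_of% (hfgh X W Y), reassoc_of% (ha X Z W Y), hfgh' X Z Y, reassoc_of% e,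
    reassoc_of% e', ha' X Z W Y, MonoidalCategory.associator_naturality_assoc]

lemma IsLeftUnitor.naturality {D : EndoTensor (homEndomodule V A) T P}
    {D' : EndoTensor (homEndomodule V A) T' P'} {k : P ⟶ T} {k' : P' ⟶ T'}
    (hk : IsLeftUnitor D k) (hk' : IsLeftUnitor D' k') {f : T ⟶ T'}
    {g : P ⟶ P'} (hg : IsTensorHom D D' (𝟙 _) f g) : g ≫ k' = k ≫ f := by
  refine D.hom_ext fun X Z Y => ?_
  have e := hg X Z Y
  have s := sq_app_actL f X Z Y
  unfold Sq at s
  rw [id_app, id_tensorHom] at e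
  rw [comp_app, comp_app, reassoc_of% e, hk' X Z Y, reassoc_of% (hk X Z Y)]
  exact (BraidedCategory.braiding_naturality_right_assoc _ _ _).trans
    ((congrArg ((β_ _ _).hom ≫ ·) s.symm).trans (Category.assoc _ _ _).symm)

lemma IsRightUnitor.naturality {D : EndoTensor S (homEndomodule V A) P}
    {D' : EndoTensor S' (homEndomodule V A) P'} {k : P ⟶ S} {k' : P' ⟶ S'}
    (hk : IsRightUnitor D k) (hk' : IsRightUnitor D' k') {f : S ⟶ S'}
    {g : P ⟶ P'} (hg : IsTensorHom D D' f (𝟙 _) g) : g ≫ k' = k ≫ f := by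
  refine D.hom_ext fun X Z Y => ?_
  have e := hg X Z Y
  have s := sq_app_actR f X Z Y
  unfold Sq at s
  rw [id_app, tensorHom_id] at e
  rw [comp_app, comp_app, reassoc_of% e, hk' X Z Y, reassoc_of% (hk X Z Y)]
  exact s.symm

/-- The element of `A(Z, W)` in the middle acts on `S` on one side and on `T` on the other; equality
is the cowedge relation of the composite. -/
lemma triangle {D₁ : EndoTensor S (homEndomodule V A) P} {D₂ : EndoTensor P T Q}
    {D₃ : EndoTensor (homEndomodule V A) T P'} {D₄ : EndoTensor S P' Q'} {D : EndoTensor S T R}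
    {a : Q ⟶ Q'} {l : P' ⟶ T} {r : P ⟶ S} {Sl : Q' ⟶ R} {rT : Q ⟶ R}
    (ha : IsAssociator D₁ D₂ D₃ D₄ a) (hl : IsLeftUnitor D₃ l) (hr : IsRightUnitor D₁ r)
    (hSl : IsTensorHom D₄ D (𝟙 S) l Sl) (hrT : IsTensorHom D₂ D r (𝟙 T) rT) : a ≫ Sl = rT := by
  refine D₁.hom_ext_right D₂ fun X Z W Y => ?_
  have e₁ := hSl X Z Y
  have e₂ := hrT X W Y
  have e₃ := congrArg (· ▷ T.at W Y) (hr X Z W)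
  have e₄ := congrArg (S.at X Z ◁ ·) (hl Z W Y)
  simp only [comp_whiskerRight, MonoidalCategory.whiskerLeft_comp] at e₃ e₄
  rw [id_app, id_tensorHom] at e₁
  rw [id_app, tensorHom_id] at e₂
  rw [comp_app, reassoc_of% (ha X Z W Y), e₁, e₂, reassoc_of% e₄, reassoc_of% e₃]
  have d := (whisker_cowedge_iff _ _ _ _).2 (D.dinat X Z W Y)
  exact d.symm

end EndoTensor

end endomodule

/-! ### Existence of composites of endomodules and their hom-object functoriality -/

section actions

variable {V : Type u} [Category.{v} V] [MonoidalCategory V] [SymmetricCategory V]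

lemma actRight_seq {P M Q T S : V} (a : P ⊗ T ⟶ M) (a' : M ⊗ S ⟶ Q) (B : V) :
    actRight ((α_ _ _ _).inv ≫ a ▷ S ≫ a') B =
      (α_ _ _ _).inv ≫ actRight a B ▷ S ≫ actRight a' B := by
  unfold actRight
  simp only [comp_whiskerRight, Category.assoc]
  rw [reassoc_of% @swapRight_naturality_left, reassoc_of% @swapRight_tensor]

lemma actRight_comp_iff {P T Q B W S : V} {a : P ⊗ T ⟶ Q} {f : Q ⊗ B ⟶ W} {b : P ⊗ B ⟶ S}
    {g : S ⊗ T ⟶ W} : actRight a B ≫ f = b ▷ T ≫ g ↔ actRight b T ≫ g = a ▷ B ≫ f := by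
  unfold actRight
  constructor <;> intro h
  · simp only [Category.assoc]
    rw [← h, Category.assoc, reassoc_of% @swapRight_swapRight]
  · simp only [Category.assoc]
    rw [← h, Category.assoc, reassoc_of% @swapRight_swapRight]

omit [SymmetricCategory V] in
-- The action laws of a joint quotient are tested on the covering actions, where they hold.
lemma IsAction.of_jointlyEpi [MonoidalClosed V] [SymmetricCategory V] {C : Type w}
    [EnrichedCategory V C] {ι : Type*} {m : ι → C → V}
    {a : ∀ i X Y, m i X ⊗ (X ⟶[V] Y) ⟶ m i Y} (ha : ∀ i, IsAction (a i)) {n : C → V}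
    {b : ∀ X Y : C, n X ⊗ (X ⟶[V] Y) ⟶ n Y} {c : ∀ i X, m i X ⟶ n X}
    (hc : ∀ X, JointlyEpi fun i => c i X) (h : ∀ i, IsNat (a i) b (c i)) : IsAction b where
  id X := (hc X).whiskerRight _ _ _ fun i => by
    rw [← whisker_exchange_assoc, ← h i X X, reassoc_of% (ha i).id]
    simp
  comp X Y Z := (hc X).whiskerRight _ _ _ fun i => by
    rw [← whisker_exchange_assoc, ← h i X Z, reassoc_of% (ha i).comp,
      associator_inv_naturality_left_assoc, ← comp_whiskerRight_assoc, ← h i X Y,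
      comp_whiskerRight_assoc, h i Y Z]

end actions

section endomodule

variable {V : Type u} [Category.{v} V] [MonoidalCategory V] [MonoidalClosed V]
  [SymmetricCategory V] {A : Type v} [Category.{w} A] [EnrichedOrdinaryCategory V A]

open VFunctor Endomodule

namespace Endomodule

lemma isNat_actRight {T K : Endomodule V A} {H : V} {τ : ∀ X Y, T.at X Y ⊗ H ⟶ K.at X Y}
    (hL : ∀ X' X Y, Sq (actRight (T.actL X' X Y) H) (K.actL X' X Y) (τ X Y) (τ X' Y))
    (hR : ∀ X Y Y', Sq (actRight (T.actR X Y Y') H) (K.actR X Y Y') (τ X Y) (τ X Y')) :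
    IsNat (fun P Q => actRight (T.act P Q) H) K.act (fun P => τ P.fst.unop P.snd) := fun P Q => by
  have := (hL Q.fst.unop P.fst.unop P.snd).seq (hR Q.fst.unop P.snd Q.snd)
  rwa [← actRight_seq, actL_actR, actL_actR] at this

lemma sq_ev_actL [HasLimits V] (T K : Endomodule V A) (X' X Y : A) :
    Sq (actRight (T.actL X' X Y) (homObj T K)) (K.actL X' X Y) (ev T K ⟨op X, Y⟩)
      (ev T K ⟨op X', Y⟩) := by
  unfold actL
  rw [actRight_precomp]
  exact (isNat_ev T K ⟨op X, Y⟩ ⟨op X', Y⟩).precomp _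

lemma sq_ev_actR [HasLimits V] (T K : Endomodule V A) (X Y Y' : A) :
    Sq (actRight (T.actR X Y Y') (homObj T K)) (K.actR X Y Y') (ev T K ⟨op X, Y⟩)
      (ev T K ⟨op X, Y'⟩) := by
  unfold actR
  rw [actRight_precomp]
  exact (isNat_ev T K ⟨op X, Y⟩ ⟨op X, Y'⟩).precomp _

end Endomodule

namespace EndoTensor

variable {R S T P Q P' Q' K L S' T' R' : Endomodule V A}

/-- The coprojections are jointly epimorphic at each `(X, Y)`, even before acting; letting
identities act shows that they generate. -/
lemma generates (D : EndoTensor S T P) :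
    Generates P.act (u := fun p : A × A × A => ⟨op p.1, p.2.2⟩)
      (fun p => D.copr p.1 p.2.1 p.2.2) := fun Q W f g H => by
  refine D.jointlyEpi Q.fst.unop Q.snd _ _ fun Z => ?_
  have h := congrArg ((ρ_ _).inv ≫ _ ◁ eId V Q ≫ ·) (H (Q.fst.unop, Z, Q.snd))
  dsimp only at h
  simp only [Category.assoc] at h
  have e (k : P.obj Q ⟶ W) : (ρ_ _).inv ≫ _ ◁ eId V Q ≫
      D.copr Q.fst.unop Z Q.snd ▷ _ ≫ P.act Q Q ≫ k = D.copr Q.fst.unop Z Q.snd ≫ k := by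
    rw [whisker_exchange_assoc, reassoc_of% (P.act_id Q)]
    simp
  exact (e f).symm.trans (h.trans (e g))

/-- The composite of endomodules presented by the coprojections of the coend. -/
def ofCopr (copr : ∀ X Z Y : A, S.at X Z ⊗ T.at Z Y ⟶ P.at X Y)
    (copr_act : ∀ X X' Y Y' Z, Sq (ptensor (S.actL X' X Z) (T.actR Z Y Y'))
      (P.act ⟨op X, Y⟩ ⟨op X', Y'⟩) (copr X Z Y) (copr X' Z Y'))
    (isUniversal : ∀ X Y : A, IsUniversal (i := Prod.snd) (j := Prod.fst)
      (fun r : A × A => actRight (S.actR X r.1 r.2) (T.at r.2 Y))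
      (fun r => actLeft (S.at X r.1) (T.actL r.1 r.2 Y)) (fun Z => copr X Z Y)) :
    EndoTensor S T P where
  copr := copr
  nat_left X' X Z Y := by
    have := (copr_act X X' Y Y Z).precomp ((ρ_ _).inv ≫ _ ◁ eId V Y)
    rwa [ptensor_whisker_id _ _ _ (T.actR_id Z Y)] at this
  nat_right X Z Y Y' := by
    have := (copr_act X X Y Y' Z).precomp ((λ_ _).inv ≫ eId V X ▷ _)
    rwa [ptensor_id_whisker _ _ _ (S.actL_id X Z)] at this
  isUniversal := isUniversal

lemma copr_act (D : EndoTensor S T P) (X X' Y Y' Z : A) :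
    Sq (ptensor (S.actL X' X Z) (T.actR Z Y Y'))
      (P.act ⟨op X, Y⟩ ⟨op X', Y'⟩) (D.copr X Z Y) (D.copr X' Z Y') := by
  have := (D.nat_left X' X Z Y).seq (D.nat_right X' Z Y Y')
  rwa [← ptensor_eq, P.actL_actR] at this

end EndoTensor

/-- Coends over `Z` are formed for each `(X, Y)`. The outer actions on `S` and `T` commute with the
inner ones that define the relations, so they descend. -/
lemma exists_endoTensor [HasColimits V] (S T : Endomodule V A) :
    ∃ P : Endomodule V A, Nonempty (EndoTensor S T P) := by
  choose Q c h using fun X Y : A => exists_isUniversal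
      (P := fun Z => S.at X Z ⊗ T.at Z Y) (i := Prod.snd) (j := Prod.fst)
      (fun r : A × A => actRight (S.actR X r.1 r.2) (T.at r.2 Y))
      (fun r => actLeft (S.at X r.1) (T.actL r.1 r.2 Y))
  choose b hb using fun X Y X' Y' : A => (h X Y).exists_desc_actRight ((X' ⟶[V] X) ⊗ (Y ⟶[V] Y'))
    (fun Z => ptensor (S.actL X' X Z) (T.actR Z Y Y') ≫ c X' Y' Z) fun r =>
      Sq.coequalize (Sq.ptensor_left (S.sq_actR X' X r.1 r.2) _)
        (Sq.ptensor_right (T.sq_actL r.1 r.2 Y Y') _) ((h X' Y').condition r)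
  have ha : IsAction (C := TensorCat Aᵒᵖ A) (m := fun P => Q P.fst.unop P.snd)
      (fun P P' => b P.fst.unop P.snd P'.fst.unop P'.snd) :=
    IsAction.of_jointlyEpi (fun Z => (S.isAction.fst Z).ptensor (T.isAction.snd (op Z)))
      (c := fun Z P => c P.fst.unop P.snd Z) (fun P => (h P.fst.unop P.snd).jointlyEpi)
      fun Z P P' => (hb P.fst.unop P.snd P'.fst.unop P'.snd Z).symm
  refine ⟨VFunctor.ofAct _ _ ha.id ha.comp, ⟨EndoTensor.ofCopr (fun X Z Y => c X Y Z)
    (fun X X' Y Y' Z => ?_) h⟩⟩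
  rw [ofAct_act]
  exact (hb X Y X' Y' Z).symm

namespace EndoTensor

variable {R S T P Q P' Q' K L S' T' R' Q₁ : Endomodule V A} [HasLimits V]

/-- `h` is the effect of the composition of endomodules on hom-objects. -/
abbrev IsHom (D : EndoTensor S T P) (D' : EndoTensor S' T' P')
    (h : homObj S S' ⊗ homObj T T' ⟶ homObj P P') : Prop :=
  IsHomTensor (s := fun p : A × A × A => ⟨op p.1, p.2.1⟩) (s' := fun p => ⟨op p.2.1, p.2.2⟩)
    (o := fun p => ⟨op p.1, p.2.2⟩) (fun p => D.copr p.1 p.2.1 p.2.2)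
    (fun p => D'.copr p.1 p.2.1 p.2.2) h

lemma IsHom.copr_ev {D : EndoTensor S T P} {D' : EndoTensor S' T' P'}
    {h : homObj S S' ⊗ homObj T T' ⟶ homObj P P'} (hh : IsHom D D' h) (X Z Y : A) :
    D.copr X Z Y ▷ _ ≫ P.at X Y ◁ h ≫ ev P P' ⟨op X, Y⟩ =
      ptensor (ev S S' ⟨op X, Z⟩) (ev T T' ⟨op Z, Y⟩) ≫ D'.copr X Z Y := hh (X, Z, Y)

/-- Naturality of the evaluations in the inner variable lets their tensor product descend to the
coend; naturality in the outer variables then gives the factorization through the end. -/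
lemma exists_isHom (D : EndoTensor S T P) (D' : EndoTensor S' T' P') :
    ∃ h : homObj S S' ⊗ homObj T T' ⟶ homObj P P', IsHom D D' h := by
  choose τ hτ using fun X Y => (D.isUniversal X Y).exists_desc_actRight
    (homObj S S' ⊗ homObj T T')
    (fun Z => ptensor (ev S S' ⟨op X, Z⟩) (ev T T' ⟨op Z, Y⟩) ≫ D'.copr X Z Y)
    fun r => Sq.coequalize (Sq.ptensor_left (sq_ev_actR S S' X r.1 r.2) _)
      (Sq.ptensor_right (sq_ev_actL T T' r.1 r.2 Y) _) (D'.dinat X r.1 r.2 Y)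
  obtain ⟨k, hk⟩ := (isNat_actRight (T := P) (K := P') (τ := τ)
    (fun X' X Y => ((D.jointlyEpi X Y).whiskerRight _).sq
      (fun Z => (D.nat_left X' X Z Y).whiskerRight _) fun Z => by
        rw [hτ, hτ]
        exact (Sq.ptensor_left (sq_ev_actL S S' X' X Z) _).comp (D'.nat_left X' X Z Y))
    (fun X Y Y' => ((D.jointlyEpi X Y).whiskerRight _).sq
      (fun Z => (D.nat_right X Z Y Y').whiskerRight _) fun Z => by
        rw [hτ, hτ]
        exact (Sq.ptensor_right (sq_ev_actR T T' Z Y Y') _).comp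
          (D'.nat_right X Z Y Y'))).exists_homLift
  exact ⟨k, fun p => by rw [hk]; exact hτ p.1 p.2.2 p.2.1⟩

lemma homObj_ext (D : EndoTensor S T P) {H : V} {f g : H ⟶ homObj P K}
    (h : ∀ X Z Y, D.copr X Z Y ▷ H ≫ P.at X Y ◁ f ≫ ev P K ⟨op X, Y⟩ =
      D.copr X Z Y ▷ H ≫ P.at X Y ◁ g ≫ ev P K ⟨op X, Y⟩) : f = g :=
  VFunctor.homObj_ext fun p => (D.jointlyEpi p.fst.unop p.snd).whiskerRight H _ _
    fun Z => h p.fst.unop Z p.snd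

lemma homObj_ext_right (D₁ : EndoTensor R S P) (D₂ : EndoTensor P T Q) {H : V}
    {f g : H ⟶ homObj Q K}
    (h : ∀ X Z W Y, (D₁.copr X Z W ▷ T.at W Y) ▷ H ≫ D₂.copr X W Y ▷ H ≫
        Q.at X Y ◁ f ≫ ev Q K ⟨op X, Y⟩ =
      (D₁.copr X Z W ▷ T.at W Y) ▷ H ≫ D₂.copr X W Y ▷ H ≫
        Q.at X Y ◁ g ≫ ev Q K ⟨op X, Y⟩) : f = g :=
  D₂.homObj_ext fun X W Y => ((D₁.jointlyEpi X W).whiskerRight _).whiskerRight H _ _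
    fun Z => h X Z W Y

lemma IsAssociator.homObj_naturality {D₁ : EndoTensor R S P} {D₂ : EndoTensor P T Q}
    {D₃ : EndoTensor S T L} {D₄ : EndoTensor R L K} {P₁ Q₁ L₁ K₁ : Endomodule V A}
    {D₁' : EndoTensor R' S' P₁} {D₂' : EndoTensor P₁ T' Q₁} {D₃' : EndoTensor S' T' L₁}
    {D₄' : EndoTensor R' L₁ K₁} {a : Q ⟶ K} {a' : Q₁ ⟶ K₁} (ha : IsAssociator D₁ D₂ D₃ D₄ a)
    (ha' : IsAssociator D₁' D₂' D₃' D₄' a') {h₁ : homObj R R' ⊗ homObj S S' ⟶ homObj P P₁}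
    {h₂ : homObj P P₁ ⊗ homObj T T' ⟶ homObj Q Q₁} {h₃ : homObj S S' ⊗ homObj T T' ⟶ homObj L L₁}
    {h₄ : homObj R R' ⊗ homObj L L₁ ⟶ homObj K K₁} (hh₁ : IsHom D₁ D₁' h₁)
    (hh₂ : IsHom D₂ D₂' h₂) (hh₃ : IsHom D₃ D₃' h₃) (hh₄ : IsHom D₄ D₄' h₄) :
    h₁ ▷ homObj T T' ≫ h₂ ≫ eHomWhiskerLeft V Q a' =
      (α_ _ _ _).hom ≫ homObj R R' ◁ h₃ ≫ h₄ ≫ eHomWhiskerRight V a K₁ := by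
  refine D₁.homObj_ext_right D₂ fun X Z W Y => ?_
  have e₁ : (D₁.copr X Z W ▷ T.at W Y) ▷ _ ≫ (P.at X W ⊗ T.at W Y) ◁ (h₁ ▷ homObj T T') ≫
      ptensor (ev P P₁ ⟨op X, W⟩) (ev T T' ⟨op W, Y⟩) =
        ptensor (ptensor (ev R R' ⟨op X, Z⟩) (ev S S' ⟨op Z, W⟩)) (ev T T' ⟨op W, Y⟩) ≫
          D₁'.copr X Z W ▷ T'.at W Y := by
    rw [ptensor_precomp_left, whiskerRight_ptensor, hh₁.copr_ev, ptensor_comp_whiskerRight]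
  have e₂ : (R.at X Z ◁ D₃.copr Z W Y) ▷ _ ≫ (R.at X Z ⊗ L.at Z Y) ◁ (homObj R R' ◁ h₃) ≫
      ptensor (ev R R' ⟨op X, Z⟩) (ev L L₁ ⟨op Z, Y⟩) =
        ptensor (ev R R' ⟨op X, Z⟩) (ptensor (ev S S' ⟨op Z, W⟩) (ev T T' ⟨op W, Y⟩)) ≫
          R'.at X Z ◁ D₃'.copr Z W Y := by
    rw [ptensor_precomp_right, whiskerLeft_ptensor, hh₃.copr_ev, ptensor_comp_whiskerLeft]
  have s := sq_ptensor_associator (ev R R' ⟨op X, Z⟩) (ev S S' ⟨op Z, W⟩) (ev T T' ⟨op W, Y⟩)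
  unfold Sq at s
  have l : (D₁.copr X Z W ▷ T.at W Y) ▷ _ ≫ D₂.copr X W Y ▷ _ ≫ Q.at X Y ◁
      (h₁ ▷ homObj T T' ≫ h₂ ≫ eHomWhiskerLeft V Q a') ≫ ev Q K₁ ⟨op X, Y⟩ =
      (ptensor (ptensor (ev R R' ⟨op X, Z⟩) (ev S S' ⟨op Z, W⟩)) (ev T T' ⟨op W, Y⟩) ≫
        (α_ _ _ _).hom) ≫ R'.at X Z ◁ D₃'.copr Z W Y ≫ D₄'.copr X Z Y := by
    have e := hh₂.copr_ev X W Y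
    have w := whiskerLeft_eHomWhiskerLeft_ev Q a' ⟨op X, Y⟩
    simp only [MonoidalCategory.whiskerLeft_comp, Category.assoc] at w ⊢
    rw [w, ← whisker_exchange_assoc, reassoc_of% e, reassoc_of% e₁, ha' X Z W Y]
  have r : (D₁.copr X Z W ▷ T.at W Y) ▷ _ ≫ D₂.copr X W Y ▷ _ ≫ Q.at X Y ◁
      ((α_ _ _ _).hom ≫ homObj R R' ◁ h₃ ≫ h₄ ≫ eHomWhiskerRight V a K₁) ≫
        ev Q K₁ ⟨op X, Y⟩ =
      ((α_ _ _ _).hom ▷ _ ≫ (_ ◁ (α_ _ _ _).hom ≫ ptensor (ev R R' ⟨op X, Z⟩)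
        (ptensor (ev S S' ⟨op Z, W⟩) (ev T T' ⟨op W, Y⟩)))) ≫
        R'.at X Z ◁ D₃'.copr Z W Y ≫ D₄'.copr X Z Y := by
    have e := hh₄.copr_ev X Z Y
    have w := whiskerLeft_eHomWhiskerRight_ev a K₁ ⟨op X, Y⟩
    have n := congrArg (· ▷ ((homObj R R' ⊗ homObj S S') ⊗ homObj T T')) (ha X Z W Y)
    simp only [MonoidalCategory.whiskerLeft_comp, comp_whiskerRight, Category.assoc] at w n ⊢
    rw [w, whisker_exchange_assoc, whisker_exchange_assoc, whisker_exchange_assoc,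
      reassoc_of% n, ← whisker_exchange_assoc (D₄.copr X Z Y),
      ← whisker_exchange_assoc (D₄.copr X Z Y), e,
      ← whisker_exchange_assoc (R.at X Z ◁ D₃.copr Z W Y), reassoc_of% e₂]
  exact l.trans ((congrArg (· ≫ _) s).trans r.symm)

lemma IsLeftUnitor.homObj_naturality {D : EndoTensor (homEndomodule V A) T P}
    {D' : EndoTensor (homEndomodule V A) T' P'} {k : P ⟶ T} {k' : P' ⟶ T'} (hk : IsLeftUnitor D k)
    (hk' : IsLeftUnitor D' k')
    {h : homObj (homEndomodule V A) (homEndomodule V A) ⊗ homObj T T' ⟶ homObj P P'}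
    (hh : IsHom D D' h) :
    (λ_ _).inv ≫ ofNat (𝟙 (homEndomodule V A)) ▷ homObj T T' ≫ h ≫ eHomWhiskerLeft V P k' =
      eHomWhiskerRight V k T' := by
  refine D.homObj_ext fun X Z Y => ?_
  have e := hh.copr_ev X Z Y
  have w := whiskerLeft_eHomWhiskerLeft_ev P k' ⟨op X, Y⟩
  have w' := whiskerLeft_eHomWhiskerRight_ev k T' ⟨op X, Y⟩
  have n := congrArg (· ▷ homObj T T') (hk X Z Y)
  have p := ptensor_id_whisker (ev (homEndomodule V A) (homEndomodule V A) ⟨op X, Z⟩)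
    (ev T T' ⟨op Z, Y⟩) (ofNat (𝟙 (homEndomodule V A))) ((ofNat_ev _ _).trans (by simp))
  have s := sq_ev_actL T T' X Z Y
  have s' := Sq.braiding' (ev T T' ⟨op Z, Y⟩) (X ⟶[V] Z)
  unfold Sq at s s'
  have n' := hk' X Z Y
  have l : D.copr X Z Y ▷ _ ≫ P.at X Y ◁
      ((λ_ _).inv ≫ ofNat (𝟙 (homEndomodule V A)) ▷ homObj T T' ≫ h ≫ eHomWhiskerLeft V P k') ≫
      ev P T' ⟨op X, Y⟩ = actLeft ((homEndomodule V A).at X Z) (ev T T' ⟨op Z, Y⟩) ≫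
        (β_ (X ⟶[V] Z) (T'.at Z Y)).hom ≫ T'.actL X Z Y := by
    simp only [MonoidalCategory.whiskerLeft_comp, Category.assoc] at w p ⊢
    rw [w, ← whisker_exchange_assoc (D.copr X Z Y), ← whisker_exchange_assoc (D.copr X Z Y),
      reassoc_of% e, reassoc_of% p]
    exact congrArg (_ ≫ ·) n'
  have r : D.copr X Z Y ▷ _ ≫ P.at X Y ◁ eHomWhiskerRight V k T' ≫ ev P T' ⟨op X, Y⟩ =
      ((β_ (X ⟶[V] Z) (T.at Z Y)).hom ≫ T.actL X Z Y) ▷ homObj T T' ≫ ev T T' ⟨op X, Y⟩ := by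
    rw [w']
    exact (Category.assoc _ _ _).symm.trans ((congrArg (· ≫ _) (comp_whiskerRight _ _ _).symm).trans
      (congrArg (· ≫ _) n))
  refine l.trans (Eq.trans ?_ r.symm)
  refine ((reassoc_of% s') _).trans (Eq.trans (congrArg (_ ≫ ·) ?_)
    ((reassoc_of% (comp_whiskerRight _ _ _)) _).symm)
  -- Evaluation is natural for the contravariant action; here its two parameters are interchanged.
  exact actRight_comp_iff.1 s

lemma IsRightUnitor.homObj_naturality {D : EndoTensor S (homEndomodule V A) P}
    {D' : EndoTensor S' (homEndomodule V A) P'} {k : P ⟶ S} {k' : P' ⟶ S'} (hk : IsRightUnitor D k)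
    (hk' : IsRightUnitor D' k')
    {h : homObj S S' ⊗ homObj (homEndomodule V A) (homEndomodule V A) ⟶ homObj P P'}
    (hh : IsHom D D' h) :
    (ρ_ _).inv ≫ homObj S S' ◁ ofNat (𝟙 (homEndomodule V A)) ≫ h ≫ eHomWhiskerLeft V P k' =
      eHomWhiskerRight V k S' := by
  refine D.homObj_ext fun X Z Y => ?_
  have e := hh.copr_ev X Z Y
  have w := whiskerLeft_eHomWhiskerLeft_ev P k' ⟨op X, Y⟩
  have w' := whiskerLeft_eHomWhiskerRight_ev k S' ⟨op X, Y⟩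
  have n := congrArg (· ▷ homObj S S') (hk X Z Y)
  have p := ptensor_whisker_id (ev S S' ⟨op X, Z⟩)
    (ev (homEndomodule V A) (homEndomodule V A) ⟨op Z, Y⟩) (ofNat (𝟙 (homEndomodule V A)))
    ((ofNat_ev _ _).trans (by simp))
  have s := sq_ev_actR S S' X Z Y
  unfold Sq at s
  have n' := hk' X Z Y
  have l : D.copr X Z Y ▷ _ ≫ P.at X Y ◁
      ((ρ_ _).inv ≫ homObj S S' ◁ ofNat (𝟙 (homEndomodule V A)) ≫ h ≫ eHomWhiskerLeft V P k') ≫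
      ev P S' ⟨op X, Y⟩ = actRight (ev S S' ⟨op X, Z⟩) ((homEndomodule V A).at Z Y) ≫
        S'.actR X Z Y := by
    simp only [MonoidalCategory.whiskerLeft_comp, Category.assoc] at w p ⊢
    rw [w, ← whisker_exchange_assoc (D.copr X Z Y), ← whisker_exchange_assoc (D.copr X Z Y),
      reassoc_of% e, reassoc_of% p]
    exact congrArg (_ ≫ ·) n'
  have r : D.copr X Z Y ▷ _ ≫ P.at X Y ◁ eHomWhiskerRight V k S' ≫ ev P S' ⟨op X, Y⟩ =
      S.actR X Z Y ▷ homObj S S' ≫ ev S S' ⟨op X, Y⟩ := by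
    rw [w']
    exact (Category.assoc _ _ _).symm.trans ((congrArg (· ≫ _) (comp_whiskerRight _ _ _).symm).trans
      (congrArg (· ≫ _) n))
  refine l.trans (Eq.trans ?_ r.symm)
  exact actRight_comp_iff.1 s

end EndoTensor

end endomodule

/-! ### Composition of endomodules as a monoidal `V`-category -/

section endomodule

variable {V : Type u} [Category.{v} V] [MonoidalCategory V] [MonoidalClosed V]
  [SymmetricCategory V] {A : Type v} [Category.{w} A] [EnrichedOrdinaryCategory V A]

open MonoidalVCategory VFunctor

variable [HasColimits V]

/-- A chosen composite of the endomodules `S` and `T`. -/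
def endoObj (S T : Endomodule V A) : Endomodule V A := (exists_endoTensor S T).choose

/-- The universal property of the chosen composite. -/
def endoTensor (S T : Endomodule V A) : EndoTensor S T (endoObj S T) :=
  (exists_endoTensor S T).choose_spec.some

/-- The associativity isomorphism of the composition of endomodules. -/
def endoAssociator (R S T : Endomodule V A) :
    endoObj (endoObj R S) T ≅ endoObj R (endoObj S T) :=
  ((endoTensor R S).exists_associator (endoTensor _ T) (endoTensor S T) (endoTensor R _)).choose

lemma isAssociator_endoAssociator (R S T : Endomodule V A) :
    (endoTensor R S).IsAssociator (endoTensor _ T) (endoTensor S T) (endoTensor R _)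
      (endoAssociator R S T).hom :=
  ((endoTensor R S).exists_associator (endoTensor _ T) (endoTensor S T)
    (endoTensor R _)).choose_spec

/-- The left unit isomorphism of the composition of endomodules. -/
def endoLeftUnitor (T : Endomodule V A) : endoObj (homEndomodule V A) T ≅ T :=
  (endoTensor (homEndomodule V A) T).exists_leftUnitor.choose

lemma isLeftUnitor_endoLeftUnitor (T : Endomodule V A) :
    (endoTensor (homEndomodule V A) T).IsLeftUnitor (endoLeftUnitor T).hom :=
  (endoTensor (homEndomodule V A) T).exists_leftUnitor.choose_spec

/-- The right unit isomorphism of the composition of endomodules. -/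
def endoRightUnitor (S : Endomodule V A) : endoObj S (homEndomodule V A) ≅ S :=
  (endoTensor S (homEndomodule V A)).exists_rightUnitor.choose

lemma isRightUnitor_endoRightUnitor (S : Endomodule V A) :
    (endoTensor S (homEndomodule V A)).IsRightUnitor (endoRightUnitor S).hom :=
  (endoTensor S (homEndomodule V A)).exists_rightUnitor.choose_spec

variable [HasLimits V]

/-- The effect of the composition of endomodules on hom-objects. -/
def endoHomTensor (S S' T T' : Endomodule V A) :
    homObj S S' ⊗ homObj T T' ⟶ homObj (endoObj S T) (endoObj S' T') :=
  ((endoTensor S T).exists_isHom (endoTensor S' T')).choose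

lemma isHom_endoHomTensor (S S' T T' : Endomodule V A) :
    (endoTensor S T).IsHom (endoTensor S' T') (endoHomTensor S S' T T') :=
  ((endoTensor S T).exists_isHom (endoTensor S' T')).choose_spec

/-- The composition of morphisms of endomodules. -/
def endoTensorHom {S S' T T' : Endomodule V A} (f : S ⟶ S') (g : T ⟶ T') :
    endoObj S T ⟶ endoObj S' T' :=
  ((isHom_endoHomTensor S S' T T').exists_tensorHom f g).choose

lemma isTensorHom_endoTensorHom {S S' T T' : Endomodule V A} (f : S ⟶ S') (g : T ⟶ T') :
    (endoTensor S T).IsTensorHom (endoTensor S' T') f g (endoTensorHom f g) := fun X Z Y =>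
  ((isHom_endoHomTensor S S' T T').exists_tensorHom f g).choose_spec.1 (X, Z, Y)

lemma ofNat_endoTensorHom {S S' T T' : Endomodule V A} (f : S ⟶ S') (g : T ⟶ T') :
    (λ_ (𝟙_ V)).inv ≫ (ofNat f ⊗ₘ ofNat g) ≫ endoHomTensor S S' T T' =
      ofNat (endoTensorHom f g) :=
  ((isHom_endoHomTensor S S' T T').exists_tensorHom f g).choose_spec.2

variable (V A) in
/-- The monoidal category `[Aᵒᵖ ⊗ A, V]` under composition of endomodules. -/
abbrev endoMonoidalCategory : MonoidalCategory (Endomodule V A) :=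
  letI : MonoidalCategoryStruct (Endomodule V A) :=
    { tensorObj := endoObj
      tensorHom := endoTensorHom
      whiskerLeft := fun S _ _ g => endoTensorHom (𝟙 S) g
      whiskerRight := fun f T => endoTensorHom f (𝟙 T)
      tensorUnit := homEndomodule V A
      associator := endoAssociator
      leftUnitor := endoLeftUnitor
      rightUnitor := endoRightUnitor }
  MonoidalCategory.ofTensorHom
    (id_tensorHom_id := fun S T => (endoTensor S T).hom_ext fun X Z Y => by
      have := isTensorHom_endoTensorHom (𝟙 S) (𝟙 T) X Z Y
      exact this.trans ((by simp : _ = (endoTensor S T).copr X Z Y).trans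
        (Category.comp_id _).symm))
    (id_tensorHom := fun _ _ _ _ => rfl)
    (tensorHom_id := fun _ _ => rfl)
    (tensorHom_comp_tensorHom := fun f₁ f₂ g₁ g₂ => (endoTensor _ _).hom_ext fun X Z Y => by
      have h₁ := isTensorHom_endoTensorHom f₁ f₂ X Z Y
      have h₂ := isTensorHom_endoTensorHom g₁ g₂ X Z Y
      have h₃ := isTensorHom_endoTensorHom (f₁ ≫ g₁) (f₂ ≫ g₂) X Z Y
      refine Eq.trans ?_ h₃.symm
      rw [comp_app]
      refine ((reassoc_of% h₁) _).trans ?_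
      refine (congrArg ((app f₁ ⟨op X, Z⟩ ⊗ₘ app f₂ ⟨op Z, Y⟩) ≫ ·) h₂).trans ?_
      simp)
    (associator_naturality := fun f₁ f₂ f₃ =>
      (isAssociator_endoAssociator _ _ _).naturality (isAssociator_endoAssociator _ _ _)
        (isTensorHom_endoTensorHom f₁ f₂) (isTensorHom_endoTensorHom _ f₃)
        (isTensorHom_endoTensorHom f₂ f₃) (isTensorHom_endoTensorHom f₁ _))
    (leftUnitor_naturality := fun f => (isLeftUnitor_endoLeftUnitor _).naturality
      (isLeftUnitor_endoLeftUnitor _) (isTensorHom_endoTensorHom _ f))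
    (rightUnitor_naturality := fun f => (isRightUnitor_endoRightUnitor _).naturality
      (isRightUnitor_endoRightUnitor _) (isTensorHom_endoTensorHom f _))
    (pentagon := fun R S T U => EndoTensor.pentagon _ _ _ _ _ _ _ _ _ _ _ _
      (isAssociator_endoAssociator R S T) (isTensorHom_endoTensorHom _ _)
      (isAssociator_endoAssociator _ _ _) (isAssociator_endoAssociator S T U)
      (isTensorHom_endoTensorHom _ _) (isAssociator_endoAssociator _ _ _)
      (isAssociator_endoAssociator _ _ _))
    (triangle := fun S T => EndoTensor.triangle (isAssociator_endoAssociator _ _ _)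
      (isLeftUnitor_endoLeftUnitor _) (isRightUnitor_endoRightUnitor _)
      (isTensorHom_endoTensorHom _ _) (isTensorHom_endoTensorHom _ _))

variable (V A) in
/-- The monoidal `V`-category `[Aᵒᵖ ⊗ A, V]` under composition of endomodules. -/
abbrev endoMonoidalVCategory :
    letI := endoMonoidalCategory V A
    MonoidalVCategory V (Endomodule V A) :=
  letI := endoMonoidalCategory V A
  { tensorHomObj := fun S S' T T' => endoHomTensor S S' T T'
    tensorHomObj_eHomEquiv := fun f g => ofNat_endoTensorHom f g
    tensorHomObj_comp := fun S S' S'' T T' T'' =>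
      IsHomTensor.comp (endoTensor S T).generates (isHom_endoHomTensor S S' T T')
        (isHom_endoHomTensor S' S'' T' T'') (isHom_endoHomTensor S S'' T T'')
    associator_naturality := fun R R' S S' T T' =>
      (isAssociator_endoAssociator _ _ _).homObj_naturality (isAssociator_endoAssociator _ _ _)
        (isHom_endoHomTensor R R' S S') (isHom_endoHomTensor _ _ T T')
        (isHom_endoHomTensor S S' T T') (isHom_endoHomTensor R R' _ _)
    leftUnitor_naturality := fun T T' => (isLeftUnitor_endoLeftUnitor _).homObj_naturality
      (isLeftUnitor_endoLeftUnitor _) (isHom_endoHomTensor _ _ T T')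
    rightUnitor_naturality := fun S S' => (isRightUnitor_endoRightUnitor _).homObj_naturality
      (isRightUnitor_endoRightUnitor _) (isHom_endoHomTensor S S' _ _) }

lemma nonempty_endomoduleComposition : Nonempty (EndomoduleComposition V A) :=
  letI := endoMonoidalCategory V A
  letI := endoMonoidalVCategory V A
  ⟨{ copr := fun S T => (endoTensor S T).copr
     isCompCowedge := fun S T X Y Z Z' => (whisker_cowedge_iff _ _ _ _).2
      ((endoTensor S T).dinat X Z Z' Y)
     existsUnique_desc := fun S T X Y _ t ht =>
      ((endoTensor S T).isUniversal X Y).existsUnique_desc t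
        fun r => (whisker_cowedge_iff _ _ _ _).1 (ht r.1 r.2)
     copr_act := fun S T X X' Y Y' Z => ((endoTensor S T).copr_act X X' Y Y' Z).symm.trans
      (Category.assoc _ _ _)
     copr_tensorHomObj := fun S S' T T' X Y Z =>
      ((isHom_endoHomTensor S S' T T').copr_ev X Z Y).trans (Category.assoc _ _ _)
     copr_associator := fun R S T => isAssociator_endoAssociator R S T
     unitIso := Iso.refl _
     copr_leftUnitor := fun T X Z Y => ((congrArg (· ≫ _) (id_whiskerRight _ _)).trans
      (Category.id_comp _)).trans (isLeftUnitor_endoLeftUnitor T X Z Y)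
     copr_rightUnitor := fun S X Z Y => ((congrArg (· ≫ _)
      (MonoidalCategory.whiskerLeft_id _ _)).trans
      (Category.id_comp _)).trans (isRightUnitor_endoRightUnitor S X Z Y) }⟩

end endomodule

/-! ### Whiskering in the hom-objects of `A` -/

section whisker

variable {V : Type u} [Category.{v} V] [MonoidalCategory V] [BraidedCategory V]
  {A : Type w} [Category.{w'} A] [MonoidalCategory A] [EnrichedOrdinaryCategory V A]
  [MonoidalVCategory V A]

open MonoidalVCategory

omit [BraidedCategory V] [MonoidalCategory A] [MonoidalVCategory V A] in
lemma eId_eHomWhiskerLeft {X Y : A} (f : X ⟶ Y) :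
    eId V X ≫ eHomWhiskerLeft V X f = eHomEquiv V f := by
  rw [eHomWhiskerLeft, rightUnitor_inv_naturality_assoc, ← whisker_exchange_assoc,
    ← unitors_inv_equal, ← leftUnitor_inv_naturality_assoc, e_id_comp, Category.comp_id]

lemma eHomWhiskerLeft_tensorLeftHom (X B : A) {Y Y' : A} (g : Y ⟶ Y') :
    eHomWhiskerLeft V B g ≫ tensorLeftHom V X B Y' =
      tensorLeftHom V X B Y ≫ eHomWhiskerLeft V (X ⊗ B) (X ◁ g) := by
  simp only [eHomWhiskerLeft, Category.assoc]
  rw [eComp_tensorLeftHom, ← eHomEquiv_tensorLeftHom, rightUnitor_inv_naturality_assoc,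
    MonoidalCategory.tensorHom_def', MonoidalCategory.whiskerLeft_comp, Category.assoc,
    Category.assoc, whisker_exchange_assoc, whisker_exchange_assoc]

lemma eHomWhiskerRight_tensorLeftHom (X : A) {B B' : A} (f : B ⟶ B') (Y : A) :
    eHomWhiskerRight V f Y ≫ tensorLeftHom V X B Y =
      tensorLeftHom V X B' Y ≫ eHomWhiskerRight V (X ◁ f) (X ⊗ Y) := by
  simp only [eHomWhiskerRight, Category.assoc]
  rw [eComp_tensorLeftHom, ← eHomEquiv_tensorLeftHom, leftUnitor_inv_naturality_assoc,
    MonoidalCategory.tensorHom_def, comp_whiskerRight, Category.assoc, Category.assoc,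
    whisker_exchange_assoc, whisker_exchange_assoc]

lemma eHomWhiskerLeft_tensorRightHom (W B : A) {Y Y' : A} (g : Y ⟶ Y') :
    eHomWhiskerLeft V B g ≫ tensorRightHom V W B Y' =
      tensorRightHom V W B Y ≫ eHomWhiskerLeft V (B ⊗ W) (g ▷ W) := by
  simp only [eHomWhiskerLeft, Category.assoc]
  rw [eComp_tensorRightHom, ← eHomEquiv_tensorRightHom, rightUnitor_inv_naturality_assoc,
    MonoidalCategory.tensorHom_def', MonoidalCategory.whiskerLeft_comp, Category.assoc,
    Category.assoc, whisker_exchange_assoc]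
  simp only [whisker_exchange_assoc]

lemma eHomWhiskerRight_tensorRightHom (W : A) {B B' : A} (f : B ⟶ B') (Y : A) :
    eHomWhiskerRight V f Y ≫ tensorRightHom V W B Y =
      tensorRightHom V W B' Y ≫ eHomWhiskerRight V (f ▷ W) (Y ⊗ W) := by
  simp only [eHomWhiskerRight, Category.assoc]
  rw [eComp_tensorRightHom, ← eHomEquiv_tensorRightHom, leftUnitor_inv_naturality_assoc,
    MonoidalCategory.tensorHom_def, comp_whiskerRight, Category.assoc, Category.assoc,
    whisker_exchange_assoc, whisker_exchange_assoc]

variable (V) in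
lemma eHomEquiv_tensorHomObj {U U' : A} (f : U ⟶ U') (W W' : A) :
    (λ_ (W ⟶[V] W')).inv ≫ eHomEquiv V f ▷ _ ≫ tensorHomObj U U' W W' =
      tensorLeftHom V U W W' ≫ eHomWhiskerLeft V (U ⊗ W) (f ▷ W') := by
  have h := congrArg (fun k => (ρ_ (W ⟶[V] W')).inv ≫ _ ◁ eHomEquiv V f ≫ k)
    (tensorLeftHom_tensorRightHom V U U' W W')
  simp only [MonoidalCategory.tensorHom_def', Category.assoc] at h
  rw [← MonoidalCategory.whiskerLeft_comp_assoc, eHomEquiv_tensorRightHom,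
    BraidedCategory.braiding_naturality_right_assoc, whisker_exchange_assoc,
    ← rightUnitor_inv_naturality_assoc] at h
  rw [eHomWhiskerLeft, h, braiding_tensorUnit_right]
  simp

variable (V) in
-- For fixed `f` the morphisms `f ▷ W` are `V`-natural in `W`: both sides equal the tensor product
-- on hom-objects with `f` inserted in the left variable.
lemma tensorLeftHom_whiskerRight {U U' : A} (f : U ⟶ U') (W W' : A) :
    tensorLeftHom V U W W' ≫ eHomWhiskerLeft V (U ⊗ W) (f ▷ W') =
      tensorLeftHom V U' W W' ≫ eHomWhiskerRight V (f ▷ W) (U' ⊗ W') := by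
  rw [← eHomEquiv_tensorHomObj, ← tensorRightHom_tensorLeftHom, eHomWhiskerRight,
    MonoidalCategory.tensorHom_def, Category.assoc, ← comp_whiskerRight_assoc,
    eHomEquiv_tensorRightHom, ← whisker_exchange_assoc, leftUnitor_inv_naturality_assoc]

variable (V) in
lemma tensorHomObj_eHomEquiv' (U U' : A) {W W' : A} (f : W ⟶ W') :
    (ρ_ (U ⟶[V] U')).inv ≫ _ ◁ eHomEquiv V f ≫ tensorHomObj U U' W W' =
      tensorRightHom V W' U U' ≫ eHomWhiskerRight V (U ◁ f) (U' ⊗ W') := by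
  have h := congrArg (fun k => (λ_ (U ⟶[V] U')).inv ≫ eHomEquiv V f ▷ _ ≫ k)
    (tensorLeftHom_tensorRightHom V U U' W W')
  simp only [MonoidalCategory.tensorHom_def, Category.assoc] at h
  rw [← comp_whiskerRight_assoc, eHomEquiv_tensorLeftHom,
    BraidedCategory.braiding_naturality_left_assoc, ← whisker_exchange_assoc,
    ← leftUnitor_inv_naturality_assoc] at h
  rw [eHomWhiskerRight, h, braiding_tensorUnit_left]
  simp

variable (V) in
lemma tensorRightHom_whiskerLeft (U U' : A) {W W' : A} (f : W ⟶ W') :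
    tensorRightHom V W U U' ≫ eHomWhiskerLeft V (U ⊗ W) (U' ◁ f) =
      tensorRightHom V W' U U' ≫ eHomWhiskerRight V (U ◁ f) (U' ⊗ W') := by
  rw [← tensorHomObj_eHomEquiv', ← tensorRightHom_tensorLeftHom, eHomWhiskerLeft,
    MonoidalCategory.tensorHom_def', Category.assoc, ← MonoidalCategory.whiskerLeft_comp_assoc,
    eHomEquiv_tensorLeftHom, whisker_exchange_assoc, rightUnitor_inv_naturality_assoc]

end whisker

/-! ### Internal homs, evaluation and coevaluation -/

section exp

variable {V : Type u} [Category.{v} V] [MonoidalCategory V] [BraidedCategory V]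
  {A : Type w} [Category.{w'} A] [MonoidalCategory A] [EnrichedOrdinaryCategory V A]
  [MonoidalVCategory V A] [RightClosed V A]

open MonoidalVCategory

namespace RightClosed

variable (V) in
/-- The effect on hom-objects of the `V`-functor `Y ↦ Y^X`. -/
def expRight (X Y Y' : A) : (Y ⟶[V] Y') ⟶ (exp V X Y ⟶[V] exp V X Y') :=
  ((λ_ _).inv ≫ eId V X ▷ _) ≫ expHom V X Y X Y'

variable (V) in
/-- The effect on hom-objects of the contravariant `V`-functor `X ↦ Y^X`. -/
def expLeft (X' X Y : A) : (X' ⟶[V] X) ⟶ (exp V X Y ⟶[V] exp V X' Y) :=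
  ((ρ_ _).inv ≫ _ ◁ eId V Y) ≫ expHom V X Y X' Y

lemma transpose_hom (X B Y : A) : (transpose V X B Y).hom =
    tensorLeftHom V X B (exp V X Y) ≫ eHomWhiskerLeft V (X ⊗ B) (eval X Y) := rfl

variable (V) in
-- `V`-naturality of evaluation in `Y`. With `hom_ext_transpose` it characterizes `expRight`.
lemma expRight_transpose (X Y Y' : A) :
    expRight V X Y Y' ≫ tensorLeftHom V X _ _ ≫ eHomWhiskerLeft V _ (eval X Y') =
      eHomWhiskerRight V (eval X Y) Y' := by
  rw [expRight, Category.assoc, expHom_transpose, expHomAux, Category.assoc,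
    ← comp_whiskerRight_assoc, reassoc_of% @eId_tensorRightHom, eId_eHomWhiskerLeft]
  rfl

variable (V) in
-- `V`-dinaturality of evaluation in `X`, which characterizes `expLeft` in the same way.
lemma expLeft_transpose (X' X Y : A) :
    expLeft V X' X Y ≫ tensorLeftHom V X' _ _ ≫ eHomWhiskerLeft V _ (eval X' Y) =
      tensorRightHom V (exp V X Y) X' X ≫ eHomWhiskerLeft V _ (eval X Y) := by
  rw [expLeft, Category.assoc, expHom_transpose, expHomAux, Category.assoc,
    whisker_exchange_assoc, ← rightUnitor_inv_naturality_assoc, e_comp_id, Category.comp_id]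

lemma hom_ext_transpose {T : V} {X B Y : A} {f g : T ⟶ (B ⟶[V] exp V X Y)}
    (h : f ≫ tensorLeftHom V X B (exp V X Y) ≫ eHomWhiskerLeft V (X ⊗ B) (eval X Y) =
      g ≫ tensorLeftHom V X B (exp V X Y) ≫ eHomWhiskerLeft V (X ⊗ B) (eval X Y)) : f = g := by
  rw [← transpose_hom] at h
  exact (cancel_mono _).1 h

variable (V) in
/-- The morphism `B ⟶ Y^X` corresponding to a morphism `X ⊗ B ⟶ Y`. -/
def lift {X B Y : A} (f : X ⊗ B ⟶ Y) : B ⟶ exp V X Y :=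
  (eHomEquiv V).symm (eHomEquiv V f ≫ (transpose V X B Y).inv)

omit [BraidedCategory V] [MonoidalCategory A] [MonoidalVCategory V A] [RightClosed V A] in
lemma eHomEquiv_eHomWhiskerLeft {X Y Z : A} (f : X ⟶ Y) (g : Y ⟶ Z) :
    eHomEquiv V f ≫ eHomWhiskerLeft V X g = eHomEquiv V (f ≫ g) := by
  rw [eHomEquiv_comp, eHomWhiskerLeft, rightUnitor_inv_naturality_assoc,
    MonoidalCategory.tensorHom_def, Category.assoc, unitors_inv_equal]

lemma eHomEquiv_transpose {X B Y : A} (f : B ⟶ exp V X Y) :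
    eHomEquiv V f ≫ (transpose V X B Y).hom = eHomEquiv V (X ◁ f ≫ eval X Y) := by
  rw [transpose_hom, reassoc_of% @eHomEquiv_tensorLeftHom, eHomEquiv_eHomWhiskerLeft]

@[simp]
lemma whiskerLeft_lift_eval {X B Y : A} (f : X ⊗ B ⟶ Y) : X ◁ lift V f ≫ eval (V := V) X Y = f := by
  apply (eHomEquiv V).injective
  rw [← eHomEquiv_transpose, lift, Equiv.apply_symm_apply, Category.assoc, Iso.inv_hom_id,
    Category.comp_id]

lemma hom_ext_eval {X B Y : A} {f g : B ⟶ exp V X Y}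
    (h : X ◁ f ≫ eval X Y = X ◁ g ≫ eval X Y) : f = g := by
  apply (eHomEquiv V).injective
  rw [← cancel_mono (transpose V X B Y).hom, eHomEquiv_transpose, eHomEquiv_transpose, h]

variable (V) in
/-- The composition `Z^X ⊗ Y^Z ⟶ Y^X` of internal homs. -/
def expComp (X Z Y : A) : exp V X Z ⊗ exp V Z Y ⟶ exp V X Y :=
  lift V ((α_ _ _ _).inv ≫ eval X Z ▷ exp V Z Y ≫ eval Z Y)

variable (V) in
/-- The coevaluation `U ⟶ (X ⊗ U)^X`. -/
def coeval (X U : A) : U ⟶ exp V X (X ⊗ U) := lift V (𝟙 (X ⊗ U))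

end RightClosed

end exp

section whisker

variable {V : Type u} [Category.{v} V] [MonoidalCategory V]
  {A : Type w} [Category.{w'} A] [EnrichedOrdinaryCategory V A]

lemma eHomWhisker_iso {T : V} {X X' Y Y' : A} {k : T ⟶ (X ⟶[V] Y)}
    {k' : T ⟶ (X' ⟶[V] Y')} {f : X ≅ X'} {g : Y ≅ Y'}
    (s : k ≫ eHomWhiskerLeft V X g.hom = k' ≫ eHomWhiskerRight V f.hom Y') :
    k' ≫ eHomWhiskerLeft V X' g.inv = k ≫ eHomWhiskerRight V f.inv Y := by
  have h := congrArg (· ≫ eHomWhiskerRight V f.inv Y' ≫ eHomWhiskerLeft V X' g.inv) s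
  simp only [Category.assoc] at h
  rw [← eHomWhiskerRight_comp_assoc, f.inv_hom_id, eHomWhiskerRight_id, Category.id_comp,
    eHom_whisker_exchange_assoc, ← eHomWhiskerLeft_comp, g.hom_inv_id, eHomWhiskerLeft_id,
    Category.comp_id] at h
  exact h.symm

variable (V) in
lemma eHomWhiskerLeft_eComp (X : A) {Y Y' : A} (g : Y ⟶ Y') (Z : A) :
    eHomWhiskerLeft V X g ▷ _ ≫ eComp V X Y' Z = _ ◁ eHomWhiskerRight V g Z ≫ eComp V X Y Z := by
  simp only [eHomWhiskerLeft, eHomWhiskerRight, MonoidalCategory.whiskerLeft_comp, Category.assoc,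
    comp_whiskerRight]
  rw [← e_assoc']
  simp

variable [BraidedCategory V] [MonoidalCategory A] [MonoidalVCategory V A]

open MonoidalVCategory

variable (V) in
lemma tensorLeftHom_associator_inv (U W Z Z' : A) :
    tensorLeftHom V W Z Z' ≫ tensorLeftHom V U _ _ ≫ eHomWhiskerLeft V _ (α_ U W Z').inv =
      tensorLeftHom V (U ⊗ W) Z Z' ≫ eHomWhiskerRight V (α_ U W Z).inv _ := by
  rw [← Category.assoc]
  exact eHomWhisker_iso (by rw [Category.assoc]; exact tensorLeftHom_associator V U W Z Z')

variable (V) in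
lemma tensorMiddleHom_associator_inv (U W W' Z : A) :
    tensorRightHom V Z W W' ≫ tensorLeftHom V U _ _ ≫ eHomWhiskerLeft V _ (α_ U W' Z).inv =
      tensorLeftHom V U W W' ≫ tensorRightHom V Z _ _ ≫ eHomWhiskerRight V (α_ U W Z).inv _ := by
  rw [← Category.assoc, ← Category.assoc]
  exact eHomWhisker_iso (by
    rw [Category.assoc, Category.assoc]; exact tensorMiddleHom_associator V U W W' Z)

variable (V) in
lemma tensorRightHom_associator_inv (U U' W Z : A) :
    tensorRightHom V (W ⊗ Z) U U' ≫ eHomWhiskerLeft V _ (α_ U' W Z).inv =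
      tensorRightHom V W U U' ≫ tensorRightHom V Z _ _ ≫
        eHomWhiskerRight V (α_ U W Z).inv _ := by
  rw [← Category.assoc (tensorRightHom V W U U')]
  exact eHomWhisker_iso (by rw [Category.assoc]; exact tensorRightHom_associator V U U' W Z)

end whisker

/-! ### Naturality of internal composition and of `A(U ⊗ W, Y^X) ≅ A(W, Y^(X ⊗ U))` -/

namespace RightClosed

variable {V : Type u} [Category.{v} V] [MonoidalCategory V] [SymmetricCategory V]
  {A : Type w} [Category.{w'} A] [MonoidalCategory A] [EnrichedOrdinaryCategory V A]
  [MonoidalVCategory V A] [RightClosed V A]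

open MonoidalVCategory

lemma whiskerLeft_expComp_eval (X Z Y : A) :
    X ◁ expComp V X Z Y ≫ eval X Y =
      (α_ _ _ _).inv ≫ eval X Z ▷ exp V Z Y ≫ eval Z Y :=
  whiskerLeft_lift_eval _

@[simp]
lemma whiskerLeft_coeval_eval (X U : A) : X ◁ coeval V X U ≫ eval (V := V) X (X ⊗ U) = 𝟙 _ :=
  whiskerLeft_lift_eval _

variable (V) in
lemma eHomWhiskerRight_transpose {X B B' Y : A} (f : B ⟶ B') :
    eHomWhiskerRight V f (exp V X Y) ≫ tensorLeftHom V X B _ ≫ eHomWhiskerLeft V _ (eval X Y) =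
      tensorLeftHom V X B' _ ≫ eHomWhiskerLeft V _ (eval X Y) ≫
        eHomWhiskerRight V (X ◁ f) Y := by
  rw [reassoc_of% @eHomWhiskerRight_tensorLeftHom, eHom_whisker_exchange]

variable (V) in
lemma expComp_transpose (B X Z Y : A) :
    eHomWhiskerLeft V B (expComp V X Z Y) ≫ tensorLeftHom V X B _ ≫
        eHomWhiskerLeft V _ (eval X Y) =
      tensorLeftHom V X B _ ≫ eHomWhiskerLeft V _ (α_ _ _ _).inv ≫
        eHomWhiskerLeft V _ (eval X Z ▷ exp V Z Y) ≫ eHomWhiskerLeft V _ (eval Z Y) := by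
  rw [reassoc_of% @eHomWhiskerLeft_tensorLeftHom, ← eHomWhiskerLeft_comp,
    whiskerLeft_expComp_eval, eHomWhiskerLeft_comp, eHomWhiskerLeft_comp]

variable (V) in
-- `V`-naturality of internal composition in `Y`: after transposition both sides are precomposition
-- with the iterated evaluation.
lemma expRight_expComp (X Z Y Y' : A) :
    expRight V Z Y Y' ≫ tensorLeftHom V (exp V X Z) _ _ ≫
        eHomWhiskerLeft V _ (expComp V X Z Y') =
      expRight V X Y Y' ≫ eHomWhiskerRight V (expComp V X Z Y) _ := by
  apply hom_ext_transpose
  simp only [Category.assoc]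
  rw [expComp_transpose, eHomWhiskerRight_transpose, reassoc_of% tensorLeftHom_associator_inv V,
    ← eHom_whisker_exchange_assoc, ← eHom_whisker_exchange,
    reassoc_of% @tensorLeftHom_whiskerRight, ← eHom_whisker_exchange_assoc,
    reassoc_of% expRight_transpose V, reassoc_of% expRight_transpose V, ← eHomWhiskerRight_comp,
    ← eHomWhiskerRight_comp, ← eHomWhiskerRight_comp, whiskerLeft_expComp_eval, Category.assoc]

variable (V) in
-- `V`-naturality of internal composition in the contravariant variable `X`.
lemma expLeft_expComp (X' X Z Y : A) :
    expLeft V X' X Z ≫ tensorRightHom V (exp V Z Y) _ _ ≫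
        eHomWhiskerLeft V _ (expComp V X' Z Y) =
      expLeft V X' X Y ≫ eHomWhiskerRight V (expComp V X Z Y) _ := by
  apply hom_ext_transpose
  simp only [Category.assoc]
  rw [expComp_transpose, eHomWhiskerRight_transpose, reassoc_of% tensorMiddleHom_associator_inv V,
    ← eHom_whisker_exchange_assoc, ← eHom_whisker_exchange,
    ← reassoc_of% @eHomWhiskerLeft_tensorRightHom, reassoc_of% expLeft_transpose V,
    reassoc_of% expLeft_transpose V, eHom_whisker_exchange V (X' ◁ _) (eval X Y),
    ← reassoc_of% tensorRightHom_whiskerLeft V, ← eHomWhiskerLeft_comp, whiskerLeft_expComp_eval]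
  simp only [eHomWhiskerLeft_comp]
  rw [reassoc_of% tensorRightHom_associator_inv V, ← eHom_whisker_exchange_assoc,
    ← eHom_whisker_exchange, ← reassoc_of% @eHomWhiskerLeft_tensorRightHom]

variable (V) in
-- Dinaturality of internal composition in the middle variable `Z`; this is what makes
-- `DayTensor.cayleyCopr` a cowedge.
lemma expRight_expLeft_expComp (X Z Z' Y : A) :
    expRight V X Z Z' ≫ tensorRightHom V (exp V Z' Y) _ _ ≫
        eHomWhiskerLeft V _ (expComp V X Z' Y) =
      expLeft V Z Z' Y ≫ tensorLeftHom V (exp V X Z) _ _ ≫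
        eHomWhiskerLeft V _ (expComp V X Z Y) := by
  apply hom_ext_transpose
  simp only [Category.assoc]
  rw [expComp_transpose, expComp_transpose, reassoc_of% tensorMiddleHom_associator_inv V,
    reassoc_of% tensorLeftHom_associator_inv V,
    ← eHom_whisker_exchange_assoc, ← eHom_whisker_exchange, ← eHom_whisker_exchange_assoc,
    ← eHom_whisker_exchange, ← reassoc_of% @eHomWhiskerLeft_tensorRightHom,
    reassoc_of% expRight_transpose V, reassoc_of% tensorLeftHom_whiskerRight V,
    ← eHom_whisker_exchange_assoc, reassoc_of% expLeft_transpose V,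
    reassoc_of% @eHomWhiskerRight_tensorRightHom, eHom_whisker_exchange_assoc]

variable (V) in
-- `V`-naturality of the coevaluation in `U`; after transposition it follows from the triangle
-- identity.
lemma tensorLeftHom_expRight_coeval (X U U' : A) :
    tensorLeftHom V X U U' ≫ expRight V X _ _ ≫ eHomWhiskerRight V (coeval V X U) _ =
      eHomWhiskerLeft V U (coeval V X U') := by
  apply hom_ext_transpose
  simp only [Category.assoc]
  rw [eHomWhiskerRight_transpose, reassoc_of% @eHomWhiskerLeft_tensorLeftHom,
    ← eHomWhiskerLeft_comp, reassoc_of% expRight_transpose V, ← eHomWhiskerRight_comp,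
    whiskerLeft_coeval_eval, whiskerLeft_coeval_eval]
  simp

variable (V) in
/-- The isomorphism `A(U ⊗ W, Y^X) ⟶ A(W, Y^(X ⊗ U))`. -/
def expTensor (X U W Y : A) : ((U ⊗ W : A) ⟶[V] exp V X Y) ⟶ (W ⟶[V] exp V (X ⊗ U) Y) :=
  (transpose V X (U ⊗ W) Y).hom ≫ eHomWhiskerRight V (α_ X U W).hom Y ≫
    (transpose V (X ⊗ U) W Y).inv

variable (V) in
lemma expTensor_transpose (X U W Y : A) :
    expTensor V X U W Y ≫ (transpose V (X ⊗ U) W Y).hom =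
      (transpose V X (U ⊗ W) Y).hom ≫ eHomWhiskerRight V (α_ X U W).hom Y := by
  simp [expTensor]

instance (X U W Y : A) : IsIso (expTensor V X U W Y) := by
  have : eHomWhiskerRight V (α_ X U W).hom Y ≫ eHomWhiskerRight V (α_ X U W).inv Y = 𝟙 _ := by
    rw [← eHomWhiskerRight_comp, Iso.inv_hom_id, eHomWhiskerRight_id]
  have : eHomWhiskerRight V (α_ X U W).inv Y ≫ eHomWhiskerRight V (α_ X U W).hom Y = 𝟙 _ := by
    rw [← eHomWhiskerRight_comp, Iso.hom_inv_id, eHomWhiskerRight_id]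
  have : IsIso (eHomWhiskerRight V (α_ X U W).hom Y) := ⟨_, by assumption, by assumption⟩
  unfold expTensor
  infer_instance

lemma coeval_whiskerRight_expComp_eval (X U Y : A) :
    X ◁ (coeval V X U ▷ exp V (X ⊗ U) Y ≫ expComp V X (X ⊗ U) Y) ≫ eval X Y =
      (α_ _ _ _).inv ≫ eval (X ⊗ U) Y := by
  rw [MonoidalCategory.whiskerLeft_comp, Category.assoc, whiskerLeft_expComp_eval,
    associator_inv_naturality_middle_assoc, ← comp_whiskerRight_assoc, whiskerLeft_coeval_eval]
  simp

variable (V) in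
-- The inverse of the transposition tensors with `U`, coevaluates and composes internally. As
-- `expTensor` is already invertible, it is enough to check the composite in the other order.
lemma expTensor_coeval (X U W Y : A) :
    expTensor V X U W Y ≫ tensorLeftHom V U W _ ≫
      eHomWhiskerLeft V _ (coeval V X U ▷ exp V (X ⊗ U) Y ≫ expComp V X (X ⊗ U) Y) = 𝟙 _ := by
  rw [← cancel_epi (inv (expTensor V X U W Y)), IsIso.inv_hom_id_assoc, Category.comp_id,
    ← cancel_mono (expTensor V X U W Y), IsIso.inv_hom_id,
    ← cancel_mono (transpose V (X ⊗ U) W Y).hom, Category.assoc, Category.assoc,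
    expTensor_transpose, transpose_hom, transpose_hom, Category.id_comp, Category.assoc,
    reassoc_of% @eHomWhiskerLeft_tensorLeftHom, ← eHomWhiskerLeft_comp_assoc,
    coeval_whiskerRight_expComp_eval, eHom_whisker_exchange,
    ← reassoc_of% tensorLeftHom_associator V, ← eHomWhiskerLeft_comp, Iso.hom_inv_id_assoc]

omit [SymmetricCategory V] [MonoidalCategory A] [MonoidalVCategory V A] [RightClosed V A] in
lemma eHomEquiv_eHomWhiskerRight {X Y Z : A} (f : X ⟶ Y) (g : Y ⟶ Z) :
    eHomEquiv V g ≫ eHomWhiskerRight V f Z = eHomEquiv V (f ≫ g) := by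
  rw [eHomEquiv_comp, eHomWhiskerRight, leftUnitor_inv_naturality_assoc,
    MonoidalCategory.tensorHom_def', Category.assoc]

lemma eHomEquiv_expTensor {X U W Y : A} (f : U ⊗ W ⟶ exp V X Y) :
    eHomEquiv V f ≫ expTensor V X U W Y =
      eHomEquiv V (lift V ((α_ X U W).hom ≫ X ◁ f ≫ eval X Y)) := by
  rw [← cancel_mono (transpose V (X ⊗ U) W Y).hom, Category.assoc, expTensor_transpose,
    eHomEquiv_transpose, whiskerLeft_lift_eval, reassoc_of% @eHomEquiv_transpose,
    eHomEquiv_eHomWhiskerRight]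

lemma eHomEquiv_expRight (X : A) {Y Y' : A} (f : Y ⟶ Y') :
    eHomEquiv V f ≫ expRight V X Y Y' = eHomEquiv V (lift V (eval X Y ≫ f)) := by
  rw [← cancel_mono (transpose V X _ Y').hom, Category.assoc, eHomEquiv_transpose,
    whiskerLeft_lift_eval, transpose_hom, expRight_transpose, eHomEquiv_eHomWhiskerRight]

lemma eHomEquiv_expLeft {X' X : A} (f : X' ⟶ X) (Y : A) :
    eHomEquiv V f ≫ expLeft V X' X Y = eHomEquiv V (lift V (f ▷ _ ≫ eval X Y)) := by
  rw [← cancel_mono (transpose V X' _ Y).hom, Category.assoc, eHomEquiv_transpose,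
    whiskerLeft_lift_eval, transpose_hom, expLeft_transpose, reassoc_of% @eHomEquiv_tensorRightHom,
    eHomEquiv_eHomWhiskerLeft]

variable (V) in
-- `V`-naturality of the transposition in `W`, from naturality of the associator of `A` in its last
-- variable.
lemma tensorLeftHom_eComp_expTensor (X U W W' Y : A) :
    (tensorLeftHom V U W W' ▷ _ ≫ eComp V _ _ _) ≫ expTensor V X U W Y =
      _ ◁ expTensor V X U W' Y ≫ eComp V _ _ _ := by
  rw [← cancel_mono (transpose V (X ⊗ U) W Y).hom]
  simp only [Category.assoc]
  rw [expTensor_transpose, reassoc_of% eComp_transpose V, eComp_transpose,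
    eComp_eHomWhiskerRight]
  have h := congrArg (fun k => k ▷ _ ≫ _ ◁ (transpose V X (U ⊗ W') Y).hom ≫ eComp V _ _ _)
    (tensorLeftHom_associator V X U W W')
  simp only [comp_whiskerRight, Category.assoc] at h
  rw [← whisker_exchange_assoc (eHomWhiskerLeft _ _ _) (transpose V X (U ⊗ W') Y).hom,
    eHomWhiskerLeft_eComp] at h
  simp only [MonoidalCategory.tensorHom_def, Category.assoc]
  rw [whisker_exchange_assoc (eHomWhiskerRight _ _ _), ← h, whisker_exchange_assoc,
    ← MonoidalCategory.whiskerLeft_comp_assoc, ← MonoidalCategory.whiskerLeft_comp_assoc,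
    ← expTensor_transpose, MonoidalCategory.whiskerLeft_comp_assoc]

variable (V) in
-- `V`-naturality of the transposition in `U`, which on the right enters contravariantly through
-- `Y^(X ⊗ U)`. It rests on naturality of the associator in its middle variable.
lemma tensorRightHom_eComp_expTensor (X U U' W Y : A) :
    (tensorRightHom V W U U' ▷ _ ≫ eComp V _ _ _) ≫ expTensor V X U W Y =
      (β_ _ _).hom ≫ (expTensor V X U' W Y ⊗ₘ
        (tensorLeftHom V X U U' ≫ expLeft V (X ⊗ U) (X ⊗ U') Y)) ≫ eComp V _ _ _ := by
  have h : (β_ _ _).hom ≫ (expTensor V X U' W Y ⊗ₘ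
        (tensorLeftHom V X U U' ≫ expLeft V (X ⊗ U) (X ⊗ U') Y)) ≫ eComp V _ _ _ ≫
          (transpose V (X ⊗ U) W Y).hom =
      ((tensorLeftHom V X U U' ≫ tensorRightHom V W _ _) ⊗ₘ
        (expTensor V X U' W Y ≫ (transpose V (X ⊗ U') W Y).hom)) ≫ eComp V _ _ _ := by
    rw [eComp_transpose, tensorHom_comp_tensorHom_assoc, transpose_hom, Category.assoc,
      expLeft_transpose, transpose_hom]
    have e {S S' T T' R R' R'' : V} (f : S ⟶ T) (g : T ⟶ R) (f' : S' ⟶ T') (g' : T' ⟶ R')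
      (k : R' ⟶ R'') : (f ≫ g ⊗ₘ f' ≫ g' ≫ k) = (f ⊗ₘ f') ≫ (g ⊗ₘ g') ≫ R ◁ k := by
      simp [← id_tensorHom]
    rw [e, e, Category.assoc, Category.assoc, Category.assoc, Category.assoc,
      ← eComp_eHomWhiskerLeft, ← eComp_eHomWhiskerLeft,
      reassoc_of% tensorLeftHom_tensorRightHom V, reassoc_of% tensorRightHom_tensorLeftHom V,
      BraidedCategory.braiding_naturality_assoc, SymmetricCategory.symmetry_assoc]
  rw [← cancel_mono (transpose V (X ⊗ U) W Y).hom]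
  simp only [Category.assoc]
  rw [h, expTensor_transpose, expTensor_transpose, reassoc_of% eComp_transpose V,
    eComp_eHomWhiskerRight]
  have h' := congrArg (fun k => k ▷ _ ≫ _ ◁ (transpose V X (U' ⊗ W) Y).hom ≫ eComp V _ _ _)
    (tensorMiddleHom_associator V X U U' W)
  simp only [comp_whiskerRight, Category.assoc] at h'
  rw [← whisker_exchange_assoc, eHomWhiskerLeft_eComp] at h'
  simp only [MonoidalCategory.tensorHom_def, comp_whiskerRight, Category.assoc,
    MonoidalCategory.whiskerLeft_comp]
  rw [whisker_exchange_assoc (eHomWhiskerRight _ _ _), ← h']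

end RightClosed

section actLeft

variable {V : Type u} [Category.{v} V] [MonoidalCategory V]

lemma actLeft_seq (B : V) {P M Q T S : V} (a : P ⊗ T ⟶ M) (a' : M ⊗ S ⟶ Q) :
    actLeft B ((α_ _ _ _).inv ≫ a ▷ S ≫ a') =
      (α_ _ _ _).inv ≫ actLeft B a ▷ S ≫ actLeft B a' := by
  unfold actLeft
  monoidal

lemma IsAction.actLeft {C : Type w} [EnrichedCategory V C] {m : C → V}
    {a : ∀ X Y : C, m X ⊗ (X ⟶[V] Y) ⟶ m Y} (h : IsAction a) (B : V) :
    IsAction (m := fun X => B ⊗ m X) (fun X Y => EnrichedCayley.actLeft B (a X Y)) where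
  id X := by
    rw [← actLeft_precomp, h.id, EnrichedCayley.actLeft]
    simp
  comp X Y Z := by rw [← actLeft_precomp, h.comp, actLeft_seq]

variable [SymmetricCategory V]

lemma swapRight_actRight {P Q T : V} (a : P ⊗ T ⟶ Q) (B : V) :
    swapRight P T B ≫ actRight a B = a ▷ B := by
  unfold actRight
  rw [reassoc_of% @swapRight_swapRight]

lemma actRight_comp {P Q Q' T : V} (a : P ⊗ T ⟶ Q) (f : Q ⟶ Q') (B : V) :
    actRight (a ≫ f) B = actRight a B ≫ f ▷ B := by
  simp [actRight]

lemma actRight_comp_left {P P' Q T : V} (f : P ⟶ P') (a : P' ⊗ T ⟶ Q) (B : V) :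
    actRight (f ▷ T ≫ a) B = f ▷ B ▷ T ≫ actRight a B := by
  unfold actRight
  rw [reassoc_of% @swapRight_naturality_left, comp_whiskerRight]

end actLeft

/-! ### The Cayley functor turns Day convolutions into composites of endomodules -/

section cayley

variable {V : Type u} [Category.{v} V] [MonoidalCategory V] [MonoidalClosed V]
  [SymmetricCategory V] {A : Type v} [Category.{w} A] [EnrichedOrdinaryCategory V A]
  [MonoidalCategory A] [MonoidalVCategory V A]

open MonoidalVCategory VFunctor RightClosed

/-- The hom-object of `A ⊗ A` factors through each variable in turn, so the cowedge condition may be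
checked in `U` and in `W` separately. -/
lemma isDayCowedge_of_actRight_actLeft {F G : VFunctor V A} {X : A} {T : V}
    (t : ∀ U W : A, (F.obj U ⊗ G.obj W) ⊗ ((U ⊗ W : A) ⟶[V] X) ⟶ T)
    (h₁ : ∀ U U' W, actRight (F.act U U') (G.obj W) ▷ _ ≫ t U' W =
      (α_ _ _ _).hom ≫ _ ◁ (tensorRightHom V W U U' ▷ _ ≫ eComp V _ _ _) ≫ t U W)
    (h₂ : ∀ U W W', actLeft (F.obj U) (G.act W W') ▷ _ ≫ t U W' =
      (α_ _ _ _).hom ≫ _ ◁ (tensorLeftHom V U W W' ▷ _ ≫ eComp V _ _ _) ≫ t U W) :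
    IsDayCowedge F G X t := fun U U' W W' => by
  change ptensor (F.act U U') (G.act W W') ▷ _ ≫ t U' W' = _
  rw [ptensor_eq, ← tensorRightHom_tensorLeftHom, comp_whiskerRight, comp_whiskerRight,
    Category.assoc, Category.assoc, h₂, associator_naturality_left_assoc,
    ← whisker_exchange_assoc, h₁, associator_naturality_right_assoc,
    ← MonoidalCategory.whiskerLeft_comp_assoc]
  have e : (U ⟶[V] U') ◁ (tensorLeftHom V U' W W' ▷ ((U' ⊗ W' : A) ⟶[V] X) ≫ eComp V _ _ _) ≫
      tensorRightHom V W U U' ▷ _ ≫ eComp V _ _ _ = (α_ _ _ _).inv ≫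
        ((tensorRightHom V W U U' ⊗ₘ tensorLeftHom V U' W W') ≫ eComp V _ _ _) ▷ _ ≫
          eComp V _ _ _ := by
    rw [whisker_exchange_assoc, MonoidalCategory.whiskerLeft_comp_assoc, ← e_assoc,
      MonoidalCategory.tensorHom_def]
    simp
  rw [e]
  monoidal

variable [RightClosed V A]

lemma cayleyObj_actL (F : VFunctor V A) (X' X Y : A) :
    Endomodule.actL (cayleyObj F) X' X Y = F.obj _ ◁ expLeft V X' X Y ≫ F.act _ _ :=
  (congrArg (_ ≫ ·) (cayleyObj_act F ⟨op X, Y⟩ ⟨op X', Y⟩)).trans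
    (MonoidalCategory.whiskerLeft_comp_assoc (F.obj (exp V X Y))
      ((ρ_ (X' ⟶[V] X)).inv ≫ _ ◁ eId V Y) (expHom V X Y X' Y) _).symm

lemma cayleyObj_actR (F : VFunctor V A) (X Y Y' : A) :
    Endomodule.actR (cayleyObj F) X Y Y' = F.obj _ ◁ expRight V X Y Y' ≫ F.act _ _ :=
  (congrArg (_ ≫ ·) (cayleyObj_act F ⟨op X, Y⟩ ⟨op X, Y'⟩)).trans
    (MonoidalCategory.whiskerLeft_comp_assoc (F.obj (exp V X Y))
      ((λ_ (Y ⟶[V] Y')).inv ≫ eId V X ▷ _) (expHom V X Y X Y') _).symm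

namespace DayTensor

variable {F G P : VFunctor V A} (D : DayTensor F G P)

/-- The universal family `F (Z^X) ⊗ G (Y^Z) ⟶ (F * G) (Y^X)`. -/
def cayleyCopr (X Z Y : A) : F.obj (exp V X Z) ⊗ G.obj (exp V Z Y) ⟶ P.obj (exp V X Y) :=
  D.ins _ _ ≫ P.mapHom (expComp V X Z Y)

lemma sq_cayleyCopr_left (X' X Z Y : A) :
    Sq (actRight (F.obj _ ◁ expLeft V X' X Z ≫ F.act _ _) (G.obj (exp V Z Y)))
      (P.obj _ ◁ expLeft V X' X Y ≫ P.act _ _) (D.cayleyCopr X Z Y) (D.cayleyCopr X' Z Y) := by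
  have h := (D.nat_left (exp V Z Y) (exp V X Z) (exp V X' Z)).precomp (expLeft V X' X Z)
  rw [shiftRight, ← MonoidalCategory.whiskerLeft_comp_assoc] at h
  rw [actRight_precomp]
  exact h.comp (Sq.actHom P.isAction ((Category.assoc _ _ _).trans (expLeft_expComp V X' X Z Y)))

lemma sq_cayleyCopr_right (X Z Y Y' : A) :
    Sq (actLeft (F.obj (exp V X Z)) (G.obj _ ◁ expRight V Z Y Y' ≫ G.act _ _))
      (P.obj _ ◁ expRight V X Y Y' ≫ P.act _ _) (D.cayleyCopr X Z Y) (D.cayleyCopr X Z Y') := by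
  have h := (D.nat_right (exp V X Z) (exp V Z Y) (exp V Z Y')).precomp (expRight V Z Y Y')
  rw [shiftLeft, ← MonoidalCategory.whiskerLeft_comp_assoc] at h
  rw [actLeft_precomp]
  exact h.comp (Sq.actHom P.isAction ((Category.assoc _ _ _).trans (expRight_expComp V X Z Y Y')))

/-- Naturality moves both sides to the universal map at `Z^X ⊗ Y^Z'`, where they agree by
dinaturality of internal composition in `Z`. -/
lemma dinat_cayleyCopr (X Z Z' Y : A) :
    actRight (F.obj _ ◁ expRight V X Z Z' ≫ F.act _ _) (G.obj (exp V Z' Y)) ≫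
        D.cayleyCopr X Z' Y =
      actLeft (F.obj (exp V X Z)) (G.obj _ ◁ expLeft V Z Z' Y ≫ G.act _ _) ≫
        D.cayleyCopr X Z Y := by
  have h := (D.nat_left (exp V Z' Y) (exp V X Z) (exp V X Z')).precomp (expRight V X Z Z')
  have h' := (D.nat_right (exp V X Z) (exp V Z' Y) (exp V Z Y)).precomp (expLeft V Z Z' Y)
  have e := act_actHom P.isAction (exp V X Z ⊗ exp V Z' Y) (expComp V X Z' Y)
  have e' := act_actHom P.isAction (exp V X Z ⊗ exp V Z' Y) (expComp V X Z Y)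
  unfold Sq at h h'
  rw [Category.assoc] at h h'
  rw [actRight_precomp, actLeft_precomp, cayleyCopr, cayleyCopr, Category.assoc, Category.assoc,
    reassoc_of% h, reassoc_of% h', shiftRight, shiftLeft]
  simp only [Category.assoc]
  erw [e, e']
  simp only [← MonoidalCategory.whiskerLeft_comp_assoc]
  rw [expRight_expLeft_expComp]

section desc

variable {X Y : A} {T : V} (k : ∀ Z, F.obj (exp V X Z) ⊗ G.obj (exp V Z Y) ⟶ T)

/-- The family on `F U ⊗ G W ⊗ A(U ⊗ W, Y^X)` induced by a family on `F (Z^X) ⊗ G (Y^Z)`. -/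
def cayleyFamily (U W : A) : (F.obj U ⊗ G.obj W) ⊗ ((U ⊗ W : A) ⟶[V] exp V X Y) ⟶ T :=
  _ ◁ expTensor V X U W Y ≫ actLeft (F.obj U) (G.act W (exp V (X ⊗ U) Y)) ≫
    F.mapHom (coeval V X U) ▷ _ ≫ k (X ⊗ U)

variable {k} (hk : ∀ Z Z', actRight (F.obj _ ◁ expRight V X Z Z' ≫ F.act _ _) (G.obj (exp V Z' Y)) ≫
        k Z' =
      actLeft (F.obj (exp V X Z)) (G.obj _ ◁ expLeft V Z Z' Y ≫ G.act _ _) ≫ k Z)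
include hk

omit D in
-- In `W` this is naturality of the transposition and functoriality of `G`. In `U` the dinaturality
-- of `k` is essential: an element of `A(U, U')` acts on `F U`, passes through the coevaluation to
-- `X ⊗ U`, crosses `k` to the side of `G`, and is absorbed by the naturality of the transposition
-- in `U`.
lemma isDayCowedge_cayleyFamily : IsDayCowedge F G (exp V X Y) (cayleyFamily k) := by
  refine isDayCowedge_of_actRight_actLeft _ (fun U U' W => ?_) (fun U W W' => ?_)
  · have e₁ := Sq.actLeft_actRight_exchange (F.act U U') (G.act W (exp V (X ⊗ U') Y))
    -- Naturality of the coevaluation rewrites the action on `F U` as an action on `F ((X ⊗ U)^X)`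
    -- along `X ⊗ -`, the form to which `hk` applies.
    have e₂ : F.act U U' ≫ F.mapHom (coeval V X U') = (F.mapHom (coeval V X U) ▷ _ ≫
        F.obj (exp V X (X ⊗ U)) ◁ tensorLeftHom V X U U') ≫
          F.obj _ ◁ expRight V X _ _ ≫ F.act _ _ := by
      have e := act_actHom F.isAction U (coeval V X U')
      rw [← tensorLeftHom_expRight_coeval, ← Category.assoc, MonoidalCategory.whiskerLeft_comp_assoc,
        ← actHom_act F.isAction, whisker_exchange_assoc] at e
      exact e.trans (by rw [MonoidalCategory.whiskerLeft_comp_assoc, Category.assoc]; rfl)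
    have e₃ := congrArg (actRight · (G.obj (exp V (X ⊗ U') Y))) e₂
    rw [Category.assoc, actRight_comp, actRight_comp_left, actRight_precomp] at e₃
    have e₄ := Sq.actLeft_whiskerRight (F.mapHom (coeval V X U)) (G.obj (exp V (X ⊗ U') Y) ◁
      expLeft V (X ⊗ U) (X ⊗ U') Y ≫ G.act _ _)
    have e₅ := (G.isAction.actLeft (F.obj U)).comp W (exp V (X ⊗ U') Y) (exp V (X ⊗ U) Y)
    rw [Iso.eq_inv_comp] at e₅
    unfold Sq at e₁ e₄
    have e₆ : actRight (F.act U U') (G.obj W) ▷ (W ⟶[V] exp V (X ⊗ U') Y) ≫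
        actLeft (F.obj U') (G.act W (exp V (X ⊗ U') Y)) = swapRight _ _ _ ≫
          actLeft (F.obj U) (G.act W (exp V (X ⊗ U') Y)) ▷ (U ⟶[V] U') ≫
            actRight (F.act U U') _ := by
      rw [← e₁, reassoc_of% @swapRight_actRight]
    unfold cayleyFamily
    rw [← MonoidalCategory.whiskerLeft_comp_assoc, tensorRightHom_eComp_expTensor,
      ← whisker_exchange_assoc, reassoc_of% e₆, reassoc_of% e₃, hk,
      ← whisker_exchange_assoc, ← reassoc_of% e₄, actLeft_precomp, Category.assoc]
    have e₇ : (F.obj U ⊗ G.obj (exp V (X ⊗ U') Y)) ◁ tensorLeftHom V X U U' ≫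
        (F.obj U ⊗ G.obj (exp V (X ⊗ U') Y)) ◁ expLeft V (X ⊗ U) (X ⊗ U') Y =
      (F.obj U ⊗ G.obj (exp V (X ⊗ U') Y)) ◁
        (tensorLeftHom V X U U' ≫ expLeft V (X ⊗ U) (X ⊗ U') Y) := by simp
    have e₈ : F.obj U ◁ G.obj W ◁ (U ⟶[V] U') ◁ expTensor V X U' W Y ≫
        F.obj U ◁ G.obj W ◁ (β_ _ _).hom = F.obj U ◁ G.obj W ◁ (β_ _ _).hom ≫
          F.obj U ◁ G.obj W ◁ expTensor V X U' W Y ▷ _ := by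
      simp only [← MonoidalCategory.whiskerLeft_comp, BraidedCategory.braiding_naturality_right]
    rw [reassoc_of% e₇, ← whisker_exchange_assoc, ← reassoc_of% e₅]
    simp [swapRight, MonoidalCategory.tensorHom_def, reassoc_of% e₈]
  · have e := (G.isAction.actLeft (F.obj U)).comp W W' (exp V (X ⊗ U) Y)
    rw [Iso.eq_inv_comp] at e
    unfold cayleyFamily
    rw [← MonoidalCategory.whiskerLeft_comp_assoc, tensorLeftHom_eComp_expTensor,
      ← whisker_exchange_assoc, ← reassoc_of% e]
    simp

omit D in
-- Dinaturality of `k` evaluated at an ordinary morphism; it is needed for the evaluation `X ⊗ Z^X ⟶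
-- Z`.
lemma mapHom_dinat {Z Z' : A} (f : Z ⟶ Z') :
    F.mapHom (lift V (eval X Z ≫ f)) ▷ _ ≫ k Z' =
      F.obj (exp V X Z) ◁ G.mapHom (lift V (f ▷ _ ≫ eval Z' Y)) ≫ k Z := by
  have h := congrArg ((ρ_ _).inv ≫ _ ◁ eHomEquiv V f ≫ ·) (hk Z Z')
  simp only [actRight_precomp, actLeft_precomp, ← MonoidalCategory.whiskerLeft_comp_assoc,
    eHomEquiv_expRight, eHomEquiv_expLeft, Category.assoc] at h
  have e : (ρ_ _).inv ≫ _ ◁ eHomEquiv V (lift V (eval (V := V) X Z ≫ f)) ≫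
      actRight (F.act _ _) (G.obj (exp V Z' Y)) = F.mapHom _ ▷ _ := actHom_actRight _ _
  have e' : (ρ_ _).inv ≫ _ ◁ eHomEquiv V (lift V (f ▷ _ ≫ eval (V := V) Z' Y)) ≫
      actLeft (F.obj (exp V X Z)) (G.act _ _) = _ ◁ G.mapHom _ := actHom_actLeft _ _
  rw [← reassoc_of% e', ← reassoc_of% e, h]

/-- Evaluate the family at `U = Z^X`, `W = Y^Z` and the element `expComp`. Its transpose is induced
by the evaluation `X ⊗ Z^X ⟶ Z`; dinaturality of `k` moves this evaluation to the side of `F`, where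
it cancels the coevaluation. -/
lemma cayleyCopr_desc {d : P.obj (exp V X Y) ⟶ T}
    (hd : ∀ U W, (D.ins U W ▷ _ ≫ P.act (U ⊗ W) _) ≫ d = cayleyFamily k U W) (Z : A) :
    D.cayleyCopr X Z Y ≫ d = k Z := by
  have h := congrArg ((ρ_ _).inv ≫ _ ◁ eHomEquiv V (expComp V X Z Y) ≫ ·)
    (hd (exp V X Z) (exp V Z Y))
  have e : (ρ_ _).inv ≫ _ ◁ eHomEquiv V (lift V (eval (V := V) X Z ▷ exp V Z Y ≫ eval Z Y)) ≫
      actLeft (F.obj (exp V X Z)) (G.act _ _) = _ ◁ G.mapHom _ := actHom_actLeft _ _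
  -- A triangle identity between coevaluation and evaluation.
  have e' : coeval V X (exp V X Z) ≫ lift V (eval X (X ⊗ exp V X Z) ≫ eval X Z) = 𝟙 _ :=
    hom_ext_eval (V := V) (by
      rw [MonoidalCategory.whiskerLeft_comp, Category.assoc, whiskerLeft_lift_eval,
        reassoc_of% @whiskerLeft_coeval_eval]
      simp)
  unfold cayleyFamily at h
  rw [← MonoidalCategory.whiskerLeft_comp_assoc, eHomEquiv_expTensor, whiskerLeft_expComp_eval,
    Iso.hom_inv_id_assoc, reassoc_of% e, whisker_exchange_assoc, ← mapHom_dinat hk,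
    ← comp_whiskerRight_assoc, mapHom_comp, e', mapHom_id, id_whiskerRight, Category.id_comp,
    Category.assoc, whisker_exchange_assoc, ← rightUnitor_inv_naturality_assoc] at h
  rw [← h, cayleyCopr, mapHom]
  simp

omit hk in
-- Naturality of the universal map moves the coevaluation and the action past it, and
-- `expTensor_coeval` then cancels the transposition. Uniqueness in `isUniversal_cayleyCopr` rests
-- on this.
lemma cayleyFamily_cayleyCopr (U W : A) :
    cayleyFamily (fun Z => D.cayleyCopr X Z Y) U W = D.ins U W ▷ _ ≫ P.act (U ⊗ W) _ := by
  have h := D.nat_right U W (exp V (X ⊗ U) Y)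
  have e := act_actHom P.isAction (U ⊗ W)
    (coeval V X U ▷ exp V (X ⊗ U) Y ≫ expComp V X (X ⊗ U) Y)
  unfold Sq shiftLeft at h
  unfold cayleyFamily cayleyCopr
  rw [reassoc_of% D.mapHom_whiskerRight_ins, reassoc_of% h, mapHom_comp, mapHom]
  refine (congrArg (fun k => _ ◁ expTensor V X U W Y ≫ D.ins U W ▷ _ ≫ _ ≫ k) e).trans ?_
  rw [whisker_exchange_assoc, ← MonoidalCategory.whiskerLeft_comp_assoc,
    ← MonoidalCategory.whiskerLeft_comp_assoc, Category.assoc, expTensor_coeval]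
  simp

omit hk in
lemma cayleyFamily_comp {T' : V} (f : T ⟶ T') (U W : A) :
    cayleyFamily k U W ≫ f = cayleyFamily (fun Z => k Z ≫ f) U W := by
  simp [cayleyFamily]

end desc

/-- Factorizations of a dinatural `k` through this family are the same as factorizations of
`cayleyFamily k` through the Day coend, of which there is exactly one. -/
lemma isUniversal_cayleyCopr (X Y : A) :
    IsUniversal (i := Prod.snd) (j := Prod.fst)
      (fun r : A × A => actRight (F.obj _ ◁ expRight V X r.1 r.2 ≫ F.act _ _)
        (G.obj (exp V r.2 Y)))
      (fun r => actLeft (F.obj (exp V X r.1)) (G.obj _ ◁ expLeft V r.1 r.2 Y ≫ G.act _ _))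
      (fun Z => D.cayleyCopr X Z Y) where
  condition r := D.dinat_cayleyCopr X r.1 r.2 Y
  existsUnique_desc k hk := by
    have hk' := fun Z Z' => hk (Z, Z')
    obtain ⟨d, hd, hd'⟩ := D.existsUnique_desc (exp V X Y) _ (isDayCowedge_cayleyFamily hk')
    refine ⟨d, D.cayleyCopr_desc hk' hd, fun d' h => hd' d' fun U W => ?_⟩
    rw [← cayleyFamily_cayleyCopr, cayleyFamily_comp]
    exact congrArg (fun k => cayleyFamily k U W) (funext h)

/-- The Cayley functor sends Day convolutions to composites of endomodules. -/
def cayley : EndoTensor (cayleyObj F) (cayleyObj G) (cayleyObj P) where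
  copr X Z Y := D.cayleyCopr X Z Y
  nat_left X' X Z Y := by
    rw [cayleyObj_actL, cayleyObj_actL]
    exact D.sq_cayleyCopr_left X' X Z Y
  nat_right X Z Y Y' := by
    rw [cayleyObj_actR, cayleyObj_actR]
    exact D.sq_cayleyCopr_right X Z Y Y'
  isUniversal X Y := by
    simp only [cayleyObj_actL, cayleyObj_actR]
    exact D.isUniversal_cayleyCopr X Y

end DayTensor

end cayley

/-! ### Associativity of internal composition and `A(X, Y) ≅ A(𝟙, Y^X)` -/

namespace RightClosed

variable {V : Type u} [Category.{v} V] [MonoidalCategory V] [SymmetricCategory V]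
  {A : Type w} [Category.{w'} A] [MonoidalCategory A] [EnrichedOrdinaryCategory V A]
  [MonoidalVCategory V A] [RightClosed V A]

open MonoidalVCategory

variable (V) in
-- Both sides evaluate to the threefold iterated evaluation.
lemma expComp_assoc (X Z W Y : A) :
    expComp V X Z W ▷ exp V W Y ≫ expComp V X W Y =
      (α_ _ _ _).hom ≫ exp V X Z ◁ expComp V Z W Y ≫ expComp V X Z Y := by
  apply hom_ext_eval
  have e := whisker_exchange (eval (V := V) X Z) (expComp V Z W Y)
  have e' := congrArg (· ▷ exp V W Y) (whiskerLeft_expComp_eval (V := V) X Z W)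
  simp only [comp_whiskerRight, MonoidalCategory.whiskerLeft_comp, Category.assoc] at e' ⊢
  rw [whiskerLeft_expComp_eval, whiskerLeft_expComp_eval, associator_inv_naturality_middle_assoc,
    reassoc_of% e', associator_inv_naturality_right_assoc, reassoc_of% e,
    whiskerLeft_expComp_eval]
  simp

variable (V) in
/-- The isomorphism `A(X, Y) ⟶ A(𝟙, Y^X)`. -/
def expUnit (X Y : A) : (X ⟶[V] Y) ⟶ (𝟙_ A ⟶[V] exp V X Y) :=
  eHomWhiskerRight V (ρ_ X).hom Y ≫ (transpose V X (𝟙_ A) Y).inv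

variable (V) in
/-- The inverse of `expUnit`. -/
def expUnitInv (X Y : A) : (𝟙_ A ⟶[V] exp V X Y) ⟶ (X ⟶[V] Y) :=
  (transpose V X (𝟙_ A) Y).hom ≫ eHomWhiskerRight V (ρ_ X).inv Y

lemma expUnit_expUnitInv (X Y : A) : expUnit V X Y ≫ expUnitInv V X Y = 𝟙 _ := by
  rw [expUnit, expUnitInv, Category.assoc, Iso.inv_hom_id_assoc, ← eHomWhiskerRight_comp,
    Iso.inv_hom_id, eHomWhiskerRight_id]

lemma expUnitInv_expUnit (X Y : A) : expUnitInv V X Y ≫ expUnit V X Y = 𝟙 _ := by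
  rw [expUnit, expUnitInv, Category.assoc, ← eHomWhiskerRight_comp_assoc,
    Iso.hom_inv_id, eHomWhiskerRight_id, Category.id_comp, Iso.hom_inv_id]

variable (V) in
lemma expUnit_transpose (X Y : A) :
    expUnit V X Y ≫ tensorLeftHom V X (𝟙_ A) _ ≫ eHomWhiskerLeft V _ (eval X Y) =
      eHomWhiskerRight V (ρ_ X).hom Y := by
  rw [← transpose_hom, expUnit, Category.assoc, Iso.inv_hom_id, Category.comp_id]

variable (V) in
-- Internal composition with the name of an element of `A(X, Z)` is the contravariant effect of that
-- element. This gives left unitality of `Υ`.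
lemma expUnit_tensorRightHom_expComp (X Z Y : A) :
    expUnit V X Z ≫ tensorRightHom V (exp V Z Y) (𝟙_ A) (exp V X Z) ≫
        eHomWhiskerRight V (λ_ (exp V Z Y)).inv _ ≫ eHomWhiskerLeft V _ (expComp V X Z Y) =
      expLeft V X Z Y := by
  apply hom_ext_transpose
  simp only [Category.assoc]
  rw [expLeft_transpose, expComp_transpose, reassoc_of% @eHomWhiskerRight_tensorLeftHom,
    ← eHom_whisker_exchange_assoc, reassoc_of% tensorMiddleHom_associator_inv V,
    ← eHom_whisker_exchange_assoc, ← eHom_whisker_exchange_assoc,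
    ← reassoc_of% @eHomWhiskerLeft_tensorRightHom, reassoc_of% expUnit_transpose V,
    reassoc_of% @eHomWhiskerRight_tensorRightHom, ← eHomWhiskerRight_comp_assoc,
    ← eHomWhiskerRight_comp_assoc]
  simp

variable (V) in
-- The covariant counterpart, for an element of `A(Z, Y)`; it gives right unitality.
lemma expUnit_tensorLeftHom_expComp (X Z Y : A) :
    expUnit V Z Y ≫ tensorLeftHom V (exp V X Z) (𝟙_ A) (exp V Z Y) ≫
        eHomWhiskerRight V (ρ_ (exp V X Z)).inv _ ≫ eHomWhiskerLeft V _ (expComp V X Z Y) =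
      expRight V X Z Y := by
  apply hom_ext_transpose
  simp only [Category.assoc]
  rw [expRight_transpose, expComp_transpose, reassoc_of% @eHomWhiskerRight_tensorLeftHom,
    ← eHom_whisker_exchange_assoc, reassoc_of% tensorLeftHom_associator_inv V,
    ← eHom_whisker_exchange_assoc, ← eHom_whisker_exchange_assoc,
    reassoc_of% tensorLeftHom_whiskerRight V, ← eHom_whisker_exchange,
    ← eHom_whisker_exchange_assoc, ← eHom_whisker_exchange_assoc,
    reassoc_of% expUnit_transpose V, ← eHomWhiskerRight_comp,
    ← eHomWhiskerRight_comp, ← eHomWhiskerRight_comp]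
  simp

variable (V) in
lemma eComp_expUnit_left (X' X Y : A) :
    ((β_ _ _).hom ≫ eComp V X' X Y) ≫ expUnit V X' Y =
      expUnit V X Y ▷ _ ≫ _ ◁ expLeft V X' X Y ≫ eComp V _ _ _ := by
  rw [← cancel_mono (transpose V X' (𝟙_ A) Y).hom]
  simp only [Category.assoc]
  have h : expUnit V X Y ▷ _ ≫ tensorLeftHom V X' (𝟙_ A) (exp V X Y) ▷ _ ≫
      _ ◁ tensorRightHom V (exp V X Y) X' X ≫ eComp V _ _ _ =
      (β_ _ _).hom ≫ tensorRightHom V (𝟙_ A) X' X ▷ _ ≫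
        _ ◁ (expUnit V X Y ≫ tensorLeftHom V X (𝟙_ A) (exp V X Y)) ≫ eComp V _ _ _ := by
    rw [← MonoidalCategory.tensorHom_def_assoc, tensorLeftHom_tensorRightHom,
      BraidedCategory.braiding_naturality_left_assoc, ← tensorRightHom_tensorLeftHom,
      MonoidalCategory.tensorHom_def_assoc, whisker_exchange_assoc,
      ← MonoidalCategory.whiskerLeft_comp_assoc]
  rw [eComp_transpose, transpose_hom, transpose_hom, expUnit_transpose, eComp_eHomWhiskerRight,
    MonoidalCategory.tensorHom_def_assoc, whisker_exchange_assoc,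
    ← MonoidalCategory.whiskerLeft_comp_assoc, expLeft_transpose,
    MonoidalCategory.whiskerLeft_comp_assoc, ← eComp_eHomWhiskerLeft, reassoc_of% h,
    eComp_eHomWhiskerLeft, ← MonoidalCategory.whiskerLeft_comp_assoc, Category.assoc,
    expUnit_transpose, ← eHomWhiskerLeft_eComp, ← comp_whiskerRight_assoc,
    tensorRightHom_rightUnitor]

variable (V) in
lemma eComp_expUnit_right (X Y Y' : A) :
    eComp V X Y Y' ≫ expUnit V X Y' =
      expUnit V X Y ▷ _ ≫ _ ◁ expRight V X Y Y' ≫ eComp V _ _ _ := by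
  rw [← cancel_mono (transpose V X (𝟙_ A) Y').hom]
  simp only [Category.assoc]
  rw [eComp_transpose, transpose_hom, transpose_hom, expUnit_transpose, eComp_eHomWhiskerRight]
  rw [MonoidalCategory.tensorHom_def_assoc, whisker_exchange_assoc,
    ← MonoidalCategory.whiskerLeft_comp_assoc, expRight_transpose, ← eHomWhiskerLeft_eComp,
    ← comp_whiskerRight_assoc, ← comp_whiskerRight_assoc, Category.assoc, expUnit_transpose]

end RightClosed

/-! ### Comparison of two choices of composite -/

section endoTensor

variable {V : Type u} [Category.{v} V] [MonoidalCategory V] [MonoidalClosed V]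
  [SymmetricCategory V] {A : Type v} [Category.{w} A] [EnrichedOrdinaryCategory V A]

open VFunctor Endomodule

namespace EndoTensor

variable {S T P S' T' P' S'' T'' P'' : Endomodule V A} {D : EndoTensor S T P}
  {D' : EndoTensor S' T' P'} {D'' : EndoTensor S'' T'' P''}

lemma IsTensorHom.comp {f : S ⟶ S'} {g : T ⟶ T'} {k : P ⟶ P'} {f' : S' ⟶ S''} {g' : T' ⟶ T''}
    {k' : P' ⟶ P''} (h : IsTensorHom D D' f g k) (h' : IsTensorHom D' D'' f' g' k') :
    IsTensorHom D D'' (f ≫ f') (g ≫ g') (k ≫ k') := fun X Z Y => by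
  rw [comp_app, comp_app, comp_app, reassoc_of% (h X Z Y), h' X Z Y,
    tensorHom_comp_tensorHom_assoc]

lemma IsTensorHom.id : IsTensorHom D D (𝟙 S) (𝟙 T) (𝟙 P) := fun X Z Y => by
  rw [id_app, id_app, id_app, Category.comp_id, id_tensorHom_id]
  exact (Category.id_comp _).symm

lemma IsTensorHom.unique {f : S ⟶ S'} {g : T ⟶ T'} {k k' : P ⟶ P'} (h : IsTensorHom D D' f g k)
    (h' : IsTensorHom D D' f g k') : k = k' :=
  D.hom_ext fun X Z Y => (h X Z Y).trans (h' X Z Y).symm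

lemma exists_comparison (D : EndoTensor S T P) (D' : EndoTensor S T P') :
    ∃ f : P ⟶ P', IsTensorHom D D' (𝟙 S) (𝟙 T) f := by
  obtain ⟨f, hf⟩ := D.exists_hom D'.copr D'.dinat D'.nat_left D'.nat_right
  refine ⟨f, fun X Z Y => (hf X Z Y).trans ?_⟩
  rw [id_app, id_app, id_tensorHom_id]
  exact (Category.id_comp _).symm

/-- Two composites of the same endomodules are isomorphic. -/
def comparison (D : EndoTensor S T P) (D' : EndoTensor S T P') : P ≅ P' where
  hom := (D.exists_comparison D').choose
  inv := (D'.exists_comparison D).choose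
  hom_inv_id := by
    have h := (D.exists_comparison D').choose_spec.comp (D'.exists_comparison D).choose_spec
    rw [Category.comp_id, Category.comp_id] at h
    exact h.unique IsTensorHom.id
  inv_hom_id := by
    have h := (D'.exists_comparison D).choose_spec.comp (D.exists_comparison D').choose_spec
    rw [Category.comp_id, Category.comp_id] at h
    exact h.unique IsTensorHom.id

lemma isTensorHom_comparison (D : EndoTensor S T P) (D' : EndoTensor S T P') :
    IsTensorHom D D' (𝟙 S) (𝟙 T) (comparison D D').hom :=
  (D.exists_comparison D').choose_spec

lemma copr_comparison (D : EndoTensor S T P) (D' : EndoTensor S T P') (X Z Y : A) :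
    D.copr X Z Y ≫ app (comparison D D').hom ⟨op X, Y⟩ = D'.copr X Z Y := by
  rw [isTensorHom_comparison D D' X Z Y, id_app, id_app, id_tensorHom_id]
  exact Category.id_comp _

end EndoTensor

end endoTensor

/-! ### `Υ` carries the unit, the associator and the unit isomorphisms across -/

section cayley

variable {V : Type u} [Category.{v} V] [MonoidalCategory V] [MonoidalClosed V]
  [SymmetricCategory V] {A : Type v} [Category.{w} A] [EnrichedOrdinaryCategory V A]
  [MonoidalCategory A] [MonoidalVCategory V A]

open MonoidalVCategory VFunctor RightClosed

omit [MonoidalClosed V] [SymmetricCategory V] in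
lemma whiskerRight_actLeft {E T M : V} {i : 𝟙_ V ⟶ E} {a : E ⊗ T ⟶ M} {x : T ⟶ M} (B : V)
    (h : i ▷ T ≫ a = (λ_ T).hom ≫ x) : (B ◁ i) ▷ T ≫ actLeft B a = (ρ_ B).hom ▷ T ≫ B ◁ x := by
  rw [actLeft, associator_naturality_middle_assoc, ← MonoidalCategory.whiskerLeft_comp, h]
  simp

omit [MonoidalClosed V] in
lemma whiskerRight_actRight {E T M : V} {i : 𝟙_ V ⟶ E} {a : E ⊗ T ⟶ M} {x : T ⟶ M} (B : V)
    (h : i ▷ T ≫ a = (λ_ T).hom ≫ x) :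
    i ▷ B ▷ T ≫ actRight a B = (λ_ B).hom ▷ T ≫ (β_ B T).hom ≫ x ▷ B := by
  rw [← actRight_comp_left, h, actRight_comp]
  unfold actRight swapRight
  simp

omit [SymmetricCategory V] [MonoidalVCategory V A] in
variable (V) in
/-- The identification of `A(𝟙, W)` with the value of `A(𝟙, -)` at `W`. -/
def toDayUnit (W : A) : ((𝟙_ A) ⟶[V] W) ⟶ (dayUnit V A).obj W := 𝟙 ((𝟙_ A) ⟶[V] W)

omit [SymmetricCategory V] [MonoidalVCategory V A] in
lemma dayUnitId_act (W : A) : dayUnitId V A ▷ ((𝟙_ A) ⟶[V] W) ≫ (dayUnit V A).act (𝟙_ A) W =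
    (λ_ _).hom ≫ toDayUnit V W := by
  rw [dayUnit_act]
  exact (eId_whiskerRight_eComp _ _).trans (Category.comp_id _).symm

namespace DayTensor

variable {F G H P Q R P' Q' F' G' : VFunctor V A}

/-- The unit isomorphism is prescribed only at the identity of `𝟙`; naturality extends the formula
to all of `A(𝟙, W)`. -/
lemma IsLeftUnitor.ins_app_unit {D : DayTensor (dayUnit V A) F P} {k : P ⟶ F}
    (h : IsLeftUnitor D k) (U W : A) :
    toDayUnit V W ▷ F.obj U ≫ D.ins W U ≫ app k (W ⊗ U) =
      (β_ _ _).hom ≫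
        F.obj U ◁ (tensorRightHom V U (𝟙_ A) W ≫ eHomWhiskerRight V (λ_ U).inv _) ≫
          F.act U (W ⊗ U) := by
  have s := (D.nat_left U (𝟙_ A) W).comp ((isNat_app k).shiftRight U (𝟙_ A) W)
  have e := congrArg (fun a => dayUnitId V A ▷ F.obj U ▷ ((𝟙_ A) ⟶[V] W) ≫ a) s
  have e' := whiskerRight_actRight (F.obj U) (dayUnitId_act (V := V) W)
  dsimp only at e
  rw [reassoc_of% e', ← comp_whiskerRight_assoc, h.ins_app, comp_whiskerRight_assoc,
    EnrichedCayley.shiftRight, ← whisker_exchange_assoc] at e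
  have e₂ : F.mapHom (λ_ U).inv ▷ _ ≫ F.act _ (W ⊗ U) = _ := actHom_act F.isAction (λ_ U).inv _
  rw [e₂, cancel_epi,
    ← MonoidalCategory.whiskerLeft_comp_assoc] at e
  rw [← e, SymmetricCategory.symmetry_assoc]

lemma IsRightUnitor.ins_app_unit {D : DayTensor F (dayUnit V A) P} {k : P ⟶ F}
    (h : IsRightUnitor D k) (U W : A) :
    F.obj U ◁ toDayUnit V W ≫ D.ins U W ≫ app k (U ⊗ W) =
      F.obj U ◁ (tensorLeftHom V U (𝟙_ A) W ≫ eHomWhiskerRight V (ρ_ U).inv _) ≫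
        F.act U (U ⊗ W) := by
  have s := (D.nat_right U (𝟙_ A) W).comp ((isNat_app k).shiftLeft U (𝟙_ A) W)
  have e := congrArg (fun a => (F.obj U ◁ dayUnitId V A) ▷ ((𝟙_ A) ⟶[V] W) ≫ a) s
  have e' := whiskerRight_actLeft (F.obj U) (dayUnitId_act (V := V) W)
  dsimp only at e
  rw [reassoc_of% e', ← comp_whiskerRight_assoc, h.ins_app, comp_whiskerRight_assoc,
    EnrichedCayley.shiftLeft, cancel_epi, ← whisker_exchange_assoc] at e
  have e₂ : F.mapHom (ρ_ U).inv ▷ _ ≫ F.act _ (U ⊗ W) = _ := actHom_act F.isAction (ρ_ U).inv _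
  rw [e₂, ← MonoidalCategory.whiskerLeft_comp_assoc] at e
  exact e

end DayTensor

variable [RightClosed V A]

variable (V A) in
/-- The isomorphism `A(-, -) ≅ Υ(A(𝟙, -))`. -/
def cayleyUnit : homEndomodule V A ≅ cayleyObj (dayUnit V A) :=
  isoOfComponents
    (Endomodule.homMk (T := homEndomodule V A) (K := cayleyObj (dayUnit V A))
      (fun X Y => expUnit V X Y)
      (fun X' X Y => by
        rw [homEndomodule_actL, cayleyObj_actL, dayUnit_act]
        exact eComp_expUnit_left V X' X Y)
      (fun X Y Y' => by
        rw [homEndomodule_actR, cayleyObj_actR, dayUnit_act]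
        exact eComp_expUnit_right V X Y Y'))
    (fun P => expUnitInv V P.fst.unop P.snd)
    (fun P => expUnit_expUnitInv P.fst.unop P.snd)
    (fun P => expUnitInv_expUnit P.fst.unop P.snd)

lemma cayleyUnit_hom_app (X Y : A) : app (cayleyUnit V A).hom ⟨op X, Y⟩ =
    expUnit V X Y ≫ toDayUnit V (exp V X Y) := (Category.comp_id _).symm

/-- The morphism of endomodules induced by a morphism of `V`-functors. -/
def cayleyMap {F G : VFunctor V A} (k : F ⟶ G) : cayleyObj F ⟶ cayleyObj G where
  app P := app k (exp V P.fst.unop P.snd)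
  naturality P Q := by
    rw [cayleyObj_act, cayleyObj_act]
    exact (isNat_app k _ _).precomp ((expFunctor V).map P Q)

namespace DayTensor

variable {F G H P Q R P' Q' F' G' : VFunctor V A}

lemma IsTensorHom.cayley {D : DayTensor F G P} {D' : DayTensor F' G' P'} {f : F ⟶ F'} {g : G ⟶ G'}
    {k : P ⟶ P'} (h : IsTensorHom D D' f g k) :
    D.cayley.IsTensorHom D'.cayley (cayleyMap f) (cayleyMap g) (cayleyMap k) := fun X Z Y => by
  change (D.ins _ _ ≫ P.mapHom _) ≫ app k _ = (app f _ ⊗ₘ app g _) ≫ D'.ins _ _ ≫ P'.mapHom _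
  rw [Category.assoc, mapHom_app, reassoc_of% (h (exp V X Z) (exp V Z Y))]

/-- The associator of `A` coming from the Day associator cancels against the one in the
associativity of internal composition. -/
lemma IsAssociator.cayley {D₁ : DayTensor F G P} {D₂ : DayTensor P H Q} {D₃ : DayTensor G H P'}
    {D₄ : DayTensor F P' Q'} {k : Q ⟶ Q'} (h : IsAssociator D₁ D₂ D₃ D₄ k) :
    D₁.cayley.IsAssociator D₂.cayley D₃.cayley D₄.cayley (cayleyMap k) := fun X Z W Y => by
  change (D₁.ins _ _ ≫ P.mapHom _) ▷ H.obj (exp V W Y) ≫ (D₂.ins _ (exp V W Y) ≫ Q.mapHom _) ≫ app k _ =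
    (α_ _ _ _).hom ≫ F.obj _ ◁ (D₃.ins _ (exp V W Y) ≫ P'.mapHom _) ≫ D₄.ins _ _ ≫ Q'.mapHom _
  rw [comp_whiskerRight_assoc, Category.assoc, reassoc_of% D₂.mapHom_whiskerRight_ins,
    ← Category.assoc (Q.mapHom _), mapHom_comp, mapHom_app,
    reassoc_of% (h.ins_app (exp V X Z) (exp V Z W) (exp V W Y)), mapHom_comp,
    MonoidalCategory.whiskerLeft_comp_assoc, reassoc_of% D₄.whiskerLeft_mapHom_ins, mapHom_comp,
    expComp_assoc, Iso.inv_hom_id_assoc]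

/-- Naturality of `k` brings internal composition to act on `F`, where
`expUnit_tensorRightHom_expComp` turns it into the contravariant action required of a left unit
isomorphism. -/
lemma IsLeftUnitor.cayleyCopr_app {D : DayTensor (dayUnit V A) F P} {k : P ⟶ F}
    (h : IsLeftUnitor D k) (X Z Y : A) :
    (expUnit V X Z ≫ toDayUnit V (exp V X Z)) ▷ F.obj (exp V Z Y) ≫
        D.cayleyCopr X Z Y ≫ app k (exp V X Y) =
      (β_ _ _).hom ≫ F.obj _ ◁ expLeft V X Z Y ≫ F.act _ _ := by
  have e : F.act (exp V Z Y) _ ≫ F.mapHom (expComp V X Z Y) = _ := act_actHom F.isAction _ _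
  have e' := h.ins_app_unit (exp V Z Y) (exp V X Z)
  rw [cayleyCopr, Category.assoc, mapHom_app, comp_whiskerRight_assoc, reassoc_of% e', e,
    BraidedCategory.braiding_naturality_left_assoc, ← MonoidalCategory.whiskerLeft_comp_assoc,
    ← MonoidalCategory.whiskerLeft_comp_assoc, Category.assoc, Category.assoc,
    expUnit_tensorRightHom_expComp]

lemma IsRightUnitor.cayleyCopr_app {D : DayTensor F (dayUnit V A) P} {k : P ⟶ F}
    (h : IsRightUnitor D k) (X Z Y : A) :
    F.obj (exp V X Z) ◁ (expUnit V Z Y ≫ toDayUnit V (exp V Z Y)) ≫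
        D.cayleyCopr X Z Y ≫ app k (exp V X Y) =
      F.obj _ ◁ expRight V X Z Y ≫ F.act _ _ := by
  have e : F.act (exp V X Z) _ ≫ F.mapHom (expComp V X Z Y) = _ := act_actHom F.isAction _ _
  have e' := h.ins_app_unit (exp V X Z) (exp V Z Y)
  rw [cayleyCopr, Category.assoc, mapHom_app, MonoidalCategory.whiskerLeft_comp_assoc,
    reassoc_of% e', e, ← MonoidalCategory.whiskerLeft_comp_assoc,
    ← MonoidalCategory.whiskerLeft_comp_assoc, Category.assoc, Category.assoc,
    expUnit_tensorLeftHom_expComp]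

end DayTensor

end cayley

open MonoidalVCategory VFunctor RightClosed

/-! ### The structure isomorphisms of `Υ` and their coherence -/

section tensorHom

variable {V : Type u} [Category.{v} V] [MonoidalCategory V] [MonoidalClosed V]
  [SymmetricCategory V] [HasLimits V] {C : Type v} [EnrichedCategory V C]
  [MonoidalCategory (VFunctor V C)] [MonoidalVCategory V (VFunctor V C)]

/-- In a monoidal `V`-category the tensor product of morphisms is forced by its effect on
hom-objects. -/
lemma IsHomTensor.tensorHom {J : Type*} {s s' o : J → C} {F G F' G' : VFunctor V C}
    {e : ∀ j, F.obj (s j) ⊗ G.obj (s' j) ⟶ (F ⊗ G).obj (o j)}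
    {e' : ∀ j, F'.obj (s j) ⊗ G'.obj (s' j) ⟶ (F' ⊗ G').obj (o j)}
    (h : IsHomTensor e e' (tensorHomObj F F' G G')) (f : F ⟶ F') (g : G ⟶ G') (j : J) :
    e j ≫ app (f ⊗ₘ g) (o j) = (app f (s j) ⊗ₘ app g (s' j)) ≫ e' j := by
  obtain ⟨k, hk, hk'⟩ := h.exists_tensorHom f g
  have e : f ⊗ₘ g = k :=
    (eHomEquiv V).injective ((tensorHomObj_eHomEquiv (V := V) f g).symm.trans hk')
  rw [e, hk]

end tensorHom

section dayTensor

variable {V : Type u} [Category.{v} V] [MonoidalCategory V] [MonoidalClosed V]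
  [SymmetricCategory V] [HasLimits V] {A : Type v} [Category.{w} A] [EnrichedOrdinaryCategory V A]
  [MonoidalCategory A] [MonoidalVCategory V A]
  [MonoidalCategory (VFunctor V A)] [MonoidalVCategory V (VFunctor V A)]
  {d : ∀ F G : VFunctor V A, DayTensor F G (F ⊗ G)}
  (hd : ∀ F F' G G', DayTensor.IsHom (d F G) (d F' G') (tensorHomObj F F' G G'))

include hd in
lemma whiskerRight_isTensorHom {F F' : VFunctor V A} (f : F ⟶ F') (G : VFunctor V A) :
    DayTensor.IsTensorHom (d F G) (d F' G) f (𝟙 G) (f ▷ G) := fun U W => by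
  rw [← tensorHom_id]
  exact (hd F F' G G).tensorHom f (𝟙 G) (U, W)

include hd in
lemma whiskerLeft_isTensorHom (F : VFunctor V A) {G G' : VFunctor V A} (g : G ⟶ G') :
    DayTensor.IsTensorHom (d F G) (d F G') (𝟙 F) g (F ◁ g) := fun U W => by
  rw [← id_tensorHom]
  exact (hd F F G G').tensorHom (𝟙 F) g (U, W)

end dayTensor

section cayley

variable {V : Type u} [Category.{v} V] [MonoidalCategory V] [MonoidalClosed V]
  [SymmetricCategory V] [HasLimits V] {A : Type v} [Category.{w} A] [EnrichedOrdinaryCategory V A]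
  [MonoidalCategory A] [MonoidalVCategory V A] [RightClosed V A]

lemma underlying_cayley_map {F G : VFunctor V A} (k : F ⟶ G) :
    (underlying (cayley V A)).map k = cayleyMap k := by
  apply (eHomEquiv V).injective
  have h : ofNat k ≫ cayleyHom F G = ofNat (cayleyMap k) := homObj_ext fun P => by
    rw [MonoidalCategory.whiskerLeft_comp_assoc, cayleyHom_ev, ofNat_ev]
    exact ofNat_ev k _
  exact ((eHomEquiv V).apply_symm_apply _).trans h

lemma DayTensor.IsHom.cayleyCopr_ev {F F' G G' P P' : VFunctor V A} {D : DayTensor F G P}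
    {D' : DayTensor F' G' P'} {h : homObj F F' ⊗ homObj G G' ⟶ homObj P P'} (hh : IsHom D D' h)
    (X Z Y : A) :
    D.cayleyCopr X Z Y ▷ _ ≫ P.obj _ ◁ h ≫ ev P P' (exp V X Y) =
      ptensor (ev F F' (exp V X Z)) (ev G G' (exp V Z Y)) ≫ D'.cayleyCopr X Z Y := by
  rw [cayleyCopr, comp_whiskerRight_assoc, mapHom_whiskerLeft_ev, Category.assoc,
    reassoc_of% (hh.ins_ev (exp V X Z) (exp V Z Y))]
  rfl

variable [MonoidalCategory (VFunctor V A)]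
  [MonoidalCategory (Endomodule V A)] [MonoidalVCategory V (Endomodule V A)]
  (d : ∀ F G : VFunctor V A, DayTensor F G (F ⊗ G))
  (e : ∀ S T : Endomodule V A, EndoTensor S T (S ⊗ T))

/-- The isomorphism `Υ F ⊗ Υ G ≅ Υ (F * G)`. -/
def cayleyMuIso (F G : VFunctor V A) :
    cayleyObj F ⊗ cayleyObj G ≅ cayleyObj (F ⊗ G) :=
  (e (cayleyObj F) (cayleyObj G)).comparison (d F G).cayley

variable {d e}
variable (he : ∀ S S' T T', EndoTensor.IsHom (e S T) (e S' T') (tensorHomObj S S' T T'))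

include he in
lemma isTensorHom_cayleyMuIso_left {F : VFunctor V A} {S : Endomodule V A}
    (f : S ⟶ cayleyObj F) (G : VFunctor V A) :
    (e S (cayleyObj G)).IsTensorHom (d F G).cayley f (𝟙 _)
      (f ▷ cayleyObj G ≫ (cayleyMuIso d e F G).hom) := by
  have h : (e S (cayleyObj G)).IsTensorHom (e (cayleyObj F) (cayleyObj G)) f (𝟙 _)
    (f ⊗ₘ 𝟙 _) := fun X Z Y => (he _ _ _ _).tensorHom f (𝟙 _) (X, Z, Y)
  have h' := h.comp (EndoTensor.isTensorHom_comparison _ (d F G).cayley)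
  rwa [Category.comp_id, Category.comp_id, tensorHom_id] at h'

include he in
lemma isTensorHom_cayleyMuIso_right {G : VFunctor V A} {S : Endomodule V A} (F : VFunctor V A)
    (f : S ⟶ cayleyObj G) :
    (e (cayleyObj F) S).IsTensorHom (d F G).cayley (𝟙 _) f
      (cayleyObj F ◁ f ≫ (cayleyMuIso d e F G).hom) := by
  have h : (e (cayleyObj F) S).IsTensorHom (e (cayleyObj F) (cayleyObj G)) (𝟙 _) f
    (𝟙 _ ⊗ₘ f) := fun X Z Y => (he _ _ _ _).tensorHom (𝟙 _) f (X, Z, Y)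
  have h' := h.comp (EndoTensor.isTensorHom_comparison _ (d F G).cayley)
  rwa [Category.comp_id, Category.comp_id, id_tensorHom] at h'

variable [MonoidalVCategory V (VFunctor V A)]
  (hd : ∀ F F' G G', DayTensor.IsHom (d F G) (d F' G') (tensorHomObj F F' G G'))

include hd he in
-- On the coprojections of the given composite, both sides become the tensor product of the
-- evaluations at `Z^X` and `Y^Z` followed by the Cayley family.
lemma cayleyMuIso_naturality (F F' G G' : VFunctor V A) :
    (cayleyHom F F' ⊗ₘ cayleyHom G G') ≫
        tensorHomObj (cayleyObj F) (cayleyObj F') (cayleyObj G) (cayleyObj G') ≫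
          eHomWhiskerLeft V (cayleyObj F ⊗ cayleyObj G) (cayleyMuIso d e F' G').hom =
      tensorHomObj F F' G G' ≫ cayleyHom (F ⊗ G) (F' ⊗ G') ≫
        eHomWhiskerRight V (cayleyMuIso d e F G).hom (cayleyObj (F' ⊗ G')) := by
  refine (e (cayleyObj F) (cayleyObj G)).homObj_ext fun X Z Y => ?_
  have w := whiskerLeft_eHomWhiskerLeft_ev (cayleyObj F ⊗ cayleyObj G)
    (cayleyMuIso d e F' G').hom ⟨op X, Y⟩
  have w' := whiskerLeft_eHomWhiskerRight_ev (cayleyMuIso d e F G).hom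
    (cayleyObj (F' ⊗ G')) ⟨op X, Y⟩
  have l := (he (cayleyObj F) (cayleyObj F') (cayleyObj G) (cayleyObj G')).copr_ev X Z Y
  have c := (e (cayleyObj F) (cayleyObj G)).copr_comparison (d F G).cayley X Z Y
  have c' := (e (cayleyObj F') (cayleyObj G')).copr_comparison (d F' G').cayley X Z Y
  have r := (hd F F' G G').cayleyCopr_ev X Z Y
  have m := cayleyHom_ev (F ⊗ G) (F' ⊗ G') ⟨op X, Y⟩
  have p : (_ ⊗ _) ◁ (cayleyHom F F' ⊗ₘ cayleyHom G G') ≫ ptensor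
      (ev (cayleyObj F) (cayleyObj F') ⟨op X, Z⟩) (ev (cayleyObj G) (cayleyObj G') ⟨op Z, Y⟩) =
      ptensor (ev F F' (exp V X Z)) (ev G G' (exp V Z Y)) := by
    rw [ptensor_precomp, cayleyHom_ev, cayleyHom_ev]
    rfl
  have L : (e (cayleyObj F) (cayleyObj G)).copr X Z Y ▷ _ ≫
      (cayleyObj F ⊗ cayleyObj G).at X Y ◁ ((cayleyHom F F' ⊗ₘ cayleyHom G G') ≫
        tensorHomObj (cayleyObj F) (cayleyObj F') (cayleyObj G) (cayleyObj G') ≫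
          eHomWhiskerLeft V (cayleyObj F ⊗ cayleyObj G) (cayleyMuIso d e F' G').hom) ≫
        ev (cayleyObj F ⊗ cayleyObj G) (cayleyObj (F' ⊗ G')) ⟨op X, Y⟩ =
      ptensor (ev F F' (exp V X Z)) (ev G G' (exp V Z Y)) ≫ (d F' G').cayleyCopr X Z Y := by
    simp only [MonoidalCategory.whiskerLeft_comp, Category.assoc] at w ⊢
    rw [w, ← whisker_exchange_assoc, reassoc_of% l, reassoc_of% p]
    exact congrArg (_ ≫ ·) c'
  have R : (e (cayleyObj F) (cayleyObj G)).copr X Z Y ▷ _ ≫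
      (cayleyObj F ⊗ cayleyObj G).at X Y ◁ (tensorHomObj F F' G G' ≫
        cayleyHom (F ⊗ G) (F' ⊗ G') ≫
          eHomWhiskerRight V (cayleyMuIso d e F G).hom (cayleyObj (F' ⊗ G'))) ≫
        ev (cayleyObj F ⊗ cayleyObj G) (cayleyObj (F' ⊗ G')) ⟨op X, Y⟩ =
      ptensor (ev F F' (exp V X Z)) (ev G G' (exp V Z Y)) ≫ (d F' G').cayleyCopr X Z Y := by
    simp only [MonoidalCategory.whiskerLeft_comp, Category.assoc] at w' ⊢
    rw [w', whisker_exchange_assoc, whisker_exchange_assoc, ← comp_whiskerRight_assoc, m]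
    exact (congrArg (· ▷ _ ≫ _) c).trans r
  exact L.trans R.symm

end cayley

open MonoidalVCategory VFunctor RightClosed

section cayley

variable {V : Type u} [Category.{v} V] [MonoidalCategory V] [MonoidalClosed V]
  [SymmetricCategory V] {A : Type v} [Category.{w} A] [EnrichedOrdinaryCategory V A]
  [MonoidalCategory A] [MonoidalVCategory V A] [RightClosed V A]

lemma cayleyMap_id (F : VFunctor V A) : cayleyMap (𝟙 F) = 𝟙 (cayleyObj F) := rfl

lemma cayleyMap_comp {F G H : VFunctor V A} (k : F ⟶ G) (l : G ⟶ H) :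
    cayleyMap (k ≫ l) = cayleyMap k ≫ cayleyMap l := rfl

/-- The isomorphism of endomodules induced by an isomorphism of `V`-functors. -/
def cayleyMapIso {F G : VFunctor V A} (k : F ≅ G) : cayleyObj F ≅ cayleyObj G where
  hom := cayleyMap k.hom
  inv := cayleyMap k.inv
  hom_inv_id := by rw [← cayleyMap_comp, k.hom_inv_id, cayleyMap_id]
  inv_hom_id := by rw [← cayleyMap_comp, k.inv_hom_id, cayleyMap_id]

variable [HasLimits V] [MonoidalCategory (VFunctor V A)]
  [MonoidalCategory (Endomodule V A)] [MonoidalVCategory V (Endomodule V A)]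
  {d : ∀ F G : VFunctor V A, DayTensor F G (F ⊗ G)}
  {e : ∀ S T : Endomodule V A, EndoTensor S T (S ⊗ T)}
  (he : ∀ S S' T T', EndoTensor.IsHom (e S T) (e S' T') (tensorHomObj S S' T T'))

include he in
-- The associators belong to two choices of composites, the given ones and those coming from Day
-- convolution, so this is an instance of `EndoTensor.IsAssociator.naturality`.
lemma cayleyMuIso_associativity
    (haD : ∀ F G H, DayTensor.IsAssociator (d F G) (d (F ⊗ G) H) (d G H) (d F (G ⊗ H)) (α_ F G H).hom)
    (haE : ∀ R S T, EndoTensor.IsAssociator (e R S) (e (R ⊗ S) T) (e S T) (e R (S ⊗ T))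
      (α_ R S T).hom) (F G H : VFunctor V A) :
    (cayleyMuIso d e F G).hom ▷ cayleyObj H ≫ (cayleyMuIso d e (F ⊗ G) H).hom ≫
        cayleyMap (α_ F G H).hom =
      (α_ (cayleyObj F) (cayleyObj G) (cayleyObj H)).hom ≫
        cayleyObj F ◁ (cayleyMuIso d e G H).hom ≫ (cayleyMuIso d e F (G ⊗ H)).hom :=
  (Category.assoc _ _ _).symm.trans <|
    (haE (cayleyObj F) (cayleyObj G) (cayleyObj H)).naturality (haD F G H).cayley
      (EndoTensor.isTensorHom_comparison _ _) (isTensorHom_cayleyMuIso_left he _ H)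
      (EndoTensor.isTensorHom_comparison _ _) (isTensorHom_cayleyMuIso_right he F _)

variable [MonoidalVCategory V (VFunctor V A)]
  (hd : ∀ F F' G G', DayTensor.IsHom (d F G) (d F' G') (tensorHomObj F F' G G'))

include hd he in
lemma cayleyMuIso_natural_left {F F' : VFunctor V A} (f : F ⟶ F') (G : VFunctor V A) :
    cayleyMap f ▷ cayleyObj G ≫ (cayleyMuIso d e F' G).hom =
      (cayleyMuIso d e F G).hom ≫ cayleyMap (f ▷ G) := by
  have h := (EndoTensor.isTensorHom_comparison (e _ _) (d F G).cayley).comp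
    (whiskerRight_isTensorHom hd f G).cayley
  rw [cayleyMap_id, Category.id_comp, Category.id_comp] at h
  exact (isTensorHom_cayleyMuIso_left he (cayleyMap f) G).unique h

include hd he in
lemma cayleyMuIso_natural_right (F : VFunctor V A) {G G' : VFunctor V A} (g : G ⟶ G') :
    cayleyObj F ◁ cayleyMap g ≫ (cayleyMuIso d e F G').hom =
      (cayleyMuIso d e F G).hom ≫ cayleyMap (F ◁ g) := by
  have h := (EndoTensor.isTensorHom_comparison (e _ _) (d F G).cayley).comp
    (whiskerLeft_isTensorHom hd F g).cayley
  rw [cayleyMap_id, Category.id_comp, Category.id_comp] at h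
  exact (isTensorHom_cayleyMuIso_right he F (cayleyMap g)).unique h

variable {iD : dayUnit V A ≅ 𝟙_ (VFunctor V A)} {iE : homEndomodule V A ≅ 𝟙_ (Endomodule V A)}

include hd he in
-- Naturality of the structure isomorphism reduces to the literal units `A(𝟙, -)` and `A(-, -)`;
-- there both sides restrict on coprojections to the contravariant action on `Υ F`.
lemma cayleyMuIso_left_unitality {F : VFunctor V A}
    (hD : DayTensor.IsLeftUnitor (d (dayUnit V A) F) (iD.hom ▷ F ≫ (λ_ F).hom))
    (hE : EndoTensor.IsLeftUnitor (e (homEndomodule V A) (cayleyObj F))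
      (iE.hom ▷ cayleyObj F ≫ (λ_ (cayleyObj F)).hom)) :
    (λ_ (cayleyObj F)).hom =
      (iE.symm ≪≫ cayleyUnit V A ≪≫ cayleyMapIso iD).hom ▷ cayleyObj F ≫
        (cayleyMuIso d e (𝟙_ _) F).hom ≫ cayleyMap (λ_ F).hom := by
  have h : iE.hom ▷ cayleyObj F ≫ (λ_ (cayleyObj F)).hom =
      ((cayleyUnit V A).hom ▷ cayleyObj F ≫ (cayleyMuIso d e (dayUnit V A) F).hom) ≫
        cayleyMap (iD.hom ▷ F ≫ (λ_ F).hom) :=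
    (e _ _).hom_ext fun X Z Y => by
      refine (hE X Z Y).trans ?_
      have l := isTensorHom_cayleyMuIso_left (d := d) he (cayleyUnit V A).hom F X Z Y
      rw [id_app, tensorHom_id, cayleyUnit_hom_app] at l
      rw [comp_app, reassoc_of% l, cayleyObj_actL]
      exact (hD.cayleyCopr_app X Z Y).symm
  rw [← cancel_epi (iE.hom ▷ cayleyObj F), h, cayleyMap_comp, Category.assoc,
    ← reassoc_of% cayleyMuIso_natural_left he hd iD.hom F]
  simp only [Iso.trans_hom, Iso.symm_hom, comp_whiskerRight, Category.assoc,
    hom_inv_whiskerRight_assoc]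
  rfl

include hd he in
lemma cayleyMuIso_right_unitality {F : VFunctor V A}
    (hD : DayTensor.IsRightUnitor (d F (dayUnit V A)) (F ◁ iD.hom ≫ (ρ_ F).hom))
    (hE : EndoTensor.IsRightUnitor (e (cayleyObj F) (homEndomodule V A))
      (cayleyObj F ◁ iE.hom ≫ (ρ_ (cayleyObj F)).hom)) :
    (ρ_ (cayleyObj F)).hom =
      cayleyObj F ◁ (iE.symm ≪≫ cayleyUnit V A ≪≫ cayleyMapIso iD).hom ≫
        (cayleyMuIso d e F (𝟙_ _)).hom ≫ cayleyMap (ρ_ F).hom := by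
  have h : cayleyObj F ◁ iE.hom ≫ (ρ_ (cayleyObj F)).hom =
      (cayleyObj F ◁ (cayleyUnit V A).hom ≫ (cayleyMuIso d e F (dayUnit V A)).hom) ≫
        cayleyMap (F ◁ iD.hom ≫ (ρ_ F).hom) :=
    (e _ _).hom_ext fun X Z Y => by
      refine (hE X Z Y).trans ?_
      have l := isTensorHom_cayleyMuIso_right (d := d) he F (cayleyUnit V A).hom X Z Y
      rw [id_app, id_tensorHom, cayleyUnit_hom_app] at l
      rw [comp_app, reassoc_of% l, cayleyObj_actR]
      exact (hD.cayleyCopr_app X Z Y).symm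
  rw [← cancel_epi (cayleyObj F ◁ iE.hom), h, cayleyMap_comp, Category.assoc,
    ← reassoc_of% cayleyMuIso_natural_right he hd F iD.hom]
  simp only [Iso.trans_hom, Iso.symm_hom, MonoidalCategory.whiskerLeft_comp, Category.assoc,
    whiskerLeft_hom_inv_assoc]
  rfl

include hd he in
lemma nonempty_strongMonoidal_cayley
    (haD : ∀ F G H, DayTensor.IsAssociator (d F G) (d (F ⊗ G) H) (d G H) (d F (G ⊗ H)) (α_ F G H).hom)
    (hlD : ∀ F, DayTensor.IsLeftUnitor (d (dayUnit V A) F) (iD.hom ▷ F ≫ (λ_ F).hom))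
    (hrD : ∀ F, DayTensor.IsRightUnitor (d F (dayUnit V A)) (F ◁ iD.hom ≫ (ρ_ F).hom))
    (haE : ∀ R S T, EndoTensor.IsAssociator (e R S) (e (R ⊗ S) T) (e S T) (e R (S ⊗ T))
      (α_ R S T).hom)
    (hlE : ∀ T, EndoTensor.IsLeftUnitor (e (homEndomodule V A) T) (iE.hom ▷ T ≫ (λ_ T).hom))
    (hrE : ∀ S, EndoTensor.IsRightUnitor (e S (homEndomodule V A)) (S ◁ iE.hom ≫ (ρ_ S).hom)) :
    Nonempty (StrongMonoidal (cayley V A)) := by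
  let c : (underlying (cayley V A)).CoreMonoidal :=
    -- The given units are only isomorphic to `A(-, -)` and `A(𝟙, -)`, so the canonical unit
    -- isomorphism is composed with both identifications.
    { εIso := iE.symm ≪≫ cayleyUnit V A ≪≫ cayleyMapIso iD
      μIso := fun F G => cayleyMuIso d e F G
      μIso_hom_natural_left := fun f G => by
        rw [underlying_cayley_map, underlying_cayley_map]
        exact cayleyMuIso_natural_left he hd f G
      μIso_hom_natural_right := fun F g => by
        rw [underlying_cayley_map, underlying_cayley_map]
        exact cayleyMuIso_natural_right he hd F g
      associativity := fun F G H => by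
        rw [underlying_cayley_map]
        exact cayleyMuIso_associativity he haD haE F G H
      left_unitality := fun F => by
        rw [underlying_cayley_map]
        exact cayleyMuIso_left_unitality he hd (hlD F) (hlE _)
      right_unitality := fun F => by
        rw [underlying_cayley_map]
        exact cayleyMuIso_right_unitality he hd (hrD F) (hrE _) }
  exact ⟨⟨c.toMonoidal, fun F F' G G' => cayleyMuIso_naturality he hd F F' G G'⟩⟩

end cayley

open MonoidalVCategory VFunctor

/-! ### Given monoidal structures read as universal families -/

section dayConvolution

variable {V : Type u} [Category.{v} V] [MonoidalCategory V] [MonoidalClosed V]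
  [SymmetricCategory V] {A : Type v} [Category.{w} A] [EnrichedOrdinaryCategory V A]
  [MonoidalCategory A] [MonoidalVCategory V A] [HasLimits V] (D : DayConvolution V A)

namespace DayConvolution

/-- The Day convolution of two `V`-functors in a Day convolution monoidal structure. -/
def tensor (F G : VFunctor V A) :
    letI := D.monoidalCategory
    DayTensor F G (F ⊗ G) :=
  DayTensor.ofCopr (D.copr F G) (D.isDayCowedge F G) (D.existsUnique_desc F G) (D.copr_act F G)

lemma isHom_tensor (F F' G G' : VFunctor V A) :
    letI := D.monoidalCategory
    letI := D.monoidalVCategory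
    DayTensor.IsHom (D.tensor F G) (D.tensor F' G') (tensorHomObj F F' G G') := fun p =>
  (D.ins_tensorHomObj F F' G G' p.1 p.2).trans (Category.assoc _ _ _).symm

lemma isAssociator_tensor (F G H : VFunctor V A) :
    letI := D.monoidalCategory
    DayTensor.IsAssociator (D.tensor F G) (D.tensor (F ⊗ G) H) (D.tensor G H)
      (D.tensor F (G ⊗ H)) (α_ F G H).hom :=
  D.ins_associator F G H

/-- Precomposition with `unitIso` replaces the given unit by `A(𝟙, -)`, the form in which the unit
isomorphisms were characterized. -/
lemma isLeftUnitor_tensor (F : VFunctor V A) :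
    letI := D.monoidalCategory
    DayTensor.IsLeftUnitor (D.tensor (dayUnit V A) F) (D.unitIso.hom ▷ F ≫ (λ_ F).hom) := by
  let := D.monoidalCategory
  let := D.monoidalVCategory
  intro U
  have h := whiskerRight_isTensorHom D.isHom_tensor D.unitIso.hom F (𝟙_ A) U
  have h' : (dayUnitId V A ≫ app D.unitIso.hom (𝟙_ A)) ▷ F.obj U ≫ (D.tensor _ F).ins (𝟙_ A) U ≫
    app (λ_ F).hom (𝟙_ A ⊗ U) ≫ F.mapHom (λ_ U).hom = (λ_ (F.obj U)).hom := D.ins_leftUnitor F U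
  rw [id_app, tensorHom_id] at h
  rw [comp_app, Category.assoc, reassoc_of% h, ← comp_whiskerRight_assoc, h']

lemma isRightUnitor_tensor (F : VFunctor V A) :
    letI := D.monoidalCategory
    DayTensor.IsRightUnitor (D.tensor F (dayUnit V A)) (F ◁ D.unitIso.hom ≫ (ρ_ F).hom) := by
  let := D.monoidalCategory
  let := D.monoidalVCategory
  intro U
  have h := whiskerLeft_isTensorHom D.isHom_tensor F D.unitIso.hom U (𝟙_ A)
  have h' : F.obj U ◁ (dayUnitId V A ≫ app D.unitIso.hom (𝟙_ A)) ≫ (D.tensor F _).ins U (𝟙_ A) ≫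
    app (ρ_ F).hom (U ⊗ 𝟙_ A) ≫ F.mapHom (ρ_ U).hom = (ρ_ (F.obj U)).hom := D.ins_rightUnitor F U
  rw [id_app, id_tensorHom] at h
  rw [comp_app, Category.assoc, reassoc_of% h, ← MonoidalCategory.whiskerLeft_comp_assoc, h']

end DayConvolution

end dayConvolution

section endomoduleComposition

variable {V : Type u} [Category.{v} V] [MonoidalCategory V] [MonoidalClosed V]
  [SymmetricCategory V] {A : Type v} [Category.{w} A] [EnrichedOrdinaryCategory V A]
  [HasLimits V] (E : EndomoduleComposition V A)

namespace EndomoduleComposition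

/-- The composite of two endomodules in a monoidal structure by composition of endomodules. -/
def tensor (S T : Endomodule V A) :
    letI := E.monoidalCategory
    EndoTensor S T (S ⊗ T) :=
  EndoTensor.ofCopr (E.copr S T)
    (fun X X' Y Y' Z => ((E.copr_act S T X X' Y Y' Z).trans (Category.assoc _ _ _).symm).symm)
    (fun X Y =>
      { condition := fun r => (whisker_cowedge_iff _ _ _ _).1 (E.isCompCowedge S T X Y r.1 r.2)
        existsUnique_desc := fun k hk => E.existsUnique_desc S T X Y k
          fun Z Z' => (whisker_cowedge_iff _ _ _ _).2 (hk (Z, Z')) })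

lemma isHom_tensor (S S' T T' : Endomodule V A) :
    letI := E.monoidalCategory
    letI := E.monoidalVCategory
    EndoTensor.IsHom (E.tensor S T) (E.tensor S' T') (tensorHomObj S S' T T') := fun p =>
  (E.copr_tensorHomObj S S' T T' p.1 p.2.2 p.2.1).trans (Category.assoc _ _ _).symm

lemma isAssociator_tensor (R S T : Endomodule V A) :
    letI := E.monoidalCategory
    EndoTensor.IsAssociator (E.tensor R S) (E.tensor (R ⊗ S) T) (E.tensor S T)
      (E.tensor R (S ⊗ T)) (α_ R S T).hom :=
  E.copr_associator R S T

lemma copr_whiskerRight {S S' : Endomodule V A} (f : S ⟶ S') (T : Endomodule V A) (X Z Y : A) :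
    letI := E.monoidalCategory
    E.copr S T X Z Y ≫ app (f ▷ T) ⟨op X, Y⟩ = app f ⟨op X, Z⟩ ▷ T.at Z Y ≫ E.copr S' T X Z Y := by
  let := E.monoidalCategory
  let := E.monoidalVCategory
  have h := (E.isHom_tensor S S' T T).tensorHom f (𝟙 T) (X, Z, Y)
  rwa [tensorHom_id, id_app, tensorHom_id] at h

lemma copr_whiskerLeft (S : Endomodule V A) {T T' : Endomodule V A} (g : T ⟶ T') (X Z Y : A) :
    letI := E.monoidalCategory
    E.copr S T X Z Y ≫ app (S ◁ g) ⟨op X, Y⟩ = S.at X Z ◁ app g ⟨op Z, Y⟩ ≫ E.copr S T' X Z Y := by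
  let := E.monoidalCategory
  let := E.monoidalVCategory
  have h := (E.isHom_tensor S S T T').tensorHom (𝟙 S) g (X, Z, Y)
  rwa [id_tensorHom, id_app, id_tensorHom] at h

lemma isLeftUnitor_tensor (T : Endomodule V A) :
    letI := E.monoidalCategory
    EndoTensor.IsLeftUnitor (E.tensor (homEndomodule V A) T) (E.unitIso.hom ▷ T ≫ (λ_ T).hom) := by
  let := E.monoidalCategory
  intro X Z Y
  exact (Category.assoc _ _ _).symm.trans ((congrArg (· ≫ _)
    (E.copr_whiskerRight E.unitIso.hom T X Z Y)).trans ((Category.assoc _ _ _).trans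
      (E.copr_leftUnitor T X Z Y)))

lemma isRightUnitor_tensor (S : Endomodule V A) :
    letI := E.monoidalCategory
    EndoTensor.IsRightUnitor (E.tensor S (homEndomodule V A)) (S ◁ E.unitIso.hom ≫ (ρ_ S).hom) := by
  let := E.monoidalCategory
  intro X Z Y
  exact (Category.assoc _ _ _).symm.trans ((congrArg (· ≫ _)
    (E.copr_whiskerLeft S E.unitIso.hom X Z Y)).trans ((Category.assoc _ _ _).trans
      (E.copr_rightUnitor S X Z Y)))

end EndomoduleComposition

end endomoduleComposition

/-! ### Strong monoidality for arbitrary choices of the coends -/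

section cayley

variable {V : Type u} [Category.{v} V] [MonoidalCategory V] [MonoidalClosed V]
  [SymmetricCategory V] {A : Type v} [Category.{w} A] [EnrichedOrdinaryCategory V A]
  [MonoidalCategory A] [MonoidalVCategory V A] [RightClosed V A] [HasLimits V]

lemma nonempty_cayleyStrongMonoidal (D : DayConvolution V A) (E : EndomoduleComposition V A) :
    Nonempty (CayleyStrongMonoidal D E) :=
  let := D.monoidalCategory
  let := D.monoidalVCategory
  let := E.monoidalCategory
  letI := E.monoidalVCategory
  nonempty_strongMonoidal_cayley (iD := D.unitIso) (iE := E.unitIso)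
    E.isHom_tensor D.isHom_tensor D.isAssociator_tensor D.isLeftUnitor_tensor
    D.isRightUnitor_tensor E.isAssociator_tensor E.isLeftUnitor_tensor E.isRightUnitor_tensor

end cayley

end EnrichedCayley
end

theorem mainTheorem6 {V : Type u} [Category.{v} V] [MonoidalCategory V] [MonoidalClosed V]
    [SymmetricCategory V] [HasLimits V] [HasColimits V]
    {A : Type v} [Category.{w} A] [MonoidalCategory A] [EnrichedOrdinaryCategory V A]
    [EnrichedCayley.MonoidalVCategory V A] [EnrichedCayley.RightClosed V A] :
    Nonempty (EnrichedCayley.DayConvolution V A) ∧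
      Nonempty (EnrichedCayley.EndomoduleComposition V A) ∧
        ∀ (D : EnrichedCayley.DayConvolution V A) (E : EnrichedCayley.EndomoduleComposition V A),
          Nonempty (EnrichedCayley.CayleyStrongMonoidal D E) := by
  exact ⟨EnrichedCayley.nonempty_dayConvolution, EnrichedCayley.nonempty_endomoduleComposition,
    EnrichedCayley.nonempty_cayleyStrongMonoidal⟩
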